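/- **Setting.** For a finite set $P$ of points of a metric space $\mathcal X$ and an integer $r\ge 1$, an $r$-gather solution is a partition of $P$ into clusters of size at least $r$, together with a center in $\mathcal X$ for each cluster; its cost is the maximum distance of a point of $P$ to the center of its cluster, and $\rho^*(P)$ is the infimum of the costs of all solutions. $\mathcal X$ has doubling dimension at most $d$ if for every $R>0$ every set of diameter at most $R$ is a union of at most $2^d$ sets of diameter at most $R/2$. In the dynamic problem $P$ is initially empty and changes by insertions of new points and deletions of present points, with queries in between; a query may be accompanied by a point $p\in P$. Algorithms are deterministic programs of a real RAM (cells for natural numbers, real numbers and points; indirect addressing; addition, subtraction and comparison of numbers, multiplication of reals by fixed rational constants; points can only be copied and have their distance computed). An elementary step takes one unit of time, and a distance computation takes time $\tau\ge 1$. **Theorem.** For every $C>1$ there are a dynamic algorithm and a constant $K>0$, depending only on $C$, such that the following holds for every metric space $\mathcal X$ of doubling dimension at most $d$ (where $d\ge 0$), every integer $r\ge 1$ (the only parameter that is given to the algorithm), every $\tau\ge 1$, every $\Delta\ge 4$, and every sequence of operations during which the ratio between the largest and the smallest distance of different points in the current set $P$ is at most $\Delta$ at any time. 1. Each insertion and each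 deletion takes, in the worst case, time at most $K\cdot r\cdot 2^{Kd}\cdot\log_2^2\Delta\cdot\log_2\log_2\Delta\cdot\tau$, and each query, with or without a point, takes, in the worst case, time at most $K\cdot 2^{Kd}\cdot\log_2^2\Delta\cdot\tau$. 2. At any time at which $|P|\ge r$, the algorithm implicitly maintains an $r$-gather solution of $P$ and a radius estimate $\rho$ with $$\text{(cost of the maintained solution)}\ \le\ \rho\ \le\ 16\,C^2\,\rho^*(P).$$ In particular the maintained solution is $16C^2$-approximate, and $\rho$ is a $16C^2$-approximation of its maximum radius. Every query that is made before the next update outputs $\rho$, and if a point $p\in P$ is given in the query, it also outputs the center of the maintained cluster that contains $p$. -/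

import Mathlib

open scoped NNReal

namespace RGather

/-! ### The machine model

A real RAM with a distance oracle.  The memory consists of three infinite arrays of cells: `N` holds
natural numbers, `R` holds exact real numbers, and `P` holds points of the metric space.  Points are
opaque: all the machine can do with them is to copy them and to ask for the distance of two of them.
There is indirect addressing (addresses are natural numbers), addition and subtraction of numbers,
multiplication of reals by fixed rational constants, and comparison of numbers.  There is no
multiplication of two memory cells, no rounding and no randomness. -/

/-- Memory of the machine; an empty point cell is `none`. -/
structure State (X : Type*) where
  nat : ℕ → ℕ
  real : ℕ → ℝ
  pt : ℕ → Option X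

/-- Elementary instructions, other than the distance computation. Their effect is `Instr.run`. -/
inductive Instr where
  /-- `N[a] ← k` -/
  | natConst (a k : ℕ)
  /-- `N[a] ← N[b] + N[c]` -/
  | natAdd (a b c : ℕ)
  /-- `N[a] ← max (N[b] - N[c]) 0` -/
  | natSub (a b c : ℕ)
  /-- `N[a] ← N[N[b]]` -/
  | natLoad (a b : ℕ)
  /-- `N[N[a]] ← N[b]` -/
  | natStore (a b : ℕ)
  /-- `R[a] ← q` -/
  | realConst (a : ℕ) (q : ℚ)
  /-- `R[a] ← R[b] + R[c]` -/
  | realAdd (a b c : ℕ)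
  /-- `R[a] ← R[b] - R[c]` -/
  | realSub (a b c : ℕ)
  /-- `R[a] ← q * R[b]` -/
  | realScale (a : ℕ) (q : ℚ) (b : ℕ)
  /-- `R[a] ← R[N[b]]` -/
  | realLoad (a b : ℕ)
  /-- `R[N[a]] ← R[b]` -/
  | realStore (a b : ℕ)
  /-- `P[a] ← P[N[b]]` -/
  | ptLoad (a b : ℕ)
  /-- `P[N[a]] ← P[b]` -/
  | ptStore (a b : ℕ)

namespace State

variable {X : Type*}

/-- Write `v` into `N[a]`. -/
def setNat (σ : State X) (a v : ℕ) : State X := { σ with nat := Function.update σ.nat a v }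

/-- Write `v` into `R[a]`. -/
noncomputable def setReal (σ : State X) (a : ℕ) (v : ℝ) : State X :=
  { σ with real := Function.update σ.real a v }

/-- Write `v` into `P[a]`. -/
def setPt (σ : State X) (a : ℕ) (v : Option X) : State X :=
  { σ with pt := Function.update σ.pt a v }

/-- The memory before the first operation: `N[0] = r`, all other numbers are `0`, and there are
no points. -/
def initial (X : Type*) (r : ℕ) : State X where
  nat := fun a => if a = 0 then r else 0
  real := fun _ => 0
  pt := fun _ => none

end State

/-- The effect of an elementary instruction. -/
noncomputable def Instr.run {X : Type*} (σ : State X) : Instr → State X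
  | .natConst a k => σ.setNat a k
  | .natAdd a b c => σ.setNat a (σ.nat b + σ.nat c)
  | .natSub a b c => σ.setNat a (σ.nat b - σ.nat c)
  | .natLoad a b => σ.setNat a (σ.nat (σ.nat b))
  | .natStore a b => σ.setNat (σ.nat a) (σ.nat b)
  | .realConst a q => σ.setReal a (q : ℝ)
  | .realAdd a b c => σ.setReal a (σ.real b + σ.real c)
  | .realSub a b c => σ.setReal a (σ.real b - σ.real c)
  | .realScale a q b => σ.setReal a ((q : ℝ) * σ.real b)
  | .realLoad a b => σ.setReal a (σ.real (σ.nat b))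
  | .realStore a b => σ.setReal (σ.nat a) (σ.real b)
  | .ptLoad a b => σ.setPt a (σ.pt (σ.nat b))
  | .ptStore a b => σ.setPt (σ.nat a) (σ.pt b)

/-- Tests on which a program can branch: comparisons of two cells. -/
inductive Test where
  | natEq (a b : ℕ)
  | natNe (a b : ℕ)
  | natLe (a b : ℕ)
  | natLt (a b : ℕ)
  | realLe (a b : ℕ)
  | realLt (a b : ℕ)

/-- The truth value of a test. -/
def Test.Holds {X : Type*} (σ : State X) : Test → Prop
  | .natEq a b => σ.nat a = σ.nat b
  | .natNe a b => σ.nat a ≠ σ.nat b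
  | .natLe a b => σ.nat a ≤ σ.nat b
  | .natLt a b => σ.nat a < σ.nat b
  | .realLe a b => σ.real a ≤ σ.real b
  | .realLt a b => σ.real a < σ.real b

/-- Programs (finite syntax trees). `dist a b c` is `R[a] ← dist (P[b], P[c])`. -/
inductive Prog where
  | skip
  | instr (i : Instr)
  | dist (a b c : ℕ)
  | seq (p q : Prog)
  | ite (b : Test) (p q : Prog)
  | loop (b : Test) (p : Prog)

/-- `Exec p σ s k σ'`: started in memory `σ`, the program `p` halts in memory `σ'`, after `s`
elementary steps (instructions and tests) and `k` distance computations.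
A distance computation on an empty point cell blocks. -/
inductive Exec {X : Type*} [MetricSpace X] : Prog → State X → ℕ → ℕ → State X → Prop where
  | skip (σ : State X) : Exec .skip σ 0 0 σ
  | instr (i : Instr) (σ : State X) : Exec (.instr i) σ 1 0 (i.run σ)
  | dist (a b c : ℕ) (σ : State X) (x y : X) (hx : σ.pt b = some x) (hy : σ.pt c = some y) :
      Exec (.dist a b c) σ 0 1 (σ.setReal a (Dist.dist x y))
  | seq {p q : Prog} {σ₁ σ₂ σ₃ : State X} {s k s' k' : ℕ}
      (hp : Exec p σ₁ s k σ₂) (hq : Exec q σ₂ s' k' σ₃) :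
      Exec (.seq p q) σ₁ (s + s') (k + k') σ₃
  | ite_true {b : Test} {p q : Prog} {σ σ' : State X} {s k : ℕ}
      (hb : b.Holds σ) (hp : Exec p σ s k σ') : Exec (.ite b p q) σ (1 + s) k σ'
  | ite_false {b : Test} {p q : Prog} {σ σ' : State X} {s k : ℕ}
      (hb : ¬ b.Holds σ) (hq : Exec q σ s k σ') : Exec (.ite b p q) σ (1 + s) k σ'
  | loop_true {b : Test} {p : Prog} {σ₁ σ₂ σ₃ : State X} {s k s' k' : ℕ}
      (hb : b.Holds σ₁) (hp : Exec p σ₁ s k σ₂) (hl : Exec (.loop b p) σ₂ s' k' σ₃) :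
      Exec (.loop b p) σ₁ (1 + s + s') (k + k') σ₃
  | loop_false {b : Test} {p : Prog} {σ : State X}
      (hb : ¬ b.Holds σ) : Exec (.loop b p) σ 1 0 σ

/-! ### Dynamic point sets -/

/-- The operations of the dynamic problem. A query may come with a point of the current set. -/
inductive Op (X : Type*) where
  | insert (p : X)
  | delete (p : X)
  | query
  | queryPoint (p : X)

namespace Op

variable {X : Type*}

/-- The operation changes the point set. -/
def IsUpdate : Op X → Prop
  | .insert _ => True
  | .delete _ => True
  | .query => False
  | .queryPoint _ => False

/-- Only new points are inserted; only present points are deleted or queried. -/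
def Legal (P : Finset X) : Op X → Prop
  | .insert p => p ∉ P
  | .delete p => p ∈ P
  | .query => True
  | .queryPoint p => p ∈ P

open Classical in
/-- The point set after the operation. -/
noncomputable def next (P : Finset X) : Op X → Finset X
  | .insert p => Insert.insert p P
  | .delete p => P.erase p
  | .query => P
  | .queryPoint _ => P

/-- The point given with an operation is placed into the cell `P[0]`. -/
def input (σ : State X) : Op X → State X
  | .insert p => σ.setPt 0 (some p)
  | .delete p => σ.setPt 0 (some p)
  | .query => σ
  | .queryPoint p => σ.setPt 0 (some p)

end Op

/-- The point set after a sequence of operations that starts from the empty set. -/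
noncomputable def pointSet {X : Type*} (h : List (Op X)) : Finset X := h.foldl Op.next ∅

/-- `Δ` bounds the ratio between the largest and the smallest distance of different points. -/
def AspectLE {X : Type*} [MetricSpace X] (Δ : ℝ) (P : Finset X) : Prop :=
  ∀ x ∈ P, ∀ y ∈ P, ∀ z ∈ P, ∀ w ∈ P, x ≠ y → z ≠ w → dist x y ≤ Δ * dist z w

/-- Sequences of legal operations during which, at any time, the aspect ratio of the point set is at
most `Δ`. -/
inductive Admissible {X : Type*} [MetricSpace X] (Δ : ℝ) : List (Op X) → Prop where
  | nil : Admissible Δ []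
  | snoc {h : List (Op X)} {o : Op X} (hh : Admissible Δ h) (legal : o.Legal (pointSet h))
      (aspect : AspectLE Δ (pointSet (h ++ [o]))) : Admissible Δ (h ++ [o])

/-- A dynamic algorithm: one program for each kind of operation. The programs share the memory, which
persists between operations. -/
structure DynAlg where
  insert : Prog
  delete : Prog
  query : Prog
  queryPoint : Prog

/-- The program that serves an operation. -/
def DynAlg.prog {X : Type*} (A : DynAlg) : Op X → Prog
  | .insert _ => A.insert
  | .delete _ => A.delete
  | .query => A.query
  | .queryPoint _ => A.queryPoint

/-- `Run A r h σ`: started with the parameter `r` and no points, and having served the operations `h`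
one after the other, the algorithm `A` has halted with memory `σ`. -/
inductive Run {X : Type*} [MetricSpace X] (A : DynAlg) (r : ℕ) : List (Op X) → State X → Prop where
  | nil : Run A r [] (State.initial X r)
  | snoc {h : List (Op X)} {o : Op X} {σ σ' : State X} {s k : ℕ} (hh : Run A r h σ)
      (ho : Exec (A.prog o) (o.input σ) s k σ') : Run A r (h ++ [o]) σ'

/-! ### The `r`-gather problem -/

/-- Finitely many clusters with a center (any point of the space) for each of them. -/
structure Clustering (X : Type*) where
  t : ℕ
  cluster : Fin t → Finset X
  center : Fin t → X

namespace Clustering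

variable {X : Type*}

/-- The clusters partition `P`, and each of them has at least `r` points. -/
structure IsGather (S : Clustering X) (r : ℕ) (P : Finset X) : Prop where
  disjoint : Pairwise fun i j => Disjoint (S.cluster i) (S.cluster j)
  cover : ∀ x, x ∈ P ↔ ∃ i, x ∈ S.cluster i
  size : ∀ i, r ≤ (S.cluster i).card

/-- The maximum radius of the clusters. -/
noncomputable def cost [MetricSpace X] (S : Clustering X) : ℝ≥0 :=
  Finset.univ.sup fun i => (S.cluster i).sup fun p => nndist p (S.center i)

end Clustering

/-- The optimal `r`-gather cost of `P` (meaningful if `P` has at least `r` points, so that there is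
a solution). -/
noncomputable def optCost {X : Type*} [MetricSpace X] (r : ℕ) (P : Finset X) : ℝ≥0 :=
  sInf {c | ∃ S : Clustering X, S.IsGather r P ∧ S.cost = c}

/-- The answer to an operation that has ended with memory `σ` is the one given by the solution `S` and
the radius estimate `ρ`: every query returns `ρ` in `R[0]`, and a query of a point `p` returns also
the center of the cluster that contains `p`, in `P[0]`. -/
def Op.Answered {X : Type*} (S : Clustering X) (ρ : ℝ) (σ : State X) : Op X → Prop
  | .insert _ => True
  | .delete _ => True
  | .query => σ.real 0 = ρ
  | .queryPoint p => σ.real 0 = ρ ∧ ∃ i, p ∈ S.cluster i ∧ σ.pt 0 = some (S.center i)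

/-! ### Doubling dimension -/

/-- The doubling dimension of `X` is at most `d`: every set of diameter at most `R` is the union of at
most `2 ^ d` sets of diameter at most `R / 2`. -/
def DoublingDimLE (X : Type*) [MetricSpace X] (d : ℝ) : Prop :=
  ∀ R : ℝ, 0 < R → ∀ S : Set X, (∀ x ∈ S, ∀ y ∈ S, dist x y ≤ R) →
    ∃ F : Finset (Set X), (F.card : ℝ) ≤ (2 : ℝ) ^ d ∧ ⋃₀ (F : Set (Set X)) = S ∧
      ∀ T ∈ F, ∀ x ∈ T, ∀ y ∈ T, dist x y ≤ R / 2

/-! ### Time bounds -/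

/-- `K · r · 2^{K d} · log² Δ · log log Δ · τ` for updates and `K · 2^{K d} · log² Δ · τ` for queries
(logarithms to base `2`). -/
noncomputable def timeBound {X : Type*} (K : ℝ) (r : ℕ) (d Δ τ : ℝ) : Op X → ℝ
  | .insert _ => K * r * 2 ^ (K * d) * Real.logb 2 Δ ^ 2 * Real.logb 2 (Real.logb 2 Δ) * τ
  | .delete _ => K * r * 2 ^ (K * d) * Real.logb 2 Δ ^ 2 * Real.logb 2 (Real.logb 2 Δ) * τ
  | .query => K * 2 ^ (K * d) * Real.logb 2 Δ ^ 2 * τ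
  | .queryPoint _ => K * 2 ^ (K * d) * Real.logb 2 Δ ^ 2 * τ

end RGather

namespace RGather

/-! ### Determinism of the machine -/

-- The points are kept in a net tree. The nodes on the level of radius `ρ` have centers more than
-- `ρ` apart, and the children of a node, which belong to the level of radius `ρ / 2`, lie within
-- `ρ` of it; hence all points below a node are within `2ρ` of its center. On every level some nodes
-- are flagged as cluster centers: they are more than `10ρ` apart, and every node has one within
-- `10ρ`. A node is bad if the nodes within `5ρ` of it carry fewer than `r` points.
--
-- Let `ρ` be the radius of the lowest level such that no level from the top down to it has a bad
-- node. Every node of this level is assigned to the flagged node within `5ρ`, of which there is at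
-- most one, or else to some flagged node within `10ρ`. A flagged node is not bad, so its cluster
-- has at least `r` points, and the cost is at most `10ρ + 2ρ = 12ρ`. The next level, of radius `ρ /
-- 2`, has a bad node. In a solution of cost at most `3ρ / 4` the cluster of its center would
-- consist of points that its weight counts, and these are fewer than `r`. So every solution costs
-- more than `3ρ / 4`, and `12ρ` is within the factor `16` of the optimum (`Stores.lt_cost`,
-- `Stores.approximation`).
--
-- An insertion or deletion of `x` changes a level only within a constant number of radii of `x`.
-- The update descends near `x` until `x` is alone (or nothing is left), exchanges the nodes there,
-- and repairs the levels on the way back (`StepHyp.step_hered`, `Split.insert`, `Split.delete`).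
-- Only numbers of points are stored with the nodes, not lists of points, so no factor `r` arises.
-- In a space of doubling dimension `d` a level has at most `2 ^ (6 d)` nodes near `x`
-- (`length_le_packing`). The top radius is kept proportional to the diameter, so `O(log Δ)` levels
-- suffice (`Good.exists_descent`, `Good.exists_insertRun`, `Good.exists_deleteRun`). Each node
-- stores the radius down to which its subtree has no bad nodes, so the roots alone yield the
-- estimate. A query of a point climbs from its isolated node to the level of the clusters
-- (`Stores.assigned_answer`). For `r = 1` there would be no bad nodes at all, and singletons are
-- used instead.
--
-- The programs are written in a small functional language with folds and loops over binary trees.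
-- It is compiled to the machine with a heap that only grows; `compile_spec` bounds the running time
-- by a constant times a syntactic cost.

theorem Exec.deterministic {X : Type*} [MetricSpace X] {p : Prog} {σ σ₁ σ₂ : State X}
    {s₁ k₁ s₂ k₂ : ℕ} (h₁ : Exec p σ s₁ k₁ σ₁) (h₂ : Exec p σ s₂ k₂ σ₂) : σ₁ = σ₂ := by
  induction h₁ generalizing s₂ k₂ σ₂ with
  | skip σ => cases h₂; rfl
  | instr i σ => cases h₂; rfl
  | dist a b c σ x y hx hy =>
    cases h₂ with
    | dist _ _ _ _ x' y' hx' hy' =>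
      rw [hx] at hx'; rw [hy] at hy'
      cases hx'; cases hy'; rfl
  | seq hp hq ihp ihq =>
    cases h₂ with
    | seq hp' hq' => obtain rfl := ihp hp'; exact ihq hq'
  | ite_true hb hp ih =>
    cases h₂ with
    | ite_true hb' hp' => exact ih hp'
    | ite_false hb' hp' => exact absurd hb hb'
  | ite_false hb hp ih =>
    cases h₂ with
    | ite_true hb' hp' => exact absurd hb' hb
    | ite_false hb' hp' => exact ih hp'
  | loop_true hb hp hl ihp ihl =>
    cases h₂ with
    | loop_true hb' hp' hl' => obtain rfl := ihp hp'; exact ihl hl'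
    | loop_false hb' => exact absurd hb hb'
  | loop_false hb =>
    cases h₂ with
    | loop_true hb' hp' hl' => exact absurd hb' hb
    | loop_false hb' => rfl

/-- The theorem speaks of every run, while the correctness proof constructs one; determinism
identifies the two. -/
theorem Run.deterministic {X : Type*} [MetricSpace X] {A : DynAlg} {r : ℕ} {h : List (Op X)}
    {σ₁ σ₂ : State X} (h₁ : Run A r h σ₁) (h₂ : Run A r h σ₂) : σ₁ = σ₂ := by
  induction h₁ generalizing σ₂ with
  | nil =>
    generalize hl : ([] : List (Op X)) = l at h₂
    cases h₂ with
    | nil => rfl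
    | snoc _ _ => simp at hl
  | @snoc h o σ σ' s k hh ho ih =>
    generalize hl : h ++ [o] = l at h₂
    cases h₂ with
    | nil => simp at hl
    | snoc hh' ho' =>
      obtain ⟨rfl, hoo⟩ := List.append_inj' hl rfl
      simp only [List.cons.injEq, and_true] at hoo
      subst hoo
      obtain rfl := ih hh'
      exact ho.deterministic ho'

/-! ### Straight-line programs -/

/-- A sequence of elementary instructions. -/
def block : List Instr → Prog
  | [] => .skip
  | i :: l => .seq (.instr i) (block l)

theorem exec_block {X : Type*} [MetricSpace X] (l : List Instr) (σ : State X) :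
    Exec (block l) σ l.length 0 (l.foldl Instr.run σ) := by
  induction l generalizing σ with
  | nil => exact .skip σ
  | cons i l ih =>
    have := Exec.seq (.instr i σ) (ih (i.run σ))
    rw [Nat.add_comm] at this
    exact this

/-! ### Values and their representation in the memory -/

/-- Values that programs compute with: binary trees over numbers and points. -/
inductive Val (X : Type*) where
  | nat (n : ℕ)
  | real (x : ℝ)
  | pt (p : X)
  | pair (a b : Val X)

/-- `c` is a code of the value in the memory. The heap consists of the odd addresses below the heap
pointer `N[4]`. -/
def Rep {X : Type*} (σ : State X) : Val X → ℕ → Prop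
  | .nat n, c => c = n
  | .real x, c => c % 2 = 1 ∧ c < σ.nat 4 ∧ σ.real c = x
  | .pt p, c => c % 2 = 1 ∧ c < σ.nat 4 ∧ σ.pt c = some p
  | .pair a b, c => c % 2 = 1 ∧ c + 2 < σ.nat 4 ∧ Rep σ a (σ.nat c) ∧ Rep σ b (σ.nat (c + 2))

/-- The heap of the second memory extends that of the first. -/
structure Ext {X : Type*} (σ σ' : State X) : Prop where
  le : σ.nat 4 ≤ σ'.nat 4
  nat : ∀ a, a % 2 = 1 → a < σ.nat 4 → σ'.nat a = σ.nat a
  real : ∀ a, a % 2 = 1 → a < σ.nat 4 → σ'.real a = σ.real a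
  pt : ∀ a, a % 2 = 1 → a < σ.nat 4 → σ'.pt a = σ.pt a

theorem Ext.refl {X : Type*} (σ : State X) : Ext σ σ :=
  ⟨le_rfl, fun _ _ _ => rfl, fun _ _ _ => rfl, fun _ _ _ => rfl⟩

theorem Ext.trans {X : Type*} {σ₁ σ₂ σ₃ : State X} (h : Ext σ₁ σ₂) (h' : Ext σ₂ σ₃) :
    Ext σ₁ σ₃ :=
  ⟨h.le.trans h'.le,
    fun a ha hl => (h'.nat a ha (hl.trans_le h.le)).trans (h.nat a ha hl),
    fun a ha hl => (h'.real a ha (hl.trans_le h.le)).trans (h.real a ha hl),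
    fun a ha hl => (h'.pt a ha (hl.trans_le h.le)).trans (h.pt a ha hl)⟩

/-- Heap cells are written once and never overwritten, so codes stay valid for ever and values may
share parts freely. This removes the need for any separation of memory regions. -/
theorem Rep.mono {X : Type*} {σ σ' : State X} (h : Ext σ σ') {v : Val X} {c : ℕ}
    (hv : Rep σ v c) : Rep σ' v c := by
  induction v generalizing c with
  | nat n => exact hv
  | real x => exact ⟨hv.1, hv.2.1.trans_le h.le, (h.real c hv.1 hv.2.1).trans hv.2.2⟩
  | pt p => exact ⟨hv.1, hv.2.1.trans_le h.le, (h.pt c hv.1 hv.2.1).trans hv.2.2⟩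
  | pair a b iha ihb =>
    obtain ⟨h1, h2, h3, h4⟩ := hv
    refine ⟨h1, h2.trans_le h.le, ?_, ?_⟩
    · rw [h.nat c h1 (by omega)]; exact iha h3
    · rw [h.nat (c + 2) (by omega) h2]; exact ihb h4

/-- The value is the number `0`, which also serves as the empty list. -/
def Val.IsZero {X : Type*} : Val X → Prop
  | .nat n => n = 0
  | _ => False

/-- Heap addresses are odd, so the code `0` is never an address, and one comparison with the zero
register recognizes the empty list. -/
theorem Rep.isZero_iff {X : Type*} {σ : State X} {v : Val X} {c : ℕ} (h : Rep σ v c) :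
    v.IsZero ↔ c = 0 := by
  cases v with
  | nat n => simp only [Rep, Val.IsZero] at *; omega
  | real x => exact ⟨False.elim, fun hc => by have := h.1; omega⟩
  | pt p => exact ⟨False.elim, fun hc => by have := h.1; omega⟩
  | pair a b => exact ⟨False.elim, fun hc => by have := h.1; omega⟩

/-! ### A small functional language -/

/-- Expressions; they are evaluated in an environment, which is a value. -/
inductive Fn where
  | env
  | fst (e : Fn)
  | snd (e : Fn)
  | pair (a b : Fn)
  | nat (k : ℕ)
  | real (q : ℚ)
  | add (a b : Fn)
  | nle (a b : Fn)
  | rle (a b : Fn)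
  | scale (q : ℚ) (a : Fn)
  | dist (a b : Fn)
  /-- if the value of `c` is zero then `t` else `e` -/
  | ifz (c t e : Fn)
  /-- the value of `f` in the environment that is the value of `e` -/
  | comp (f e : Fn)
  /-- left fold of the list `l`; the environment of `b` is extended by the accumulator and the
  element -/
  | fold (i l b : Fn)
  /-- starting from the value of `i`, replace it by the value of `b` as long as `c` is not zero -/
  | loop (c b i : Fn)

section Semantics

variable {X : Type*}

/-- Left fold of a list-like value. -/
def foldVal (f : Val X → Val X → Option (Val X)) : Val X → Val X → Option (Val X)
  | .pair a l, acc => (f a acc).bind (foldVal f l)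
  | .nat n, acc => if n = 0 then some acc else none
  | _, _ => none

/-- The cost of a left fold. -/
def foldCost (f : Val X → Val X → Option (Val X)) (g : Val X → Val X → ℕ) : Val X → Val X → ℕ
  | .pair a l, acc => 1 + g a acc + ((f a acc).elim 0 (foldCost f g l))
  | _, _ => 0

/-- The value after `n` iterations. -/
def iterVal (b : Val X → Option (Val X)) (v : Val X) : ℕ → Option (Val X)
  | 0 => some v
  | n + 1 => (iterVal b v n).bind b

/-- The loop is left after exactly `n` iterations. -/
def LoopStops (c b : Val X → Option (Val X)) (v : Val X) (n : ℕ) : Prop :=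
  ((iterVal b v n).bind c) = some (.nat 0) ∧ ∀ k < n, ((iterVal b v k).bind c) = some (.nat 1)

open Classical in
/-- The number of iterations of a loop. -/
noncomputable def loopCount (c b : Val X → Option (Val X)) (v : Val X) : Option ℕ :=
  if h : ∃ n, LoopStops c b v n then some h.choose else none

/-- At the smaller of two stopping times the condition would have to be both `0` and `1`. Hence the
choice in `loopCount` is harmless. -/
theorem LoopStops.unique {c b : Val X → Option (Val X)} {v : Val X} {n m : ℕ}
    (h : LoopStops c b v n) (h' : LoopStops c b v m) : n = m := by
  rcases lt_trichotomy n m with hl | hl | hl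
  · have := (h.1.symm.trans (h'.2 n hl)); simp at this
  · exact hl
  · have := (h'.1.symm.trans (h.2 m hl)); simp at this

theorem LoopStops.loopCount_eq {c b : Val X → Option (Val X)} {v : Val X} {n : ℕ}
    (h : LoopStops c b v n) : loopCount c b v = some n := by
  have hex : ∃ n, LoopStops c b v n := ⟨n, h⟩
  rw [loopCount, dif_pos hex, hex.choose_spec.unique h]

theorem loopStops_of_loopCount {c b : Val X → Option (Val X)} {v : Val X} {n : ℕ}
    (h : loopCount c b v = some n) : LoopStops c b v n := by
  unfold loopCount at h
  split_ifs at h with hex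
  obtain rfl := Option.some.inj h
  exact hex.choose_spec

variable [MetricSpace X]

open Classical in
/-- The value of an expression. -/
noncomputable def run : Fn → Val X → Option (Val X)
  | .env, v => some v
  | .fst e, v => match run e v with
    | some (.pair a _) => some a
    | _ => none
  | .snd e, v => match run e v with
    | some (.pair _ b) => some b
    | _ => none
  | .pair a b, v => match run a v, run b v with
    | some x, some y => some (.pair x y)
    | _, _ => none
  | .nat k, _ => some (.nat k)
  | .real q, _ => some (.real q)
  | .add a b, v => match run a v, run b v with
    | some (.nat x), some (.nat y) => some (.nat (x + y))
    | _, _ => none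
  | .nle a b, v => match run a v, run b v with
    | some (.nat x), some (.nat y) => some (.nat (if x ≤ y then 1 else 0))
    | _, _ => none
  | .rle a b, v => match run a v, run b v with
    | some (.real x), some (.real y) => some (.nat (if x ≤ y then 1 else 0))
    | _, _ => none
  | .scale q a, v => match run a v with
    | some (.real x) => some (.real (q * x))
    | _ => none
  | .dist a b, v => match run a v, run b v with
    | some (.pt x), some (.pt y) => some (.real (Dist.dist x y))
    | _, _ => none
  | .ifz c t e, v => match run c v with
    | some x => if x.IsZero then run t v else run e v
    | none => none
  | .comp f e, v => (run e v).bind (run f)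
  | .fold i l b, v => match run i v, run l v with
    | some x, some y => foldVal (fun a acc => run b (.pair a (.pair acc v))) y x
    | _, _ => none
  | .loop c b i, v => match run i v with
    | some x => (loopCount (run c) (run b) x).bind (iterVal (run b) x)
    | none => none

/-- A bound for the number of evaluation steps. -/
noncomputable def cost : Fn → Val X → ℕ
  | .env, _ => 1
  | .fst e, v => 1 + cost e v
  | .snd e, v => 1 + cost e v
  | .pair a b, v => 1 + cost a v + cost b v
  | .nat _, _ => 1
  | .real _, _ => 1
  | .add a b, v => 1 + cost a v + cost b v
  | .nle a b, v => 1 + cost a v + cost b v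
  | .rle a b, v => 1 + cost a v + cost b v
  | .scale _ a, v => 1 + cost a v
  | .dist a b, v => 1 + cost a v + cost b v
  -- Both branches are charged. For expressions without `comp`, `fold` and `loop` the cost is
  -- therefore a numeral that does not depend on the environment.
  | .ifz c t e, v => 1 + cost c v + cost t v + cost e v
  | .comp f e, v => 1 + cost e v + ((run e v).elim 0 (cost f))
  | .fold i l b, v => 1 + cost i v + cost l v + (match run i v, run l v with
    | some x, some y => foldCost (fun a acc => run b (.pair a (.pair acc v)))
        (fun a acc => cost b (.pair a (.pair acc v))) y x
    | _, _ => 0)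
  | .loop c b i, v => 1 + cost i v + (match run i v with
    | some x => ((loopCount (run c) (run b) x).elim 0 fun n =>
        (∑ k ∈ Finset.range n, (1 + (iterVal (run b) x k).elim 0 fun u => cost c u + cost b u)) +
          (iterVal (run b) x n).elim 0 (cost c))
    | none => 0)

end Semantics

/-! ### Compilation -/

/-- `N[a] ← N[b]` -/
def copyI (a b : ℕ) : List Instr := [.natAdd a b 2]

/-- `N[a] ←` a new pair with the components `N[b]` and `N[c]` -/
def consI (a b c : ℕ) : List Instr :=
  [.natStore 4 b, .natConst 10 2, .natAdd 12 4 10, .natStore 12 c, .natAdd a 4 2,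
    .natConst 10 4, .natAdd 4 4 10]

/-- `N[a] ←` a new cell with the real number `R[0]` -/
def newRealI (a : ℕ) : List Instr :=
  [.realStore 4 0, .natAdd a 4 2, .natConst 10 4, .natAdd 4 4 10]

/-- `N[a] ←` a new cell with the point `P[0]` -/
def newPtI (a : ℕ) : List Instr :=
  [.ptStore 4 0, .natAdd a 4 2, .natConst 10 4, .natAdd 4 4 10]

/-- The second component of the pair with code `N[b]`. -/
def sndI (a b : ℕ) : List Instr :=
  [.natConst 10 2, .natAdd 12 b 10, .natLoad a 12]

/-- The program for an expression. The environment is in register `d` (address `2 * d`) and the result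
is written to register `d + 1`. Registers beyond are used as scratch. -/
def compile : Fn → ℕ → Prog
  | .env, d => block (copyI (2 * d + 2) (2 * d))
  | .fst e, d => .seq (compile e d) (block [.natLoad (2 * d + 2) (2 * d + 2)])
  | .snd e, d => .seq (compile e d) (block (sndI (2 * d + 2) (2 * d + 2)))
  -- The value of `a` is kept in register `d + 1`, and `b` is evaluated with a copy of the
  -- environment in register `d + 2`, so its value arrives in register `d + 3`. The other binary
  -- operations follow the same pattern.
  | .pair a b, d => .seq (compile a d) (.seq (block (copyI (2 * d + 4) (2 * d)))
      (.seq (compile b (d + 2)) (block (consI (2 * d + 2) (2 * d + 2) (2 * d + 6)))))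
  | .nat k, d => block [.natConst (2 * d + 2) k]
  | .real q, d => block (.realConst 0 q :: newRealI (2 * d + 2))
  | .add a b, d => .seq (compile a d) (.seq (block (copyI (2 * d + 4) (2 * d)))
      (.seq (compile b (d + 2)) (block [.natAdd (2 * d + 2) (2 * d + 2) (2 * d + 6)])))
  | .nle a b, d => .seq (compile a d) (.seq (block (copyI (2 * d + 4) (2 * d)))
      (.seq (compile b (d + 2)) (.ite (.natLe (2 * d + 2) (2 * d + 6))
        (block [.natConst (2 * d + 2) 1]) (block [.natConst (2 * d + 2) 0]))))
  | .rle a b, d => .seq (compile a d) (.seq (block (copyI (2 * d + 4) (2 * d)))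
      (.seq (compile b (d + 2)) (.seq (block [.realLoad 0 (2 * d + 2), .realLoad 2 (2 * d + 6)])
        (.ite (.realLe 0 2)
          (block [.natConst (2 * d + 2) 1]) (block [.natConst (2 * d + 2) 0])))))
  | .scale q a, d => .seq (compile a d)
      (block (.realLoad 0 (2 * d + 2) :: .realScale 0 q 0 :: newRealI (2 * d + 2)))
  | .dist a b, d => .seq (compile a d) (.seq (block (copyI (2 * d + 4) (2 * d)))
      (.seq (compile b (d + 2)) (.seq (block [.ptLoad 0 (2 * d + 2), .ptLoad 2 (2 * d + 6)])
        (.seq (.dist 0 0 2) (block (newRealI (2 * d + 2)))))))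
  | .ifz c t e, d => .seq (compile c d) (.ite (.natEq (2 * d + 2) 2) (compile t d) (compile e d))
  | .comp f e, d => .seq (compile e d) (.seq (compile f (d + 1))
      (block (copyI (2 * d + 2) (2 * d + 4))))
  -- Register `d + 1` holds the accumulator and `d + 3` the remaining list; the environment of the
  -- body is built in `d + 4`, and its value arrives in `d + 5`.
  | .fold i l b, d => .seq (compile i d) (.seq (block (copyI (2 * d + 4) (2 * d)))
      (.seq (compile l (d + 2)) (.loop (.natNe (2 * d + 6) 2)
        (.seq (block (consI (2 * d + 8) (2 * d + 2) (2 * d) ++ .natLoad (2 * d + 10) (2 * d + 6) ::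
          consI (2 * d + 8) (2 * d + 10) (2 * d + 8)))
        (.seq (compile b (d + 4)) (block (copyI (2 * d + 2) (2 * d + 10) ++
          sndI (2 * d + 6) (2 * d + 6))))))))
  -- The current state is in register `d + 1`, which is the environment of both `c` and `b`; the
  -- value of the condition is in `d + 2`.
  | .loop c b i, d => .seq (compile i d) (.seq (compile c (d + 1))
      (.loop (.natNe (2 * d + 4) 2) (.seq (compile b (d + 1))
        (.seq (block (copyI (2 * d + 2) (2 * d + 4))) (compile c (d + 1))))))

section Correctness

variable {X : Type*}

/-- The zero register is zero and the heap pointer is odd. -/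
def Proper (σ : State X) : Prop := σ.nat 2 = 0 ∧ σ.nat 4 % 2 = 1

/-- The effect of a computation on the memory, apart from its result: registers up to `d` are
unchanged, and the heap has been extended. -/
structure Post (d : ℕ) (σ σ' : State X) : Prop where
  ext : Ext σ σ'
  proper : Proper σ'
  keep : ∀ a, a % 2 = 0 → a ≤ 2 * d → a ≠ 4 → a ≠ 10 → a ≠ 12 → σ'.nat a = σ.nat a

theorem Post.trans {d : ℕ} {σ₁ σ₂ σ₃ : State X} (h : Post d σ₁ σ₂) (h' : Post d σ₂ σ₃) :
    Post d σ₁ σ₃ :=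
  ⟨h.ext.trans h'.ext, h'.proper, fun a h0 h1 h2 h3 h4 =>
    (h'.keep a h0 h1 h2 h3 h4).trans (h.keep a h0 h1 h2 h3 h4)⟩

theorem Post.mono {d d' : ℕ} {σ σ' : State X} (h : Post d' σ σ') (hd : d ≤ d') : Post d σ σ' :=
  ⟨h.ext, h.proper, fun a h0 h1 => h.keep a h0 (by omega)⟩

theorem Post.refl {d : ℕ} {σ : State X} (h : Proper σ) : Post d σ σ :=
  ⟨Ext.refl σ, h, fun _ _ _ _ _ _ => rfl⟩

/-- Writing into a register beyond `d`. -/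
theorem post_setNat {d a v : ℕ} {σ : State X} (h : Proper σ) (ha : a % 2 = 0) (hd : 2 * d < a)
    (hd8 : 8 ≤ d) : Post d σ (σ.setNat a v) := by
  obtain ⟨h1, h2⟩ := h
  refine ⟨⟨?_, ?_, ?_, ?_⟩, ⟨?_, ?_⟩, ?_⟩
  all_goals simp only [State.setNat, Function.update_apply]
  · split_ifs <;> omega
  · intro b hb hb'; split_ifs <;> omega
  · intros; trivial
  · intros; trivial
  · split_ifs <;> omega
  · split_ifs <;> omega
  · intro b hb hb'; split_ifs <;> omega

/-- Writing into an even real cell. -/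
theorem post_setReal {d a : ℕ} {v : ℝ} {σ : State X} (h : Proper σ) (ha : a % 2 = 0) :
    Post d σ (σ.setReal a v) := by
  refine ⟨⟨le_rfl, fun _ _ _ => rfl, ?_, fun _ _ _ => rfl⟩, h, fun _ _ _ _ _ _ => rfl⟩
  intro b hb _
  simp only [State.setReal, Function.update_apply]
  rw [if_neg (by omega)]

/-- Writing into an even point cell. -/
theorem post_setPt {d a : ℕ} {v : Option X} {σ : State X} (h : Proper σ) (ha : a % 2 = 0) :
    Post d σ (σ.setPt a v) := by
  refine ⟨⟨le_rfl, fun _ _ _ => rfl, fun _ _ _ => rfl, ?_⟩, h, fun _ _ _ _ _ _ => rfl⟩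
  intro b hb _
  simp only [State.setPt, Function.update_apply]
  rw [if_neg (by omega)]

theorem rep_consI {d a b c : ℕ} {σ : State X} {v w : Val X} (h : Proper σ) (hd8 : 8 ≤ d)
    (ha : a % 2 = 0) (hb : b % 2 = 0) (hc : c % 2 = 0) (hda : 2 * d < a) (hdb : 16 ≤ b)
    (hdc : 16 ≤ c) (hv : Rep σ v (σ.nat b)) (hw : Rep σ w (σ.nat c)) :
    Post d σ ((consI a b c).foldl Instr.run σ) ∧
      Rep ((consI a b c).foldl Instr.run σ) (.pair v w)
        (((consI a b c).foldl Instr.run σ).nat a) ∧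
      ∀ e, e % 2 = 0 → 16 ≤ e → e ≠ a →
        ((consI a b c).foldl Instr.run σ).nat e = σ.nat e := by
  obtain ⟨h1, h2⟩ := h
  set σ' := (consI a b c).foldl Instr.run σ with hσ'
  -- The memory after the block as a table; the cases are in the reverse order of the writes, so
  -- that the last write to an address wins.
  have hn : ∀ e, σ'.nat e = if e = 4 then σ.nat 4 + 4 else if e = 10 then 4 else
      if e = a then σ.nat 4 else if e = σ.nat 4 + 2 then σ.nat c else
      if e = 12 then σ.nat 4 + 2 else if e = σ.nat 4 then σ.nat b else σ.nat e := by
    intro e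
    have n0 : σ.nat 4 ≠ 0 := by omega
    have n1 : σ.nat 4 ≠ 4 := by omega
    have n2 : σ.nat 4 ≠ 2 := by omega
    have n3 : σ.nat 4 ≠ 10 := by omega
    have n4 : σ.nat 4 + 2 ≠ 4 := by omega
    have n5 : σ.nat 4 + 2 ≠ 2 := by omega
    have n6 : σ.nat 4 + 2 ≠ 10 := by omega
    have n7 : c ≠ σ.nat 4 := by omega
    have n8 : c ≠ 12 := by omega
    have n9 : c ≠ 10 := by omega
    have n10 : a ≠ 4 := by omega
    have n11 : a ≠ 10 := by omega
    simp only [hσ', consI, List.foldl, Instr.run, State.setNat, Function.update_apply]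
    simp [n0, n7, n8, n9, n1.symm, n2.symm, n4.symm, n10.symm, h1]
    by_cases e4 : e = 4
    · simp [e4]
    by_cases e10 : e = 10
    · simp [e10]
    by_cases e12 : e = 12
    · have : (12 : ℕ) ≠ a := by omega
      have : (12 : ℕ) ≠ σ.nat 4 + 2 := by omega
      simp [*]
    simp [e4, e10, e12]
  have hr : σ'.real = σ.real := by simp [hσ', consI, Instr.run, State.setNat]
  have hp : σ'.pt = σ.pt := by simp [hσ', consI, Instr.run, State.setNat]
  have hext : Ext σ σ' := by
    refine ⟨?_, ?_, fun _ _ _ => by rw [hr], fun _ _ _ => by rw [hp]⟩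
    · rw [hn]; simp
    · intro e he hl; rw [hn]; split_ifs <;> omega
  have h4 : σ'.nat 4 = σ.nat 4 + 4 := by rw [hn]; simp
  refine ⟨⟨hext, ⟨?_, ?_⟩, ?_⟩, ⟨?_, ?_, ?_, ?_⟩, ?_⟩
  · rw [hn]; split_ifs <;> omega
  · rw [h4]; omega
  · intro e he hl h3 h10 h12; rw [hn]; split_ifs <;> omega
  · rw [hn a]; split_ifs <;> omega
  · rw [hn a, h4]; split_ifs <;> omega
  · have : σ'.nat a = σ.nat 4 := by rw [hn a]; split_ifs <;> omega
    rw [this]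
    have : σ'.nat (σ.nat 4) = σ.nat b := by rw [hn]; split_ifs <;> omega
    rw [this]; exact hv.mono hext
  · have : σ'.nat a = σ.nat 4 := by rw [hn a]; split_ifs <;> omega
    rw [this]
    have : σ'.nat (σ.nat 4 + 2) = σ.nat c := by rw [hn]; split_ifs <;> omega
    rw [this]; exact hw.mono hext
  · intro e he h16 hea; rw [hn]; split_ifs <;> omega

theorem rep_newRealI {d a : ℕ} {σ : State X} (h : Proper σ) (hd8 : 8 ≤ d)
    (ha : a % 2 = 0) (hda : 2 * d < a) :
    Post d σ ((newRealI a).foldl Instr.run σ) ∧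
      Rep ((newRealI a).foldl Instr.run σ) (.real (σ.real 0))
        (((newRealI a).foldl Instr.run σ).nat a) := by
  obtain ⟨h1, h2⟩ := h
  set σ' := (newRealI a).foldl Instr.run σ with hσ'
  have hn : ∀ e, σ'.nat e = if e = 4 then σ.nat 4 + 4 else if e = 10 then 4 else
      if e = a then σ.nat 4 else σ.nat e := by
    intro e
    have n10 : a ≠ 4 := by omega
    have n11 : a ≠ 10 := by omega
    simp only [hσ', newRealI, List.foldl, Instr.run, State.setNat, State.setReal,
      Function.update_apply]
    simp [n10.symm, h1]
  have hr : ∀ e, σ'.real e = if e = σ.nat 4 then σ.real 0 else σ.real e := by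
    intro e
    simp [hσ', newRealI, Instr.run, State.setNat, State.setReal, Function.update_apply]
  have hp : σ'.pt = σ.pt := by simp [hσ', newRealI, Instr.run, State.setNat, State.setReal]
  have hext : Ext σ σ' := by
    refine ⟨?_, ?_, ?_, fun _ _ _ => by rw [hp]⟩
    · rw [hn]; simp
    · intro e he hl; rw [hn]; split_ifs <;> omega
    · intro e he hl; rw [hr, if_neg (by omega)]
  have h4 : σ'.nat 4 = σ.nat 4 + 4 := by rw [hn]; simp
  have hA : σ'.nat a = σ.nat 4 := by rw [hn a]; split_ifs <;> omega
  refine ⟨⟨hext, ⟨?_, ?_⟩, ?_⟩, ⟨?_, ?_, ?_⟩⟩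
  · rw [hn]; split_ifs <;> omega
  · rw [h4]; omega
  · intro e he hl h3 h10 h12; rw [hn]; split_ifs <;> omega
  · rw [hA, h2]
  · rw [hA, h4]; omega
  · rw [hA, hr, if_pos rfl]

theorem rep_newPtI {d a : ℕ} {σ : State X} (h : Proper σ) (hd8 : 8 ≤ d)
    (ha : a % 2 = 0) (hda : 2 * d < a) {p : X} (hp0 : σ.pt 0 = some p) :
    Post d σ ((newPtI a).foldl Instr.run σ) ∧
      Rep ((newPtI a).foldl Instr.run σ) (.pt p)
        (((newPtI a).foldl Instr.run σ).nat a) := by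
  obtain ⟨h1, h2⟩ := h
  set σ' := (newPtI a).foldl Instr.run σ with hσ'
  have hn : ∀ e, σ'.nat e = if e = 4 then σ.nat 4 + 4 else if e = 10 then 4 else
      if e = a then σ.nat 4 else σ.nat e := by
    intro e
    have n10 : a ≠ 4 := by omega
    have n11 : a ≠ 10 := by omega
    simp only [hσ', newPtI, List.foldl, Instr.run, State.setNat, State.setPt,
      Function.update_apply]
    simp [n10.symm, h1]
  have hr : ∀ e, σ'.pt e = if e = σ.nat 4 then σ.pt 0 else σ.pt e := by
    intro e
    simp [hσ', newPtI, Instr.run, State.setNat, State.setPt, Function.update_apply]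
  have hp : σ'.real = σ.real := by simp [hσ', newPtI, Instr.run, State.setNat, State.setPt]
  have hext : Ext σ σ' := by
    refine ⟨?_, ?_, fun _ _ _ => by rw [hp], ?_⟩
    · rw [hn]; simp
    · intro e he hl; rw [hn]; split_ifs <;> omega
    · intro e he hl; rw [hr, if_neg (by omega)]
  have h4 : σ'.nat 4 = σ.nat 4 + 4 := by rw [hn]; simp
  have hA : σ'.nat a = σ.nat 4 := by rw [hn a]; split_ifs <;> omega
  refine ⟨⟨hext, ⟨?_, ?_⟩, ?_⟩, ⟨?_, ?_, ?_⟩⟩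
  · rw [hn]; split_ifs <;> omega
  · rw [h4]; omega
  · intro e he hl h3 h10 h12; rw [hn]; split_ifs <;> omega
  · rw [hA, h2]
  · rw [hA, h4]; omega
  · rw [hA, hr, if_pos rfl, hp0]

/-- From the memory `σ` the program computes the value `w` within `n` steps. -/
def Computes [MetricSpace X] (d : ℕ) (σ : State X) (p : Prog) (w : Val X) (n : ℕ) : Prop :=
  ∃ s k σ', Exec p σ s k σ' ∧ s + k ≤ n ∧ Post d σ σ' ∧ Rep σ' w (σ'.nat (2 * d + 2))

variable [MetricSpace X]

theorem Computes.seq_post {d : ℕ} {σ σ₁ : State X} {p q : Prog} {w : Val X} {n m s k : ℕ}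
    (he : Exec p σ s k σ₁) (hs : s + k ≤ m) (hp : Post d σ σ₁) (hq : Computes d σ₁ q w n) :
    Computes d σ (.seq p q) w (m + n) := by
  obtain ⟨s', k', σ', he', hs', hp', hr⟩ := hq
  exact ⟨_, _, σ', .seq he he', by omega, hp.trans hp', hr⟩

theorem Computes.mono {d : ℕ} {σ : State X} {p : Prog} {w : Val X} {n m : ℕ}
    (h : Computes d σ p w n) (hnm : n ≤ m) : Computes d σ p w m := by
  obtain ⟨s, k, σ', h1, h2, h3⟩ := h
  exact ⟨s, k, σ', h1, h2.trans hnm, h3⟩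

theorem foldl_copyI (a b : ℕ) {σ : State X} (h : Proper σ) :
    (copyI a b).foldl Instr.run σ = σ.setNat a (σ.nat b) := by
  simp [copyI, Instr.run, h.1]

theorem Post.keepReg {d i : ℕ} {σ σ' : State X} (h : Post d σ σ') (hi : 8 ≤ i) (hid : i ≤ d) :
    σ'.nat (2 * i) = σ.nat (2 * i) :=
  h.keep _ (by omega) (by omega) (by omega) (by omega) (by omega)

/-- Evaluation of two expressions, one after the other. -/
theorem computes_binary {d : ℕ} {σ : State X} {a b : Fn} {q : Prog} {v x y w : Val X}
    {na nb n : ℕ} (hd : 8 ≤ d) (h : Proper σ) (hv : Rep σ v (σ.nat (2 * d)))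
    (ha : Computes d σ (compile a d) x na)
    (hb : ∀ σ' : State X, Proper σ' → Rep σ' v (σ'.nat (2 * (d + 2))) →
      Computes (d + 2) σ' (compile b (d + 2)) y nb)
    (hq : ∀ σ' : State X, Proper σ' → σ'.nat (2 * d) = σ.nat (2 * d) → Ext σ σ' →
      Rep σ' x (σ'.nat (2 * d + 2)) →
      Rep σ' y (σ'.nat (2 * d + 6)) → Computes d σ' q w n) :
    Computes d σ (.seq (compile a d) (.seq (block (copyI (2 * d + 4) (2 * d)))
      (.seq (compile b (d + 2)) q))) w (na + (1 + (nb + n))) := by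
  obtain ⟨s₁, k₁, σ₁, he₁, hs₁, hp₁, hr₁⟩ := ha
  refine .seq_post he₁ hs₁ hp₁ ?_
  have hex := exec_block (copyI (2 * d + 4) (2 * d)) σ₁
  rw [foldl_copyI _ _ hp₁.proper] at hex
  set σ₂ := σ₁.setNat (2 * d + 4) (σ₁.nat (2 * d)) with hσ₂
  have hp₂ : Post (d + 1) σ₁ σ₂ := post_setNat hp₁.proper (by omega) (by omega) (by omega)
  refine .seq_post hex (by simp [copyI]) (hp₂.mono (by omega)) ?_
  have hv₂ : Rep σ₂ v (σ₂.nat (2 * (d + 2))) := by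
    have : σ₂.nat (2 * (d + 2)) = σ.nat (2 * d) := by
      rw [← hp₁.keepReg hd le_rfl, hσ₂]
      simp [State.setNat, mul_add]
    rw [this]
    exact hv.mono (hp₁.ext.trans hp₂.ext)
  obtain ⟨s₃, k₃, σ₃, he₃, hs₃, hp₃, hr₃⟩ := hb σ₂ hp₂.proper hv₂
  refine .seq_post he₃ hs₃ (hp₃.mono (by omega)) (hq σ₃ hp₃.proper ?_ ?_ ?_ hr₃)
  · rw [hp₃.keepReg hd (by omega), hp₂.keepReg hd (by omega), hp₁.keepReg hd le_rfl]
  · exact (hp₁.ext.trans hp₂.ext).trans hp₃.ext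
  · have h1 := hp₃.keepReg (i := d + 1) (by omega) (by omega)
    have h2 := hp₂.keepReg (i := d + 1) (by omega) (by omega)
    rw [mul_add, mul_one] at h1 h2
    rw [h1, h2]
    exact hr₁.mono (hp₂.ext.trans hp₃.ext)

theorem computes_setNat {d n : ℕ} {σ : State X} (hd : 8 ≤ d) (h : Proper σ) (i : Instr)
    (hi : i.run σ = σ.setNat (2 * d + 2) n) {w : Val X} (hw : Rep σ w n) :
    Computes d σ (block [i]) w 1 := by
  have hp : Post d σ (σ.setNat (2 * d + 2) n) := post_setNat h (by omega) (by omega) hd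
  refine ⟨_, _, _, exec_block _ σ, by simp, ?_, ?_⟩
  · simpa [hi] using hp
  · simpa [hi, State.setNat] using hw.mono hp.ext

theorem computes_ite {d : ℕ} {σ : State X} (b : Test) {p q : Prog} {w : Val X} {n : ℕ}
    (hp : b.Holds σ → Computes d σ p w n) (hq : ¬ b.Holds σ → Computes d σ q w n) :
    Computes d σ (.ite b p q) w (n + 1) := by
  by_cases hb : b.Holds σ
  · obtain ⟨s, k, σ', h1, h2, h3⟩ := hp hb
    exact ⟨_, _, σ', .ite_true hb h1, by omega, h3⟩
  · obtain ⟨s, k, σ', h1, h2, h3⟩ := hq hb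
    exact ⟨_, _, σ', .ite_false hb h1, by omega, h3⟩

/-- The last clause is needed since `Post d` does not protect register `d + 1`, which holds the
accumulator of a fold while the list advances. -/
theorem rep_sndI {a b d : ℕ} {σ : State X} {v w : Val X} (h : Proper σ) (hd : 8 ≤ d)
    (ha : a % 2 = 0) (hb : b % 2 = 0) (hda : 2 * d < a) (hb16 : 16 ≤ b)
    (hv : Rep σ (.pair v w) (σ.nat b)) :
    Post d σ ((sndI a b).foldl Instr.run σ) ∧
      Rep ((sndI a b).foldl Instr.run σ) w (((sndI a b).foldl Instr.run σ).nat a) ∧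
      ∀ e, e % 2 = 0 → 16 ≤ e → e ≠ a → ((sndI a b).foldl Instr.run σ).nat e = σ.nat e := by
  set σ' := (sndI a b).foldl Instr.run σ with hσ'
  have hn : ∀ e, σ'.nat e = if e = a then σ.nat (σ.nat b + 2) else
      if e = 12 then σ.nat b + 2 else if e = 10 then 2 else σ.nat e := by
    intro e
    have h1 : b ≠ 10 := by omega
    have h2 : σ.nat b ≠ 10 := by have := hv.1; omega
    have h3 : σ.nat b + 2 ≠ 12 := by have := hv.1; omega
    have h4 : σ.nat b + 2 ≠ 10 := by have := hv.1; omega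
    have h5 : σ.nat b ≠ 8 := by have := hv.1; omega
    simp [hσ', sndI, Instr.run, State.setNat, Function.update_apply, h1, h3, h4]
  have hr : σ'.real = σ.real := by simp [hσ', sndI, Instr.run, State.setNat]
  have hp : σ'.pt = σ.pt := by simp [hσ', sndI, Instr.run, State.setNat]
  obtain ⟨h1, h2⟩ := h
  have hext : Ext σ σ' := by
    refine ⟨?_, ?_, fun _ _ _ => by rw [hr], fun _ _ _ => by rw [hp]⟩
    · rw [hn]; split_ifs <;> omega
    · intro e he hl; rw [hn]; split_ifs <;> omega
  refine ⟨⟨hext, ⟨?_, ?_⟩, ?_⟩, ?_, ?_⟩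
  · rw [hn]; split_ifs <;> omega
  · rw [hn]; split_ifs <;> omega
  · intro e he hl h3 h10 h12; rw [hn]; split_ifs <;> omega
  · rw [hn a, if_pos rfl]; exact hv.2.2.2.mono hext
  · intro e he h16 hea; rw [hn]; split_ifs <;> omega

/-- The loop of the program for a fold. -/
theorem exec_foldLoop {d : ℕ} {b : Fn} {f : Val X → Val X → Option (Val X)}
    {g : Val X → Val X → ℕ} {v : Val X} (hd : 8 ≤ d)
    (hf : f = fun a acc => run b (.pair a (.pair acc v)))
    (hb : ∀ (σ : State X) (a acc w : Val X), Proper σ →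
      Rep σ (.pair a (.pair acc v)) (σ.nat (2 * (d + 4))) → f a acc = some w →
      Computes (d + 4) σ (compile b (d + 4)) w (20 * g a acc))
    (l : Val X) : ∀ (acc w : Val X) (σ : State X), Proper σ → Rep σ v (σ.nat (2 * d)) →
      Rep σ acc (σ.nat (2 * d + 2)) → Rep σ l (σ.nat (2 * d + 6)) → foldVal f l acc = some w →
      Computes d σ (.loop (.natNe (2 * d + 6) 2)
        (.seq (block (consI (2 * d + 8) (2 * d + 2) (2 * d) ++ .natLoad (2 * d + 10) (2 * d + 6) ::
          consI (2 * d + 8) (2 * d + 10) (2 * d + 8)))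
        (.seq (compile b (d + 4)) (block (copyI (2 * d + 2) (2 * d + 10) ++
          sndI (2 * d + 6) (2 * d + 6)))))) w (20 * foldCost f g l acc + 1) := by
  induction l with
  | nat n =>
    intro acc w σ h hv hacc hl hw
    simp only [foldVal] at hw
    split_ifs at hw with hn
    obtain rfl := Option.some.inj hw
    refine ⟨1, 0, σ, .loop_false ?_, by omega, Post.refl h, hacc⟩
    simp only [Rep] at hl
    simp [Test.Holds, hl, h.1, hn]
  | real x => intro acc w σ h hv hacc hl hw; simp [foldVal] at hw
  | pt p => intro acc w σ h hv hacc hl hw; simp [foldVal] at hw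
  | pair a l iha ihl =>
    intro acc w σ h hv hacc hl hw
    simp only [foldVal] at hw
    obtain ⟨acc', hacc', hw'⟩ := Option.bind_eq_some_iff.1 hw
    have hl1 := hl.1
    have hex := exec_block (consI (2 * d + 8) (2 * d + 2) (2 * d) ++
      .natLoad (2 * d + 10) (2 * d + 6) :: consI (2 * d + 8) (2 * d + 10) (2 * d + 8)) σ
    rw [List.foldl_append, List.foldl_cons] at hex
    -- the pair of accumulator and environment
    obtain ⟨hp₁, hr₁, hk₁⟩ := rep_consI (d := d + 3) (a := 2 * d + 8) (b := 2 * d + 2) (c := 2 * d)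
      h (by omega) (by omega) (by omega) (by omega) (by omega) (by omega) (by omega) hacc hv
    set σ₁ := (consI (2 * d + 8) (2 * d + 2) (2 * d)).foldl Instr.run σ
    -- the element
    have hrun : (Instr.natLoad (2 * d + 10) (2 * d + 6)).run σ₁ =
        σ₁.setNat (2 * d + 10) (σ₁.nat (σ₁.nat (2 * d + 6))) := rfl
    rw [hrun] at hex
    have hp₂ : Post (d + 4) σ₁ (σ₁.setNat (2 * d + 10) (σ₁.nat (σ₁.nat (2 * d + 6)))) :=
      post_setNat hp₁.proper (by omega) (by omega) (by omega)
    have hr₂ : Rep (σ₁.setNat (2 * d + 10) (σ₁.nat (σ₁.nat (2 * d + 6)))) a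
        ((σ₁.setNat (2 * d + 10) (σ₁.nat (σ₁.nat (2 * d + 6)))).nat (2 * d + 10)) := by
      have : (σ₁.setNat (2 * d + 10) (σ₁.nat (σ₁.nat (2 * d + 6)))).nat (2 * d + 10) =
          σ₁.nat (σ₁.nat (2 * d + 6)) := by simp [State.setNat]
      rw [this]
      have hl' := hl.mono hp₁.ext
      rw [← hk₁ (2 * d + 6) (by omega) (by omega) (by omega)] at hl'
      exact hl'.2.2.1.mono hp₂.ext
    have hk₂ : (σ₁.setNat (2 * d + 10) (σ₁.nat (σ₁.nat (2 * d + 6)))).nat (2 * d + 8) =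
        σ₁.nat (2 * d + 8) := by simp [State.setNat]
    set σ₂ := σ₁.setNat (2 * d + 10) (σ₁.nat (σ₁.nat (2 * d + 6)))
    have hr₂' := hr₁.mono hp₂.ext
    rw [← hk₂] at hr₂'
    obtain ⟨hp₃, hr₃, hk₃⟩ := rep_consI (d := d + 3) (a := 2 * d + 8) (b := 2 * d + 10)
      (c := 2 * d + 8) hp₂.proper (by omega) (by omega) (by omega) (by omega) (by omega) (by omega)
      (by omega) hr₂ hr₂'
    set σ₃ := (consI (2 * d + 8) (2 * d + 10) (2 * d + 8)).foldl Instr.run σ₂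
    have hp03 : Post (d + 3) σ σ₃ := (hp₁.trans (hp₂.mono (by omega))).trans hp₃
    -- the body
    rw [show 2 * d + 8 = 2 * (d + 4) by ring] at hr₃
    obtain ⟨s₄, k₄, σ₄, he₄, hs₄, hp₄, hr₄⟩ := hb σ₃ a acc acc' hp₃.proper hr₃ hacc'
    have hp04 : Post (d + 3) σ σ₄ := hp03.trans (hp₄.mono (by omega))
    -- the next accumulator and the next list
    have hex₅ := exec_block (copyI (2 * d + 2) (2 * d + 10) ++ sndI (2 * d + 6) (2 * d + 6)) σ₄
    rw [List.foldl_append, foldl_copyI _ _ hp₄.proper] at hex₅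
    have hp₅ : Post d σ₄ (σ₄.setNat (2 * d + 2) (σ₄.nat (2 * d + 10))) :=
      post_setNat hp₄.proper (by omega) (by omega) (by omega)
    have hr₅ : Rep (σ₄.setNat (2 * d + 2) (σ₄.nat (2 * d + 10))) acc'
        ((σ₄.setNat (2 * d + 2) (σ₄.nat (2 * d + 10))).nat (2 * d + 2)) := by
      have : (σ₄.setNat (2 * d + 2) (σ₄.nat (2 * d + 10))).nat (2 * d + 2) =
          σ₄.nat (2 * (d + 4) + 2) := by simp [State.setNat, mul_add]
      rw [this]
      exact hr₄.mono hp₅.ext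
    have hl₅ : Rep (σ₄.setNat (2 * d + 2) (σ₄.nat (2 * d + 10))) (.pair a l)
        ((σ₄.setNat (2 * d + 2) (σ₄.nat (2 * d + 10))).nat (2 * d + 6)) := by
      have : (σ₄.setNat (2 * d + 2) (σ₄.nat (2 * d + 10))).nat (2 * d + 6) =
          σ.nat (2 * d + 6) := by
        have h1 := hp04.keepReg (i := d + 3) (by omega) le_rfl
        rw [mul_add] at h1
        rw [← h1]
        simp [State.setNat]
      rw [this]
      exact hl.mono (hp04.ext.trans hp₅.ext)
    set σ₅ := σ₄.setNat (2 * d + 2) (σ₄.nat (2 * d + 10))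
    obtain ⟨hp₆, hr₆, hk₆⟩ := rep_sndI (a := 2 * d + 6) (b := 2 * d + 6) (d := d) hp₅.proper hd
      (by omega) (by omega) (by omega) (by omega) hl₅
    set σ₆ := (sndI (2 * d + 6) (2 * d + 6)).foldl Instr.run σ₅
    have hp06 : Post d σ σ₆ := (hp04.mono (by omega)).trans (hp₅.trans hp₆)
    have hv₆ : Rep σ₆ v (σ₆.nat (2 * d)) := by
      rw [hp06.keepReg hd le_rfl]; exact hv.mono hp06.ext
    have hacc₆ : Rep σ₆ acc' (σ₆.nat (2 * d + 2)) := by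
      rw [hk₆ _ (by omega) (by omega) (by omega)]; exact hr₅.mono hp₆.ext
    obtain ⟨s₇, k₇, σ₇, he₇, hs₇, hp₇, hr₇⟩ := ihl acc' w σ₆ hp₆.proper hv₆ hacc₆ hr₆ hw'
    refine ⟨_, _, σ₇, .loop_true ?_ (.seq hex (.seq he₄ hex₅)) he₇, ?_, hp06.trans hp₇, hr₇⟩
    · simp only [Test.Holds, h.1]
      omega
    · simp only [consI, copyI, sndI, List.length_append, List.length_cons, List.length_nil,
        foldCost, hacc', Option.elim]
      omega

/-- The loop of the program for a `loop`. -/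
theorem exec_loopLoop {d : ℕ} {c b : Fn} (hd : 8 ≤ d)
    (hc : ∀ (σ : State X) (x w : Val X), Proper σ → Rep σ x (σ.nat (2 * (d + 1))) →
      run c x = some w → Computes (d + 1) σ (compile c (d + 1)) w (20 * cost c x))
    (hb : ∀ (σ : State X) (x w : Val X), Proper σ → Rep σ x (σ.nat (2 * (d + 1))) →
      run b x = some w → Computes (d + 1) σ (compile b (d + 1)) w (20 * cost b x))
    (x : Val X) (n : ℕ) (hfin : LoopStops (run c) (run b) x n) :
    ∀ (j k : ℕ) (u w y : Val X) (σ : State X), k + j = n → Proper σ →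
      Rep σ u (σ.nat (2 * d + 2)) → Rep σ y (σ.nat (2 * d + 4)) →
      iterVal (run b) x k = some u → run c u = some y → iterVal (run b) x n = some w →
      Computes d σ (.loop (.natNe (2 * d + 4) 2) (.seq (compile b (d + 1))
        (.seq (block (copyI (2 * d + 2) (2 * d + 4))) (compile c (d + 1))))) w
        ((∑ i ∈ Finset.range j, (20 + 20 * (iterVal (run b) x (k + i)).elim 0 (cost b) +
          20 * (iterVal (run b) x (k + i + 1)).elim 0 (cost c))) + 1) := by
  intro j
  induction j with
  | zero =>
    intro k u w y σ hk h hu hy hit hcy hw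
    obtain rfl : k = n := by omega
    rw [hit] at hw
    obtain rfl := Option.some.inj hw
    have h0 := hfin.1
    rw [hit, Option.bind_some, hcy] at h0
    obtain rfl := Option.some.inj h0
    refine ⟨1, 0, σ, .loop_false ?_, by omega, Post.refl h, hu⟩
    simp only [Rep] at hy
    simp [Test.Holds, hy, h.1]
  | succ j ih =>
    intro k u w y σ hk h hu hy hit hcy hw
    have h1 := hfin.2 k (by omega)
    rw [hit, Option.bind_some, hcy] at h1
    obtain rfl := Option.some.inj h1
    -- The loop does stop later, so `hfin` prescribes the value of the condition at the next state;
    -- in particular that state exists.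
    have hnext : ∃ u', run b u = some u' ∧ ∃ y', run c u' = some y' := by
      have : ((iterVal (run b) x (k + 1)).bind (run c)) = some (.nat 0) ∨
          ((iterVal (run b) x (k + 1)).bind (run c)) = some (.nat 1) := by
        rcases Nat.lt_or_ge (k + 1) n with hlt | hge
        · exact Or.inr (hfin.2 _ hlt)
        · obtain rfl : k + 1 = n := by omega
          exact Or.inl hfin.1
      rw [iterVal, hit, Option.bind_some] at this
      rcases this with h | h
      all_goals
        obtain ⟨u', hu', hy'⟩ := Option.bind_eq_some_iff.1 h
        exact ⟨u', hu', _, hy'⟩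
    obtain ⟨u', hu', y', hy'⟩ := hnext
    have hit' : iterVal (run b) x (k + 1) = some u' := by rw [iterVal, hit, Option.bind_some, hu']
    obtain ⟨s₁, k₁, σ₁, he₁, hs₁, hp₁, hr₁⟩ := hb σ u u' h (by rw [mul_add]; exact hu) hu'
    have hex := exec_block (copyI (2 * d + 2) (2 * d + 4)) σ₁
    rw [foldl_copyI _ _ hp₁.proper] at hex
    have hp₂ : Post d σ₁ (σ₁.setNat (2 * d + 2) (σ₁.nat (2 * d + 4))) :=
      post_setNat hp₁.proper (by omega) (by omega) (by omega)
    have hr₂ : Rep (σ₁.setNat (2 * d + 2) (σ₁.nat (2 * d + 4))) u'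
        ((σ₁.setNat (2 * d + 2) (σ₁.nat (2 * d + 4))).nat (2 * (d + 1))) := by
      have : (σ₁.setNat (2 * d + 2) (σ₁.nat (2 * d + 4))).nat (2 * (d + 1)) =
          σ₁.nat (2 * (d + 1) + 2) := by simp [State.setNat, mul_add]
      rw [this]
      exact hr₁.mono hp₂.ext
    set σ₂ := σ₁.setNat (2 * d + 2) (σ₁.nat (2 * d + 4))
    obtain ⟨s₃, k₃, σ₃, he₃, hs₃, hp₃, hr₃⟩ := hc σ₂ u' y' hp₂.proper hr₂ hy'
    have hu₃ : Rep σ₃ u' (σ₃.nat (2 * d + 2)) := by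
      have h1 := hp₃.keepReg (i := d + 1) (by omega) (by omega)
      rw [mul_add, mul_one] at h1
      rw [h1]
      exact hr₂.mono hp₃.ext
    obtain ⟨s₄, k₄, σ₄, he₄, hs₄, hp₄, hr₄⟩ := ih (k + 1) u' w y' σ₃ (by omega) hp₃.proper hu₃
      (by rw [mul_add] at hr₃; exact hr₃) hit' hy' hw
    refine ⟨_, _, σ₄, .loop_true ?_ (.seq he₁ (.seq hex he₃)) he₄, ?_,
      (hp₁.mono (by omega)).trans (hp₂.trans ((hp₃.mono (by omega)).trans hp₄)), hr₄⟩
    · simp only [Rep] at hy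
      simp [Test.Holds, hy, h.1]
    · rw [Finset.sum_range_succ']
      have hre : ∀ i, k + (i + 1) = k + 1 + i := fun i => by ring
      rw [Finset.sum_congr rfl fun i _ => by rw [hre i]]
      simp only [copyI, List.length_cons, List.length_nil, add_zero, hit, hit', Option.elim_some]
      omega

/-- The program for an expression computes its value. -/
theorem compile_spec (e : Fn) : ∀ {d : ℕ} {σ : State X} {v w : Val X}, 8 ≤ d → Proper σ →
    Rep σ v (σ.nat (2 * d)) → run e v = some w →
    Computes d σ (compile e d) w (20 * cost e v) := by
  induction e with
  | env =>
    intro d σ v w hd h hv hw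
    obtain rfl := Option.some.inj hw
    refine (computes_setNat hd h _ ?_ hv).mono (by simp [cost])
    simp [Instr.run, h.1]
  | fst e ih =>
    intro d σ v w hd h hv hw
    simp only [run] at hw
    split at hw
    case h_2 => simp at hw
    rename_i a b hab
    obtain rfl := Option.some.inj hw
    obtain ⟨s, k, σ₁, he, hs, hp, hr⟩ := ih hd h hv hab
    refine (Computes.seq_post he hs hp (computes_setNat hd hp.proper _ rfl hr.2.2.1)).mono ?_
    simp only [cost]; omega
  | snd e ih =>
    intro d σ v w hd h hv hw
    simp only [run] at hw
    split at hw
    case h_2 => simp at hw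
    rename_i a b hab
    obtain rfl := Option.some.inj hw
    obtain ⟨s, k, σ₁, he, hs, hp, hr⟩ := ih hd h hv hab
    obtain ⟨hp', hr', -⟩ := rep_sndI (a := 2 * d + 2) (d := d) hp.proper hd (by omega) (by omega)
      (by omega) (by omega) hr
    refine (Computes.seq_post he hs hp ⟨_, _, _, exec_block _ _, le_rfl, hp', hr'⟩).mono ?_
    simp only [cost, sndI, List.length_cons, List.length_nil]; omega
  | pair a b iha ihb =>
    intro d σ v w hd h hv hw
    simp only [run] at hw
    split at hw
    case h_2 => simp at hw
    rename_i x y hx hy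
    obtain rfl := Option.some.inj hw
    refine (computes_binary (n := 7) hd h hv (iha hd h hv hx)
      (fun σ' h' hv' => ihb (by omega) h' hv' hy) ?_).mono (by simp only [cost]; omega)
    intro σ' h' _ _ hx' hy'
    obtain ⟨hp, hr, -⟩ := rep_consI (d := d) (a := 2 * d + 2) h' hd (by omega) (by omega) (by omega)
      (by omega) (by omega) (by omega) hx' hy'
    exact ⟨_, _, _, exec_block _ _, by simp [consI], hp, hr⟩
  | nat k =>
    intro d σ v w hd h hv hw
    obtain rfl := Option.some.inj hw
    exact (computes_setNat hd h _ rfl (show Rep σ (.nat k) k from rfl)).mono (by simp [cost])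
  | real q =>
    intro d σ v w hd h hv hw
    obtain rfl := Option.some.inj hw
    have hex := exec_block (.realConst 0 q :: newRealI (2 * d + 2)) σ
    rw [List.foldl_cons] at hex
    have hp₁ : Post d σ (σ.setReal 0 (q : ℝ)) := post_setReal h (by omega)
    obtain ⟨hp, hr⟩ := rep_newRealI (d := d) (a := 2 * d + 2) hp₁.proper hd (by omega) (by omega)
    rw [show (σ.setReal 0 (q : ℝ)).real 0 = q by simp [State.setReal]] at hr
    exact ⟨_, _, _, hex, by simp [newRealI, cost], hp₁.trans hp, hr⟩
  | add a b iha ihb =>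
    intro d σ v w hd h hv hw
    simp only [run] at hw
    split at hw
    case h_2 => simp at hw
    rename_i x y hx hy
    obtain rfl := Option.some.inj hw
    refine (computes_binary (n := 1) hd h hv (iha hd h hv hx)
      (fun σ' h' hv' => ihb (by omega) h' hv' hy) ?_).mono (by simp only [cost]; omega)
    intro σ' h' _ _ hx' hy'
    refine computes_setNat hd h' _ rfl ?_
    simp only [Rep] at hx' hy' ⊢
    rw [hx', hy']
  | nle a b iha ihb =>
    intro d σ v w hd h hv hw
    simp only [run] at hw
    split at hw
    case h_2 => simp at hw
    rename_i x y hx hy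
    obtain rfl := Option.some.inj hw
    refine (computes_binary (n := 2) hd h hv (iha hd h hv hx)
      (fun σ' h' hv' => ihb (by omega) h' hv' hy) ?_).mono (by simp only [cost]; omega)
    intro σ' h' _ _ hx' hy'
    simp only [Rep] at hx' hy'
    refine computes_ite _ (fun hle => ?_) (fun hle => ?_)
    all_goals
      simp only [Test.Holds, hx', hy'] at hle
      exact computes_setNat hd h' _ rfl (by simp [Rep, hle])
  | rle a b iha ihb =>
    intro d σ v w hd h hv hw
    simp only [run] at hw
    split at hw
    case h_2 => simp at hw
    rename_i x y hx hy
    obtain rfl := Option.some.inj hw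
    refine (computes_binary (n := 2 + 2) hd h hv (iha hd h hv hx)
      (fun σ' h' hv' => ihb (by omega) h' hv' hy) ?_).mono (by simp only [cost]; omega)
    intro σ' h' _ _ hx' hy'
    have hp₁ := post_setReal (d := d) (a := 0) (v := x) h' (by omega)
    have hp₂ := hp₁.trans (post_setReal (d := d) (a := 2) (v := y) hp₁.proper (by omega))
    have hex := exec_block [.realLoad 0 (2 * d + 2), .realLoad 2 (2 * d + 6)] σ'
    have hst : [Instr.realLoad 0 (2 * d + 2), .realLoad 2 (2 * d + 6)].foldl Instr.run σ' =
        (σ'.setReal 0 x).setReal 2 y := by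
      have hne : σ'.nat (2 * d + 6) ≠ 0 := by have := hy'.1; omega
      simp only [List.foldl, Instr.run]
      simp [State.setReal, hx'.2.2, hy'.2.2, hne]
    rw [hst] at hex
    refine Computes.seq_post hex (by simp) hp₂ (computes_ite _ (fun hle => ?_) (fun hle => ?_))
    all_goals
      simp only [Test.Holds, State.setReal] at hle
      exact computes_setNat hd hp₂.proper _ rfl (by simpa [Rep] using hle)
  | scale q a ih =>
    intro d σ v w hd h hv hw
    simp only [run] at hw
    split at hw
    case h_2 => simp at hw
    rename_i x hx
    obtain rfl := Option.some.inj hw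
    obtain ⟨s, k, σ₁, he, hs, hp, hr⟩ := ih hd h hv hx
    have hp₂ := post_setReal (d := d) (a := 0) (v := (q : ℝ) * x) hp.proper (by omega)
    have hex := exec_block (.realLoad 0 (2 * d + 2) :: .realScale 0 q 0 :: newRealI (2 * d + 2)) σ₁
    rw [List.foldl_cons, List.foldl_cons] at hex
    have hst : Instr.run (Instr.run σ₁ (.realLoad 0 (2 * d + 2))) (.realScale 0 q 0) =
        σ₁.setReal 0 ((q : ℝ) * x) := by
      simp [Instr.run, State.setReal, hr.2.2]
    rw [hst] at hex
    obtain ⟨hp', hr'⟩ := rep_newRealI (d := d) (a := 2 * d + 2) hp₂.proper hd (by omega) (by omega)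
    refine (Computes.seq_post he hs hp ⟨_, _, _, hex, le_rfl, hp₂.trans hp', ?_⟩).mono ?_
    · simpa [State.setReal] using hr'
    · simp only [cost, newRealI, List.length_cons, List.length_nil]; omega
  | dist a b iha ihb =>
    intro d σ v w hd h hv hw
    simp only [run] at hw
    split at hw
    case h_2 => simp at hw
    rename_i x y hx hy
    obtain rfl := Option.some.inj hw
    refine (computes_binary (n := 2 + 5) hd h hv (iha hd h hv hx)
      (fun σ' h' hv' => ihb (by omega) h' hv' hy) ?_).mono (by simp only [cost]; omega)
    intro σ' h' _ _ hx' hy'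
    have hp₁ := post_setPt (d := d) (a := 0) (v := some x) h' (by omega)
    have hp₂ := hp₁.trans (post_setPt (d := d) (a := 2) (v := some y) hp₁.proper (by omega))
    have hex := exec_block [.ptLoad 0 (2 * d + 2), .ptLoad 2 (2 * d + 6)] σ'
    have hst : [Instr.ptLoad 0 (2 * d + 2), .ptLoad 2 (2 * d + 6)].foldl Instr.run σ' =
        (σ'.setPt 0 (some x)).setPt 2 (some y) := by
      have hne : σ'.nat (2 * d + 6) ≠ 0 := by have := hy'.1; omega
      simp only [List.foldl, Instr.run]
      simp [State.setPt, hx'.2.2, hy'.2.2, hne]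
    rw [hst] at hex
    refine Computes.seq_post hex (by simp) hp₂ ?_
    have hp₃ := post_setReal (d := d) (a := 0) (v := Dist.dist x y) hp₂.proper (by omega)
    obtain ⟨hp', hr'⟩ := rep_newRealI (d := d) (a := 2 * d + 2) hp₃.proper hd (by omega) (by omega)
    refine ⟨_, _, _, .seq (.dist 0 0 2 _ x y ?_ ?_) (exec_block _ _), by simp [newRealI],
      hp₃.trans hp', ?_⟩
    · simp [State.setPt]
    · simp [State.setPt]
    · simpa [State.setReal] using hr'
  | ifz c t e ihc iht ihe =>
    intro d σ v w hd h hv hw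
    simp only [run] at hw
    split at hw
    case h_2 => simp at hw
    rename_i x hx
    obtain ⟨s, k, σ₁, he, hs, hp, hr⟩ := ihc hd h hv hx
    have hv₁ : Rep σ₁ v (σ₁.nat (2 * d)) := by
      rw [hp.keepReg hd le_rfl]; exact hv.mono hp.ext
    refine (Computes.seq_post he hs hp (computes_ite (n := 20 * (cost t v + cost e v)) _
      (fun hz => ?_) (fun hz => ?_))).mono (by simp only [cost]; omega)
    all_goals
      simp only [Test.Holds, hp.proper.1] at hz
      have hz' := hr.isZero_iff
    · rw [if_pos (hz'.2 hz)] at hw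
      exact (iht hd hp.proper hv₁ hw).mono (by omega)
    · rw [if_neg (fun hh => hz (hz'.1 hh))] at hw
      exact (ihe hd hp.proper hv₁ hw).mono (by omega)
  | comp f e ihf ihe =>
    intro d σ v w hd h hv hw
    simp only [run] at hw
    obtain ⟨x, hx, hfx⟩ := Option.bind_eq_some_iff.1 hw
    obtain ⟨s, k, σ₁, he, hs, hp, hr⟩ := ihe hd h hv hx
    obtain ⟨s', k', σ₂, he', hs', hp', hr'⟩ := ihf (d := d + 1) (by omega) hp.proper
      (by rw [mul_add]; exact hr) hfx
    have hcopy : Computes d σ₂ (block (copyI (2 * d + 2) (2 * d + 4))) w 1 := by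
      refine computes_setNat hd hp'.proper _ ?_ (n := σ₂.nat (2 * d + 4)) ?_
      · simp [Instr.run, hp'.proper.1]
      · rw [mul_add] at hr'; exact hr'
    refine (Computes.seq_post he hs hp (Computes.seq_post he' hs' (hp'.mono (by omega))
      hcopy)).mono ?_
    simp only [cost, hx, Option.elim]; omega
  | fold i l b ihi ihl ihb =>
    intro d σ v w hd h hv hw
    simp only [run] at hw
    split at hw
    case h_2 => simp at hw
    rename_i x y hx hy
    refine (computes_binary (n := 20 * foldCost (fun a acc => run b (.pair a (.pair acc v)))
        (fun a acc => cost b (.pair a (.pair acc v))) y x + 1) hd h hv (ihi hd h hv hx)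
      (fun σ' h' hv' => ihl (by omega) h' hv' hy) ?_).mono (by simp only [cost, hx, hy]; omega)
    intro σ' h' hk hext hx' hy'
    refine exec_foldLoop hd rfl (fun σ a acc w h hr hw => ihb (by omega) h hr hw) y x w σ' h' ?_
      hx' hy' hw
    rw [hk]; exact hv.mono hext
  | loop c b i ihc ihb ihi =>
    intro d σ v w hd h hv hw
    simp only [run] at hw
    split at hw
    case h_2 => simp at hw
    rename_i x hx
    obtain ⟨n, hn, hw'⟩ := Option.bind_eq_some_iff.1 hw
    have hfin := loopStops_of_loopCount hn
    -- The first test has a value: `0` if there are no iterations, and `1` otherwise.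
    have h0 : ∃ y, run c x = some y := by
      rcases Nat.eq_zero_or_pos n with rfl | hpos
      · have := hfin.1; rw [iterVal, Option.bind_some] at this; exact ⟨_, this⟩
      · have := hfin.2 0 hpos; rw [iterVal, Option.bind_some] at this; exact ⟨_, this⟩
    obtain ⟨y, hy⟩ := h0
    obtain ⟨s, k, σ₁, he, hs, hp, hr⟩ := ihi hd h hv hx
    obtain ⟨s', k', σ₂, he', hs', hp', hr'⟩ := ihc (d := d + 1) (by omega) hp.proper
      (by rw [mul_add]; exact hr) hy
    have hu : Rep σ₂ x (σ₂.nat (2 * d + 2)) := by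
      have h1 := hp'.keepReg (i := d + 1) (by omega) (by omega)
      rw [mul_add, mul_one] at h1
      rw [h1]
      exact hr.mono hp'.ext
    have hlast := exec_loopLoop hd (fun σ x w h hr hw => ihc (by omega) h hr hw)
      (fun σ x w h hr hw => ihb (by omega) h hr hw) x n hfin n 0 x w y σ₂ (by omega) hp'.proper hu
      (by rw [mul_add] at hr'; exact hr') rfl hy hw'
    refine (Computes.seq_post he hs hp (Computes.seq_post he' hs' (hp'.mono (by omega))
      hlast)).mono ?_
    -- The program evaluates the condition once before the loop and again after each body, whereas
    -- `cost` pairs every condition with the body that follows it. The two sums differ by a shift of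
    -- one.
    have hsum : ∀ m, (∑ j ∈ Finset.range m, (20 + 20 * (iterVal (run b) x (0 + j)).elim 0 (cost b) +
          20 * (iterVal (run b) x (0 + j + 1)).elim 0 (cost c))) + 20 * cost c x ≤
        20 * ((∑ k ∈ Finset.range m, (1 + (iterVal (run b) x k).elim 0 fun u =>
          cost c u + cost b u)) + (iterVal (run b) x m).elim 0 (cost c)) := by
      intro m
      induction m with
      | zero => simp [iterVal]
      | succ m ihm =>
        rw [Finset.sum_range_succ, Finset.sum_range_succ]
        simp only [zero_add] at ihm ⊢
        cases hm : iterVal (run b) x m with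
        | none => simp only [hm, Option.elim] at ihm ⊢; omega
        | some u => simp only [hm, Option.elim] at ihm ⊢; omega
    have := hsum n
    have hcost : cost (.loop c b i) v = 1 + cost i v + ((∑ k ∈ Finset.range n,
        (1 + (iterVal (run b) x k).elim 0 fun u => cost c u + cost b u)) +
          (iterVal (run b) x n).elim 0 (cost c)) := by
      simp only [cost, hx, hn]
      rfl
    omega

end Correctness

/-! ### Lists as values -/

section Lists

variable {X : Type*}

/-- The value that represents a list. -/
def encL {α : Type*} (ea : α → Val X) : List α → Val X
  | [] => .nat 0
  | a :: l => .pair (ea a) (encL ea l)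

@[simp] theorem encL_nil {α : Type*} (ea : α → Val X) : encL ea [] = .nat 0 := rfl

@[simp] theorem encL_cons {α : Type*} (ea : α → Val X) (a : α) (l : List α) :
    encL ea (a :: l) = .pair (ea a) (encL ea l) := rfl

theorem foldVal_encL {α β : Type*} (ea : α → Val X) (eb : β → Val X)
    {F : Val X → Val X → Option (Val X)} (f : β → α → β) (l : List α)
    (h : ∀ a ∈ l, ∀ b, F (ea a) (eb b) = some (eb (f b a))) (b : β) :
    foldVal F (encL ea l) (eb b) = some (eb (l.foldl f b)) := by
  induction l generalizing b with
  | nil => simp [foldVal]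
  | cons a l ih =>
    simp only [encL_cons, foldVal, h a List.mem_cons_self b, Option.bind_some, List.foldl_cons]
    exact ih (fun a ha => h a (List.mem_cons_of_mem _ ha)) _

theorem foldCost_encL_le {α : Type*} (ea : α → Val X) {F : Val X → Val X → Option (Val X)}
    {G : Val X → Val X → ℕ} {B : ℕ} (l : List α) (h : ∀ a ∈ l, ∀ acc, G (ea a) acc ≤ B)
    (acc : Val X) : foldCost F G (encL ea l) acc ≤ l.length * (B + 1) := by
  induction l generalizing acc with
  | nil => simp [foldCost]
  | cons a l ih =>
    have ih' := ih fun a ha => h a (List.mem_cons_of_mem _ ha)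
    have ha := h a List.mem_cons_self acc
    simp only [encL_cons, foldCost, List.length_cons]
    have : (F (ea a) acc).elim 0 (foldCost F G (encL ea l)) ≤ l.length * (B + 1) := by
      cases F (ea a) acc with
      | none => simp
      | some v => exact ih' v
    nlinarith

/-- For bodies whose cost depends on the accumulator: `I i` describes the accumulator after `i`
elements, typically by a bound for its size. -/
theorem foldCost_encL_le' {α β : Type*} (ea : α → Val X) (eb : β → Val X)
    {F : Val X → Val X → Option (Val X)} {G : Val X → Val X → ℕ} {B : ℕ} (f : β → α → β)
    (l : List α) (I : ℕ → β → Prop)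
    (hF : ∀ a ∈ l, ∀ b, F (ea a) (eb b) = some (eb (f b a))) (N : ℕ)
    (hI : ∀ i b, ∀ a ∈ l, I i b → I (i + 1) (f b a))
    (hB : ∀ i b, ∀ a ∈ l, i < N → I i b → G (ea a) (eb b) ≤ B) (i : ℕ) (hi : i + l.length ≤ N)
    (b : β) (hb : I i b) : foldCost F G (encL ea l) (eb b) ≤ l.length * (B + 1) := by
  induction l generalizing b i with
  | nil => simp [foldCost]
  | cons a l ih =>
    have ih' := ih (fun a ha => hF a (List.mem_cons_of_mem _ ha))
      (fun i b a ha => hI i b a (List.mem_cons_of_mem _ ha))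
      (fun i b a ha => hB i b a (List.mem_cons_of_mem _ ha)) (i + 1)
      (by rw [List.length_cons] at hi; omega) _ (hI i b a List.mem_cons_self hb)
    have ha := hB i b a List.mem_cons_self (by rw [List.length_cons] at hi; omega) hb
    simp only [encL_cons, foldCost, List.length_cons, hF a List.mem_cons_self b, Option.elim_some]
    nlinarith

end Lists

/-! ### Derived expressions -/

section Derived

/-- The innermost variable of an environment. -/
abbrev v0 : Fn := .fst .env
/-- The variable with index `1`. -/
abbrev v1 : Fn := .fst (.snd .env)
/-- The variable with index `2`. -/
abbrev v2 : Fn := .fst (.snd (.snd .env))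
/-- The variable with index `3`. -/
abbrev v3 : Fn := .fst (.snd (.snd (.snd .env)))
/-- The variable with index `4`. -/
abbrev v4 : Fn := .fst (.snd (.snd (.snd (.snd .env))))
/-- The variable with index `5`. -/
abbrev v5 : Fn := .fst (.snd (.snd (.snd (.snd (.snd .env)))))
/-- The variable with index `6`. -/
abbrev v6 : Fn := .fst (.snd (.snd (.snd (.snd (.snd (.snd .env))))))

/-- The reverse of a list. -/
def revE (l : Fn) : Fn := .fold (.nat 0) l (.pair v0 v1)

/-- The list of the values of `b` for the elements of `l`. -/
def mapE (l b : Fn) : Fn := revE (.fold (.nat 0) l (.pair b v1))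

/-- The elements of `l` for which the value of `p` is not zero. -/
def filterE (l p : Fn) : Fn := revE (.fold (.nat 0) l (.ifz p v1 (.pair v0 v1)))

/-- The concatenation of the lists `b` for the elements of `l`. -/
def flatMapE (l b : Fn) : Fn := revE (.fold (.nat 0) l (.fold v1 b (.pair v0 v1)))

/-- Whether `p` has a nonzero value for an element of `l`. -/
def anyE (l p : Fn) : Fn := .fold (.nat 0) l (.ifz v1 p (.nat 1))

/-- The sum of the values of `b` for the elements of `l`. -/
def sumE (l b : Fn) : Fn := .fold (.nat 0) l (.add v1 b)

variable {X : Type*} [MetricSpace X]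

/-- The number that represents a truth value. -/
def encB (b : Bool) : Val X := .nat b.toNat

theorem run_fold {α β : Type*} (ea : α → Val X) (eb : β → Val X) (f : β → α → β) (l : List α)
    (b₀ : β) {i le b : Fn} {v : Val X} (hi : run i v = some (eb b₀))
    (hl : run le v = some (encL ea l))
    (h : ∀ a ∈ l, ∀ y, run b (.pair (ea a) (.pair (eb y) v)) = some (eb (f y a))) :
    run (.fold i le b) v = some (eb (l.foldl f b₀)) := by
  simp only [run, hi, hl]
  exact foldVal_encL ea eb f l h b₀

theorem cost_fold_le {α : Type*} (ea : α → Val X) (l : List α) {i le b : Fn} {v x : Val X} {B : ℕ}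
    (hi : run i v = some x) (hl : run le v = some (encL ea l))
    (h : ∀ a ∈ l, ∀ acc, cost b (.pair (ea a) (.pair acc v)) ≤ B) :
    cost (.fold i le b) v ≤ 1 + cost i v + cost le v + l.length * (B + 1) := by
  simp only [cost, hi, hl]
  have := foldCost_encL_le (F := fun a acc => run b (.pair a (.pair acc v))) ea l
    (G := fun a acc => cost b (.pair a (.pair acc v))) h x
  omega

theorem cost_fold_le' {α β : Type*} (ea : α → Val X) (eb : β → Val X) (f : β → α → β)
    (l : List α) (b₀ : β) {i le b : Fn} {v : Val X} {B : ℕ} (I : ℕ → β → Prop)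
    (hi : run i v = some (eb b₀)) (hl : run le v = some (encL ea l))
    (hF : ∀ a ∈ l, ∀ y, run b (.pair (ea a) (.pair (eb y) v)) = some (eb (f y a)))
    (h0 : I 0 b₀) (hI : ∀ i b, ∀ a ∈ l, I i b → I (i + 1) (f b a))
    (hB : ∀ i y, ∀ a ∈ l, i < l.length → I i y → cost b (.pair (ea a) (.pair (eb y) v)) ≤ B) :
    cost (.fold i le b) v ≤ 1 + cost i v + cost le v + l.length * (B + 1) := by
  simp only [cost, hi, hl]
  have := foldCost_encL_le' (F := fun a acc => run b (.pair a (.pair acc v))) ea eb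
    (G := fun a acc => cost b (.pair a (.pair acc v))) f l I hF l.length hI hB 0 (by omega) b₀ h0
  omega

/-- Folds produce their output lists in reverse order, which is why the derived list operations end
with `revE`. -/
theorem foldl_cons {α β : Type*} (f : α → β) (l : List α) (acc : List β) :
    l.foldl (fun acc a => f a :: acc) acc = (l.map f).reverse ++ acc := by
  induction l generalizing acc with
  | nil => simp
  | cons a l ih => simp [ih]

theorem run_revE {α : Type*} (ea : α → Val X) (l : List α) {le : Fn} {v : Val X}
    (hl : run le v = some (encL ea l)) : run (revE le) v = some (encL ea l.reverse) := by
  have := run_fold ea (encL ea) (fun acc a => a :: acc) l [] (i := .nat 0) (le := le)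
    (b := .pair v0 v1) (v := v) (by simp [run]) hl (by simp [run])
  rw [revE, this, foldl_cons (fun a => a)]
  simp

theorem cost_revE_le {α : Type*} (ea : α → Val X) (l : List α) {le : Fn} {v : Val X}
    (hl : run le v = some (encL ea l)) : cost (revE le) v ≤ cost le v + 7 * l.length + 2 := by
  have := cost_fold_le ea l (i := .nat 0) (le := le)
    (b := .pair v0 v1) (v := v) (x := .nat 0) (B := 6) (by simp [run]) hl (by simp [cost])
  rw [revE]
  simp only [cost] at this ⊢
  omega

section Map

variable {α β : Type*} (ea : α → Val X) (eb : β → Val X) (f : α → β) (l : List α) {le b : Fn}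
  {v : Val X} {B : ℕ} (hl : run le v = some (encL ea l))
  (h : ∀ a ∈ l, ∀ acc, run b (.pair (ea a) (.pair acc v)) = some (eb (f a)))

include hl h

theorem run_mapE : run (mapE le b) v = some (encL eb (l.map f)) := by
  have := run_fold ea (encL eb) (fun acc a => f a :: acc) l [] (i := .nat 0) (le := le)
    (b := .pair b v1) (v := v) (by simp [run]) hl (by intro a ha y; simp [run, h a ha])
  rw [mapE, run_revE eb _ this, foldl_cons]
  simp

theorem cost_mapE_le (hB : ∀ a ∈ l, ∀ acc, cost b (.pair (ea a) (.pair acc v)) ≤ B) :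
    cost (mapE le b) v ≤ cost le v + l.length * (B + 12) + 4 := by
  have h1 := run_fold ea (encL eb) (fun acc a => f a :: acc) l [] (i := .nat 0) (le := le)
    (b := .pair b v1) (v := v) (by simp [run]) hl (by intro a ha y; simp [run, h a ha])
  have h2 := cost_fold_le ea l (i := .nat 0) (le := le)
    (b := .pair b v1) (v := v) (x := .nat 0) (B := B + 4) (by simp [run]) hl
    (by intro a ha acc; have := hB a ha acc; simp only [cost]; omega)
  have h3 := cost_revE_le eb _ h1
  rw [foldl_cons] at h3
  rw [mapE]
  simp only [cost, List.append_nil, List.length_reverse, List.length_map] at h2 h3 ⊢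
  nlinarith

end Map

theorem foldl_filter {α : Type*} (p : α → Bool) (l acc : List α) :
    l.foldl (fun acc a => if p a then a :: acc else acc) acc = (l.filter p).reverse ++ acc := by
  induction l generalizing acc with
  | nil => simp
  | cons a l ih => by_cases h : p a <;> simp [ih, h]

section Filter

variable {α : Type*} (ea : α → Val X) (p : α → Bool) (l : List α) {le b : Fn}
  {v : Val X} {B : ℕ} (hl : run le v = some (encL ea l))
  (h : ∀ a ∈ l, ∀ acc, run b (.pair (ea a) (.pair acc v)) = some (encB (p a)))

include hl h

theorem run_filterE_aux : run (.fold (.nat 0) le (.ifz b v1 (.pair v0 v1))) v =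
    some (encL ea (l.filter p).reverse) := by
  have := run_fold ea (encL ea) (fun acc a => if p a then a :: acc else acc) l [] (i := .nat 0)
    (le := le) (b := .ifz b v1 (.pair v0 v1)) (v := v) (by simp [run]) hl (by
      intro a ha y
      by_cases hp : p a <;> simp [run, h a ha, hp, encB, Val.IsZero])
  rw [this, foldl_filter, List.append_nil]

theorem run_filterE : run (filterE le b) v = some (encL ea (l.filter p)) := by
  rw [filterE, run_revE ea _ (run_filterE_aux ea p l hl h), List.reverse_reverse]

theorem cost_filterE_le (hB : ∀ a ∈ l, ∀ acc, cost b (.pair (ea a) (.pair acc v)) ≤ B) :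
    cost (filterE le b) v ≤ cost le v + l.length * (B + 18) + 4 := by
  have h2 := cost_fold_le ea l (i := .nat 0) (le := le)
    (b := .ifz b v1 (.pair v0 v1)) (v := v) (x := .nat 0) (B := B + 10) (by simp [run]) hl
    (by intro a ha acc; have := hB a ha acc; simp only [cost]; omega)
  have h3 := cost_revE_le ea _ (run_filterE_aux ea p l hl h)
  have h4 := List.length_filter_le p l
  rw [filterE]
  simp only [cost, List.length_reverse] at h2 h3 ⊢
  nlinarith

end Filter

section FlatMap

variable {α β : Type*} (ea : α → Val X) (eb : β → Val X) (f : α → List β) (l : List α)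
  {le b : Fn} {v : Val X} {B M : ℕ} (hl : run le v = some (encL ea l))
  (h : ∀ a ∈ l, ∀ acc, run b (.pair (ea a) (.pair acc v)) = some (encL eb (f a)))

include hl h

theorem run_flatMapE_aux : run (.fold (.nat 0) le (.fold v1 b (.pair v0 v1))) v =
    some (encL eb (l.flatMap f).reverse) := by
  have := run_fold ea (encL eb) (fun acc a => (f a).reverse ++ acc) l [] (i := .nat 0)
    (le := le) (b := .fold v1 b (.pair v0 v1)) (v := v) (by simp [run]) hl (by
      intro a ha y
      have := run_fold eb (encL eb) (fun acc a => a :: acc) (f a) y (i := v1) (le := b)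
        (b := .pair v0 v1) (v := .pair (ea a) (.pair (encL eb y) v)) (by simp [run]) (h a ha _)
        (by simp [run])
      rw [this, foldl_cons (fun a => a), List.map_id'])
  rw [this]
  congr 2
  have : ∀ acc, l.foldl (fun acc a => (f a).reverse ++ acc) acc = (l.flatMap f).reverse ++ acc := by
    clear this h hl
    induction l with
    | nil => simp
    | cons a l ih => intro acc; simp [ih]
  simp [this]

theorem run_flatMapE : run (flatMapE le b) v = some (encL eb (l.flatMap f)) := by
  rw [flatMapE, run_revE eb _ (run_flatMapE_aux ea eb f l hl h), List.reverse_reverse]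

theorem cost_flatMapE_le (hB : ∀ a ∈ l, ∀ acc, cost b (.pair (ea a) (.pair acc v)) ≤ B)
    (hM : ∀ a ∈ l, (f a).length ≤ M) :
    cost (flatMapE le b) v ≤ cost le v + l.length * (B + 14 * M + 5) + 4 := by
  have h2 := cost_fold_le ea l (i := .nat 0) (le := le)
    (b := .fold v1 b (.pair v0 v1)) (v := v) (x := .nat 0) (B := B + 7 * M + 4) (by simp [run]) hl
    (by
      intro a ha acc
      have h3 := cost_fold_le eb (f a) (i := v1) (le := b) (B := 6) (x := acc)
        (b := .pair v0 v1) (v := .pair (ea a) (.pair acc v)) (by simp [run]) (h a ha _)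
        (by simp [cost])
      have h4 := hB a ha acc
      have h5 := hM a ha
      refine h3.trans ?_
      simp only [v1, cost]
      omega)
  have h3 := cost_revE_le eb _ (run_flatMapE_aux ea eb f l hl h)
  have h4 : (l.flatMap f).length ≤ l.length * M := by
    rw [List.length_flatMap]
    have := List.sum_le_card_nsmul (l.map fun a => (f a).length) M (by
      intro n hn
      obtain ⟨a, ha, rfl⟩ := List.mem_map.1 hn
      exact hM a ha)
    simpa using this
  rw [flatMapE]
  simp only [cost, List.length_reverse] at h2 h3 ⊢
  nlinarith

end FlatMap

section Any

variable {α : Type*} (ea : α → Val X) (p : α → Bool) (l : List α) {le b : Fn}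
  {v : Val X} {B : ℕ} (hl : run le v = some (encL ea l))

include hl

theorem run_anyE (h : ∀ a ∈ l, ∀ acc, run b (.pair (ea a) (.pair acc v)) = some (encB (p a))) :
    run (anyE le b) v = some (encB (l.any p)) := by
  have := run_fold ea encB (fun acc a => acc || p a) l false (i := .nat 0)
    (le := le) (b := .ifz v1 b (.nat 1)) (v := v) (by simp [run, encB]) hl (by
      intro a ha y
      cases y <;> simp [run, h a ha, encB, Val.IsZero])
  rw [anyE, this]
  congr 2
  have : ∀ acc, l.foldl (fun acc a => acc || p a) acc = (acc || l.any p) := by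
    clear this h hl
    induction l with
    | nil => simp
    | cons a l ih => intro acc; simp [ih, Bool.or_assoc]
  simp [this]

theorem cost_anyE_le (hB : ∀ a ∈ l, ∀ acc, cost b (.pair (ea a) (.pair acc v)) ≤ B) :
    cost (anyE le b) v ≤ cost le v + l.length * (B + 6) + 2 := by
  have h2 := cost_fold_le ea l (i := .nat 0) (le := le)
    (b := .ifz v1 b (.nat 1)) (v := v) (x := .nat 0) (B := B + 5) (by simp [run]) hl
    (by intro a ha acc; have := hB a ha acc; simp only [cost]; omega)
  rw [anyE]
  simp only [cost] at h2 ⊢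
  nlinarith

end Any

section Sum

variable {α : Type*} (ea : α → Val X) (f : α → ℕ) (l : List α) {le b : Fn}
  {v : Val X} {B : ℕ} (hl : run le v = some (encL ea l))

include hl

theorem run_sumE (h : ∀ a ∈ l, ∀ acc, run b (.pair (ea a) (.pair acc v)) = some (.nat (f a))) :
    run (sumE le b) v = some (.nat (l.map f).sum) := by
  have := run_fold ea .nat (fun acc a => acc + f a) l 0 (i := .nat 0)
    (le := le) (b := .add v1 b) (v := v) (by simp [run]) hl (by
      intro a ha y; simp [run, h a ha])
  rw [sumE, this]
  congr 2
  have : ∀ acc, l.foldl (fun acc a => acc + f a) acc = acc + (l.map f).sum := by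
    clear this h hl
    induction l with
    | nil => simp
    | cons a l ih => intro acc; simp [ih, add_assoc]
  simp [this]

theorem cost_sumE_le (hB : ∀ a ∈ l, ∀ acc, cost b (.pair (ea a) (.pair acc v)) ≤ B) :
    cost (sumE le b) v ≤ cost le v + l.length * (B + 5) + 2 := by
  have h2 := cost_fold_le ea l (i := .nat 0) (le := le)
    (b := .add v1 b) (v := v) (x := .nat 0) (B := B + 4) (by simp [run]) hl
    (by intro a ha acc; have := hB a ha acc; simp only [cost]; omega)
  rw [sumE]
  simp only [cost] at h2 ⊢
  nlinarith

end Sum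

theorem iterVal_eq {b : Val X → Option (Val X)} (s : ℕ → Val X) (n : ℕ)
    (hb : ∀ k < n, b (s k) = some (s (k + 1))) : ∀ k ≤ n, iterVal b (s 0) k = some (s k) := by
  intro k hk
  induction k with
  | zero => rfl
  | succ k ih => rw [iterVal, ih (by omega), Option.bind_some, hb k (by omega)]

/-- A loop whose successive states are known. -/
theorem run_loop {c b i : Fn} {v : Val X} (s : ℕ → Val X) (n : ℕ) (hi : run i v = some (s 0))
    (hb : ∀ k < n, run b (s k) = some (s (k + 1)))
    (hc : ∀ k < n, run c (s k) = some (.nat 1)) (hn : run c (s n) = some (.nat 0)) :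
    run (.loop c b i) v = some (s n) := by
  have hit := iterVal_eq s n hb
  have hs : LoopStops (run c) (run b) (s 0) n :=
    ⟨by rw [hit n le_rfl, Option.bind_some, hn],
      fun k hk => by rw [hit k hk.le, Option.bind_some, hc k hk]⟩
  simp only [run, hi, hs.loopCount_eq, Option.bind_some, hit n le_rfl]

/-- The factor is `n + 1` because the condition is evaluated once more after the last iteration. -/
theorem cost_loop_le {c b i : Fn} {v : Val X} (s : ℕ → Val X) (n : ℕ) (hi : run i v = some (s 0))
    (hb : ∀ k < n, run b (s k) = some (s (k + 1)))
    (hc : ∀ k < n, run c (s k) = some (.nat 1)) (hn : run c (s n) = some (.nat 0)) {B : ℕ}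
    (hB : ∀ k ≤ n, cost c (s k) + cost b (s k) ≤ B) :
    cost (.loop c b i) v ≤ 1 + cost i v + (n + 1) * (B + 1) := by
  have hit := iterVal_eq s n hb
  have hs : LoopStops (run c) (run b) (s 0) n :=
    ⟨by rw [hit n le_rfl, Option.bind_some, hn],
      fun k hk => by rw [hit k hk.le, Option.bind_some, hc k hk]⟩
  have hsum : (∑ k ∈ Finset.range n, (1 + (iterVal (run b) (s 0) k).elim 0
      fun u => cost c u + cost b u)) ≤ n * (B + 1) := by
    have := Finset.sum_le_card_nsmul (Finset.range n) (fun k => 1 + (iterVal (run b) (s 0) k).elim 0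
      fun u => cost c u + cost b u) (B + 1) (by
        intro k hk
        have hk' := Finset.mem_range.1 hk
        have := hB k hk'.le
        rw [hit k hk'.le, Option.elim_some]
        omega)
    simpa using this
  have hlast : (iterVal (run b) (s 0) n).elim 0 (cost c) ≤ B := by
    rw [hit n le_rfl, Option.elim_some]
    have := hB n le_rfl
    omega
  have hcost : cost (.loop c b i) v = 1 + cost i v + ((∑ k ∈ Finset.range n,
      (1 + (iterVal (run b) (s 0) k).elim 0 fun u => cost c u + cost b u)) +
        (iterVal (run b) (s 0) n).elim 0 (cost c)) := by
    simp only [cost, hi, hs.loopCount_eq]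
    rfl
  rw [hcost]
  nlinarith

end Derived

/-! ### Trees -/

/-- A node of the net tree: its center, whether it is a cluster center of its level, whether there are
few points near it, the number of points below it, the radius of the lowest level below it for which
there are many points near all nodes from here on, and its children. -/
inductive Tree (X : Type*) where
  | mk (x : X) (flag bad : Bool) (c : ℕ) (g : ℝ) (ch : List (Tree X))

namespace Tree

variable {X : Type*}

/-- The center of a node. -/
def x : Tree X → X | mk x _ _ _ _ _ => x
/-- Whether the node is a cluster center. -/
def flag : Tree X → Bool | mk _ f _ _ _ _ => f
/-- Whether there are fewer points than necessary near the node. -/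
def bad : Tree X → Bool | mk _ _ b _ _ _ => b
/-- The number of points below the node. -/
def c : Tree X → ℕ | mk _ _ _ c _ _ => c
/-- The radius down to which the tree below the node is without bad nodes. -/
def g : Tree X → ℝ | mk _ _ _ _ g _ => g
/-- The stored children. -/
def ch : Tree X → List (Tree X) | mk _ _ _ _ _ l => l

/-- A leaf. It stands for an infinite chain of nodes. -/
def leaf (x : X) : Tree X := mk x true true 1 0 []

/-- The children of a node. -/
def kids (t : Tree X) : List (Tree X) :=
  match t.ch with
  | [] => [leaf t.x]
  | k :: l => k :: l

end Tree

mutual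
/-- The value that represents a tree. -/
def encT {X : Type*} : Tree X → Val X
  | .mk x f b c g ch => .pair (.pt x) (.pair (.nat f.toNat) (.pair (.nat b.toNat) (.pair (.nat c)
      (.pair (.real g) (encTs ch)))))
/-- The value that represents a list of trees. -/
def encTs {X : Type*} : List (Tree X) → Val X
  | [] => .nat 0
  | t :: l => .pair (encT t) (encTs l)
end

theorem encTs_eq {X : Type*} (l : List (Tree X)) : encTs l = encL encT l := by
  induction l with
  | nil => rfl
  | cons t l ih => simp [encTs, ih]

/-! ### Operations on lists of nodes of a level -/

section Level

variable {X : Type*} [MetricSpace X]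

/-- The children of the nodes near `x`. -/
noncomputable def near (x : X) (R : ℝ) (L : List (Tree X)) : List (Tree X) :=
  (L.flatMap Tree.kids).filter fun t => decide (dist t.x x ≤ 16 * R)

/-- Remove the node `x` and all children near `x`. -/
noncomputable def strip (x : X) (R : ℝ) (L : List (Tree X)) : List (Tree X) :=
  (L.filter fun t => !decide (dist t.x x ≤ 0)).map fun t =>
    .mk t.x t.flag t.bad t.c t.g (t.kids.filter fun k => !decide (dist k.x x ≤ 16 * R))

/-- Make `w` a child of `u`. -/
def addKid (w u : Tree X) : Tree X := .mk u.x u.flag u.bad u.c u.g (w :: u.ch)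

/-- A new node with the single child `w`. -/
def newNode (w : Tree X) : Tree X := .mk w.x false false 0 0 [w]

/-- Make `w` a child of the first node that is close enough, or of a new node. -/
noncomputable def attach (R : ℝ) (w : Tree X) : List (Tree X) → List (Tree X)
  | [] => [newNode w]
  | u :: L => if dist u.x w.x ≤ R then addKid w u :: L else u :: attach R w L

/-- Make all members of a list children of nodes of another list. -/
noncomputable def attachAll (R : ℝ) (K L : List (Tree X)) : List (Tree X) :=
  K.foldl (fun L w => attach R w L) L

/-- Compute the stored number of points and radius of a node from those of its children. -/
noncomputable def recount (R : ℝ) (t : Tree X) : Tree X :=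
  .mk t.x t.flag t.bad (t.ch.map Tree.c).sum
    (if t.ch.any Tree.bad then R else t.ch.foldl (fun m k => max m k.g) 0) t.ch

/-- Make a node a cluster center. -/
def setFlag (t : Tree X) : Tree X := .mk t.x true t.bad t.c t.g t.ch

/-- Choose new cluster centers near `x`, where `F` is the list of those that there are. -/
noncomputable def flagsFrom (x : X) (R : ℝ) : List X → List (Tree X) → List (Tree X)
  | _, [] => []
  | F, t :: L =>
    if dist t.x x ≤ 22 * R ∧ ¬ (F.any fun y => decide (dist y t.x ≤ 10 * R)) then
      setFlag t :: flagsFrom x R (t.x :: F) L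
    else t :: flagsFrom x R F L

/-- Choose new cluster centers near `x`. -/
noncomputable def flags (x : X) (R : ℝ) (L : List (Tree X)) : List (Tree X) :=
  flagsFrom x R ((L.filter Tree.flag).map Tree.x) L

/-- The number of points below nodes of the list that are near `y`. -/
noncomputable def weight (R : ℝ) (L : List (Tree X)) (y : X) : ℕ :=
  (L.map fun t => if dist t.x y ≤ 5 * R then t.c else 0).sum

/-- Find out which nodes are bad, near `x`. -/
noncomputable def bads (r : ℕ) (x : X) (R : ℝ) (L : List (Tree X)) : List (Tree X) :=
  L.map fun t => if dist t.x x ≤ 22 * R then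
    .mk t.x t.flag (!decide (r ≤ weight R L t.x)) t.c t.g t.ch else t

/-- Update of the nodes of a level near `x`, where `K` is the new list of nodes of the next level. -/
noncomputable def step (r : ℕ) (x : X) (R : ℝ) (L K : List (Tree X)) : List (Tree X) :=
  bads r x R (flags x R ((attachAll R K (strip x R L)).map (recount R)))

end Level

/-! ### Programs for these operations -/

/-- The components of a tree. -/
abbrev xE (t : Fn) : Fn := .fst t
/-- Whether the node is a cluster center. -/
abbrev flagE (t : Fn) : Fn := .fst (.snd t)
/-- Whether the node is bad. -/
abbrev badE (t : Fn) : Fn := .fst (.snd (.snd t))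
/-- The number of points below a node. -/
abbrev cE (t : Fn) : Fn := .fst (.snd (.snd (.snd t)))
/-- The stored radius of a node. -/
abbrev gE (t : Fn) : Fn := .fst (.snd (.snd (.snd (.snd t))))
/-- The stored children of a node. -/
abbrev chE (t : Fn) : Fn := .snd (.snd (.snd (.snd (.snd t))))
/-- A tree with given components. -/
abbrev mkE (x f b c g ch : Fn) : Fn := .pair x (.pair f (.pair b (.pair c (.pair g ch))))
/-- A leaf. -/
abbrev leafE (x : Fn) : Fn := mkE x (.nat 1) (.nat 1) (.nat 1) (.real 0) (.nat 0)
/-- The children of a node. -/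
abbrev kidsE (t : Fn) : Fn := .ifz (chE t) (.pair (leafE (xE t)) (.nat 0)) (chE t)
/-- Negation. -/
abbrev notE (b : Fn) : Fn := .ifz b (.nat 1) (.nat 0)
/-- Whether the distance of `a` and `b` is at most `q * R`. -/
abbrev dleE (q : ℚ) (a b R : Fn) : Fn := .rle (.dist a b) (.scale q R)

/-- The program for `near`, with arguments `x`, `R` and `L`. -/
def nearE : Fn := filterE (flatMapE v2 (kidsE v0)) (dleE 16 (xE v0) v2 v3)

/-- The program for `strip`, with arguments `x`, `R` and `L`. -/
def stripE : Fn := mapE (filterE v2 (notE (.rle (.dist (xE v0) v2) (.real 0))))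
  (mkE (xE v0) (flagE v0) (badE v0) (cE v0) (gE v0)
    (filterE (kidsE v0) (notE (dleE 16 (xE v0) v4 v5))))

/-- The loop for `attach`. -/
def attachLoopE : Fn := .fold (.pair (.nat 0) (.nat 0)) v2
  (.ifz (.fst v1)
    (.ifz (dleE 1 (xE v0) (xE v3) v2)
      (.pair (.nat 0) (.pair v0 (.snd v1)))
      (.pair (.nat 1) (.pair (mkE (xE v0) (flagE v0) (badE v0) (cE v0) (gE v0)
        (.pair v3 (chE v0))) (.snd v1))))
    (.pair (.nat 1) (.pair v0 (.snd v1))))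

/-- The program for `attach`, with arguments `R`, `w` and `L`. -/
def attachE : Fn := .comp
  (revE (.ifz (.fst v0) (.pair
    (mkE (xE v2) (.nat 0) (.nat 0) (.nat 0) (.real 0) (.pair v2 (.nat 0))) (.snd v0)) (.snd v0)))
  (.pair attachLoopE .env)

/-- The program for `attachAll`, with arguments `R`, `K` and `L`. -/
def attachAllE : Fn := .fold v2 v1 (.comp attachE (.pair v2 (.pair v0 (.pair v1 (.nat 0)))))

/-- The program for `recount`, with arguments `R` and a list of trees. -/
def recountE : Fn := mapE v1 (mkE (xE v0) (flagE v0) (badE v0) (sumE (chE v0) (cE v0))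
  (.ifz (anyE (chE v0) (badE v0))
    (.fold (.real 0) (chE v0) (.ifz (.rle v1 (gE v0)) v1 (gE v0))) v2) (chE v0))

/-- The program for `flags`, with arguments `x`, `R` and `L`. -/
def flagsE : Fn := revE (.snd (.fold (.pair (mapE (filterE v2 (flagE v0)) (xE v0)) (.nat 0)) v2
  (.ifz (dleE 22 (xE v0) v2 v3)
    (.pair (.fst v1) (.pair v0 (.snd v1)))
    (.ifz (anyE (.fst v1) (dleE 10 v0 (xE v2) v5))
      (.pair (.pair (xE v0) (.fst v1))
        (.pair (mkE (xE v0) (.nat 1) (badE v0) (cE v0) (gE v0) (chE v0)) (.snd v1)))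
      (.pair (.fst v1) (.pair v0 (.snd v1)))))))

/-- The program for `bads`, with arguments `r`, `x`, `R` and `L`. -/
def badsE : Fn := mapE v3 (.ifz (dleE 22 (xE v0) v3 v4) v0
  (mkE (xE v0) (flagE v0)
    (notE (.nle v2 (sumE v5 (.ifz (dleE 5 (xE v0) (xE v2) v6) (.nat 0) (cE v0)))))
    (cE v0) (gE v0) (chE v0)))

/-- The program for `step`, with arguments `r`, `x`, `R`, `L` and `K`. -/
def stepE : Fn := .comp badsE (.pair v0 (.pair v1 (.pair v2 (.pair
  (.comp flagsE (.pair v1 (.pair v2 (.pair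
    (.comp recountE (.pair v2 (.pair
      (.comp attachAllE (.pair v2 (.pair v4 (.pair
        (.comp stripE (.pair v1 (.pair v2 (.pair v3 (.nat 0))))) (.nat 0))))) (.nat 0))))
    (.nat 0))))) (.nat 0)))))

-- Correctness and cost of the programs that work on one level.

section Specs

variable {X : Type*} [MetricSpace X]

theorem encT_eq (t : Tree X) : encT t = .pair (.pt t.x) (.pair (.nat t.flag.toNat)
    (.pair (.nat t.bad.toNat) (.pair (.nat t.c) (.pair (.real t.g) (encL encT t.ch))))) := by
  cases t
  simp [encT, encTs_eq, Tree.x, Tree.flag, Tree.bad, Tree.c, Tree.g, Tree.ch]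

theorem run_kidsE {e : Fn} {v : Val X} {t : Tree X} (h : run e v = some (encT t)) :
    run (kidsE e) v = some (encL encT t.kids) := by
  rcases t with ⟨x, f, b, c, g, _ | ⟨k, l⟩⟩
  · simp [run, h, encT_eq, Tree.kids, Tree.ch, Tree.leaf, Val.IsZero, Tree.x, Tree.flag, Tree.bad,
      Tree.c, Tree.g]
  · simp [run, h, encT, encTs_eq, Tree.kids, Tree.ch, Val.IsZero]

theorem run_notE {e : Fn} {v : Val X} {b : Bool} (h : run e v = some (encB b)) :
    run (notE e) v = some (encB (!b)) := by
  cases b <;> simp [run, h, encB, Val.IsZero]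

theorem run_rle {a b : Fn} {v : Val X} {y z : ℝ} (ha : run a v = some (.real y))
    (hb : run b v = some (.real z)) : run (.rle a b) v = some (encB (decide (y ≤ z))) := by
  by_cases h : y ≤ z <;> simp [run, ha, hb, encB, h]

theorem run_nle {a b : Fn} {v : Val X} {y z : ℕ} (ha : run a v = some (.nat y))
    (hb : run b v = some (.nat z)) : run (.nle a b) v = some (encB (decide (y ≤ z))) := by
  by_cases h : y ≤ z <;> simp [run, ha, hb, encB, h]

theorem run_dleE {a b R : Fn} {q : ℚ} {v : Val X} {y z : X} {ρ c : ℝ} (hq : (q : ℝ) = c)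
    (ha : run a v = some (.pt y)) (hb : run b v = some (.pt z)) (hR : run R v = some (.real ρ)) :
    run (dleE q a b R) v = some (encB (decide (dist y z ≤ c * ρ))) :=
  run_rle (by simp [run, ha, hb]) (by simp [run, hR, hq])

theorem run_ifz {c t e : Fn} {v w : Val X} {b : Bool} (hc : run c v = some (encB b))
    (ht : b = false → run t v = some w) (he : b = true → run e v = some w) :
    run (.ifz c t e) v = some w := by
  cases b <;> simp [run, hc, encB, Val.IsZero, ht, he]

variable {x : X} {R : ℝ} {L K : List (Tree X)} {M : ℕ} {v : Val X}

omit [MetricSpace X] in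
theorem length_kids_le {t : Tree X} (hM : 1 ≤ M) (h : t.ch.length ≤ M) : t.kids.length ≤ M := by
  unfold Tree.kids
  split
  · simpa using hM
  · rename_i hh; rwa [hh] at h

omit [MetricSpace X] in
theorem length_flatMap_kids_le (hM : 1 ≤ M) (h : ∀ t ∈ L, t.ch.length ≤ M) :
    (L.flatMap Tree.kids).length ≤ L.length * M := by
  rw [List.length_flatMap]
  have := List.sum_le_card_nsmul (L.map fun a => a.kids.length) M (by
    intro n hn
    obtain ⟨a, ha, rfl⟩ := List.mem_map.1 hn
    exact length_kids_le hM (h a ha))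
  simpa using this

theorem run_nearE : run nearE (.pair (.pt x) (.pair (.real R) (.pair (encL encT L) v))) =
    some (encL encT (near x R L)) := by
  refine run_filterE encT (fun t : Tree X => decide (dist t.x x ≤ 16 * R)) (L.flatMap Tree.kids) ?_ ?_
  · exact run_flatMapE encT encT Tree.kids L (by simp [run]) fun t _ acc =>
      run_kidsE (by simp [run])
  · intro t _ acc
    exact run_dleE (by norm_num) (by simp [run, encT_eq]) (by simp [run]) (by simp [run])

/-- `M` bounds both the number of nodes and their degrees, so there are at most `M ^ 2` children,
each of which needs a constant number of steps. The other bounds for a level are quadratic in `M` as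
well. -/
theorem cost_nearE_le (hM : 1 ≤ M) (hL : L.length ≤ M) (h : ∀ t ∈ L, t.ch.length ≤ M) :
    cost nearE (.pair (.pt x) (.pair (.real R) (.pair (encL encT L) v))) ≤ 200 * M ^ 2 := by
  have hrun := run_flatMapE (le := v2) (v := .pair (.pt x) (.pair (.real R)
    (.pair (encL encT L) v))) encT encT Tree.kids L (by simp [run]) fun t _ acc =>
      run_kidsE (e := v0) (by simp [run])
  have h1 := cost_flatMapE_le (le := v2) (b := kidsE v0) (M := M) (v := .pair (.pt x)
    (.pair (.real R) (.pair (encL encT L) v))) encT encT Tree.kids L (by simp [run])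
    (fun t _ acc => run_kidsE (e := v0) (by simp [run])) (B := 35) (by simp [cost])
    (fun t ht => length_kids_le hM (h t ht))
  have h2 := cost_filterE_le (b := dleE 16 (xE v0) v2 v3) (B := 20) encT
    (fun t => decide (dist t.x x ≤ 16 * R)) _ hrun
    (fun t _ acc => run_dleE (by norm_num) (by simp [run, encT_eq]) (by simp [run])
      (by simp [run])) (by simp [cost])
  have h3 := length_flatMap_kids_le hM h
  rw [nearE]
  refine h2.trans ?_
  have h4 : L.length * M ≤ M * M := Nat.mul_le_mul_right _ hL
  have h5 : L.length * (35 + 14 * M + 5) ≤ M * (35 + 14 * M + 5) := Nat.mul_le_mul_right _ hL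
  have h6 : cost v2 (.pair (.pt x) (.pair (.real R) (.pair (encL encT L) v))) = 4 := rfl
  rw [h6] at h1
  nlinarith

theorem run_stripE : run stripE (.pair (.pt x) (.pair (.real R) (.pair (encL encT L) v))) =
    some (encL encT (strip x R L)) := by
  refine run_mapE encT encT _ _ (run_filterE encT (fun t : Tree X => !decide (dist t.x x ≤ 0)) L
    (by simp [run]) ?_) ?_
  · intro t _ acc
    exact run_notE (run_rle (by simp [run, encT_eq]) (by simp [run]))
  · intro t _ acc
    have := run_filterE (le := kidsE v0) (b := notE (dleE 16 (xE v0) v4 v5))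
      (v := .pair (encT t) (.pair acc (.pair (.pt x) (.pair (.real R) (.pair (encL encT L) v)))))
      encT (fun k => !decide (dist k.x x ≤ 16 * R)) t.kids (run_kidsE (by simp [run])) (by
        intro k _ acc
        exact run_notE (run_dleE (by norm_num) (by simp [run, encT_eq]) (by simp [run])
          (by simp [run])))
    rcases t with ⟨y, f, b, c, g, l⟩
    simp [run, encT, encTs_eq, Tree.x, Tree.flag, Tree.bad, Tree.c, Tree.g] at this ⊢
    simp [this]

theorem cost_stripE_le (hM : 1 ≤ M) (hL : L.length ≤ M) (h : ∀ t ∈ L, t.ch.length ≤ M) :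
    cost stripE (.pair (.pt x) (.pair (.real R) (.pair (encL encT L) v))) ≤ 300 * M ^ 2 := by
  have hrun := run_filterE (le := v2) (v := .pair (.pt x) (.pair (.real R)
    (.pair (encL encT L) v))) (b := notE (.rle (.dist (xE v0) v2) (.real 0))) encT
    (fun t => !decide (dist t.x x ≤ 0)) L (by simp [run])
    (fun t _ acc => run_notE (run_rle (by simp [run, encT_eq]) (by simp [run])))
  have h1 := cost_filterE_le (le := v2) (v := .pair (.pt x) (.pair (.real R)
    (.pair (encL encT L) v))) (b := notE (.rle (.dist (xE v0) v2) (.real 0))) (B := 30) encT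
    (fun t => !decide (dist t.x x ≤ 0)) L (by simp [run])
    (fun t _ acc => run_notE (run_rle (by simp [run, encT_eq]) (by simp [run]))) (by simp [cost])
  have hrun2 : ∀ t ∈ L, ∀ acc, run (filterE (kidsE v0) (notE (dleE 16 (xE v0) v4 v5)))
      (.pair (encT t) (.pair acc (.pair (.pt x) (.pair (.real R) (.pair (encL encT L) v))))) =
      some (encL encT (t.kids.filter fun k => !decide (dist k.x x ≤ 16 * R))) ∧
      cost (filterE (kidsE v0) (notE (dleE 16 (xE v0) v4 v5)))
      (.pair (encT t) (.pair acc (.pair (.pt x) (.pair (.real R) (.pair (encL encT L) v))))) ≤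
        39 + M * 58 := by
    intro t ht acc
    have hk : run (kidsE v0) (.pair (encT t) (.pair acc (.pair (.pt x) (.pair (.real R)
        (.pair (encL encT L) v))))) = some (encL encT t.kids) := run_kidsE (by simp [run])
    have hb : ∀ k ∈ t.kids, ∀ acc', run (notE (dleE 16 (xE v0) v4 v5)) (.pair (encT k) (.pair acc'
        (.pair (encT t) (.pair acc (.pair (.pt x) (.pair (.real R)
        (.pair (encL encT L) v))))))) = some (encB (!decide (dist k.x x ≤ 16 * R))) := by
      intro k _ acc
      exact run_notE (run_dleE (by norm_num) (by simp [run, encT_eq]) (by simp [run])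
          (by simp [run]))
    refine ⟨run_filterE encT _ _ hk hb, (cost_filterE_le (B := 40) encT _ _ hk hb
      (by simp [cost])).trans ?_⟩
    have h3 := Nat.mul_le_mul_right (40 + 18) (length_kids_le hM (h t ht))
    have h4 : ∀ v : Val X, cost (kidsE v0) v ≤ 35 := fun v => by simp [cost]
    exact (by have := h4 (.pair (encT t) (.pair acc (.pair (.pt x) (.pair (.real R)
      (.pair (encL encT L) v))))); omega)
  have h2 := cost_mapE_le (b := mkE (xE v0) (flagE v0) (badE v0) (cE v0) (gE v0)
    (filterE (kidsE v0) (notE (dleE 16 (xE v0) v4 v5)))) (B := 80 + M * 58) encT encT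
    (fun t => .mk t.x t.flag t.bad t.c t.g
      (t.kids.filter fun k => !decide (dist k.x x ≤ 16 * R))) _ hrun (by
      intro t ht acc
      have := (hrun2 t (List.mem_of_mem_filter ht) acc).1
      rcases t with ⟨y, f, b, c, g, l⟩
      simp [run, encT, encTs_eq, Tree.x, Tree.flag, Tree.bad, Tree.c, Tree.g] at this ⊢
      simp [this]) (by
      intro t ht acc
      have := (hrun2 t (List.mem_of_mem_filter ht) acc).2
      simp only [cost] at this ⊢
      omega)
  rw [stripE]
  refine h2.trans ?_
  have h3 := List.length_filter_le (fun t : Tree X => !decide (dist t.x x ≤ 0)) L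
  have h5 := Nat.mul_le_mul_right (80 + M * 58 + 12) (h3.trans hL)
  have h6 := Nat.mul_le_mul_right (30 + 18) hL
  have h7 : cost v2 (.pair (.pt x) (.pair (.real R) (.pair (encL encT L) v))) = 4 := rfl
  rw [h7] at h1
  nlinarith

/-- The state of the loop for `attach`. -/
def encBL (s : Bool × List (Tree X)) : Val X := .pair (.nat s.1.toNat) (encL encT s.2)

/-- One iteration of the loop for `attach`. -/
noncomputable def attachBody (R : ℝ) (w : Tree X) (s : Bool × List (Tree X)) (u : Tree X) :
    Bool × List (Tree X) :=
  if s.1 then (true, u :: s.2) else if dist u.x w.x ≤ R then (true, addKid w u :: s.2)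
  else (false, u :: s.2)

theorem foldl_attachBody_true (R : ℝ) (w : Tree X) (L out : List (Tree X)) :
    L.foldl (attachBody R w) (true, out) = (true, L.reverse ++ out) := by
  induction L generalizing out with
  | nil => rfl
  | cons u L ih => simp [attachBody, ih]

/-- A fold cannot stop early, so the program runs through the whole list with a mark that tells
whether `w` has found a parent. The output is reversed; a new node put in front of it thus ends up
last, as in `attach`. -/
theorem foldl_attachBody_false (R : ℝ) (w : Tree X) (L out : List (Tree X)) :
    (if (L.foldl (attachBody R w) (false, out)).1 then (L.foldl (attachBody R w) (false, out)).2
      else newNode w :: (L.foldl (attachBody R w) (false, out)).2).reverse =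
      out.reverse ++ attach R w L := by
  induction L generalizing out with
  | nil => simp [attach]
  | cons u L ih =>
    by_cases h : dist u.x w.x ≤ R
    · have : attachBody R w (false, out) u = (true, addKid w u :: out) := by simp [attachBody, h]
      rw [List.foldl_cons, this, foldl_attachBody_true]
      simp [attach, h]
    · have : attachBody R w (false, out) u = (false, u :: out) := by simp [attachBody, h]
      rw [List.foldl_cons, this, ih]
      simp [attach, h]

theorem length_foldl_attachBody (R : ℝ) (w : Tree X) (L : List (Tree X))
    (s : Bool × List (Tree X)) :
    (L.foldl (attachBody R w) s).2.length = s.2.length + L.length := by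
  induction L generalizing s with
  | nil => rfl
  | cons u L ih =>
    rw [List.foldl_cons, ih]
    have : (attachBody R w s u).2.length = s.2.length + 1 := by
      unfold attachBody; split_ifs <;> rfl
    rw [this, List.length_cons]
    omega

theorem run_attachLoopE {w : Tree X} :
    run attachLoopE (.pair (.real R) (.pair (encT w) (.pair (encL encT L) v))) =
      some (encBL (L.foldl (attachBody R w) (false, []))) := by
  refine run_fold encT encBL (attachBody R w) L (false, []) (by simp [run, encBL])
    (by simp [run]) ?_
  rintro u - ⟨b, out⟩
  refine run_ifz (b := b) (by simp [run, encBL, encB]) ?_ ?_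
  · rintro rfl
    refine run_ifz (b := decide (dist u.x w.x ≤ 1 * R))
      (run_dleE (by norm_num) (by simp [run, encT_eq]) (by simp [run, encT_eq]) (by simp [run]))
      ?_ ?_
    · intro h
      rw [one_mul, decide_eq_false_iff_not] at h
      simp [run, encBL, attachBody, h]
    · intro h
      rw [one_mul, decide_eq_true_iff] at h
      rw [show attachBody R w (false, out) u = (true, addKid w u :: out) by simp [attachBody, h]]
      rcases u with ⟨y, f, b, c, g, l⟩
      simp [run, encBL, addKid, encT, encTs_eq, Tree.x, Tree.flag, Tree.bad, Tree.c, Tree.g,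
        Tree.ch]
  · rintro rfl
    simp [run, encBL, attachBody]

theorem run_attachE_aux {w : Tree X} {env : Val X} {s : Bool × List (Tree X)} :
    run (.ifz (.fst v0) (.pair
      (mkE (xE v2) (.nat 0) (.nat 0) (.nat 0) (.real 0) (.pair v2 (.nat 0))) (.snd v0)) (.snd v0))
      (.pair (encBL s) (.pair (.real R) (.pair (encT w) env))) =
      some (encL encT (if s.1 then s.2 else newNode w :: s.2)) := by
  rcases s with ⟨b, out⟩
  refine run_ifz (b := b) (by simp [run, encBL, encB]) ?_ ?_
  · rintro rfl
    rcases w with ⟨y, f, b, c, g, l⟩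
    simp [run, encBL, newNode, encT, encTs_eq, Tree.x]
  · rintro rfl
    simp [run, encBL]

theorem run_attachE {w : Tree X} :
    run attachE (.pair (.real R) (.pair (encT w) (.pair (encL encT L) v))) =
      some (encL encT (attach R w L)) := by
  have h := foldl_attachBody_false R w L []
  rw [List.reverse_nil, List.nil_append] at h
  rw [← h]
  have hp : run (.pair attachLoopE .env)
      (.pair (.real R) (.pair (encT w) (.pair (encL encT L) v))) =
      some (.pair (encBL (L.foldl (attachBody R w) (false, [])))
        (.pair (.real R) (.pair (encT w) (.pair (encL encT L) v)))) := by
    simp only [run, run_attachLoopE]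
  rw [attachE, run, hp, Option.bind_some]
  exact run_revE encT _ run_attachE_aux

theorem cost_attachE_le {w : Tree X} :
    cost attachE (.pair (.real R) (.pair (encT w) (.pair (encL encT L) v))) ≤
      200 * (L.length + 1) := by
  have h1 := cost_fold_le (B := 130) (i := .pair (.nat 0) (.nat 0)) (le := v2)
    (b := (.ifz (.fst v1)
    (.ifz (dleE 1 (xE v0) (xE v3) v2)
      (.pair (.nat 0) (.pair v0 (.snd v1)))
      (.pair (.nat 1) (.pair (mkE (xE v0) (flagE v0) (badE v0) (cE v0) (gE v0)
        (.pair v3 (chE v0))) (.snd v1))))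
    (.pair (.nat 1) (.pair v0 (.snd v1)))))
    (v := .pair (.real R) (.pair (encT w) (.pair (encL encT L) v))) encT L
    (x := .pair (.nat 0) (.nat 0)) (by simp [run])
    (by simp [run]) (by simp [cost])
  have hp : run (.pair attachLoopE .env)
      (.pair (.real R) (.pair (encT w) (.pair (encL encT L) v))) =
      some (.pair (encBL (L.foldl (attachBody R w) (false, [])))
        (.pair (.real R) (.pair (encT w) (.pair (encL encT L) v)))) := by
    simp only [run, run_attachLoopE]
  have h2 := cost_revE_le encT _ (run_attachE_aux (R := R) (w := w)
    (s := L.foldl (attachBody R w) (false, [])) (env := .pair (encL encT L) v))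
  have h3 : (if (L.foldl (attachBody R w) (false, [])).1 then
      (L.foldl (attachBody R w) (false, [])).2
      else newNode w :: (L.foldl (attachBody R w) (false, [])).2).length ≤ L.length + 1 := by
    have := length_foldl_attachBody R w L (false, [])
    split_ifs
    · rw [this]; simp
    · rw [List.length_cons, this]; simp
  rw [attachE, cost, hp, Option.elim_some, cost]
  rw [← attachLoopE] at h1
  simp only [cost] at h1 h2 ⊢
  omega

theorem length_attach_le (w : Tree X) : (attach R w L).length ≤ L.length + 1 := by
  induction L with
  | nil => simp [attach]
  | cons u L ih => unfold attach; split_ifs <;> simp [ih]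

theorem length_attachAll_le : (attachAll R K L).length ≤ L.length + K.length := by
  induction K generalizing L with
  | nil => simp [attachAll]
  | cons w K ih =>
    have := (ih (L := attach R w L))
    have h := length_attach_le (R := R) (L := L) w
    simp only [attachAll, List.foldl_cons, List.length_cons] at this ⊢
    omega

theorem length_ch_attach_le {w : Tree X} {m : ℕ} (h : ∀ u ∈ L, u.ch.length ≤ m) :
    ∀ u ∈ attach R w L, u.ch.length ≤ m + 1 := by
  induction L with
  | nil => simp [attach, newNode, Tree.ch]
  | cons u L ih =>
    unfold attach
    have h1 := h u List.mem_cons_self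
    have h2 := fun t ht => h t (List.mem_cons_of_mem _ ht)
    split_ifs
    · intro t ht
      rcases List.mem_cons.1 ht with rfl | ht
      · simp only [addKid, Tree.ch, List.length_cons] at h1 ⊢
        exact Nat.succ_le_succ h1
      · exact (h2 t ht).trans (by omega)
    · intro t ht
      rcases List.mem_cons.1 ht with rfl | ht
      · omega
      · exact ih h2 t ht

/-- Each attachment raises the degree of one node by one. The crude bound suffices, because packing
bounds the degrees again once the level is finished. -/
theorem length_ch_attachAll_le {m : ℕ} (h : ∀ u ∈ L, u.ch.length ≤ m) :
    ∀ u ∈ attachAll R K L, u.ch.length ≤ m + K.length := by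
  induction K generalizing L m with
  | nil => simpa [attachAll] using h
  | cons w K ih =>
    intro u hu
    have := ih (length_ch_attach_le (R := R) (w := w) h) u hu
    rw [List.length_cons]
    omega

theorem run_attachAllE :
    run attachAllE (.pair (.real R) (.pair (encL encT K) (.pair (encL encT L) v))) =
      some (encL encT (attachAll R K L)) := by
  refine run_fold encT (encL encT) (fun L w => attach R w L) K L (by simp [run])
    (by simp [run]) ?_
  intro w _ l
  simp only [run, Option.bind_some]
  exact run_attachE

theorem cost_attachAllE_le (hM : 1 ≤ M) (hL : L.length ≤ M) (hK : K.length ≤ M) :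
    cost attachAllE (.pair (.real R) (.pair (encL encT K) (.pair (encL encT L) v))) ≤
      1000 * M ^ 2 := by
  have h := cost_fold_le' (i := v2) (le := v1)
    (b := .comp attachE (.pair v2 (.pair v0 (.pair v1 (.nat 0)))))
    (v := .pair (.real R) (.pair (encL encT K) (.pair (encL encT L) v)))
    encT (encL encT) (fun L w => attach R w L) K L
    (fun i l => l.length ≤ L.length + i) (B := 20 + 200 * (2 * M + 1)) (by simp [run])
    (by simp [run])
    (by
      intro w _ l
      simp only [run, Option.bind_some]
      exact run_attachE) (by simp)
    (by
      intro i l w _ hl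
      exact (length_attach_le w).trans (by omega))
    (by
      intro i l w _ hi hl
      have h1 := cost_attachE_le (R := R) (w := w) (L := l) (v := (.nat 0))
      simp only [cost, run, Option.elim_some]
      have : l.length + 1 ≤ 2 * M := by omega
      have h2 := Nat.mul_le_mul_left 200 this
      omega)
  rw [attachAllE]
  refine h.trans ?_
  have h6 : cost v2 (.pair (.real R) (.pair (encL encT K) (.pair (encL encT L) v))) = 4 := rfl
  have h7 : cost v1 (.pair (.real R) (.pair (encL encT K) (.pair (encL encT L) v))) = 3 := rfl
  rw [h6, h7]
  have h8 := Nat.mul_le_mul_right (20 + 200 * (2 * M + 1) + 1) hK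
  nlinarith

/-- The body of the program for `recount`. -/
theorem run_recountBody {t : Tree X} {acc : Val X} :
    run (mkE (xE v0) (flagE v0) (badE v0) (sumE (chE v0) (cE v0))
      (.ifz (anyE (chE v0) (badE v0))
      (.fold (.real 0) (chE v0) (.ifz (.rle v1 (gE v0)) v1 (gE v0))) v2) (chE v0))
      (.pair (encT t) (.pair acc (.pair (.real R) v))) = some (encT (recount R t)) := by
  rcases t with ⟨y, f, b, c, g, l⟩
  have h1 := run_sumE (le := chE v0) (b := cE v0) encT Tree.c l
    (v := .pair (encT (.mk y f b c g l)) (.pair acc (.pair (.real R) v)))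
    (by simp [run, encT, encTs_eq]) (by intro k _ acc; simp [run, encT_eq])
  have h2 := run_anyE (le := chE v0) (b := badE v0) encT Tree.bad l
    (v := .pair (encT (.mk y f b c g l)) (.pair acc (.pair (.real R) v)))
    (by simp [run, encT, encTs_eq]) (by intro k _ acc; simp [run, encT_eq, encB])
  have h3 := run_fold (i := .real 0) (le := chE v0)
    (b := .ifz (.rle v1 (gE v0)) v1 (gE v0)) encT .real (fun m k => max m k.g) l 0
    (v := .pair (encT (.mk y f b c g l)) (.pair acc (.pair (.real R) v)))
    (by simp [run]) (by simp [run, encT, encTs_eq]) (by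
      intro k _ m
      refine run_ifz (b := decide (m ≤ k.g))
        (run_rle (by simp [run]) (by simp [run, encT_eq])) ?_ ?_
      · intro h
        rw [decide_eq_false_iff_not, not_le] at h
        simp [run, max_eq_left h.le]
      · intro h
        rw [decide_eq_true_iff] at h
        simp [run, encT_eq, max_eq_right h])
  have h4 : run (.ifz (anyE (chE v0) (badE v0))
      (.fold (.real 0) (chE v0) (.ifz (.rle v1 (gE v0)) v1 (gE v0))) v2)
      (.pair (encT (.mk y f b c g l)) (.pair acc (.pair (.real R) v))) =
      some (.real (if l.any Tree.bad then R else l.foldl (fun m k => max m k.g) 0)) := by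
    refine run_ifz h2 ?_ ?_
    · intro h; rw [h3]; simp [h]
    · intro h; simp [run, h]
  have h5 : ∀ {x' f' b' c' g' l' : Fn} {w : Val X} {x₁ f₁ b₁ c₁ g₁ l₁ : Val X},
      run x' w = some x₁ → run f' w = some f₁ → run b' w = some b₁ → run c' w = some c₁ →
      run g' w = some g₁ → run l' w = some l₁ → run (mkE x' f' b' c' g' l') w =
      some (.pair x₁ (.pair f₁ (.pair b₁ (.pair c₁ (.pair g₁ l₁))))) := by
    intro x' f' b' c' g' l' w x₁ f₁ b₁ c₁ g₁ l₁ h1 h2 h3 h4 h5 h6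
    simp [run, h1, h2, h3, h4, h5, h6]
  rw [h5 (x₁ := .pt y) (f₁ := .nat f.toNat) (b₁ := .nat b.toNat) (l₁ := encL encT l)
    (by simp [run, encT]) (by simp [run, encT]) (by simp [run, encT]) h1 h4
    (by simp [run, encT, encTs_eq])]
  simp [recount, encT, encTs_eq, Tree.x, Tree.flag, Tree.bad, Tree.ch]

theorem run_recountE : run recountE (.pair (.real R) (.pair (encL encT L) v)) =
    some (encL encT (L.map (recount R))) :=
  run_mapE encT encT _ _ (by simp [run]) fun _ _ _ => run_recountBody

theorem cost_recountE_le (hM : 1 ≤ M) (hL : L.length ≤ 2 * M) (h : ∀ t ∈ L, t.ch.length ≤ 2 * M) :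
    cost recountE (.pair (.real R) (.pair (encL encT L) v)) ≤ 1000 * M ^ 2 := by
  have h1 := cost_mapE_le (le := v1) (v := .pair (.real R) (.pair (encL encT L) v))
    (b := mkE (xE v0) (flagE v0) (badE v0) (sumE (chE v0) (cE v0))
      (.ifz (anyE (chE v0) (badE v0))
      (.fold (.real 0) (chE v0) (.ifz (.rle v1 (gE v0)) v1 (gE v0))) v2) (chE v0))
    encT encT _ L (by simp [run]) (fun _ _ _ => run_recountBody) (B := 80 + 100 * M) (by
      intro t ht acc
      have hch : run (chE v0) (.pair (encT t) (.pair acc (.pair (.real R)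
        (.pair (encL encT L) v)))) = some (encL encT t.ch) := by simp [run, encT_eq]
      have h1 := cost_sumE_le (b := cE v0) encT t.ch hch (B := 6) (by simp [cost])
      have h2 := cost_anyE_le (b := badE v0) encT t.ch hch (B := 5) (by simp [cost])
      have h3 := cost_fold_le (i := .real 0) (b := .ifz (.rle v1 (gE v0)) v1 (gE v0))
        encT t.ch (x := .real 0) (by simp [run]) hch (B := 25) (by simp [cost])
      have hlen := h t ht
      simp only [cost] at h1 h2 h3 ⊢
      omega)
  rw [recountE]
  refine h1.trans ?_
  have h6 : cost v1 (.pair (.real R) (.pair (encL encT L) v)) = 3 := rfl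
  rw [h6]
  have h8 := Nat.mul_le_mul_right (80 + 100 * M + 12) hL
  nlinarith

/-- The state of the loop for `flags`. -/
def encFL (s : List X × List (Tree X)) : Val X := .pair (encL .pt s.1) (encL encT s.2)

/-- One iteration of the loop for `flags`. -/
noncomputable def flagsBody (x : X) (R : ℝ) (s : List X × List (Tree X)) (t : Tree X) :
    List X × List (Tree X) :=
  if dist t.x x ≤ 22 * R ∧ ¬ (s.1.any fun y => decide (dist y t.x ≤ 10 * R)) then
    (t.x :: s.1, setFlag t :: s.2) else (s.1, t :: s.2)

/-- The list of centers is part of the state of the loop, as each new center influences all later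
decisions. -/
theorem foldl_flagsBody (F : List X) (out : List (Tree X)) :
    (L.foldl (flagsBody x R) (F, out)).2 = (flagsFrom x R F L).reverse ++ out := by
  induction L generalizing F out with
  | nil => simp [flagsFrom]
  | cons t L ih =>
    rw [List.foldl_cons, flagsFrom]
    by_cases h : dist t.x x ≤ 22 * R ∧ ¬ (F.any fun y => decide (dist y t.x ≤ 10 * R))
    · rw [if_pos h, flagsBody, if_pos h, ih]; simp
    · rw [if_neg h, flagsBody, if_neg h, ih]; simp

/-- The expression for one iteration of the loop for `flags`. -/
abbrev flagsBodyE : Fn := .ifz (dleE 22 (xE v0) v2 v3)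
    (.pair (.fst v1) (.pair v0 (.snd v1)))
    (.ifz (anyE (.fst v1) (dleE 10 v0 (xE v2) v5))
      (.pair (.pair (xE v0) (.fst v1))
        (.pair (mkE (xE v0) (.nat 1) (badE v0) (cE v0) (gE v0) (chE v0)) (.snd v1)))
      (.pair (.fst v1) (.pair v0 (.snd v1))))

theorem run_flagsBodyE {t : Tree X} {s : List X × List (Tree X)} :
    run flagsBodyE (.pair (encT t) (.pair (encFL s) (.pair (.pt x) (.pair (.real R) v)))) =
      some (encFL (flagsBody x R s t)) := by
  rcases s with ⟨F, out⟩
  have hany := run_anyE (le := .fst v1) (b := dleE 10 v0 (xE v2) v5) .pt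
    (fun y => decide (dist y t.x ≤ 10 * R)) F
    (v := .pair (encT t) (.pair (encFL (F, out)) (.pair (.pt x) (.pair (.real R) v))))
    (by simp [run, encFL])
    (fun y _ acc => run_dleE (by norm_num) (by simp [run]) (by simp [run, encT_eq])
      (by simp [run]))
  refine run_ifz (b := decide (dist t.x x ≤ 22 * R))
    (run_dleE (by norm_num) (by simp [run, encT_eq]) (by simp [run]) (by simp [run])) ?_ ?_
  · intro h
    rw [decide_eq_false_iff_not] at h
    simp [run, encFL, flagsBody, h]
  · intro h
    rw [decide_eq_true_iff] at h
    refine run_ifz hany ?_ ?_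
    · intro h'
      rcases t with ⟨y, f, b, c, g, l⟩
      rw [flagsBody, if_pos ⟨h, by simpa using h'⟩]
      simp [run, encFL, setFlag, encT, encTs_eq, Tree.x, Tree.bad, Tree.c, Tree.g, Tree.ch]
    · intro h'
      rw [flagsBody, if_neg (fun hh => hh.2 h')]
      simp [run, encFL]

theorem run_flagsInit : run (.pair (mapE (filterE v2 (flagE v0)) (xE v0)) (.nat 0))
    (.pair (.pt x) (.pair (.real R) (.pair (encL encT L) v))) =
      some (encFL ((L.filter Tree.flag).map Tree.x, [])) := by
  have h1 := run_filterE (le := v2) (b := flagE v0) encT Tree.flag L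
    (v := .pair (.pt x) (.pair (.real R) (.pair (encL encT L) v))) (by simp [run])
    (by intro t _ acc; simp [run, encT_eq, encB])
  have h2 := run_mapE (b := xE v0) encT .pt Tree.x _ h1 (by intro t _ acc; simp [run, encT_eq])
  simp only [run, h2]
  rfl

theorem run_flagsE : run flagsE (.pair (.pt x) (.pair (.real R) (.pair (encL encT L) v))) =
    some (encL encT (flags x R L)) := by
  have h3 := run_fold encT encFL (flagsBody x R) L _ (le := v2) (b := flagsBodyE)
    (run_flagsInit (x := x) (R := R) (L := L) (v := v)) (by simp [run])
    (fun t _ s => run_flagsBodyE)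
  have h4 := foldl_flagsBody (L := L) (x := x) (R := R) ((L.filter Tree.flag).map Tree.x) []
  rw [List.append_nil] at h4
  have h5 : run (.snd (.fold (.pair (mapE (filterE v2 (flagE v0)) (xE v0)) (.nat 0)) v2
      flagsBodyE)) (.pair (.pt x) (.pair (.real R) (.pair (encL encT L) v))) =
      some (encL encT (flags x R L).reverse) := by
    rw [run, h3, flags, ← h4]
    rfl
  rw [flagsE, run_revE encT _ h5, List.reverse_reverse]

theorem length_flagsFrom (F : List X) : (flagsFrom x R F L).length = L.length := by
  induction L generalizing F with
  | nil => rfl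
  | cons t L ih => rw [flagsFrom]; split_ifs <;> simp [ih]

theorem cost_flagsE_le (hM : 1 ≤ M) (hL : L.length ≤ 2 * M) :
    cost flagsE (.pair (.pt x) (.pair (.real R) (.pair (encL encT L) v))) ≤ 1000 * M ^ 2 := by
  have h1 := run_filterE (le := v2) (b := flagE v0) encT Tree.flag L
    (v := .pair (.pt x) (.pair (.real R) (.pair (encL encT L) v))) (by simp [run])
    (by intro t _ acc; simp [run, encT_eq, encB])
  have c1 := cost_filterE_le (le := v2) (b := flagE v0) (B := 4) encT Tree.flag L
    (v := .pair (.pt x) (.pair (.real R) (.pair (encL encT L) v))) (by simp [run])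
    (by intro t _ acc; simp [run, encT_eq, encB]) (by simp [cost])
  have c2 := cost_mapE_le (b := xE v0) (B := 3) encT .pt Tree.x _ h1
    (by intro t _ acc; simp [run, encT_eq]) (by simp [cost])
  have hlen := List.length_filter_le Tree.flag L
  have c3 := cost_fold_le' encT encFL (flagsBody x R) L _ (le := v2) (b := flagsBodyE)
    (fun i s => s.1.length ≤ L.length + i) (B := 100 + 160 * M)
    (run_flagsInit (x := x) (R := R) (L := L) (v := v)) (by simp [run])
    (fun t _ s => run_flagsBodyE) (by simpa using hlen)
    (by
      intro i s t _ hs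
      unfold flagsBody
      split_ifs
      · simp only [List.length_cons]; omega
      · simp only; omega)
    (by
      intro i s t _ hi hs
      have hc := cost_anyE_le (le := .fst v1) (b := dleE 10 v0 (xE v2) v5) .pt s.1 (B := 20)
        (v := .pair (encT t) (.pair (encFL s) (.pair (.pt x) (.pair (.real R)
          (.pair (encL encT L) v))))) (by simp [run, encFL]) (by simp [cost])
      simp only [cost] at hc ⊢
      nlinarith)
  have h3 := run_fold encT encFL (flagsBody x R) L _ (le := v2) (b := flagsBodyE)
    (run_flagsInit (x := x) (R := R) (L := L) (v := v)) (by simp [run])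
    (fun t _ s => run_flagsBodyE)
  have h4 := foldl_flagsBody (L := L) (x := x) (R := R) ((L.filter Tree.flag).map Tree.x) []
  rw [List.append_nil] at h4
  have h5 : run (.snd (.fold (.pair (mapE (filterE v2 (flagE v0)) (xE v0)) (.nat 0)) v2
      flagsBodyE)) (.pair (.pt x) (.pair (.real R) (.pair (encL encT L) v))) =
      some (encL encT (flags x R L).reverse) := by
    rw [run, h3, flags, ← h4]
    rfl
  have c4 := cost_revE_le encT _ h5
  rw [List.length_reverse, flags, length_flagsFrom] at c4
  rw [flagsE]
  refine c4.trans ?_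
  have e1 : cost v2 (.pair (.pt x) (.pair (.real R) (.pair (encL encT L) v))) = 4 := rfl
  rw [e1] at c1 c3
  have e2 : ∀ (a : Fn) (w : Val X), cost (.snd a) w = 1 + cost a w := fun _ _ => rfl
  have e3 : ∀ (a b : Fn) (w : Val X), cost (.pair a b) w = 1 + cost a w + cost b w :=
    fun _ _ _ => rfl
  have e4 : ∀ (w : Val X), cost (.nat 0) w = 1 := fun _ => rfl
  rw [e3, e4] at c3
  rw [e2]
  have h8 := Nat.mul_le_mul_right (100 + 160 * M + 1) hL
  have h9 := Nat.mul_le_mul_right (3 + 12) (hlen.trans hL)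
  have h10 := Nat.mul_le_mul_right (4 + 18) hL
  nlinarith

/-- The expression for one element in the program for `bads`. -/
abbrev badsBodyE : Fn := .ifz (dleE 22 (xE v0) v3 v4) v0
  (mkE (xE v0) (flagE v0)
    (notE (.nle v2 (sumE v5 (.ifz (dleE 5 (xE v0) (xE v2) v6) (.nat 0) (cE v0)))))
    (cE v0) (gE v0) (chE v0))

theorem run_badsBodyE {r : ℕ} {t : Tree X} {acc : Val X} :
    run badsBodyE (.pair (encT t) (.pair acc (.pair (.nat r) (.pair (.pt x) (.pair (.real R)
      (.pair (encL encT L) v)))))) =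
      some (encT (if dist t.x x ≤ 22 * R then
        .mk t.x t.flag (!decide (r ≤ weight R L t.x)) t.c t.g t.ch else t)) := by
  have h1 := run_sumE (le := v5) (b := .ifz (dleE 5 (xE v0) (xE v2) v6) (.nat 0) (cE v0)) encT
    (fun t' => if dist t'.x t.x ≤ 5 * R then t'.c else 0) L
    (v := .pair (encT t) (.pair acc (.pair (.nat r) (.pair (.pt x) (.pair (.real R)
      (.pair (encL encT L) v)))))) (by simp [run]) (by
      intro t' _ acc
      refine run_ifz (b := decide (dist t'.x t.x ≤ 5 * R))
        (run_dleE (by norm_num) (by simp [run, encT_eq]) (by simp [run, encT_eq]) (by simp [run]))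
        ?_ ?_
      · intro h
        rw [decide_eq_false_iff_not] at h
        simp [run, h]
      · intro h
        rw [decide_eq_true_iff] at h
        simp [run, encT_eq, h])
  have h2 := run_notE (run_nle (a := v2) (y := r) (by simp [run]) h1)
  refine run_ifz (b := decide (dist t.x x ≤ 22 * R))
    (run_dleE (by norm_num) (by simp [run, encT_eq]) (by simp [run]) (by simp [run])) ?_ ?_
  · intro h
    rw [decide_eq_false_iff_not] at h
    simp [run, h]
  · intro h
    rw [decide_eq_true_iff] at h
    rw [if_pos h]
    have h5 : ∀ {x' f' b' c' g' l' : Fn} {w : Val X} {x₁ f₁ b₁ c₁ g₁ l₁ : Val X},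
        run x' w = some x₁ → run f' w = some f₁ → run b' w = some b₁ → run c' w = some c₁ →
        run g' w = some g₁ → run l' w = some l₁ → run (mkE x' f' b' c' g' l') w =
        some (.pair x₁ (.pair f₁ (.pair b₁ (.pair c₁ (.pair g₁ l₁))))) := by
      intro x' f' b' c' g' l' w x₁ f₁ b₁ c₁ g₁ l₁ h1 h2 h3 h4 h5 h6
      simp [run, h1, h2, h3, h4, h5, h6]
    rw [h5 (x₁ := .pt t.x) (f₁ := .nat t.flag.toNat) (c₁ := .nat t.c) (g₁ := .real t.g)
      (l₁ := encL encT t.ch) (by simp [run, encT_eq]) (by simp [run, encT_eq]) h2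
      (by simp [run, encT_eq]) (by simp [run, encT_eq]) (by simp [run, encT_eq])]
    simp only [encT, encTs_eq]
    rfl

theorem run_badsE {r : ℕ} : run badsE (.pair (.nat r) (.pair (.pt x) (.pair (.real R)
    (.pair (encL encT L) v)))) = some (encL encT (bads r x R L)) :=
  run_mapE encT encT _ _ (by simp [run]) fun _ _ _ => run_badsBodyE

theorem cost_badsE_le {r : ℕ} (hM : 1 ≤ M) (hL : L.length ≤ 2 * M) :
    cost badsE (.pair (.nat r) (.pair (.pt x) (.pair (.real R)
    (.pair (encL encT L) v)))) ≤ 1000 * M ^ 2 := by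
  have h1 := cost_mapE_le (le := v3) (v := .pair (.nat r) (.pair (.pt x) (.pair (.real R)
    (.pair (encL encT L) v)))) (b := badsBodyE) encT encT _ L (by simp [run])
    (fun _ _ _ => run_badsBodyE) (B := 90 + 120 * M) (by
      intro t ht acc
      have hc := cost_sumE_le (le := v5)
        (b := .ifz (dleE 5 (xE v0) (xE v2) v6) (.nat 0) (cE v0)) encT L (B := 30)
        (v := .pair (encT t) (.pair acc (.pair (.nat r) (.pair (.pt x) (.pair (.real R)
          (.pair (encL encT L) v)))))) (by simp [run]) (by simp [cost])
      simp only [cost] at hc ⊢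
      nlinarith)
  rw [badsE]
  refine h1.trans ?_
  have h6 : cost v3 (.pair (.nat r) (.pair (.pt x) (.pair (.real R)
    (.pair (encL encT L) v)))) = 5 := rfl
  rw [h6]
  have h8 := Nat.mul_le_mul_right (90 + 120 * M + 12) hL
  nlinarith

theorem run_stepE {r : ℕ} : run stepE (.pair (.nat r) (.pair (.pt x) (.pair (.real R)
    (.pair (encL encT L) (.pair (encL encT K) v))))) = some (encL encT (step r x R L K)) := by
  simp only [stepE, run, Option.bind_some, run_stripE, run_attachAllE, run_recountE, run_flagsE,
    run_badsE]
  rfl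

theorem length_strip_le : (strip x R L).length ≤ L.length := by
  rw [strip, List.length_map]
  exact List.length_filter_le _ _

/-- Stripping does not enlarge a list, and attaching the at most `M` members of `K` adds at most `M`
to lengths and degrees. So the bound `2 * M` holds throughout the step. -/
theorem cost_stepE_le {r : ℕ} (hM : 1 ≤ M) (hL : L.length ≤ M) (hK : K.length ≤ M)
    (h : ∀ t ∈ L, t.ch.length ≤ M) : cost stepE (.pair (.nat r) (.pair (.pt x) (.pair (.real R)
    (.pair (encL encT L) (.pair (encL encT K) v))))) ≤ 5000 * M ^ 2 := by
  have l1 := length_strip_le (x := x) (R := R) (L := L)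
  have l2 := length_attachAll_le (R := R) (K := K) (L := strip x R L)
  have k1 : ∀ t ∈ strip x R L, t.ch.length ≤ M := by
    intro t ht
    obtain ⟨t', ht', rfl⟩ := List.mem_map.1 ht
    exact (List.length_filter_le _ _).trans (length_kids_le hM (h t' (List.mem_of_mem_filter ht')))
  have k2 := length_ch_attachAll_le (R := R) (K := K) k1
  have c1 := cost_stripE_le (x := x) (R := R) (v := .nat 0) hM hL h
  have c2 := cost_attachAllE_le (R := R) (v := .nat 0) hM (l1.trans hL) hK
  have c3 := cost_recountE_le (R := R) (L := attachAll R K (strip x R L)) (v := .nat 0) hM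
    (by omega) (fun t ht => (k2 t ht).trans (by omega))
  have c4 := cost_flagsE_le (x := x) (R := R)
    (L := (attachAll R K (strip x R L)).map (recount R)) (v := .nat 0) hM
    (by rw [List.length_map]; omega)
  have c5 := cost_badsE_le (r := r) (x := x) (R := R)
    (L := flags x R ((attachAll R K (strip x R L)).map (recount R))) (v := .nat 0) hM
    (by rw [flags, length_flagsFrom, List.length_map]; omega)
  simp only [stepE, cost, run, Option.bind_some, run_stripE, run_attachAllE, run_recountE,
    run_flagsE, Option.elim_some]
  have : 1 ≤ M ^ 2 := Nat.one_le_pow _ _ hM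
  omega

end Specs

/-! ### Points below a node -/

mutual
/-- The points below a node. -/
def Tree.pts {X : Type*} : Tree X → List X
  | .mk x _ _ _ _ ch => match ch with
    | [] => [x]
    | t :: l => t.pts ++ ptsList l
/-- The points below the nodes of a list. -/
def ptsList {X : Type*} : List (Tree X) → List X
  | [] => []
  | t :: l => t.pts ++ ptsList l
end

section Points

variable {X : Type*}

theorem ptsList_eq (l : List (Tree X)) : ptsList l = l.flatMap Tree.pts := by
  induction l with
  | nil => rfl
  | cons t l ih => simp [ptsList, ih]

theorem Tree.pts_leaf (x : X) : (Tree.leaf x).pts = [x] := by simp [Tree.leaf, Tree.pts]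

theorem Tree.pts_eq (t : Tree X) : t.pts = t.kids.flatMap Tree.pts := by
  rcases t with ⟨x, f, b, c, g, _ | ⟨k, l⟩⟩
  · simp [Tree.pts, Tree.kids, Tree.ch, Tree.leaf, Tree.x]
  · simp [Tree.pts, Tree.kids, Tree.ch, ptsList_eq]

theorem Tree.kids_eq_ch {t : Tree X} (h : t.ch ≠ []) : t.kids = t.ch := by
  unfold Tree.kids
  split
  · contradiction
  · rename_i hh; exact hh.symm

theorem Tree.kids_of_nil {t : Tree X} (h : t.ch = []) : t.kids = [Tree.leaf t.x] := by
  unfold Tree.kids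
  split
  · rfl
  · rename_i hh; rw [hh] at h; contradiction

theorem Tree.pts_of_nil {t : Tree X} (h : t.ch = []) : t.pts = [t.x] := by
  rw [Tree.pts_eq, Tree.kids_of_nil h]
  simp [Tree.pts_leaf]

theorem Tree.sizeOf_kid_lt {t k : Tree X} (h : k ∈ t.ch) : sizeOf k < sizeOf t := by
  rcases t with ⟨x, f, b, c, g, l⟩
  have := List.sizeOf_lt_of_mem h
  simp only [Tree.ch] at this
  simp only [Tree.mk.sizeOf_spec]
  omega

/-- The nodes `k` levels below those of a list. -/
def lev (L : List (Tree X)) : ℕ → List (Tree X)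
  | 0 => L
  | k + 1 => lev (L.flatMap Tree.kids) k

theorem lev_succ (L : List (Tree X)) (k : ℕ) : lev L (k + 1) = (lev L k).flatMap Tree.kids := by
  induction k generalizing L with
  | zero => rfl
  | succ k ih => rw [lev, ih]; rfl

theorem lev_append (L L' : List (Tree X)) (k : ℕ) : lev (L ++ L') k = lev L k ++ lev L' k := by
  induction k generalizing L L' with
  | zero => rfl
  | succ k ih => rw [lev, List.flatMap_append, ih]; rfl

theorem lev_perm {L L' : List (Tree X)} (h : L.Perm L') (k : ℕ) : (lev L k).Perm (lev L' k) := by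
  induction k generalizing L L' with
  | zero => exact h
  | succ k ih => exact ih (h.flatMap_right _)

/-- Every level carries the same points: passing to the children only splits the list below a node,
and a leaf is its own child. -/
theorem flatMap_pts_lev (L : List (Tree X)) (k : ℕ) :
    (lev L k).flatMap Tree.pts = L.flatMap Tree.pts := by
  induction k generalizing L with
  | zero => rfl
  | succ k ih =>
    rw [lev, ih, List.flatMap_assoc]
    congr 1
    funext t
    exact (Tree.pts_eq t).symm

theorem lev_leaf (x : X) (k : ℕ) : lev [Tree.leaf x] k = [Tree.leaf x] := by
  induction k with
  | zero => rfl
  | succ k ih => rw [lev]; simpa [Tree.kids, Tree.leaf, Tree.ch, Tree.x] using ih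

end Points

/-! ### The invariant of a level -/

section Invariant

variable {X : Type*} [MetricSpace X]

/-- The invariant of the nodes of a level of radius `R`. -/
structure Lvl (r : ℕ) (R : ℝ) (L : List (Tree X)) : Prop where
  sep : L.Pairwise fun t u => R < dist t.x u.x
  kid : ∀ t ∈ L, ∀ k ∈ t.kids, dist k.x t.x ≤ R
  own : ∀ t ∈ L, ∃ k ∈ t.kids, k.x = t.x
  cnt : ∀ t ∈ L, t.c = t.pts.length
  -- The flagged nodes are a net of the level. Their separation is twice the radius `5 * R` of a
  -- weight, so that the points counted by the weights of two flagged nodes are disjoint.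
  flagSep : L.Pairwise fun t u => t.flag = true → u.flag = true → 10 * R < dist t.x u.x
  cover : ∀ t ∈ L, ∃ u ∈ L, u.flag = true ∧ dist u.x t.x ≤ 10 * R
  bad : ∀ t ∈ L, t.bad = !decide (r ≤ weight R L t.x)
  radius : ∀ t ∈ L, t.ch ≠ [] →
    t.g = if t.ch.any Tree.bad then R else t.ch.foldl (fun m k => max m k.g) 0
  radius_le : ∀ t ∈ L, t.g ≤ R
  -- A node without stored children is bad. Hence levels without bad nodes consist of nodes with
  -- stored children, for which `radius` describes `g`.
  of_nil : ∀ t ∈ L, t.ch = [] → t.bad = true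

theorem weight_perm {R : ℝ} {L L' : List (Tree X)} (h : L.Perm L') (y : X) :
    weight R L y = weight R L' y :=
  (h.map _).sum_eq

theorem weight_append {R : ℝ} {L L' : List (Tree X)} (y : X) :
    weight R (L ++ L') y = weight R L y + weight R L' y := by
  simp [weight]

theorem weight_eq_zero {R : ℝ} {L : List (Tree X)} {y : X}
    (h : ∀ t ∈ L, 5 * R < dist t.x y) : weight R L y = 0 := by
  unfold weight
  rw [List.sum_eq_zero]
  intro n hn
  obtain ⟨t, ht, rfl⟩ := List.mem_map.1 hn
  exact if_neg (not_le.2 (h t ht))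

theorem Lvl.perm {r : ℕ} {R : ℝ} {L L' : List (Tree X)} (h : Lvl r R L) (hp : L.Perm L') :
    Lvl r R L' where
  sep := (hp.pairwise_iff (fun {t u} h => by rwa [dist_comm])).1 h.sep
  kid t ht := h.kid t (hp.mem_iff.2 ht)
  own t ht := h.own t (hp.mem_iff.2 ht)
  cnt t ht := h.cnt t (hp.mem_iff.2 ht)
  flagSep := (hp.pairwise_iff (fun {t u} h h1 h2 => by
    rw [dist_comm]; exact h h2 h1)).1 h.flagSep
  cover t ht := by
    obtain ⟨u, hu, h'⟩ := h.cover t (hp.mem_iff.2 ht)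
    exact ⟨u, hp.mem_iff.1 hu, h'⟩
  bad t ht := by rw [h.bad t (hp.mem_iff.2 ht), weight_perm hp]
  radius t ht := h.radius t (hp.mem_iff.2 ht)
  radius_le t ht := h.radius_le t (hp.mem_iff.2 ht)
  of_nil t ht := h.of_nil t (hp.mem_iff.2 ht)

theorem Lvl.nil (r : ℕ) (R : ℝ) : Lvl r R ([] : List (Tree X)) := by
  constructor <;> simp

/-- A leaf has weight `1`, so it is truly bad exactly because `r` is at least `2`. -/
theorem Lvl.leaf {r : ℕ} (hr : 2 ≤ r) {R : ℝ} (hR : 0 ≤ R) (x : X) : Lvl r R [Tree.leaf x] := by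
  constructor
  · simp
  · simp [Tree.leaf, Tree.kids, Tree.ch, Tree.x, hR]
  · simp [Tree.leaf, Tree.kids, Tree.ch, Tree.x]
  · simp [Tree.pts_leaf]; simp [Tree.leaf, Tree.c]
  · simp
  · simp [Tree.leaf, Tree.flag, hR]
  · simp [Tree.leaf, Tree.bad, weight, Tree.x, Tree.c, hR]; omega
  · simp [Tree.leaf, Tree.ch]
  · simp [Tree.leaf, Tree.g, hR]
  · simp [Tree.leaf, Tree.bad]

/-- No condition looks farther than `10 * R`: flags interact up to that distance, weights only up to
`5 * R`. Lists that are farther apart do not notice each other. -/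
theorem Lvl.append {r : ℕ} {R : ℝ} (hR : 0 ≤ R) {A F : List (Tree X)} (hA : Lvl r R A)
    (hF : Lvl r R F) (h : ∀ a ∈ A, ∀ t ∈ F, 10 * R < dist a.x t.x) : Lvl r R (A ++ F) where
  sep := List.pairwise_append.2 ⟨hA.sep, hF.sep, fun a ha t ht => by
    have := h a ha t ht; linarith⟩
  kid := by simpa [or_imp, forall_and] using ⟨hA.kid, hF.kid⟩
  own t ht := (List.mem_append.1 ht).elim (hA.own t) (hF.own t)
  cnt t ht := (List.mem_append.1 ht).elim (hA.cnt t) (hF.cnt t)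
  flagSep := List.pairwise_append.2 ⟨hA.flagSep, hF.flagSep, fun a ha t ht _ _ => h a ha t ht⟩
  cover t ht := by
    rcases List.mem_append.1 ht with ht | ht
    · obtain ⟨u, hu, h'⟩ := hA.cover t ht
      exact ⟨u, List.mem_append_left _ hu, h'⟩
    · obtain ⟨u, hu, h'⟩ := hF.cover t ht
      exact ⟨u, List.mem_append_right _ hu, h'⟩
  bad t ht := by
    rw [weight_append]
    rcases List.mem_append.1 ht with ht | ht
    · rw [weight_eq_zero (L := F) fun u hu => by
        have := h t ht u hu; rw [dist_comm]; linarith, add_zero]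
      exact hA.bad t ht
    · rw [weight_eq_zero (L := A) fun u hu => by
        have := h u hu t ht; linarith, zero_add]
      exact hF.bad t ht
  radius t ht := (List.mem_append.1 ht).elim (hA.radius t) (hF.radius t)
  radius_le t ht := (List.mem_append.1 ht).elim (hA.radius_le t) (hF.radius_le t)
  of_nil t ht := (List.mem_append.1 ht).elim (hA.of_nil t) (hF.of_nil t)

theorem Lvl.of_append {r : ℕ} {R : ℝ} (hR : 0 ≤ R) {A F : List (Tree X)} (hA : Lvl r R (A ++ F))
    (h : ∀ a ∈ A, ∀ t ∈ F, 10 * R < dist a.x t.x) : Lvl r R F where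
  sep := (List.pairwise_append.1 hA.sep).2.1
  kid t ht := hA.kid t (List.mem_append_right _ ht)
  own t ht := hA.own t (List.mem_append_right _ ht)
  cnt t ht := hA.cnt t (List.mem_append_right _ ht)
  flagSep := (List.pairwise_append.1 hA.flagSep).2.1
  cover t ht := by
    obtain ⟨u, hu, hf, hd⟩ := hA.cover t (List.mem_append_right _ ht)
    rcases List.mem_append.1 hu with hu | hu
    · exact absurd hd (not_le.2 (h u hu t ht))
    · exact ⟨u, hu, hf, hd⟩
  bad t ht := by
    rw [hA.bad t (List.mem_append_right _ ht), weight_append,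
      weight_eq_zero (L := A) fun u hu => by have := h u hu t ht; linarith, zero_add]
  radius t ht := hA.radius t (List.mem_append_right _ ht)
  radius_le t ht := hA.radius_le t (List.mem_append_right _ ht)
  of_nil t ht := hA.of_nil t (List.mem_append_right _ ht)

/-- The invariant of all levels. -/
def Hered (r : ℕ) (R : ℝ) (L : List (Tree X)) : Prop := ∀ k, Lvl r (R / 2 ^ k) (lev L k)

theorem hered_iff {r : ℕ} {R : ℝ} {L : List (Tree X)} :
    Hered r R L ↔ Lvl r R L ∧ Hered r (R / 2) (L.flatMap Tree.kids) := by
  have hd : ∀ k : ℕ, R / 2 ^ (k + 1) = R / 2 / 2 ^ k := fun k => by rw [pow_succ']; field_simp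
  constructor
  · intro h
    refine ⟨by simpa [RGather.lev] using h 0, fun k => ?_⟩
    rw [← hd]
    exact h (k + 1)
  · rintro ⟨h0, h⟩ k
    cases k with
    | zero => simpa [RGather.lev] using h0
    | succ k => rw [hd]; exact h k

theorem Hered.perm {r : ℕ} {R : ℝ} {L L' : List (Tree X)} (h : Hered r R L) (hp : L.Perm L') :
    Hered r R L' := fun k => (h k).perm (lev_perm hp k)

/-- Following the child with the same center leads to a leaf with this center, since the stored tree
is finite. -/
theorem Hered.center_mem {r : ℕ} {R : ℝ} {L : List (Tree X)} (h : Hered r R L) (t : Tree X) :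
    ∀ k, t ∈ RGather.lev L k → t.x ∈ t.pts := by
  induction hn : sizeOf t using Nat.strong_induction_on generalizing t with
  | _ n ih =>
    intro k ht
    by_cases hch : t.ch = []
    · rw [Tree.pts_of_nil hch]; simp
    · obtain ⟨u, hu, hux⟩ := (h k).own t ht
      have hu' : u ∈ RGather.lev L (k + 1) := by
        rw [lev_succ]; exact List.mem_flatMap.2 ⟨t, ht, hu⟩
      have := ih (sizeOf u) (by
        rw [← hn]; rw [Tree.kids_eq_ch hch] at hu; exact Tree.sizeOf_kid_lt hu) u rfl (k + 1) hu'
      rw [Tree.pts_eq]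
      exact List.mem_flatMap.2 ⟨u, hu, hux ▸ this⟩

/-- The distances to the parents form a geometric series with ratio `1 / 2`. -/
theorem Hered.dist_le {r : ℕ} {R : ℝ} (hR : 0 ≤ R) {L : List (Tree X)} (h : Hered r R L)
    (t : Tree X) : ∀ k, t ∈ RGather.lev L k → ∀ p ∈ t.pts, dist p t.x ≤ 2 * (R / 2 ^ k) := by
  induction hn : sizeOf t using Nat.strong_induction_on generalizing t with
  | _ n ih =>
    intro k ht p hp
    by_cases hch : t.ch = []
    · rw [Tree.pts_of_nil hch, List.mem_singleton] at hp
      rw [hp, dist_self]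
      positivity
    · rw [Tree.pts_eq] at hp
      obtain ⟨u, hu, hpu⟩ := List.mem_flatMap.1 hp
      have hu' : u ∈ RGather.lev L (k + 1) := by
        rw [lev_succ]; exact List.mem_flatMap.2 ⟨t, ht, hu⟩
      have h1 := ih (sizeOf u) (by
        rw [← hn]; rw [Tree.kids_eq_ch hch] at hu; exact Tree.sizeOf_kid_lt hu) u rfl (k + 1) hu' p
        hpu
      have h2 := (h k).kid t ht u hu
      have h3 := dist_triangle p u.x t.x
      have h4 : 2 * (R / 2 ^ (k + 1)) = R / 2 ^ k := by rw [pow_succ]; field_simp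
      linarith

/-- The center of a descendant is one of the points, hence lies below a top node; so one bound
serves for all levels. -/
theorem Hered.dist_lev_le {r : ℕ} {R : ℝ} (hR : 0 ≤ R) {L : List (Tree X)} (h : Hered r R L)
    (k : ℕ) : ∀ t ∈ RGather.lev L k, ∃ u ∈ L, dist t.x u.x ≤ 2 * R := by
  intro t ht
  have h1 := h.center_mem t k ht
  have h2 : t.x ∈ L.flatMap Tree.pts := by
    rw [← flatMap_pts_lev L k]; exact List.mem_flatMap.2 ⟨t, ht, h1⟩
  obtain ⟨u, hu, hxu⟩ := List.mem_flatMap.1 h2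
  refine ⟨u, hu, ?_⟩
  have := h.dist_le hR u 0 hu _ hxu
  simpa using this

theorem Hered.leaf {r : ℕ} (hr : 2 ≤ r) {R : ℝ} (hR : 0 ≤ R) (x : X) :
    Hered r R [Tree.leaf x] := by
  intro k
  rw [lev_leaf]
  exact Lvl.leaf hr (by positivity) x

theorem pow_div_le {R : ℝ} (hR : 0 ≤ R) (k : ℕ) : R / 2 ^ k ≤ R :=
  div_le_self hR (one_le_pow₀ (by norm_num))

/-- Centers on lower levels stray at most `2 * R` from a top node on either side, which leaves `14 -
4 = 10` radii, as `Lvl.append` requires. -/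
theorem Hered.append {r : ℕ} {R : ℝ} (hR : 0 ≤ R) {A F : List (Tree X)} (hA : Hered r R A)
    (hF : Hered r R F) (h : ∀ a ∈ A, ∀ t ∈ F, 14 * R < dist a.x t.x) : Hered r R (A ++ F) := by
  intro k
  rw [lev_append]
  refine (hA k).append (by positivity) (hF k) fun a ha t ht => ?_
  obtain ⟨a', ha', h1⟩ := hA.dist_lev_le hR k a ha
  obtain ⟨t', ht', h2⟩ := hF.dist_lev_le hR k t ht
  have h3 := h a' ha' t' ht'
  have h4 := dist_triangle4 a'.x a.x t.x t'.x
  rw [dist_comm a'.x a.x] at h4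
  have := pow_div_le hR k
  linarith

theorem Hered.of_append {r : ℕ} {R : ℝ} (hR : 0 ≤ R) {A F : List (Tree X)}
    (hA : Hered r R (A ++ F)) (h : ∀ a ∈ A, ∀ t ∈ F, 14 * R < dist a.x t.x)  :
    Hered r R F := by
  -- The invariant is not known for `A` and `F` separately, so `Hered.dist_lev_le` does not apply to
  -- them. The same bound is derived for sublists, from the invariant of `A ++ F`.
  have key : ∀ {L : List (Tree X)}, (∀ t ∈ L, t ∈ A ++ F) → ∀ k, ∀ t ∈ RGather.lev L k,
      ∃ u ∈ L, dist t.x u.x ≤ 2 * R := by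
    intro L hL k t ht
    have hsub : ∀ k, ∀ t ∈ RGather.lev L k, t ∈ RGather.lev (A ++ F) k := by
      intro k
      induction k with
      | zero => exact hL
      | succ k ih =>
        intro t ht
        rw [lev_succ] at ht ⊢
        obtain ⟨u, hu, htu⟩ := List.mem_flatMap.1 ht
        exact List.mem_flatMap.2 ⟨u, ih u hu, htu⟩
    have h1 := hA.center_mem t k (hsub k t ht)
    have h2 : t.x ∈ L.flatMap Tree.pts := by
      rw [← flatMap_pts_lev L k]; exact List.mem_flatMap.2 ⟨t, ht, h1⟩
    obtain ⟨u, hu, hxu⟩ := List.mem_flatMap.1 h2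
    refine ⟨u, hu, ?_⟩
    have := hA.dist_le hR u 0 (hsub 0 u hu) _ hxu
    simpa using this
  intro k
  have hk := hA k
  rw [lev_append] at hk
  refine hk.of_append (by positivity) fun a ha t ht => ?_
  obtain ⟨a', ha', h1⟩ := key (fun t ht => List.mem_append_left _ ht) k a ha
  obtain ⟨t', ht', h2⟩ := key (fun t ht => List.mem_append_right _ ht) k t ht
  have h3 := h a' ha' t' ht'
  have h4 := dist_triangle4 a'.x a.x t.x t'.x
  rw [dist_comm a'.x a.x] at h4
  have := pow_div_le hR k
  linarith

end Invariant

/-! ### The update of a level -/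

section Step

variable {X : Type*} [MetricSpace X]

theorem attach_cases (R : ℝ) (w : Tree X) (S : List (Tree X)) :
    (∃ S₁ u S₂, S = S₁ ++ u :: S₂ ∧ dist u.x w.x ≤ R ∧
      attach R w S = S₁ ++ addKid w u :: S₂) ∨
    ((∀ v ∈ S, R < dist v.x w.x) ∧ attach R w S = S ++ [newNode w]) := by
  induction S with
  | nil => right; simp [attach]
  | cons v S ih =>
    by_cases h : dist v.x w.x ≤ R
    · left
      exact ⟨[], v, S, rfl, h, by simp [attach, h]⟩
    · rcases ih with ⟨S₁, u, S₂, h1, h2, h3⟩ | ⟨h1, h2⟩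
      · left
        exact ⟨v :: S₁, u, S₂, by simp [h1], h2, by simp [attach, h, h3]⟩
      · right
        refine ⟨?_, by simp [attach, h, h2]⟩
        intro u hu
        rcases List.mem_cons.1 hu with rfl | hu
        · exact not_le.1 h
        · exact h1 u hu

/-- The nodes after some of the members of `K` have been attached to the nodes `L`. -/
structure Attached (R : ℝ) (L K S : List (Tree X)) : Prop where
  perm : (S.flatMap Tree.ch).Perm (K ++ L.flatMap Tree.ch)
  sep : S.Pairwise fun t u => R < dist t.x u.x
  old : ∀ u ∈ S, (∃ v ∈ L, v.x = u.x ∧ v.flag = u.flag ∧ v.bad = u.bad) ∨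
    (u.flag = false ∧ ∃ w ∈ K, w.x = u.x)
  persist : ∀ v ∈ L, ∃ u ∈ S, v.x = u.x ∧ v.flag = u.flag
  near : ∀ u ∈ S, ∀ k ∈ u.ch, dist k.x u.x ≤ R
  -- A node may be waiting for the child with its own center: this child has been stripped, and it
  -- has not occurred among the members attached so far.
  own : ∀ u ∈ S, (∃ k ∈ u.ch, k.x = u.x) ∨
    ∃ v ∈ L, v.x = u.x ∧ (∀ k ∈ v.ch, k.x ≠ v.x) ∧ ∀ w ∈ K, w.x ≠ v.x

theorem Attached.init {R : ℝ} {L : List (Tree X)}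
    (sep : L.Pairwise fun t u => R < dist t.x u.x)
    (near : ∀ u ∈ L, ∀ k ∈ u.ch, dist k.x u.x ≤ R) : Attached R L [] L where
  perm := by simp
  sep := sep
  old u hu := Or.inl ⟨u, hu, rfl, rfl, rfl⟩
  persist v hv := ⟨v, hv, rfl, rfl⟩
  near := near
  own u hu := by
    by_cases h : ∃ k ∈ u.ch, k.x = u.x
    · exact Or.inl h
    · push Not at h
      exact Or.inr ⟨u, hu, rfl, h, by simp⟩

/-- A new node is created only if no node is within `R` of `w`, so separation survives. If some node
has the center of `w`, then `w` goes to that node, although `attach` takes the first one that is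
close enough: by separation no other node is within `R`. -/
theorem Attached.attach {R : ℝ} (hR : 0 ≤ R) {L K S : List (Tree X)} (h : Attached R L K S)
    (w : Tree X) : Attached R L (K ++ [w]) (attach R w S) := by
  rcases attach_cases R w S with ⟨S₁, u, S₂, rfl, hd, he⟩ | ⟨hfar, he⟩
  · rw [he]
    have hx : (addKid w u).x = u.x := rfl
    have hmem : ∀ v ∈ S₁ ++ addKid w u :: S₂, v = addKid w u ∨ v ∈ S₁ ++ u :: S₂ := by
      intro v hv
      simp only [List.mem_append, List.mem_cons] at hv ⊢
      tauto
    have hu : u ∈ S₁ ++ u :: S₂ := by simp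
    refine ⟨?_, ?_, ?_, ?_, ?_, ?_⟩
    · have h1 : (S₁ ++ addKid w u :: S₂).flatMap Tree.ch =
          S₁.flatMap Tree.ch ++ w :: (u.ch ++ S₂.flatMap Tree.ch) := by
        simp [addKid, Tree.ch]
      have h2 := h.perm
      rw [List.flatMap_append, List.flatMap_cons] at h2
      rw [h1]
      refine List.perm_middle.trans ?_
      refine (h2.cons w).trans ?_
      rw [List.append_assoc]
      exact (List.perm_middle (a := w) (l₁ := K) (l₂ := L.flatMap Tree.ch)).symm
    · have := h.sep
      rw [List.pairwise_append, List.pairwise_cons] at this ⊢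
      refine ⟨this.1, this.2.1, fun a ha b hb => ?_⟩
      rcases List.mem_cons.1 hb with rfl | hb
      · exact this.2.2 a ha u List.mem_cons_self
      · exact this.2.2 a ha b (List.mem_cons_of_mem _ hb)
    · intro v hv
      have : ∀ v ∈ S₁ ++ u :: S₂, (∃ v' ∈ L, v'.x = v.x ∧ v'.flag = v.flag ∧ v'.bad = v.bad) ∨
          (v.flag = false ∧ ∃ w' ∈ K ++ [w], w'.x = v.x) := by
        intro v hv
        rcases h.old v hv with h' | ⟨h', w', hw', h''⟩
        · exact Or.inl h'
        · exact Or.inr ⟨h', w', List.mem_append_left _ hw', h''⟩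
      rcases hmem v hv with rfl | hv
      · exact this u hu
      · exact this v hv
    · intro v hv
      obtain ⟨v', hv', h1, h2⟩ := h.persist v hv
      simp only [List.mem_append, List.mem_cons] at hv'
      rcases hv' with hv' | rfl | hv'
      · exact ⟨v', by simp [hv'], h1, h2⟩
      · exact ⟨addKid w v', by simp, h1, h2⟩
      · exact ⟨v', by simp [hv'], h1, h2⟩
    · intro v hv k hk
      rcases hmem v hv with rfl | hv
      · rcases List.mem_cons.1 (show k ∈ w :: u.ch from hk) with rfl | hk
        · rw [hx, dist_comm]; exact hd
        · exact h.near u hu k hk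
      · exact h.near v hv k hk
    · -- a node with the same center as `w` gets it
      have hother : ∀ v ∈ S₁ ++ S₂, w.x ≠ v.x := by
        intro v hv hwv
        have hsep := h.sep
        have h1 : dist u.x v.x ≤ R := by rwa [← hwv]
        rw [List.pairwise_append, List.pairwise_cons] at hsep
        rcases List.mem_append.1 hv with hv | hv
        · have := hsep.2.2 v hv u List.mem_cons_self
          rw [dist_comm] at this
          linarith
        · have := hsep.2.1.1 v hv
          linarith
      intro v hv
      simp only [List.mem_append, List.mem_cons] at hv
      rcases hv with hv | rfl | hv
      rotate_left
      · by_cases hwx : w.x = u.x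
        · exact Or.inl ⟨w, by simp [addKid, Tree.ch], hwx⟩
        · rcases h.own u hu with ⟨k, hk, hkx⟩ | ⟨v', hv', h1, h2, h3⟩
          · exact Or.inl ⟨k, List.mem_cons_of_mem _ hk, hkx⟩
          · refine Or.inr ⟨v', hv', h1, h2, ?_⟩
            intro w' hw'
            rcases List.mem_append.1 hw' with hw' | hw'
            · exact h3 w' hw'
            · rw [List.mem_singleton.1 hw', h1]; exact hwx
      all_goals
        rcases h.own v (by simp [hv]) with h' | ⟨v', hv', h1, h2, h3⟩
        · exact Or.inl h'
        · refine Or.inr ⟨v', hv', h1, h2, ?_⟩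
          intro w' hw'
          rcases List.mem_append.1 hw' with hw' | hw'
          · exact h3 w' hw'
          · rw [List.mem_singleton.1 hw', h1]; exact hother v (by simp [hv])
  · rw [he]
    refine ⟨?_, ?_, ?_, ?_, ?_, ?_⟩
    · rw [List.flatMap_append]
      have : [newNode w].flatMap Tree.ch = [w] := by simp [newNode, Tree.ch]
      rw [this, List.append_assoc]
      refine (List.perm_append_comm).trans ?_
      refine (h.perm.cons w).trans ?_
      exact (List.perm_middle (a := w) (l₁ := K) (l₂ := L.flatMap Tree.ch)).symm
    · rw [List.pairwise_append]
      refine ⟨h.sep, by simp, fun a ha b hb => ?_⟩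
      rw [List.mem_singleton.1 hb]
      exact hfar a ha
    · intro v hv
      rcases List.mem_append.1 hv with hv | hv
      · rcases h.old v hv with h' | ⟨h', w', hw', h''⟩
        · exact Or.inl h'
        · exact Or.inr ⟨h', w', List.mem_append_left _ hw', h''⟩
      · rw [List.mem_singleton.1 hv]
        exact Or.inr ⟨rfl, w, by simp, rfl⟩
    · intro v hv
      obtain ⟨v', hv', h'⟩ := h.persist v hv
      exact ⟨v', List.mem_append_left _ hv', h'⟩
    · intro v hv k hk
      rcases List.mem_append.1 hv with hv | hv
      · exact h.near v hv k hk
      · rw [List.mem_singleton.1 hv] at hk ⊢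
        rw [List.mem_singleton.1 (show k ∈ [w] from hk)]
        simpa [newNode, Tree.x] using hR
    · intro v hv
      rcases List.mem_append.1 hv with hv | hv
      · rcases h.own v hv with h' | ⟨v', hv', h1, h2, h3⟩
        · exact Or.inl h'
        · refine Or.inr ⟨v', hv', h1, h2, ?_⟩
          intro w' hw'
          rcases List.mem_append.1 hw' with hw' | hw'
          · exact h3 w' hw'
          · rw [List.mem_singleton.1 hw', h1]
            intro hwv
            have := hfar v hv
            rw [hwv, dist_self] at this
            linarith
      · rw [List.mem_singleton.1 hv]
        exact Or.inl ⟨w, by simp [newNode, Tree.ch], rfl⟩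

theorem Attached.attachAll {R : ℝ} (hR : 0 ≤ R) {L K S : List (Tree X)} (h : Attached R L K S)
    (K' : List (Tree X)) : Attached R L (K ++ K') (attachAll R K' S) := by
  induction K' generalizing K S with
  | nil => simpa [RGather.attachAll] using h
  | cons w K' ih =>
    have := ih (h.attach hR w)
    rwa [List.append_assoc] at this

/-- Attaching does not change functions of nodes that vanish on all changed nodes. -/
theorem sum_attachAll {R : ℝ} (φ : Tree X → ℕ) (K : List (Tree X))
    (h1 : ∀ w ∈ K, ∀ u : Tree X, dist u.x w.x ≤ R → φ (addKid w u) = φ u)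
    (h2 : ∀ w ∈ K, φ (newNode w) = 0) (S : List (Tree X)) :
    ((attachAll R K S).map φ).sum = (S.map φ).sum := by
  induction K generalizing S with
  | nil => rfl
  | cons w K ih =>
    have := ih (fun w hw => h1 w (List.mem_cons_of_mem _ hw))
      (fun w hw => h2 w (List.mem_cons_of_mem _ hw)) (attach R w S)
    rw [attachAll, List.foldl_cons, ← attachAll, this]
    rcases attach_cases R w S with ⟨S₁, u, S₂, rfl, hd, he⟩ | ⟨-, he⟩
    · rw [he]; simp [h1 w List.mem_cons_self u hd]
    · rw [he]; simp [h2 w List.mem_cons_self]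

/-! #### Flags -/

/-- Applying `setFlag` on both sides erases the only component that may differ. -/
theorem map_setFlag_flagsFrom (x : X) (R : ℝ) (F : List X) (L : List (Tree X)) :
    (flagsFrom x R F L).map setFlag = L.map setFlag := by
  induction L generalizing F with
  | nil => rfl
  | cons t L ih =>
    rw [flagsFrom]
    split_ifs
    · rw [List.map_cons, ih]; rfl
    · rw [List.map_cons, ih]; rfl

theorem flagsFrom_mem (x : X) (R : ℝ) (F : List X) (L : List (Tree X)) :
    ∀ t ∈ flagsFrom x R F L, t ∈ L ∨ ∃ u ∈ L, t = setFlag u ∧ dist u.x x ≤ 22 * R ∧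
      ∀ y ∈ F, 10 * R < dist y u.x := by
  induction L generalizing F with
  | nil => simp [flagsFrom]
  | cons t L ih =>
    intro u hu
    rw [flagsFrom] at hu
    split_ifs at hu with hc
    · rcases List.mem_cons.1 hu with rfl | hu
      · refine Or.inr ⟨t, List.mem_cons_self, rfl, hc.1, ?_⟩
        have := hc.2
        simpa using this
      · rcases ih _ u hu with h | ⟨v, hv, h1, h2, h3⟩
        · exact Or.inl (List.mem_cons_of_mem _ h)
        · exact Or.inr ⟨v, List.mem_cons_of_mem _ hv, h1, h2,
            fun y hy => h3 y (List.mem_cons_of_mem _ hy)⟩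
    · rcases List.mem_cons.1 hu with rfl | hu
      · exact Or.inl List.mem_cons_self
      · rcases ih _ u hu with h | ⟨v, hv, h1, h2, h3⟩
        · exact Or.inl (List.mem_cons_of_mem _ h)
        · exact Or.inr ⟨v, List.mem_cons_of_mem _ hv, h1, h2, h3⟩

/-- `F` has to contain the centers of all old flags, including those later in the list, so that new
flags keep away from old ones that are yet to come. -/
theorem flagsFrom_pairwise (x : X) (R : ℝ) (F : List X) (L : List (Tree X))
    (hF : ∀ t ∈ L, t.flag = true → t.x ∈ F)
    (hL : L.Pairwise fun t u => t.flag = true → u.flag = true → 10 * R < dist t.x u.x) :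
    (flagsFrom x R F L).Pairwise fun t u => t.flag = true → u.flag = true →
      10 * R < dist t.x u.x := by
  induction L generalizing F with
  | nil => simp [flagsFrom]
  | cons t L ih =>
    rw [List.pairwise_cons] at hL
    have hF' := fun u hu => hF u (List.mem_cons_of_mem _ hu)
    rw [flagsFrom]
    split_ifs with hc
    · have hc2 : ∀ y ∈ F, 10 * R < dist y t.x := by simpa using hc.2
      refine List.pairwise_cons.2 ⟨?_, ih _ (fun u hu h => List.mem_cons_of_mem _ (hF' u hu h))
        hL.2⟩
      intro u hu _ huf
      rcases flagsFrom_mem x R _ L u hu with h | ⟨v, hv, h1, h2, h3⟩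
      · rw [dist_comm]; exact hc2 _ (hF' u h huf)
      · rw [h1]; exact h3 _ List.mem_cons_self
    · refine List.pairwise_cons.2 ⟨?_, ih _ hF' hL.2⟩
      intro u hu htf huf
      rcases flagsFrom_mem x R _ L u hu with h | ⟨v, hv, h1, h2, h3⟩
      · exact hL.1 u h htf huf
      · rw [h1]; exact h3 _ (hF t List.mem_cons_self htf)

/-- A node that the greedy choice passes over had, at that moment, a center within `10 * R`, and
this center is either in the initial list or was flagged on the way. -/
theorem flagsFrom_cover (x : X) (R : ℝ) (hR : 0 ≤ R) (F : List X) (L : List (Tree X)) :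
    ∀ t ∈ flagsFrom x R F L, dist t.x x ≤ 22 * R → ∃ y, dist y t.x ≤ 10 * R ∧
      (y ∈ F ∨ ∃ u ∈ flagsFrom x R F L, u.flag = true ∧ u.x = y) := by
  induction L generalizing F with
  | nil => simp [flagsFrom]
  | cons t L ih =>
    intro u hu hux
    rw [flagsFrom] at hu ⊢
    split_ifs at hu ⊢ with hc
    · have ht : ∃ y, dist y t.x ≤ 10 * R ∧ (y ∈ F ∨ ∃ u ∈ setFlag t :: flagsFrom x R (t.x :: F) L,
          u.flag = true ∧ u.x = y) :=
        ⟨t.x, by rw [dist_self]; positivity, Or.inr ⟨setFlag t, List.mem_cons_self, rfl, rfl⟩⟩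
      rcases List.mem_cons.1 hu with rfl | hu
      · exact ht
      · obtain ⟨y, hy, h | ⟨v, hv, hvf, hvy⟩⟩ := ih _ u hu hux
        · rcases List.mem_cons.1 h with rfl | h
          · exact ⟨t.x, hy, Or.inr ⟨setFlag t, List.mem_cons_self, rfl, rfl⟩⟩
          · exact ⟨y, hy, Or.inl h⟩
        · exact ⟨y, hy, Or.inr ⟨v, List.mem_cons_of_mem _ hv, hvf, hvy⟩⟩
    · rcases List.mem_cons.1 hu with rfl | hu
      · have : ¬ ∀ y ∈ F, 10 * R < dist y u.x := by
          intro h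
          exact hc ⟨hux, by simpa using h⟩
        push Not at this
        obtain ⟨y, hy, hyd⟩ := this
        exact ⟨y, hyd, Or.inl hy⟩
      · obtain ⟨y, hy, h | ⟨v, hv, hvf, hvy⟩⟩ := ih _ u hu hux
        · exact ⟨y, hy, Or.inl h⟩
        · exact ⟨y, hy, Or.inr ⟨v, List.mem_cons_of_mem _ hv, hvf, hvy⟩⟩

theorem flagsFrom_persist (x : X) (R : ℝ) (F : List X) (L : List (Tree X)) :
    ∀ t ∈ L, t.flag = true → ∃ u ∈ flagsFrom x R F L, u.flag = true ∧ u.x = t.x := by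
  induction L generalizing F with
  | nil => simp
  | cons t L ih =>
    intro u hu huf
    rw [flagsFrom]
    split_ifs with hc
    · rcases List.mem_cons.1 hu with rfl | hu
      · exact ⟨setFlag u, List.mem_cons_self, rfl, rfl⟩
      · obtain ⟨v, hv, h⟩ := ih _ u hu huf
        exact ⟨v, List.mem_cons_of_mem _ hv, h⟩
    · rcases List.mem_cons.1 hu with rfl | hu
      · exact ⟨u, List.mem_cons_self, huf, rfl⟩
      · obtain ⟨v, hv, h⟩ := ih _ u hu huf
        exact ⟨v, List.mem_cons_of_mem _ hv, h⟩

end Step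

-- The update of one level preserves the invariant.

section StepInvariant

variable {X : Type*} [MetricSpace X]

/-- The part of a node that does not depend on the other nodes of its level. -/
def core (t : Tree X) : X × ℕ × ℝ × List (Tree X) := (t.x, t.c, t.g, t.ch)

theorem map_core_flags (x : X) (R : ℝ) (L : List (Tree X)) :
    (flags x R L).map core = L.map core := by
  have h : ∀ l : List (Tree X), (l.map setFlag).map core = l.map core := by
    intro l
    rw [List.map_map]
    rfl
  rw [flags, ← h, map_setFlag_flagsFrom, h]

theorem map_core_bads (r : ℕ) (x : X) (R : ℝ) (L : List (Tree X)) :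
    (bads r x R L).map core = L.map core := by
  rw [bads, List.map_map]
  refine List.map_congr_left fun t _ => ?_
  simp only [Function.comp]
  split_ifs <;> rfl

theorem map_core_step (r : ℕ) (x : X) (R : ℝ) (L K : List (Tree X)) :
    (step r x R L K).map core =
      (attachAll R K (strip x R L)).map fun u => core (recount R u) := by
  rw [step, map_core_bads, map_core_flags, List.map_map]
  rfl

/-- What is known when the nodes `L` near `x` of a level are updated, where `far` are the other nodes
of the level and `K` are the new nodes of the next level. -/
structure StepHyp (r : ℕ) (x : X) (R : ℝ) (L far K : List (Tree X)) : Prop where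
  pos : 0 ≤ R
  lvl : Lvl r R (L ++ far)
  -- The radius `32 * R` exceeds all that matters. Children within `16 * R` are exchanged, so
  -- parents within `17 * R` are affected, and weights change only within `22 * R`. Recomputing
  -- these weights takes nodes within `27 * R`, and new flags within `22 * R` are still `10 * R`
  -- away from the far nodes.
  mem_near : ∀ t ∈ L, dist t.x x ≤ 32 * R
  mem_far : ∀ t ∈ far, 32 * R < dist t.x x
  kids : Hered r (R / 2) (K ++ ((L.flatMap Tree.kids).filter
    (fun t => !decide (dist t.x x ≤ 16 * R)) ++ far.flatMap Tree.kids))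
  kids_near : ∀ w ∈ K, dist w.x x ≤ 16 * R
  -- Only the center `x` may vanish from the next level. All other centers come back, so every
  -- remaining node recovers a child with its own center.
  persist : ∀ k ∈ near x R L, k.x ≠ x → ∃ w ∈ K, w.x = k.x

namespace StepHyp

variable {r : ℕ} {x : X} {R : ℝ} {L far K : List (Tree X)}

theorem mem_strip {u : Tree X} (hu : u ∈ strip x R L) : ∃ t ∈ L, t.x ≠ x ∧ u.x = t.x ∧
    u.flag = t.flag ∧ u.bad = t.bad ∧
    u.ch = t.kids.filter fun k => !decide (dist k.x x ≤ 16 * R) := by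
  obtain ⟨t, ht, rfl⟩ := List.mem_map.1 hu
  have h1 := List.mem_filter.1 ht
  refine ⟨t, h1.1, ?_, rfl, rfl, rfl, rfl⟩
  rintro rfl
  simp at h1

theorem strip_of_mem {t : Tree X} (ht : t ∈ L) (hx : t.x ≠ x) : ∃ u ∈ strip x R L, u.x = t.x ∧
    u.flag = t.flag := by
  refine ⟨_, List.mem_map.2 ⟨t, List.mem_filter.2 ⟨ht, ?_⟩, rfl⟩, rfl, rfl⟩
  simpa using hx

theorem attached (h : StepHyp r x R L far K) :
    Attached R (strip x R L) K (attachAll R K (strip x R L)) := by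
  have h0 : Attached R (strip x R L) [] (strip x R L) := by
    refine Attached.init ?_ ?_
    · have := (List.pairwise_append.1 h.lvl.sep).1.filter (fun t => !decide (dist t.x x ≤ 0))
      rw [strip, List.pairwise_map]
      exact this
    · intro u hu k hk
      obtain ⟨t, ht, -, hx, -, -, hch⟩ := mem_strip hu
      rw [hch] at hk
      rw [hx]
      exact h.lvl.kid t (List.mem_append_left _ ht) k (List.mem_filter.1 hk).1
  simpa using h0.attachAll h.pos K

/-- The child with the center of its parent is either too far from `x` to be stripped, or it is
replaced by a member of `K` with the same center, which `attach` returns to the parent. -/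
theorem own (h : StepHyp r x R L far K) : ∀ u ∈ attachAll R K (strip x R L),
    ∃ k ∈ u.ch, k.x = u.x := by
  intro u hu
  rcases h.attached.own u hu with h' | ⟨v, hv, h1, h2, h3⟩
  · exact h'
  · exfalso
    obtain ⟨t, ht, htx, hx, -, -, hch⟩ := mem_strip hv
    obtain ⟨k, hk, hkx⟩ := h.lvl.own t (List.mem_append_left _ ht)
    by_cases hd : dist k.x x ≤ 16 * R
    · obtain ⟨w, hw, hwk⟩ := h.persist k (List.mem_filter.2
        ⟨List.mem_flatMap.2 ⟨t, ht, hk⟩, by simpa using hd⟩) (by rw [hkx]; exact htx)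
      exact h3 w hw (by rw [hwk, hkx, hx])
    · refine h2 k ?_ (by rw [hkx, hx])
      rw [hch]
      exact List.mem_filter.2 ⟨hk, by simpa using hd⟩

theorem mem_step {t : Tree X} (ht : t ∈ step r x R L K) :
    ∃ u ∈ attachAll R K (strip x R L), t.x = u.x ∧ t.ch = u.ch ∧ t.c = (u.ch.map Tree.c).sum ∧
      t.g = if t.ch.any Tree.bad then R else t.ch.foldl (fun m k => max m k.g) 0 := by
  have h1 : core t ∈ (step r x R L K).map core := List.mem_map_of_mem ht
  rw [map_core_step] at h1
  obtain ⟨u, hu, he⟩ := List.mem_map.1 h1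
  simp only [core, recount, Tree.x, Tree.c, Tree.g, Tree.ch, Prod.mk.injEq] at he
  obtain ⟨e1, e2, e3, e4⟩ := he
  refine ⟨u, hu, e1.symm, e4.symm, e2.symm, ?_⟩
  have e4' : t.ch = u.ch := e4.symm
  rw [e4']
  exact e3.symm

theorem step_of_mem {u : Tree X} (hu : u ∈ attachAll R K (strip x R L)) :
    ∃ t ∈ step r x R L K, t.x = u.x := by
  have h1 : core (recount R u) ∈ (step r x R L K).map core := by
    rw [map_core_step]
    exact List.mem_map_of_mem hu
  obtain ⟨t, ht, he⟩ := List.mem_map.1 h1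
  simp only [core, Prod.mk.injEq] at he
  exact ⟨t, ht, he.1⟩

/-- A node of the updated level is an old node, or one near `x`. -/
theorem old_or_near (h : StepHyp r x R L far K) {t : Tree X} (ht : t ∈ step r x R L K) :
    (∃ v ∈ L, v.x ≠ x ∧ v.x = t.x) ∨ dist t.x x ≤ 16 * R := by
  obtain ⟨u, hu, hx, -⟩ := mem_step ht
  rcases h.attached.old u hu with ⟨v, hv, h1, -⟩ | ⟨-, w, hw, hwx⟩
  · obtain ⟨t', ht', h2, h3, -⟩ := mem_strip hv
    exact Or.inl ⟨t', ht', h2, by rw [hx, ← h1, h3]⟩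
  · right
    rw [hx, ← hwx]
    exact h.kids_near w hw

theorem step_near (h : StepHyp r x R L far K) :
    ∀ t ∈ step r x R L K, dist t.x x ≤ 32 * R := by
  intro t ht
  rcases h.old_or_near ht with ⟨v, hv, -, hx⟩ | h1
  · rw [← hx]; exact h.mem_near v hv
  · have := h.pos; linarith

theorem step_persist (h : StepHyp r x R L far K) :
    ∀ u ∈ L, u.x ≠ x → ∃ t ∈ step r x R L K, t.x = u.x := by
  intro u hu hx
  obtain ⟨v, hv, h1, -⟩ := strip_of_mem (R := R) hu hx
  obtain ⟨w, hw, h2, -⟩ := h.attached.persist v hv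
  obtain ⟨t, ht, h3⟩ := step_of_mem (r := r) hw
  exact ⟨t, ht, by rw [h3, ← h2, h1]⟩

theorem step_kids (h : StepHyp r x R L far K) {t : Tree X} (ht : t ∈ step r x R L K) :
    t.ch ≠ [] ∧ t.kids = t.ch := by
  obtain ⟨u, hu, -, hch, -⟩ := mem_step ht
  obtain ⟨k, hk, -⟩ := h.own u hu
  have : t.ch ≠ [] := by rw [hch]; exact List.ne_nil_of_mem hk
  exact ⟨this, Tree.kids_eq_ch this⟩

/-- Dropping the node `x` loses no further children: those of `x` are within `R` of `x`, so they are
among the near ones that are stripped anyway. -/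
theorem flatMap_strip_ch (h : StepHyp r x R L far K) : (strip x R L).flatMap Tree.ch =
    (L.flatMap Tree.kids).filter fun t => !decide (dist t.x x ≤ 16 * R) := by
  have hk : ∀ t ∈ L, ∀ k ∈ t.kids, dist k.x t.x ≤ R := fun t ht =>
    h.lvl.kid t (List.mem_append_left _ ht)
  have hR := h.pos
  clear h
  induction L with
  | nil => rfl
  | cons t L ih =>
    have ih := ih fun t ht => hk t (List.mem_cons_of_mem _ ht)
    rw [List.flatMap_cons, List.filter_append, ← ih]
    by_cases htx : t.x = x
    · have h1 : (t.kids.filter fun k => !decide (dist k.x x ≤ 16 * R)) = [] := by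
        refine List.filter_eq_nil_iff.2 fun k hkt => ?_
        have := hk t List.mem_cons_self k hkt
        rw [htx] at this
        simp only [Bool.not_eq_true', decide_eq_false_iff_not, not_not]
        linarith
      rw [h1, strip, strip, List.filter_cons_of_neg (by simp [htx]), List.nil_append]
    · rw [strip, strip, List.filter_cons_of_pos (by simpa using htx)]
      rfl

/-- The step only redistributes the nodes of the next level among parents. Hence the invariant of
all lower levels carries over by permutation. -/
theorem perm_kids (h : StepHyp r x R L far K) :
    ((step r x R L K ++ far).flatMap Tree.kids).Perm (K ++ ((L.flatMap Tree.kids).filter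
      (fun t => !decide (dist t.x x ≤ 16 * R)) ++ far.flatMap Tree.kids)) := by
  have h1 : (step r x R L K).flatMap Tree.kids = (attachAll R K (strip x R L)).flatMap Tree.ch := by
    have e1 : (step r x R L K).flatMap Tree.kids = (step r x R L K).flatMap Tree.ch := by
      rw [List.flatMap_def, List.flatMap_def,
        List.map_congr_left fun t ht => (h.step_kids ht).2]
    have e2 : ∀ l : List (Tree X), l.flatMap Tree.ch = (l.map core).flatMap fun c => c.2.2.2 := by
      intro l; rw [List.flatMap_map]; rfl
    rw [e1, e2, map_core_step, List.flatMap_map]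
    rfl
  rw [List.flatMap_append, h1, ← List.append_assoc]
  refine List.Perm.append_right _ ?_
  rw [← h.flatMap_strip_ch]
  exact h.attached.perm

theorem perm_pts (h : StepHyp r x R L far K) :
    ((step r x R L K ++ far).flatMap Tree.pts).Perm ((K ++ ((L.flatMap Tree.kids).filter
      (fun t => !decide (dist t.x x ≤ 16 * R)) ++ far.flatMap Tree.kids)).flatMap Tree.pts) := by
  rw [← flatMap_pts_lev _ 1]
  exact h.perm_kids.flatMap_right _

theorem mem_kids (h : StepHyp r x R L far K) {t k : Tree X} (ht : t ∈ step r x R L K ++ far)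
    (hk : k ∈ t.kids) : k ∈ K ++ ((L.flatMap Tree.kids).filter
      (fun t => !decide (dist t.x x ≤ 16 * R)) ++ far.flatMap Tree.kids) :=
  h.perm_kids.mem_iff.1 (List.mem_flatMap.2 ⟨t, ht, hk⟩)

theorem kids_lvl (h : StepHyp r x R L far K) : Lvl r (R / 2) (K ++ ((L.flatMap Tree.kids).filter
    (fun t => !decide (dist t.x x ≤ 16 * R)) ++ far.flatMap Tree.kids)) :=
  (hered_iff.1 h.kids).1

theorem pts_length {t : Tree X} (h : ∀ k ∈ t.kids, k.c = k.pts.length) :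
    t.pts.length = (t.kids.map Tree.c).sum := by
  rw [Tree.pts_eq, List.length_flatMap]
  exact congrArg List.sum (List.map_congr_left fun k hk => (h k hk).symm)

/-- The updated level before nodes are marked as bad. -/
theorem mem_bads {l : List (Tree X)} {t : Tree X} (ht : t ∈ bads r x R l) : ∃ u ∈ l,
    t.x = u.x ∧ t.flag = u.flag ∧
      t.bad = if dist u.x x ≤ 22 * R then !decide (r ≤ weight R l u.x) else u.bad := by
  obtain ⟨u, hu, rfl⟩ := List.mem_map.1 ht
  refine ⟨u, hu, ?_⟩
  split_ifs <;> exact ⟨rfl, rfl, rfl⟩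

theorem bads_of_mem {l : List (Tree X)} {u : Tree X} (hu : u ∈ l) : ∃ t ∈ bads r x R l,
    t.x = u.x ∧ t.flag = u.flag := by
  refine ⟨_, List.mem_map.2 ⟨u, hu, rfl⟩, ?_⟩
  split_ifs <;> exact ⟨rfl, rfl⟩

theorem bads_pairwise {l : List (Tree X)} (hl : l.Pairwise fun t u => t.flag = true →
    u.flag = true → 10 * R < dist t.x u.x) : (bads r x R l).Pairwise fun t u => t.flag = true →
    u.flag = true → 10 * R < dist t.x u.x := by
  rw [bads, List.pairwise_map]
  refine hl.imp fun {a b} h => ?_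
  split_ifs <;> exact h

theorem weight_congr {l l' : List (Tree X)} (h : l.map core = l'.map core) (y : X) :
    weight R l y = weight R l' y := by
  have : ∀ l : List (Tree X), weight R l y =
      ((l.map core).map fun c => if dist c.1 y ≤ 5 * R then c.2.1 else 0).sum := by
    intro l; rw [List.map_map]; rfl
  rw [this, this, h]

/-- New nodes are not flagged, so all flags at this stage are inherited from old nodes with the same
centers. -/
theorem flag_recount_pairwise (h : StepHyp r x R L far K) :
    ((attachAll R K (strip x R L)).map (recount R)).Pairwise fun t u => t.flag = true →
      u.flag = true → 10 * R < dist t.x u.x := by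
  rw [List.pairwise_map]
  refine h.attached.sep.imp_of_mem fun {a b} ha hb hab hfa hfb => ?_
  have key : ∀ u ∈ attachAll R K (strip x R L), u.flag = true → ∃ t ∈ L, t.x = u.x ∧
      t.flag = true := by
    intro u hu hf
    rcases h.attached.old u hu with ⟨v, hv, h1, h2, -⟩ | ⟨h1, -⟩
    · obtain ⟨t, ht, -, h3, h4, -⟩ := mem_strip hv
      exact ⟨t, ht, by rw [← h3, h1], by rw [← h4, h2, hf]⟩
    · rw [h1] at hf; contradiction
  obtain ⟨t, ht, htx, htf⟩ := key a ha hfa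
  obtain ⟨u, hu, hux, huf⟩ := key b hb hfb
  have hne : t ≠ u := by
    rintro rfl
    rw [← htx, ← hux, dist_self] at hab
    exact absurd hab (not_lt.2 h.pos)
  have hsym : ∀ a ∈ L, ∀ b ∈ L, a ≠ b → a.flag = true → b.flag = true →
      10 * R < dist a.x b.x := by
    have : Std.Symm fun t u : Tree X => t.flag = true → u.flag = true → 10 * R < dist t.x u.x :=
      ⟨fun a b h h1 h2 => by rw [dist_comm]; exact h h2 h1⟩
    intro a ha b hb hab
    exact (List.pairwise_append.1 h.lvl.flagSep).1.forall ha hb hab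
  have := hsym t ht u hu hne htf huf
  rw [htx, hux] at this
  exact this

/-- Nodes that count for `y` are more than `17 * R` from `x`, whereas all attachments happen within
`17 * R` of `x`. -/
theorem weight_outer (h : StepHyp r x R L far K) {y : X} (hy : 22 * R < dist y x) :
    weight R (step r x R L K) y = weight R L y := by
  have hR := h.pos
  -- The summand of the weight, cut off within `17 * R` of `x`. There it vanishes, so
  -- `sum_attachAll` applies; on the nodes that count for `y` the cutoff makes no difference.
  let φ : Tree X → ℕ := fun t =>
    if 17 * R < dist t.x x ∧ dist t.x y ≤ 5 * R then (t.ch.map Tree.c).sum else 0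
  have h1 : weight R (step r x R L K) y = ((attachAll R K (strip x R L)).map φ).sum := by
    have : ∀ l : List (Tree X), weight R l y =
        ((l.map core).map fun c => if dist c.1 y ≤ 5 * R then c.2.1 else 0).sum := by
      intro l; rw [List.map_map]; rfl
    rw [this, map_core_step, List.map_map]
    congr 1
    refine List.map_congr_left fun u _ => ?_
    simp only [Function.comp, core, recount, Tree.x, Tree.c, φ]
    change (if dist u.x y ≤ 5 * R then _ else _) = if 17 * R < dist u.x x ∧ dist u.x y ≤ 5 * R then _ else _
    by_cases hd : dist u.x y ≤ 5 * R
    · rw [if_pos hd, if_pos]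
      refine ⟨?_, hd⟩
      have := dist_triangle y u.x x
      rw [dist_comm y u.x] at this
      linarith
    · rw [if_neg hd, if_neg (fun h => hd h.2)]
  rw [h1, sum_attachAll]
  rotate_left
  · intro w hw u hu
    have h2 := h.kids_near w hw
    have h3 := dist_triangle u.x w.x x
    have h4 : ¬ (17 * R < dist u.x x) := by linarith
    have h5 : φ (addKid w u) = 0 := if_neg (fun h => h4 h.1)
    have h6 : φ u = 0 := if_neg (fun h => h4 h.1)
    rw [h5, h6]
  · intro w hw
    have h2 := h.kids_near w hw
    have h4 : ¬ (17 * R < dist w.x x) := by linarith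
    exact if_neg (fun h => h4 h.1)
  have hkid : ∀ t ∈ L, ∀ k ∈ t.kids, dist k.x t.x ≤ R := fun t ht =>
    h.lvl.kid t (List.mem_append_left _ ht)
  have hcnt : ∀ t ∈ L, 17 * R < dist t.x x →
      ((t.kids.filter fun k => !decide (dist k.x x ≤ 16 * R)).map Tree.c).sum = t.c := by
    intro t ht hd
    have hfar : ∀ k ∈ t.kids, ¬ dist k.x x ≤ 16 * R := by
      intro k hk h3
      have := hkid t ht k hk
      have h4 := dist_triangle t.x k.x x
      rw [dist_comm t.x k.x] at h4
      linarith
    rw [List.filter_eq_self.2 fun k hk => by simpa using hfar k hk,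
      h.lvl.cnt t (List.mem_append_left _ ht), pts_length]
    intro k hk
    exact h.kids_lvl.cnt k (List.mem_append_right _ (List.mem_append_left _ (List.mem_filter.2
      ⟨List.mem_flatMap.2 ⟨t, ht, hk⟩, by simpa using hfar k hk⟩)))
  have hfin : ∀ l : List (Tree X), (∀ t ∈ l, t ∈ L) →
      ((strip x R l).map φ).sum = weight R l y := by
    intro l
    induction l with
    | nil => intro _; rfl
    | cons t l ih =>
      intro hl
      have ih := ih fun t ht => hl t (List.mem_cons_of_mem _ ht)
      have ht := hl t List.mem_cons_self
      have hw : weight R (t :: l) y = (if dist t.x y ≤ 5 * R then t.c else 0) + weight R l y := by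
        simp [weight]
      rw [hw, ← ih]
      by_cases htx : t.x = x
      · rw [strip, List.filter_cons_of_neg (by simp [htx]), ← strip, if_neg, zero_add]
        rw [htx, dist_comm]
        linarith
      · rw [strip, List.filter_cons_of_pos (by simpa using htx), List.map_cons, List.map_cons,
          ← strip, List.sum_cons]
        congr 1
        change (if 17 * R < dist t.x x ∧ dist t.x y ≤ 5 * R then
          ((t.kids.filter fun k => !decide (dist k.x x ≤ 16 * R)).map Tree.c).sum else 0) = _
        by_cases hd : dist t.x y ≤ 5 * R
        · have h7 : 17 * R < dist t.x x := by
            have := dist_triangle y t.x x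
            rw [dist_comm y t.x] at this
            linarith
          rw [if_pos ⟨h7, hd⟩, if_pos hd]
          exact hcnt t ht h7
        · rw [if_neg hd, if_neg (fun h => hd h.2)]
  exact hfin L fun _ h => h

/-- Within `22 * R` of `x`, flags and bad marks have been recomputed, so the conditions hold by
construction. Farther out they are inherited, because the nodes, their flags and their weights agree
with the old level. The far nodes do not interfere, by the distance of `32 * R`. -/
theorem step_lvl (h : StepHyp r x R L far K) : Lvl r R (step r x R L K ++ far) := by
  have hR := h.pos
  set S1 := attachAll R K (strip x R L) with hS1
  set S2 := S1.map (recount R) with hS2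
  have hflags : flags x R S2 = flagsFrom x R ((S2.filter Tree.flag).map Tree.x) S2 := rfl
  have hstep : step r x R L K = bads r x R (flags x R S2) := rfl
  have hF : ∀ t ∈ S2, t.flag = true → t.x ∈ (S2.filter Tree.flag).map Tree.x := fun t ht hf =>
    List.mem_map_of_mem (List.mem_filter.2 ⟨ht, hf⟩)
  have hpersist : ∀ t ∈ L ++ far, t.x ≠ x → t.flag = true →
      ∃ u ∈ step r x R L K ++ far, u.flag = true ∧ u.x = t.x := by
    intro t ht hx hf
    rcases List.mem_append.1 ht with ht | ht
    · obtain ⟨v, hv, h1, h1'⟩ := strip_of_mem (R := R) ht hx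
      obtain ⟨w, hw, h2, h2'⟩ := h.attached.persist v hv
      obtain ⟨u, hu, h3, h3'⟩ := flagsFrom_persist x R ((S2.filter Tree.flag).map Tree.x) S2
        (recount R w) (List.mem_map_of_mem hw) (show w.flag = true by rw [← h2', h1', hf])
      obtain ⟨z, hz, h4, h4'⟩ := bads_of_mem (r := r) (x := x) (R := R) (hflags ▸ hu)
      refine ⟨z, List.mem_append_left _ hz, by rw [h4', h3], ?_⟩
      rw [h4, h3']
      change w.x = _
      rw [← h2, h1]
    · exact ⟨t, List.mem_append_right _ ht, hf, rfl⟩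
  -- A node beyond `22 * R` cannot be new, since new nodes have the centers of members of `K`,
  -- within `16 * R`; and its bad mark was not recomputed.
  have hold : ∀ t ∈ step r x R L K, 22 * R < dist t.x x → ∃ v ∈ L, v.x = t.x ∧ v.bad = t.bad := by
    intro t ht hd
    obtain ⟨u, hu, h1, -, h2⟩ := mem_bads (hstep ▸ ht)
    rw [if_neg (by rw [← h1]; linarith)] at h2
    obtain ⟨z, hz, h3, h3'⟩ : ∃ z ∈ S2, z.x = u.x ∧ z.bad = u.bad := by
      rcases flagsFrom_mem _ _ _ _ u (hflags ▸ hu) with hu | ⟨z, hz, rfl, -⟩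
      · exact ⟨u, hu, rfl, rfl⟩
      · exact ⟨z, hz, rfl, rfl⟩
    obtain ⟨w, hw, rfl⟩ := List.mem_map.1 hz
    rcases h.attached.old w hw with ⟨v, hv, h4, -, h4'⟩ | ⟨-, w', hw', h4⟩
    · obtain ⟨t', ht', -, h5, -, h5', -⟩ := mem_strip hv
      refine ⟨t', ht', ?_, ?_⟩
      · rw [h1, ← h3, ← h5, h4]; rfl
      · rw [h2, ← h3', ← h5', h4']; rfl
    · exfalso
      have := h.kids_near w' hw'
      have h6 : w'.x = t.x := by rw [h4, h1, ← h3]; rfl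
      rw [h6] at this
      linarith
  refine ⟨?_, ?_, ?_, ?_, ?_, ?_, ?_, ?_, ?_, ?_⟩
  · refine List.pairwise_append.2 ⟨?_, (List.pairwise_append.1 h.lvl.sep).2.1, ?_⟩
    · have h1 : ((step r x R L K).map core).Pairwise fun a b => R < dist a.1 b.1 := by
        rw [map_core_step, List.pairwise_map]
        exact h.attached.sep
      exact List.pairwise_map.1 h1
    · intro t ht f hf
      rcases h.old_or_near ht with ⟨v, hv, -, hx⟩ | h1
      · rw [← hx]
        exact (List.pairwise_append.1 h.lvl.sep).2.2 v hv f hf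
      · have h2 := h.mem_far f hf
        have h3 := dist_triangle f.x t.x x
        rw [dist_comm f.x t.x] at h3
        linarith
  · intro t ht k hk
    rcases List.mem_append.1 ht with ht | ht
    · rw [(h.step_kids ht).2] at hk
      obtain ⟨u, hu, h1, h2, -⟩ := mem_step ht
      rw [h2] at hk
      rw [h1]
      exact h.attached.near u hu k hk
    · exact h.lvl.kid t (List.mem_append_right _ ht) k hk
  · intro t ht
    rcases List.mem_append.1 ht with ht | ht
    · rw [(h.step_kids ht).2]
      obtain ⟨u, hu, h1, h2, -⟩ := mem_step ht
      rw [h1, h2]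
      exact h.own u hu
    · exact h.lvl.own t (List.mem_append_right _ ht)
  · intro t ht
    rcases List.mem_append.1 ht with ht' | ht'
    · obtain ⟨u, hu, h1, h2, h3, -⟩ := mem_step ht'
      rw [pts_length fun k hk => h.kids_lvl.cnt k (h.mem_kids ht hk), (h.step_kids ht').2, h3, h2]
    · exact h.lvl.cnt t (List.mem_append_right _ ht')
  · have hpw := flagsFrom_pairwise x R _ S2 hF h.flag_recount_pairwise
    refine List.pairwise_append.2 ⟨bads_pairwise hpw, (List.pairwise_append.1 h.lvl.flagSep).2.1, ?_⟩
    intro t ht f hf htf hff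
    -- Here `32 - 22 = 10`: a newly flagged node is far enough from all far nodes.
    have hinner : dist t.x x ≤ 22 * R → 10 * R < dist t.x f.x := by
      intro h1
      have h2 := h.mem_far f hf
      have h3 := dist_triangle f.x t.x x
      rw [dist_comm f.x t.x] at h3
      linarith
    obtain ⟨u, hu, h1, h1', -⟩ := mem_bads (hstep ▸ ht)
    rcases flagsFrom_mem _ _ _ _ u (hflags ▸ hu) with hu | ⟨z, hz, rfl, hd, -⟩
    · obtain ⟨w, hw, rfl⟩ := List.mem_map.1 hu
      rcases h.attached.old w hw with ⟨v, hv, h4, h4', -⟩ | ⟨h4, -⟩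
      · obtain ⟨t', ht', -, h5, h5', -⟩ := mem_strip hv
        have h6 : t'.x = t.x := by rw [h1, ← h5, h4]; rfl
        rw [← h6]
        refine (List.pairwise_append.1 h.lvl.flagSep).2.2 t' ht' f hf ?_ hff
        rw [← h5', h4', ← htf, h1']; rfl
      · rw [h1', show (recount R w).flag = w.flag from rfl, h4] at htf
        contradiction
    · exact hinner (by rw [h1]; exact hd)
  · intro t ht
    by_cases hd : dist t.x x ≤ 22 * R
    · rcases List.mem_append.1 ht with ht' | ht'
      · obtain ⟨u, hu, h1, -⟩ := mem_bads (hstep ▸ ht')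
        obtain ⟨y, hy, hyF⟩ := flagsFrom_cover x R hR _ S2 u (hflags ▸ hu) (by rw [← h1]; exact hd)
        have : ∃ u ∈ flags x R S2, u.flag = true ∧ u.x = y := by
          rcases hyF with hyF | hyF
          · obtain ⟨z, hz, rfl⟩ := List.mem_map.1 hyF
            have hz := List.mem_filter.1 hz
            exact flagsFrom_persist _ _ _ _ z hz.1 hz.2
          · exact hyF
        obtain ⟨z, hz, hzf, hzy⟩ := this
        obtain ⟨v, hv, h4, h4'⟩ := bads_of_mem (r := r) (x := x) (R := R) hz
        refine ⟨v, List.mem_append_left _ hv, by rw [h4', hzf], ?_⟩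
        rw [h4, hzy, h1]
        exact hy
      · have := h.mem_far t ht'
        linarith
    · push Not at hd
      obtain ⟨v, hv, hvx⟩ : ∃ v ∈ L ++ far, v.x = t.x := by
        rcases List.mem_append.1 ht with ht' | ht'
        · obtain ⟨v, hv, hvx, -⟩ := hold t ht' hd
          exact ⟨v, List.mem_append_left _ hv, hvx⟩
        · exact ⟨t, List.mem_append_right _ ht', rfl⟩
      obtain ⟨u, hu, huf, hud⟩ := h.lvl.cover v hv
      -- The old cluster center that covers `t` is not the removed node, as `t` is more than `22 *
      -- R` from `x` and within `10 * R` of `u`.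
      have hux : u.x ≠ x := by
        intro he
        rw [he, hvx, dist_comm] at hud
        linarith
      obtain ⟨z, hz, hzf, hzx⟩ := hpersist u hu hux huf
      exact ⟨z, hz, hzf, by rw [hzx, ← hvx]; exact hud⟩
  · intro t ht
    rw [weight_append]
    by_cases hd : dist t.x x ≤ 22 * R
    · rcases List.mem_append.1 ht with ht' | ht'
      · obtain ⟨u, hu, h1, -, h2⟩ := mem_bads (hstep ▸ ht')
        rw [h2, if_pos (by rw [← h1]; exact hd), weight_eq_zero (L := far), add_zero, hstep,
          weight_congr (map_core_bads r x R (flags x R S2)), h1]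
        intro f hf
        have h3 := h.mem_far f hf
        have h4 := dist_triangle f.x t.x x
        linarith
      · have := h.mem_far t ht'
        linarith
    · push Not at hd
      rw [h.weight_outer hd, ← weight_append]
      rcases List.mem_append.1 ht with ht' | ht'
      · obtain ⟨v, hv, hvx, hvb⟩ := hold t ht' hd
        rw [← hvb, ← hvx]
        exact h.lvl.bad v (List.mem_append_left _ hv)
      · exact h.lvl.bad t (List.mem_append_right _ ht')
  · intro t ht hch
    rcases List.mem_append.1 ht with ht' | ht'
    · obtain ⟨u, hu, -, -, -, h4⟩ := mem_step ht'
      exact h4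
    · exact h.lvl.radius t (List.mem_append_right _ ht') hch
  · intro t ht
    rcases List.mem_append.1 ht with ht' | ht'
    · obtain ⟨u, hu, -, -, -, h4⟩ := mem_step ht'
      rw [h4]
      split_ifs
      · exact le_rfl
      · have : ∀ (l : List (Tree X)) (m : ℝ), m ≤ R → (∀ k ∈ l, k.g ≤ R) →
            l.foldl (fun m k => max m k.g) m ≤ R := by
          intro l
          induction l with
          | nil => intro m hm _; exact hm
          | cons k l ih =>
            intro m hm hl
            exact ih _ (max_le hm (hl k List.mem_cons_self))
              fun k hk => hl k (List.mem_cons_of_mem _ hk)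
        refine this _ _ hR fun k hk => ?_
        have := h.kids_lvl.radius_le k (h.mem_kids ht (by rwa [(h.step_kids ht').2]))
        linarith
    · exact h.lvl.radius_le t (List.mem_append_right _ ht')
  · intro t ht hch
    rcases List.mem_append.1 ht with ht' | ht'
    · exact absurd hch (h.step_kids ht').1
    · exact h.lvl.of_nil t (List.mem_append_right _ ht') hch

theorem step_hered (h : StepHyp r x R L far K) : Hered r R (step r x R L K ++ far) :=
  hered_iff.2 ⟨h.step_lvl, h.kids.perm h.perm_kids.symm⟩

end StepHyp

end StepInvariant

-- Descending near a point, and exchanging the nodes found there.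

section Descent

variable {X : Type*} [MetricSpace X]

/-- The nodes near `x` that are `n` levels below those of a list. -/
noncomputable def nearN (x : X) : ℕ → ℝ → List (Tree X) → List (Tree X)
  | 0, _, L => L
  | n + 1, R, L => nearN x n (R / 2) (near x R L)

/-- Replace the nodes near `x` that are `n` levels below those of a list by `K`, and update the levels
above. -/
noncomputable def upd (r : ℕ) (x : X) : ℕ → ℝ → List (Tree X) → List (Tree X) → List (Tree X)
  | 0, _, _, K => K
  | n + 1, R, L, K => step r x R L (upd r x n (R / 2) (near x R L) K)

theorem nearN_succ (x : X) (n : ℕ) (R : ℝ) (L : List (Tree X)) :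
    nearN x (n + 1) R L = near x (R / 2 ^ n) (nearN x n R L) := by
  induction n generalizing R L with
  | zero => simp [nearN]
  | succ n ih =>
    rw [nearN, ih, nearN, pow_succ']
    congr 1
    field_simp

/-- The nodes `L` are near `x`, and the remaining nodes `far` of the level are not. -/
structure Split (r : ℕ) (x : X) (R : ℝ) (L far : List (Tree X)) : Prop where
  pos : 0 ≤ R
  hered : Hered r R (L ++ far)
  mem_near : ∀ t ∈ L, dist t.x x ≤ 32 * R
  mem_far : ∀ t ∈ far, 32 * R < dist t.x x

variable {r : ℕ} {x : X} {R : ℝ} {L far K : List (Tree X)}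

theorem Split.lvl (h : Split r x R L far) : Lvl r R (L ++ far) := (hered_iff.1 h.hered).1

theorem Split.perm_kids : (near x R L ++ ((L.flatMap Tree.kids).filter
    (fun t => !decide (dist t.x x ≤ 16 * R)) ++ far.flatMap Tree.kids)).Perm
      ((L ++ far).flatMap Tree.kids) := by
  rw [List.flatMap_append, ← List.append_assoc]
  exact (List.filter_append_perm _ _).append_right _

/-- The bound `16 * R` for children is `32` times the radius `R / 2` of their level, so the same
shape recurs. Children of far nodes are more than `31 * R` away and stay far. -/
theorem Split.next (h : Split r x R L far) : Split r x (R / 2) (near x R L)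
    ((L.flatMap Tree.kids).filter (fun t => !decide (dist t.x x ≤ 16 * R)) ++
      far.flatMap Tree.kids) where
  pos := by have := h.pos; positivity
  hered := (hered_iff.1 h.hered).2.perm Split.perm_kids.symm
  mem_near t ht := by
    have := (List.mem_filter.1 ht).2
    simp only [decide_eq_true_eq] at this
    linarith
  mem_far t ht := by
    rcases List.mem_append.1 ht with ht | ht
    · have := (List.mem_filter.1 ht).2
      simp only [Bool.not_eq_true', decide_eq_false_iff_not] at this
      linarith
    · obtain ⟨u, hu, htu⟩ := List.mem_flatMap.1 ht
      have h1 := h.mem_far u hu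
      have h2 := h.lvl.kid u (List.mem_append_right _ hu) t htu
      have h3 := dist_triangle u.x t.x x
      rw [dist_comm u.x t.x] at h3
      have := h.pos
      linarith

theorem Split.next_pts : ((near x R L ++ ((L.flatMap Tree.kids).filter
    (fun t => !decide (dist t.x x ≤ 16 * R)) ++ far.flatMap Tree.kids)).flatMap Tree.pts).Perm
      ((L ++ far).flatMap Tree.pts) := by
  rw [← flatMap_pts_lev (L ++ far) 1]
  exact Split.perm_kids.flatMap_right _

theorem Split.nearN (h : Split r x R L far) (n : ℕ) : ∃ farn,
    Split r x (R / 2 ^ n) (nearN x n R L) farn ∧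
      ((RGather.nearN x n R L ++ farn).flatMap Tree.pts).Perm ((L ++ far).flatMap Tree.pts) := by
  induction n generalizing R L far with
  | zero => exact ⟨far, by simpa [RGather.nearN] using h, List.Perm.refl _⟩
  | succ n ih =>
    obtain ⟨f, h1, h2⟩ := ih h.next
    refine ⟨f, ?_, h2.trans Split.next_pts⟩
    rw [pow_succ', ← div_div]
    exact h1

/-- The nodes `K` may replace those near `x` that are `n` levels below `L`. -/
def Fits (r : ℕ) (x : X) (R : ℝ) (L far : List (Tree X)) (n : ℕ) (K : List (Tree X)) : Prop :=
  -- The far nodes of lower levels are never computed, so the condition ranges over all lists that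
  -- could complete the near ones.
  ∀ farn, Split r x (R / 2 ^ n) (nearN x n R L) farn →
    ((nearN x n R L ++ farn).flatMap Tree.pts).Perm ((L ++ far).flatMap Tree.pts) →
    Split r x (R / 2 ^ n) K farn ∧ ∀ k ∈ nearN x n R L, k.x ≠ x → ∃ w ∈ K, w.x = k.x

theorem Split.step (h : Split r x R L far) (h1 : Split r x (R / 2) K ((L.flatMap Tree.kids).filter
      (fun t => !decide (dist t.x x ≤ 16 * R)) ++ far.flatMap Tree.kids))
    (h2 : ∀ k ∈ near x R L, k.x ≠ x → ∃ w ∈ K, w.x = k.x) :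
    StepHyp r x R L far K ∧ Split r x R (step r x R L K) far := by
  have hs : StepHyp r x R L far K :=
    { pos := h.pos
      lvl := h.lvl
      mem_near := h.mem_near
      mem_far := h.mem_far
      kids := h1.hered
      kids_near := fun w hw => by have := h1.mem_near w hw; linarith
      persist := h2 }
  exact ⟨hs, h.pos, hs.step_hered, hs.step_near, h.mem_far⟩

/-- This moves a replacement one level up. It shows that every intermediate list of the bottom-up
pass is the near part of a valid level, which bounds its size. -/
theorem Fits.step {n : ℕ} (hK : Fits r x R L far (n + 1) K) :
    Fits r x R L far n (step r x (R / 2 ^ n) (nearN x n R L) K) := by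
  intro f hf hp
  have hn := hf.next
  have := hK _ (by rw [nearN_succ, pow_succ, ← div_div]; exact hn)
    (by rw [nearN_succ]; exact Split.next_pts.trans hp)
  rw [nearN_succ, pow_succ, ← div_div] at this
  obtain ⟨h1, h2⟩ := hf.step this.1 this.2
  exact ⟨h2, h1.step_persist⟩

/-- The change of the point set is stated additively, with the old near points on one side and the
new ones on the other, so that no multiset difference is needed. -/
theorem Split.upd (h : Split r x R L far) (n : ℕ) (hK : Fits r x R L far n K) :
    Split r x R (upd r x n R L K) far ∧
    (∀ k ∈ L, k.x ≠ x → ∃ w ∈ upd r x n R L K, w.x = k.x) ∧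
    ((RGather.upd r x n R L K ++ far).flatMap Tree.pts ++
      (RGather.nearN x n R L).flatMap Tree.pts).Perm
      ((L ++ far).flatMap Tree.pts ++ K.flatMap Tree.pts) := by
  induction n generalizing R L far with
  | zero =>
    have := hK far (by simpa [RGather.nearN] using h) (List.Perm.refl _)
    refine ⟨by simpa [RGather.upd] using this.1, this.2, ?_⟩
    simp only [RGather.upd, RGather.nearN, List.flatMap_append]
    rw [← Multiset.coe_eq_coe]
    simp only [← Multiset.coe_add]
    abel
  | succ n ih =>
    obtain ⟨h1, h2, h3⟩ := ih h.next (fun f hf hp => by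
      have := hK f (by rw [pow_succ', ← div_div]; exact hf) (hp.trans Split.next_pts)
      rwa [pow_succ', ← div_div] at this)
    obtain ⟨hs, hs'⟩ := h.step h1 h2
    refine ⟨hs', hs.step_persist, ?_⟩
    refine (hs.perm_pts.append_right _).trans ?_
    exact h3.trans (Split.next_pts.append_right _)

/-- The number of points below the nodes of a list, according to the nodes. -/
def total (L : List (Tree X)) : ℕ := (L.map Tree.c).sum

theorem Lvl.total_eq {r : ℕ} {R : ℝ} {L far : List (Tree X)} (h : Lvl r R (L ++ far)) :
    total L = (L.flatMap Tree.pts).length := by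
  rw [total, List.length_flatMap]
  exact congrArg List.sum (List.map_congr_left fun t ht => h.cnt t (List.mem_append_left _ ht))

theorem Split.center_mem (h : Split r x R L far) : ∀ t ∈ L ++ far, t.x ∈ t.pts := fun t ht =>
  h.hered.center_mem t 0 ht

theorem Split.dist_le (h : Split r x R L far) : ∀ t ∈ L ++ far, ∀ p ∈ t.pts,
    dist p t.x ≤ 2 * R := fun t ht p hp => by
  have := h.hered.dist_le h.pos t 0 ht p hp
  simpa using this

/-- Near nodes are within `32 * R`, and their points stray by `2 * R`. This is the source of the
constant `34`, and thereby of the depth bound. -/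
theorem Split.dist_pts_le (h : Split r x R L far) {p : X} (hp : p ∈ L.flatMap Tree.pts) :
    dist p x ≤ 34 * R := by
  obtain ⟨t, ht, hpt⟩ := List.mem_flatMap.1 hp
  have h1 := h.mem_near t ht
  have h2 := h.dist_le t (List.mem_append_left _ ht) p hpt
  have h3 := dist_triangle p t.x x
  linarith

theorem Split.eq_nil (h : Split r x R L far) (h0 : total L = 0) : L = [] := by
  rw [h.lvl.total_eq, List.length_eq_zero_iff, List.flatMap_eq_nil_iff] at h0
  refine List.eq_nil_iff_forall_not_mem.2 fun t ht => ?_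
  have := h.center_mem t (List.mem_append_left _ ht)
  rw [h0 t ht] at this
  simp at this

theorem Split.total_eq_zero (h : Split r x R L far)
    (hp : ∀ p ∈ (L ++ far).flatMap Tree.pts, 34 * R < dist p x) : total L = 0 := by
  rw [h.lvl.total_eq, List.length_eq_zero_iff]
  refine List.eq_nil_iff_forall_not_mem.2 fun p hpL => ?_
  have h1 := h.dist_pts_le hpL
  have h2 := hp p (by rw [List.flatMap_append]; exact List.mem_append_left _ hpL)
  linarith

/-- The point `x` cannot be below a far node, whose points are more than `30 * R` from `x`. -/
theorem Split.mem_pts (h : Split r x R L far) (hR : 0 < R)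
    (hx : x ∈ (L ++ far).flatMap Tree.pts) : x ∈ L.flatMap Tree.pts := by
  rw [List.flatMap_append] at hx
  rcases List.mem_append.1 hx with hx | hx
  · exact hx
  · exfalso
    obtain ⟨t, ht, hxt⟩ := List.mem_flatMap.1 hx
    have h1 := h.mem_far t ht
    have h2 := h.dist_le t (List.mem_append_right _ ht) x hxt
    rw [dist_comm] at h2
    linarith

theorem Split.total_eq_one (h : Split r x R L far) (hR : 0 < R)
    (hx : x ∈ (L ++ far).flatMap Tree.pts) (hn : ((L ++ far).flatMap Tree.pts).Nodup)
    (hp : ∀ p ∈ (L ++ far).flatMap Tree.pts, p ≠ x → 34 * R < dist p x) : total L = 1 := by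
  have hxL := h.mem_pts hR hx
  rw [h.lvl.total_eq]
  rw [List.flatMap_append] at hn
  have hnL := (List.nodup_append.1 hn).1
  have : L.flatMap Tree.pts = [x] := by
    refine List.perm_singleton.1 ((List.perm_ext_iff_of_nodup hnL (List.nodup_singleton x)).2 ?_)
    intro p
    rw [List.mem_singleton]
    refine ⟨fun hpL => ?_, fun h => h ▸ hxL⟩
    by_contra hpx
    have h1 := h.dist_pts_le hpL
    have h2 := hp p (by rw [List.flatMap_append]; exact List.mem_append_left _ hpL) hpx
    linarith
  rw [this]
  rfl

/-- The centers of near nodes are points below near nodes, so all of them equal `x`; since nodes are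
separated, there is just one. -/
theorem Split.eq_singleton (h : Split r x R L far) (hR : 0 < R)
    (hx : x ∈ (L ++ far).flatMap Tree.pts) (h1 : total L = 1) :
    ∃ t, L = [t] ∧ t.pts = [x] ∧ t.x = x := by
  have hxL := h.mem_pts hR hx
  rw [h.lvl.total_eq, List.length_eq_one_iff] at h1
  obtain ⟨y, hy⟩ := h1
  have hxy : x = y := by rw [hy] at hxL; simpa using hxL
  subst hxy
  have hone : ∀ t ∈ L, t.x = x := by
    intro t ht
    have : t.x ∈ L.flatMap Tree.pts :=
      List.mem_flatMap.2 ⟨t, ht, h.center_mem t (List.mem_append_left _ ht)⟩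
    rw [hy] at this
    simpa using this
  have hsep := (List.pairwise_append.1 h.lvl.sep).1
  match L, hone, hsep, hy with
  | [], _, _, hy => simp at hy
  | [t], hone, _, hy => exact ⟨t, rfl, by simpa using hy, hone t (by simp)⟩
  | t :: u :: l, hone, hsep, _ =>
    exfalso
    have := (List.pairwise_cons.1 hsep).1 u (by simp)
    rw [hone t (by simp), hone u (by simp), dist_self] at this
    linarith

/-- A count of `0` means that there are no near nodes. All other nodes are more than `32 * R` from
`x`, so a leaf can be added independently of them. -/
theorem Split.fits_leaf (hr : 2 ≤ r) (h : Split r x R L far) {n : ℕ}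
    (hn : total (RGather.nearN x n R L) = 0) : Fits r x R L far n [Tree.leaf x] := by
  obtain ⟨f, hf, -⟩ := h.nearN n
  have hnil := hf.eq_nil hn
  intro f hf _
  rw [hnil] at hf ⊢
  have hx : ∀ t ∈ [Tree.leaf x], t.x = x := by simp [Tree.leaf, Tree.x]
  refine ⟨⟨hf.pos, ?_, ?_, hf.mem_far⟩, by simp⟩
  · refine (Hered.leaf hr hf.pos x).append hf.pos (by simpa using hf.hered) ?_
    intro a ha t ht
    rw [hx a ha, dist_comm]
    have := hf.mem_far t ht
    have := hf.pos
    linarith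
  · intro t ht
    rw [hx t ht, dist_self]
    have := hf.pos
    positivity

/-- A count of `1` means that the only near node is `x` with the single point `x`. The other nodes
are too far away to have used it for a weight or a flag. -/
theorem Split.fits_nil (hR : 0 < R) (hx : x ∈ (L ++ far).flatMap Tree.pts) {n : ℕ}
    (hn : total (RGather.nearN x n R L) = 1) : Fits r x R L far n [] := by
  intro f hf hp
  obtain ⟨t, ht, htp, htx⟩ := hf.eq_singleton (by positivity) (hp.mem_iff.2 hx) hn
  rw [ht] at hf ⊢
  refine ⟨⟨hf.pos, ?_, by simp, hf.mem_far⟩, ?_⟩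
  · refine hf.hered.of_append hf.pos ?_
    intro a ha u hu
    rw [List.mem_singleton.1 ha, htx, dist_comm]
    have := hf.mem_far u hu
    have := hf.pos
    linarith
  · intro k hk hkx
    rw [List.mem_singleton.1 hk] at hkx
    exact absurd htx hkx

theorem Split.insert (hr : 2 ≤ r) (h : Split r x R L []) {n : ℕ}
    (hn : total (RGather.nearN x n R L) = 0) :
    Hered r R (RGather.upd r x n R L [Tree.leaf x]) ∧
    ((RGather.upd r x n R L [Tree.leaf x]).flatMap Tree.pts).Perm (x :: L.flatMap Tree.pts) := by
  obtain ⟨f, hf, -⟩ := h.nearN n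
  have hnil := hf.eq_nil hn
  obtain ⟨h1, -, h3⟩ := h.upd n (h.fits_leaf hr hn)
  refine ⟨by simpa using h1.hered, ?_⟩
  rw [hnil] at h3
  simp only [List.flatMap_nil, List.append_nil, List.flatMap_cons, Tree.pts_leaf] at h3
  exact h3.trans List.perm_append_comm

theorem Split.delete (h : Split r x R L []) (hR : 0 < R) {n : ℕ}
    (hx : x ∈ L.flatMap Tree.pts) (hn : total (RGather.nearN x n R L) = 1) :
    Hered r R (RGather.upd r x n R L []) ∧
    (x :: (RGather.upd r x n R L []).flatMap Tree.pts).Perm (L.flatMap Tree.pts) := by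
  obtain ⟨f, hf, hp⟩ := h.nearN n
  have hRn : 0 < R / 2 ^ n := by positivity
  have hx' : x ∈ (L ++ []).flatMap Tree.pts := by simpa using hx
  obtain ⟨t, ht, htp, htx⟩ := hf.eq_singleton hRn (hp.mem_iff.2 hx') hn
  obtain ⟨h1, -, h3⟩ := h.upd n (Split.fits_nil hR hx' hn)
  refine ⟨by simpa using h1.hered, ?_⟩
  rw [ht] at h3
  simp only [List.flatMap_nil, List.append_nil, List.flatMap_cons, htp] at h3
  exact (List.perm_append_comm (l₁ := [x])).trans h3

end Descent

/-! ### The invariant between the operations -/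

section Good

variable {X : Type*} [MetricSpace X]

/-- The forest `L` with top radius `R` stores the points `P`. -/
structure Stores (r : ℕ) (P : Finset X) (R : ℝ) (L : List (Tree X)) : Prop where
  pos : 0 < R
  hered : Hered r R L
  perm : (L.flatMap Tree.pts).Perm P.toList
  -- The constant is that of the weights: each top node sees all points, hence is not bad once there
  -- are `r` of them.
  diam : ∀ p ∈ P, ∀ q ∈ P, dist p q ≤ 5 * R

/-- The top radius is not larger than necessary. -/
def Tight (P : Finset X) (R : ℝ) : Prop := 2 ≤ P.card → ∃ p ∈ P, ∃ q ∈ P, R < 2 * dist p q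

variable {r : ℕ} {P : Finset X} {R : ℝ} {L : List (Tree X)}

theorem Stores.mem (h : Stores r P R L) {p : X} : p ∈ L.flatMap Tree.pts ↔ p ∈ P := by
  rw [h.perm.mem_iff, Finset.mem_toList]

theorem Stores.nodup (h : Stores r P R L) : (L.flatMap Tree.pts).Nodup :=
  h.perm.nodup_iff.2 P.nodup_toList

theorem Stores.center (h : Stores r P R L) {t : Tree X} (ht : t ∈ L) : t.x ∈ P :=
  h.mem.1 (List.mem_flatMap.2 ⟨t, ht, h.hered.center_mem t 0 ht⟩)

theorem Stores.total_eq (h : Stores r P R L) : total L = P.card := by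
  rw [Lvl.total_eq (r := r) (R := R) (L := L) (far := []), h.perm.length_eq, Finset.length_toList]
  simpa using (hered_iff.1 h.hered).1

theorem Stores.dist_le (h : Stores r P R L) {t : Tree X} (ht : t ∈ L) {p : X} (hp : p ∈ t.pts) :
    dist p t.x ≤ 2 * R := by
  simpa using h.hered.dist_le h.pos.le t 0 ht p hp

theorem Stores.split (h : Stores r P R L) {x : X} (hx : ∀ t ∈ L, dist t.x x ≤ 32 * R) :
    Split r x R L [] :=
  ⟨h.pos.le, by simpa using h.hered, hx, by simp⟩

theorem Stores.split_of_mem (h : Stores r P R L) {x : X} (hx : x ∈ P) : Split r x R L [] :=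
  h.split fun t ht => by
    have := h.diam _ (h.center ht) _ hx
    have := h.pos
    linarith

theorem Stores.leaf (hr : 2 ≤ r) (p : X) (hR : 0 < R) : Stores r {p} R [Tree.leaf p] where
  pos := hR
  hered := Hered.leaf hr hR.le p
  perm := by simp [Tree.pts_leaf]
  diam := by simp [hR.le]

theorem Stores.nil (hR : 0 < R) : Stores r (∅ : Finset X) R [] where
  pos := hR
  hered k := by
    have : lev ([] : List (Tree X)) k = [] := by
      induction k with
      | zero => rfl
      | succ k ih => rw [lev]; exact ih
    rw [this]
    exact Lvl.nil _ _
  perm := by simp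
  diam := by simp

/-- Add a level at the top. -/
theorem Stores.raise (h : Stores r P R L) {y : X} (hy : y ∈ P) :
    Stores r P (2 * R) (step r y (2 * R) [] L) := by
  have hR := h.pos
  have hs : StepHyp r y (2 * R) [] [] L :=
    { pos := by positivity
      lvl := Lvl.nil _ _
      mem_near := by simp
      mem_far := by simp
      kids := by simpa using h.hered
      kids_near := fun w hw => by
        have := h.diam _ (h.center hw) _ hy
        linarith
      persist := by simp [near] }
  refine ⟨by positivity, by simpa using hs.step_hered, ?_, fun p hp q hq => ?_⟩
  · have := hs.perm_pts
    simp only [List.append_nil, List.flatMap_nil, List.filter_nil] at this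
    exact this.trans h.perm
  · have := h.diam p hp q hq
    linarith

/-- Remove the top level. -/
theorem Stores.pop (h : Stores r P R L) {t : Tree X} (ht : L.flatMap Tree.kids = [t]) :
    Stores r P (R / 2) (L.flatMap Tree.kids) := by
  have hR := h.pos
  have hh := (hered_iff.1 h.hered).2
  have hperm : ((L.flatMap Tree.kids).flatMap Tree.pts).Perm P.toList := by
    have := flatMap_pts_lev L 1
    simp only [lev] at this
    rw [this]
    exact h.perm
  refine ⟨by positivity, hh, hperm, fun p hp q hq => ?_⟩
  -- All points lie below the single node `t` of radius `R / 2`. So the diameter is at most `2 * R`,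
  -- less than the `5 * (R / 2)` that is allowed.
  have key : ∀ p ∈ P, dist p t.x ≤ R := by
    intro p hp
    have hp' := hperm.mem_iff.2 (Finset.mem_toList.2 hp)
    rw [ht] at hp'
    have := hh.dist_le (by positivity) t 0 (by rw [lev, ht]; simp) p (by simpa using hp')
    simp only [pow_zero, div_one] at this
    linarith
  have h1 := key p hp
  have h2 := key q hq
  have h3 := dist_triangle_right p q t.x
  linarith

/-- If the top level is as low as possible then its radius is not too large. -/
theorem Stores.tight (h : Stores r P R L)
    (ht : ∀ t, L.flatMap Tree.kids = [t] → t.c = 1) : Tight P R := by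
  intro hP
  have hh := (hered_iff.1 h.hered).2
  have hl := (hered_iff.1 hh).1
  have hpts : (L.flatMap Tree.kids).flatMap Tree.pts = L.flatMap Tree.pts := flatMap_pts_lev L 1
  have hmem : ∀ t ∈ L.flatMap Tree.kids, t.x ∈ P := fun t ht => by
    rw [← h.mem, ← hpts]
    exact List.mem_flatMap.2 ⟨t, ht, hh.center_mem t 0 ht⟩
  have hlen := h.perm.length_eq
  rw [← hpts, Finset.length_toList] at hlen
  match hk : L.flatMap Tree.kids with
  | [] => rw [hk] at hlen; simp at hlen; omega
  | [t] =>
    have h1 := ht t hk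
    rw [hl.cnt t (by rw [hk]; simp)] at h1
    rw [hk] at hlen
    simp at hlen
    omega
  -- Two nodes of the next level are more than `R / 2` apart, and their centers are points of `P`.
  | t :: u :: l =>
    refine ⟨t.x, hmem t (by rw [hk]; simp), u.x, hmem u (by rw [hk]; simp), ?_⟩
    have h1 := hl.sep
    rw [hk] at h1
    have := (List.pairwise_cons.1 h1).1 u (by simp)
    linarith

-- The points are within `2 * R` of top nodes, and these are within `3 * R` of `x`; the sum is the
-- `5 * R` required by `diam`.
open Classical in
theorem Stores.insert (hr : 2 ≤ r) (h : Stores r P R L) {x : X} (hx : x ∉ P)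
    (hnear : ∀ t ∈ L, dist t.x x ≤ 3 * R) {n : ℕ} (hn : total (nearN x n R L) = 0) :
    Stores r (insert x P) R (upd r x n R L [Tree.leaf x]) := by
  have hR := h.pos
  have hs := (h.split (x := x) fun t ht => (hnear t ht).trans (by linarith)).insert hr hn
  refine ⟨hR, hs.1, hs.2.trans ((h.perm.cons x).trans (Finset.toList_insert hx).symm), ?_⟩
  have key : ∀ p ∈ P, dist p x ≤ 5 * R := by
    intro p hp
    obtain ⟨t, ht, hpt⟩ := List.mem_flatMap.1 (h.mem.2 hp)
    have h1 := h.dist_le ht hpt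
    have h2 := hnear t ht
    have h3 := dist_triangle p t.x x
    linarith
  intro p hp q hq
  rcases Finset.mem_insert.1 hp with hpx | hp <;> rcases Finset.mem_insert.1 hq with hqx | hq
  · rw [hpx, hqx, dist_self]; positivity
  · rw [hpx, dist_comm]; exact key q hq
  · rw [hqx]; exact key p hp
  · exact h.diam p hp q hq

open Classical in
theorem Stores.delete (h : Stores r P R L) {x : X} (hx : x ∈ P) {n : ℕ}
    (hn : total (nearN x n R L) = 1) : Stores r (P.erase x) R (upd r x n R L []) := by
  have hs := (h.split_of_mem hx).delete h.pos (h.mem.2 hx) hn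
  refine ⟨h.pos, hs.1, ?_, fun p hp q hq => h.diam p (Finset.mem_of_mem_erase hp) q
    (Finset.mem_of_mem_erase hq)⟩
  have h1 : (x :: (P.erase x).toList).Perm P.toList := by
    have := Finset.toList_insert (Finset.notMem_erase x P)
    rw [Finset.insert_erase hx] at this
    exact this.symm
  exact (List.perm_cons x).1 (hs.2.trans (h.perm.trans h1.symm))

end Good

/-! ### Programs for the operations -/

/-- The number of points below the nodes of a list. -/
def totalE (l : Fn) : Fn := sumE l (cE v0)

/-- The loop condition of `descendE`. -/
def descendCondE (e : ℕ) : Fn :=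
  .ifz (.nle (totalE v2) (.nat e)) (.nat 1) (notE (.nle (.nat e) (totalE v2)))

/-- The loop body of `descendE`. -/
def descendBodyE : Fn := .pair v0 (.pair (.scale (1 / 2) v1) (.pair nearE
  (.pair (.pair v1 v2) (.snd (.snd (.snd .env))))))

/-- Go down near `x` until there are `e` points, with arguments `x`, `R` and `L`. -/
def descendE (e : ℕ) : Fn :=
  .loop (descendCondE e) descendBodyE (.pair v0 (.pair v1 (.pair v2 (.nat 0))))

/-- Go down near `x` until there are `e` points, replace the nodes there by `K`, and update the levels
above, with arguments `r`, `x`, `R` and `L`. -/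
def updE (e : ℕ) (K : Fn) : Fn := .fold K (.snd (.snd (.snd (.comp (descendE e) (.snd .env)))))
  (.comp stepE (.pair v2 (.pair v3 (.pair (.fst v0) (.pair (.snd v0) (.pair v1 (.nat 0)))))))

/-- The center of the last node of a list. -/
def anchorE (d l : Fn) : Fn := .fold d l (xE v0)

/-- Forget the radius if there is only one point, with arguments `r`, `x`, `R` and `L`. -/
def resetE : Fn := .pair v0 (.pair v1 (.ifz
  (.ifz (.nle (totalE v3) (.nat 1)) (.nat 0) (.nle (.nat 1) (totalE v3)))
  (.pair v2 (.pair v3 (.nat 0)))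
  (.pair (.dist (anchorE v1 v3) v1)
    (.pair (.pair (leafE (anchorE v1 v3)) (.nat 0)) (.nat 0)))))

/-- The loop condition of `raiseE`. -/
def raiseCondE : Fn := anyE v3 (notE (dleE 3 (xE v0) v3 v4))

/-- The loop body of `raiseE`. -/
def raiseBodyE : Fn := .pair v0 (.pair v1 (.pair (.scale 2 v2) (.pair
  (.comp stepE (.pair v0 (.pair (anchorE v1 v3) (.pair (.scale 2 v2) (.pair (.nat 0)
    (.pair v3 (.nat 0))))))) (.nat 0))))

/-- Add levels at the top until all nodes are near `x`, with arguments `r`, `x`, `R` and `L`. -/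
def raiseE : Fn := .loop raiseCondE raiseBodyE .env

/-- Insert `x`, with arguments `r`, `x`, `R` and `L`. -/
def insertE : Fn := .comp (.pair v2 (.pair (updE 0 (.pair (leafE v1) (.nat 0))) (.nat 0)))
  (.comp raiseE resetE)

/-- The loop condition of `popE`. -/
def popCondE : Fn := .comp (.ifz (.nle (sumE .env (.nat 1)) (.nat 1)) (.nat 0)
  (.nle (.nat 2) (totalE .env))) (flatMapE v1 (kidsE v0))

/-- The loop body of `popE`. -/
def popBodyE : Fn := .pair (.scale (1 / 2) v0) (.pair (flatMapE v1 (kidsE v0)) (.nat 0))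

/-- Remove levels from the top while they are not necessary, with arguments `R` and `L`. -/
def popE : Fn := .loop popCondE popBodyE .env

/-- Delete `x`, with arguments `r`, `x`, `R` and `L`. -/
def deleteE : Fn := .comp popE (.pair v2 (.pair (updE 1 (.nat 0)) (.nat 0)))

/-- The largest stored radius of a list of nodes. -/
def maxgE (l : Fn) : Fn := .fold (.real 0) l (.ifz (.rle v1 (gE v0)) v1 (gE v0))

/-- The radius estimate, for the list of the top nodes. -/
def queryE : Fn := .scale 12 (maxgE .env)

/-- The node of a level that has a child with a given center. -/
def followE : Fn := .fold (.fst v1) (.snd v0)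
  (.ifz (anyE (kidsE v0) (.rle (.dist (xE v0) (.fst v5)) (.real 0))) v1 (xE v0))

/-- One pass over a level in search for a cluster center. -/
def pickBodyE (q : ℚ) : Fn := .ifz (flagE v0) v1 (.ifz (dleE q (xE v0) v2 v4) v1 (xE v0))

/-- The cluster center for a node, with arguments `y`, a default value, `R` and `L`. -/
def pickE : Fn := .pair v0 (.fold (.fold v1 v3 (pickBodyE 10)) v3 (pickBodyE 5))

/-- Processing of a level by a query. -/
def queryBodyE : Fn := .ifz (.rle (.fst v0) v2) v1
  (.comp pickE (.pair followE (.pair (.snd v1) (.pair (.fst v0) (.pair (.snd v0) (.nat 0))))))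

/-- The radius estimate and the center for `x`, with arguments `x`, `R` and `L`. -/
def queryPointE : Fn := .comp (.pair (.scale 12 v0)
    (.snd (.fold (.pair v1 v1) (.snd (.snd .env)) queryBodyE)))
  (.pair (maxgE v2) (.pair v0 (.snd (.snd (.snd (descendE 1))))))

-- Correctness and cost of the programs for updates and queries.

section Semantics

variable {X : Type*} [MetricSpace X]

/-- A radius and a list of nodes as a value. -/
def encS (s : ℝ × List (Tree X)) : Val X := .pair (.real s.1) (encL encT s.2)

/-- The levels above level `n` near `x`, the lowest one first. -/
noncomputable def stackN (x : X) (R : ℝ) (L : List (Tree X)) : ℕ → List (ℝ × List (Tree X))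
  | 0 => []
  | k + 1 => (R / 2 ^ k, nearN x k R L) :: stackN x R L k

theorem length_stackN (x : X) (R : ℝ) (L : List (Tree X)) (n : ℕ) :
    (stackN x R L n).length = n := by
  induction n with
  | zero => rfl
  | succ n ih => simp [stackN, ih]

theorem mem_stackN {x : X} {R : ℝ} {L : List (Tree X)} {n : ℕ} {s : ℝ × List (Tree X)}
    (h : s ∈ stackN x R L n) : ∃ k < n, s = (R / 2 ^ k, nearN x k R L) := by
  induction n with
  | zero => simp [stackN] at h
  | succ n ih =>
    rcases List.mem_cons.1 h with rfl | h
    · exact ⟨n, by omega, rfl⟩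
    · obtain ⟨k, hk, he⟩ := ih h
      exact ⟨k, by omega, he⟩

/-- `upd` recurses from the top, while the program folds over the stack from the bottom; unfolding
at the lower end connects the two. -/
theorem upd_succ (r : ℕ) (x : X) (n : ℕ) (R : ℝ) (L K : List (Tree X)) :
    upd r x (n + 1) R L K = upd r x n R L (step r x (R / 2 ^ n) (nearN x n R L) K) := by
  induction n generalizing R L with
  | zero => simp [upd, nearN]
  | succ n ih =>
    rw [upd, ih, upd, nearN, pow_succ', ← div_div]

theorem foldl_stackN (r : ℕ) (x : X) (n : ℕ) (R : ℝ) (L K : List (Tree X)) :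
    (stackN x R L n).foldl (fun K s => step r x s.1 s.2 K) K = upd r x n R L K := by
  induction n generalizing K with
  | zero => rfl
  | succ n ih => rw [stackN, List.foldl_cons, ih, upd_succ]

/-- Lists of nodes of bounded size. -/
def Small (M : ℕ) (L : List (Tree X)) : Prop := L.length ≤ M ∧ ∀ t ∈ L, t.ch.length ≤ M

variable {x : X} {R : ℝ} {L K : List (Tree X)} {M n r e : ℕ} {v : Val X}

theorem run_totalE {l : Fn} (hl : run l v = some (encL encT L)) :
    run (totalE l) v = some (.nat (total L)) :=
  run_sumE encT Tree.c L hl (by intro t _ acc; simp [run, encT_eq])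

theorem cost_totalE_le {l : Fn} (hl : run l v = some (encL encT L)) :
    cost (totalE l) v ≤ cost l v + L.length * 11 + 2 :=
  cost_sumE_le encT L hl (B := 6) (by simp [cost])

theorem run_descendCondE : run (descendCondE e) (.pair (.pt x) (.pair (.real R)
    (.pair (encL encT L) v))) = some (.nat (if total L = e then 0 else 1)) := by
  have h1 := run_totalE (l := v2) (v := .pair (.pt x) (.pair (.real R) (.pair (encL encT L) v)))
    (L := L) (by simp [run])
  by_cases h : total L ≤ e <;> by_cases h' : e ≤ total L
  · simp [descendCondE, run, h1, le_antisymm h h', Val.IsZero]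
  · have : total L ≠ e := by omega
    simp [descendCondE, run, h1, h, h', this, Val.IsZero]
  · have : total L ≠ e := by omega
    simp [descendCondE, run, h1, h, this, Val.IsZero]
  · omega

theorem run_descendBodyE : run descendBodyE (.pair (.pt x) (.pair (.real R)
    (.pair (encL encT L) v))) = some (.pair (.pt x) (.pair (.real (R / 2))
      (.pair (encL encT (near x R L)) (.pair (encS (R, L)) v)))) := by
  have h : ((1 / 2 : ℚ) : ℝ) * R = R / 2 := by push_cast; ring
  simp only [descendBodyE, run, run_nearE, h, encS]

/-- The states of the loop of `descendE`. -/
noncomputable def descendS (x : X) (R : ℝ) (L : List (Tree X)) (k : ℕ) : Val X :=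
  .pair (.pt x) (.pair (.real (R / 2 ^ k)) (.pair (encL encT (nearN x k R L))
    (encL encS (stackN x R L k))))

theorem run_descendBodyE_descendS (k : ℕ) :
    run descendBodyE (descendS x R L k) = some (descendS x R L (k + 1)) := by
  rw [descendS, run_descendBodyE, descendS, nearN_succ, stackN, encL_cons, pow_succ, ← div_div]

theorem run_descendE (hn : total (nearN x n R L) = e)
    (hlt : ∀ k < n, total (nearN x k R L) ≠ e) : run (descendE e) (.pair (.pt x) (.pair (.real R)
    (.pair (encL encT L) v))) = some (descendS x R L n) := by
  refine run_loop (descendS x R L) n ?_ (fun k _ => run_descendBodyE_descendS k) ?_ ?_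
  · simp [run, descendS, nearN, stackN]
  · intro k hk
    rw [descendS, run_descendCondE, if_neg (hlt k hk)]
  · rw [descendS, run_descendCondE, if_pos hn]

theorem cost_descendE_le (hn : total (nearN x n R L) = e)
    (hlt : ∀ k < n, total (nearN x k R L) ≠ e) (hM : 1 ≤ M)
    (hs : ∀ k ≤ n, Small M (nearN x k R L)) : cost (descendE e) (.pair (.pt x) (.pair (.real R)
    (.pair (encL encT L) v))) ≤ (n + 1) * (300 * M ^ 2) := by
  have h := cost_loop_le (c := descendCondE e) (b := descendBodyE)
    (i := .pair v0 (.pair v1 (.pair v2 (.nat 0))))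
    (v := .pair (.pt x) (.pair (.real R) (.pair (encL encT L) v))) (descendS x R L) n
    (by simp [run, descendS, nearN, stackN]) (fun k _ => run_descendBodyE_descendS k)
    (fun k hk => by rw [descendS, run_descendCondE, if_neg (hlt k hk)])
    (by rw [descendS, run_descendCondE, if_pos hn]) (B := 22 * M + 60 + 200 * M ^ 2)
    (by
      intro k hk
      have h1 := cost_totalE_le (l := v2) (v := descendS x R L k) (L := nearN x k R L)
        (by simp [run, descendS])
      have h2 := cost_nearE_le (x := x) (R := R / 2 ^ k) (v := encL encS (stackN x R L k)) hM
        (hs k hk).1 (hs k hk).2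
      rw [← descendS] at h2
      have h3 := (hs k hk).1
      simp only [descendCondE, descendBodyE, cost] at h1 ⊢
      omega)
  have h2 : M ≤ M ^ 2 := Nat.le_self_pow (by norm_num) M
  refine h.trans ?_
  simp only [cost]
  nlinarith

/-- The cost of the body is needed only at accumulators that are actually reached. During an update
their sizes are bounded by packing, and not by any slow growth. -/
theorem foldCost_encL_le_prefix {α β : Type*} (ea : α → Val X) (eb : β → Val X)
    {F : Val X → Val X → Option (Val X)} {G : Val X → Val X → ℕ} {B : ℕ} (f : β → α → β)
    (l : List α) (b : β) (hF : ∀ a ∈ l, ∀ b, F (ea a) (eb b) = some (eb (f b a)))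
    (hB : ∀ l₁ a l₂, l = l₁ ++ a :: l₂ → G (ea a) (eb (l₁.foldl f b)) ≤ B) :
    foldCost F G (encL ea l) (eb b) ≤ l.length * (B + 1) := by
  induction l generalizing b with
  | nil => simp [foldCost]
  | cons a l ih =>
    have ih' := ih (f b a) (fun a ha => hF a (List.mem_cons_of_mem _ ha))
      (fun l₁ a' l₂ h => hB (a :: l₁) a' l₂ (by rw [h]; rfl))
    have ha := hB [] a l rfl
    simp only [encL_cons, foldCost, List.length_cons, hF a List.mem_cons_self b, Option.elim_some]
    simp only [List.foldl_nil] at ha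
    nlinarith

theorem cost_fold_le_prefix {α β : Type*} (ea : α → Val X) (eb : β → Val X) (f : β → α → β)
    (l : List α) (b₀ : β) {i le b : Fn} {B : ℕ}
    (hi : run i v = some (eb b₀)) (hl : run le v = some (encL ea l))
    (hF : ∀ a ∈ l, ∀ y, run b (.pair (ea a) (.pair (eb y) v)) = some (eb (f y a)))
    (hB : ∀ l₁ a l₂, l = l₁ ++ a :: l₂ →
      cost b (.pair (ea a) (.pair (eb (l₁.foldl f b₀)) v)) ≤ B) :
    cost (.fold i le b) v ≤ 1 + cost i v + cost le v + l.length * (B + 1) := by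
  simp only [cost, hi, hl]
  have := foldCost_encL_le_prefix (F := fun a acc => run b (.pair a (.pair acc v))) ea eb
    (G := fun a acc => cost b (.pair a (.pair acc v))) f l b₀ hF hB
  omega

theorem run_updE {KE : Fn} (hn : total (nearN x n R L) = e)
    (hlt : ∀ k < n, total (nearN x k R L) ≠ e)
    (hK : run KE (.pair (.nat r) (.pair (.pt x) (.pair (.real R) (.pair (encL encT L) v)))) =
      some (encL encT K)) :
    run (updE e KE) (.pair (.nat r) (.pair (.pt x) (.pair (.real R) (.pair (encL encT L) v)))) =
      some (encL encT (upd r x n R L K)) := by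
  rw [← foldl_stackN]
  refine run_fold encS (encL encT) (fun K s => step r x s.1 s.2 K) _ _ hK ?_ ?_
  · simp [run, run_descendE hn hlt, descendS]
  · intro s _ K
    simp [run, encS, run_stepE]

theorem cost_updE_le {KE : Fn} (hn : total (nearN x n R L) = e)
    (hlt : ∀ k < n, total (nearN x k R L) ≠ e) (hM : 1 ≤ M)
    (hs : ∀ k ≤ n, Small M (nearN x k R L))
    (hK : run KE (.pair (.nat r) (.pair (.pt x) (.pair (.real R) (.pair (encL encT L) v)))) =
      some (encL encT K))
    (hKs : ∀ l₁ a l₂, stackN x R L n = l₁ ++ a :: l₂ →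
      (l₁.foldl (fun K s => step r x s.1 s.2 K) K).length ≤ M) :
    cost (updE e KE) (.pair (.nat r) (.pair (.pt x) (.pair (.real R) (.pair (encL encT L) v)))) ≤
      cost KE (.pair (.nat r) (.pair (.pt x) (.pair (.real R) (.pair (encL encT L) v)))) +
        (n + 1) * (6000 * M ^ 2) := by
  have h := cost_fold_le_prefix (i := KE)
    (le := .snd (.snd (.snd (.comp (descendE e) (.snd .env)))))
    (b := .comp stepE (.pair v2 (.pair v3 (.pair (.fst v0) (.pair (.snd v0)
      (.pair v1 (.nat 0))))))) (B := 5000 * M ^ 2 + 60) encS (encL encT)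
    (fun K s => step r x s.1 s.2 K) (stackN x R L n) K hK
    (by simp [run, run_descendE hn hlt, descendS])
    (by intro s _ K; simp [run, encS, run_stepE])
    (by
      intro l₁ s l₂ hl
      obtain ⟨k, hk, hse⟩ := mem_stackN (s := s) (by rw [hl]; simp)
      have hss := hs k hk.le
      have h1 := cost_stepE_le (x := x) (R := s.1) (L := s.2) (r := r) (v := .nat 0) hM
        (by rw [hse]; exact hss.1) (hKs l₁ s l₂ hl) (by rw [hse]; exact hss.2)
      simp only [cost, run, encS, Option.elim_some]
      omega)
  have h2 := cost_descendE_le (v := v) hn hlt hM hs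
  rw [length_stackN] at h
  rw [updE]
  refine h.trans ?_
  simp only [cost, run, Option.elim_some]
  have h3 : 1 ≤ M ^ 2 := Nat.one_le_pow _ _ hM
  nlinarith

/-! #### Insertions -/

/-- The center of the last node of a list, or `d`. -/
def anchor (d : X) (L : List (Tree X)) : X := L.foldl (fun _ t => t.x) d

theorem run_anchorE {d : X} {de le : Fn} (hd : run de v = some (.pt d))
    (hl : run le v = some (encL encT L)) : run (anchorE de le) v = some (.pt (anchor d L)) :=
  run_fold encT .pt (fun _ t => t.x) L d hd hl (by intro t _ y; simp [run, encT_eq])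

theorem cost_anchorE_le {d : X} {de le : Fn} (hd : run de v = some (.pt d))
    (hl : run le v = some (encL encT L)) :
    cost (anchorE de le) v ≤ 1 + cost de v + cost le v + L.length * 4 :=
  cost_fold_le encT L hd hl (B := 3) (by simp [cost])

/-- Radius and top nodes after `resetE`. -/
noncomputable def reset (x : X) (R : ℝ) (L : List (Tree X)) : ℝ × List (Tree X) :=
  if total L = 1 then (dist (anchor x L) x, [Tree.leaf (anchor x L)]) else (R, L)

/-- The arguments of an update. -/
def encA (r : ℕ) (x : X) (s : ℝ × List (Tree X)) : Val X :=
  .pair (.nat r) (.pair (.pt x) (.pair (.real s.1) (.pair (encL encT s.2) (.nat 0))))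

theorem run_resetE : run resetE (.pair (.nat r) (.pair (.pt x) (.pair (.real R)
    (.pair (encL encT L) v)))) = some (encA r x (reset x R L)) := by
  have h1 := run_totalE (l := v3) (v := .pair (.nat r) (.pair (.pt x) (.pair (.real R)
    (.pair (encL encT L) v)))) (L := L) (by simp [run])
  have h2 := run_anchorE (de := v1) (le := v3) (v := .pair (.nat r) (.pair (.pt x) (.pair (.real R)
    (.pair (encL encT L) v)))) (L := L) (d := x) (by simp [run]) (by simp [run])
  by_cases h : total L = 1
  · simp [resetE, run, h1, h2, h, reset, encA, Val.IsZero, encT_eq, Tree.leaf, Tree.x, Tree.flag,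
      Tree.bad, Tree.c, Tree.g, Tree.ch]
  · by_cases h' : total L ≤ 1
    · have : total L = 0 := by omega
      simp [resetE, run, h1, this, reset, encA, Val.IsZero]
    · simp [resetE, run, h1, h, h', reset, encA, Val.IsZero]

theorem cost_resetE_le : cost resetE (.pair (.nat r) (.pair (.pt x) (.pair (.real R)
    (.pair (encL encT L) v)))) ≤ 150 + 40 * L.length := by
  have h1 := cost_totalE_le (l := v3) (v := .pair (.nat r) (.pair (.pt x) (.pair (.real R)
    (.pair (encL encT L) v)))) (L := L) (by simp [run])
  have h2 := cost_anchorE_le (de := v1) (le := v3) (v := .pair (.nat r) (.pair (.pt x)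
    (.pair (.real R) (.pair (encL encT L) v)))) (L := L) (d := x) (by simp [run]) (by simp [run])
  simp only [resetE, cost] at h1 h2 ⊢
  omega

/-- Radius and top nodes after some steps of the loop of `raiseE`. -/
noncomputable def raiseS (r : ℕ) (x : X) (s : ℝ × List (Tree X)) : ℕ → ℝ × List (Tree X)
  | 0 => s
  | k + 1 => (2 * (raiseS r x s k).1, step r (anchor x (raiseS r x s k).2)
      (2 * (raiseS r x s k).1) [] (raiseS r x s k).2)

/-- All nodes are near `x`. -/
def AllNear (x : X) (s : ℝ × List (Tree X)) : Prop := ∀ t ∈ s.2, dist t.x x ≤ 3 * s.1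

open Classical in
theorem run_raiseCondE (s : ℝ × List (Tree X)) : run raiseCondE (encA r x s) =
    some (.nat (if AllNear x s then 0 else 1)) := by
  have h := run_anyE (le := v3) (b := notE (dleE 3 (xE v0) v3 v4)) (v := encA r x s) encT
    (fun t => !decide (dist t.x x ≤ 3 * s.1)) s.2 (by simp [run, encA])
    (by
      intro t _ acc
      exact run_notE (run_dleE (by norm_num) (by simp [run, encT_eq]) (by simp [run, encA])
        (by simp [run, encA])))
  rw [raiseCondE, h, encB]
  by_cases hn : AllNear x s
  · have : (s.2.any fun t => !decide (dist t.x x ≤ 3 * s.1)) = false := by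
      rw [List.any_eq_false]
      intro t ht
      simpa using hn t ht
    rw [this, if_pos hn]; rfl
  · have : (s.2.any fun t => !decide (dist t.x x ≤ 3 * s.1)) = true := by
      rw [AllNear] at hn
      push Not at hn
      rw [List.any_eq_true]
      obtain ⟨t, ht, h⟩ := hn
      exact ⟨t, ht, by simpa using h⟩
    rw [this, if_neg hn]; rfl

theorem cost_raiseCondE_le (s : ℝ × List (Tree X)) :
    cost raiseCondE (encA r x s) ≤ 10 + 30 * s.2.length := by
  have h := cost_anyE_le (le := v3) (b := notE (dleE 3 (xE v0) v3 v4)) (v := encA r x s) encT s.2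
    (by simp [run, encA]) (B := 24) (by simp [cost])
  rw [raiseCondE]
  simp only [cost] at h ⊢
  omega

theorem run_raiseBodyE (s : ℝ × List (Tree X)) : run raiseBodyE (encA r x s) =
    some (encA r x (2 * s.1, step r (anchor x s.2) (2 * s.1) [] s.2)) := by
  have h2 := run_anchorE (de := v1) (le := v3) (v := encA r x s) (L := s.2) (d := x)
    (by simp [run, encA]) (by simp [run, encA])
  have h3 := run_stepE (r := r) (x := anchor x s.2) (R := 2 * s.1) (L := []) (K := s.2) (v := .nat 0)
  have h4 : run v2 (encA r x s) = some (.real s.1) := by simp [run, encA]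
  have h5 : run v3 (encA r x s) = some (encL encT s.2) := by simp [run, encA]
  have h6 : run v0 (encA r x s) = some (.nat r) := by simp [run, encA]
  have h7 : run v1 (encA r x s) = some (.pt x) := by simp [run, encA]
  have h8 : run (.scale 2 v2) (encA r x s) = some (.real (2 * s.1)) := by simp [run, encA]
  have h9 : run (.comp stepE (.pair v0 (.pair (anchorE v1 v3) (.pair (.scale 2 v2) (.pair (.nat 0)
    (.pair v3 (.nat 0))))))) (encA r x s) =
      some (encL encT (step r (anchor x s.2) (2 * s.1) [] s.2)) := by
    rw [← h3]
    rw [run]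
    simp only [run] at h2 h4 h5 h6 h7 h8 ⊢
    simp only [h2, h4, h5, h6]
    simp
  have hpair : ∀ {a b : Fn} {w y z : Val X}, run a w = some y → run b w = some z →
      run (.pair a b) w = some (.pair y z) := by
    intro a b w y z h h'
    simp only [run, h, h']
  exact hpair h6 (hpair h7 (hpair h8 (hpair h9 (by simp [run]))))

theorem cost_raiseBodyE_le (hM : 1 ≤ M) (s : ℝ × List (Tree X)) (hs : s.2.length ≤ M) :
    cost raiseBodyE (encA r x s) ≤ 6000 * M ^ 2 := by
  have h2 := run_anchorE (de := v1) (le := v3) (v := encA r x s) (L := s.2) (d := x)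
    (by simp [run, encA]) (by simp [run, encA])
  have h2' := cost_anchorE_le (de := v1) (le := v3) (v := encA r x s) (L := s.2) (d := x)
    (by simp [run, encA]) (by simp [run, encA])
  have h3 := cost_stepE_le (r := r) (x := anchor x s.2) (R := 2 * s.1) (L := []) (K := s.2)
    (v := .nat 0) hM (by simp) hs (by simp)
  have h4 : run (.pair v0 (.pair (anchorE v1 v3) (.pair (.scale 2 v2) (.pair (.nat 0)
    (.pair v3 (.nat 0)))))) (encA r x s) = some (.pair (.nat r) (.pair (.pt (anchor x s.2))
      (.pair (.real (2 * s.1)) (.pair (encL encT ([] : List (Tree X)))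
        (.pair (encL encT s.2) (.nat 0)))))) := by
    simp only [encA] at h2 ⊢
    simp only [run] at h2 ⊢
    simp only [h2]
    simp
  have h5 : M ≤ M ^ 2 := Nat.le_self_pow (by norm_num) M
  have h6 : cost raiseBodyE (encA r x s) = cost (.comp stepE (.pair v0 (.pair (anchorE v1 v3)
      (.pair (.scale 2 v2) (.pair (.nat 0) (.pair v3 (.nat 0))))))) (encA r x s) + 15 := by
    simp only [raiseBodyE, cost]
    omega
  rw [h6, cost, h4, Option.elim_some]
  simp only [cost] at h2' ⊢
  omega

theorem run_raiseE (s : ℝ × List (Tree X)) (hn : AllNear x (raiseS r x s n))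
    (hlt : ∀ k < n, ¬ AllNear x (raiseS r x s k)) :
    run raiseE (encA r x s) = some (encA r x (raiseS r x s n)) := by
  refine run_loop (fun k => encA r x (raiseS r x s k)) n (by simp [run, raiseS])
    (fun k _ => run_raiseBodyE _) ?_ ?_
  · intro k hk
    rw [run_raiseCondE, if_neg (hlt k hk)]
  · rw [run_raiseCondE, if_pos hn]

theorem cost_raiseE_le (s : ℝ × List (Tree X)) (hn : AllNear x (raiseS r x s n))
    (hlt : ∀ k < n, ¬ AllNear x (raiseS r x s k)) (hM : 1 ≤ M)
    (hs : ∀ k ≤ n, (raiseS r x s k).2.length ≤ M) :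
    cost raiseE (encA r x s) ≤ (n + 1) * (6100 * M ^ 2) := by
  have h := cost_loop_le (c := raiseCondE) (b := raiseBodyE) (i := .env) (v := encA r x s)
    (fun k => encA r x (raiseS r x s k)) n (by simp [run, raiseS])
    (fun k _ => run_raiseBodyE _) (fun k hk => by rw [run_raiseCondE, if_neg (hlt k hk)])
    (by rw [run_raiseCondE, if_pos hn]) (B := 10 + 30 * M + 6000 * M ^ 2) (by
      intro k hk
      have h1 := cost_raiseCondE_le (r := r) (x := x) (raiseS r x s k)
      have h2 := cost_raiseBodyE_le (r := r) (x := x) hM (raiseS r x s k) (hs k hk)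
      have h3 := hs k hk
      omega)
  have h2 : M ≤ M ^ 2 := Nat.le_self_pow (by norm_num) M
  refine h.trans ?_
  simp only [cost]
  nlinarith

/-- The new radius and top nodes as a value. -/
def encO (s : ℝ × List (Tree X)) : Val X :=
  .pair (.real s.1) (.pair (encL encT s.2) (.nat 0))

/-- What is known about the loops of an insertion. -/
structure InsertRun (r : ℕ) (x : X) (R : ℝ) (L : List (Tree X)) (m n : ℕ)
    (s : ℝ × List (Tree X)) : Prop where
  eq : s = raiseS r x (reset x R L) m
  near : AllNear x s
  lt : ∀ k < m, ¬ AllNear x (raiseS r x (reset x R L) k)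
  total : total (nearN x n s.1 s.2) = 0
  total_lt : ∀ k < n, RGather.total (nearN x k s.1 s.2) ≠ 0

theorem run_insertE {m n : ℕ} {s : ℝ × List (Tree X)} (h : InsertRun r x R L m n s) :
    run insertE (.pair (.nat r) (.pair (.pt x) (.pair (.real R) (.pair (encL encT L) v)))) =
      some (encO (s.1, upd r x n s.1 s.2 [Tree.leaf x])) := by
  have h1 := run_raiseE (reset x R L) (by rw [← h.eq]; exact h.near) h.lt
  rw [← h.eq] at h1
  have h2 := run_updE (KE := .pair (leafE v1) (.nat 0)) (r := r) (v := .nat 0)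
    (K := [Tree.leaf x]) h.total h.total_lt (by
      simp [run, encT_eq, Tree.leaf, Tree.x, Tree.flag, Tree.bad, Tree.c, Tree.g, Tree.ch])
  rw [insertE, run, run, run_resetE, Option.bind_some, h1, Option.bind_some, encA]
  simp only [run, h2]
  rfl

theorem cost_insertE_le {m n : ℕ} {s : ℝ × List (Tree X)} (h : InsertRun r x R L m n s)
    (hM : 1 ≤ M) (hL : L.length ≤ M)
    (hr : ∀ k ≤ m, (raiseS r x (reset x R L) k).2.length ≤ M)
    (hs : ∀ k ≤ n, Small M (nearN x k s.1 s.2))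
    (hKs : ∀ l₁ a l₂, stackN x s.1 s.2 n = l₁ ++ a :: l₂ →
      (l₁.foldl (fun K s => step r x s.1 s.2 K) [Tree.leaf x]).length ≤ M) :
    cost insertE (.pair (.nat r) (.pair (.pt x) (.pair (.real R) (.pair (encL encT L) v)))) ≤
      (m + n + 2) * (7000 * M ^ 2) := by
  have h1 := run_raiseE (reset x R L) (by rw [← h.eq]; exact h.near) h.lt
  have c1 := cost_raiseE_le (reset x R L) (by rw [← h.eq]; exact h.near) h.lt hM hr
  rw [← h.eq] at h1
  have c2 := cost_updE_le (KE := .pair (leafE v1) (.nat 0)) (r := r) (v := .nat 0)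
    (K := [Tree.leaf x]) h.total h.total_lt hM hs (by
      simp [run, encT_eq, Tree.leaf, Tree.x, Tree.flag, Tree.bad, Tree.c, Tree.g, Tree.ch]) hKs
  have c3 := cost_resetE_le (r := r) (x := x) (R := R) (L := L) (v := v)
  have c4 : cost (.pair (leafE v1) (.nat 0)) (.pair (.nat r) (.pair (.pt x) (.pair (.real s.1)
    (.pair (encL encT s.2) (.nat 0))))) = 15 := by simp [cost]
  rw [c4] at c2
  change cost _ (encA r x s) ≤ _ at c2
  rw [insertE, cost, cost, run, run_resetE, Option.bind_some, h1, Option.elim_some,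
    Option.elim_some]
  simp only [cost]
  have h5 : M ≤ M ^ 2 := Nat.le_self_pow (by norm_num) M
  nlinarith

/-! #### Deletions -/

/-- Radius and top nodes after some steps of the loop of `popE`. -/
noncomputable def popS (s : ℝ × List (Tree X)) : ℕ → ℝ × List (Tree X)
  | 0 => s
  | k + 1 => ((popS s k).1 / 2, (popS s k).2.flatMap Tree.kids)

/-- The top level is not necessary. -/
def Superfluous (s : ℝ × List (Tree X)) : Prop :=
  -- The second condition stops the loop at sets with one point, for which every level is a single
  -- node.
  (s.2.flatMap Tree.kids).length ≤ 1 ∧ 2 ≤ total (s.2.flatMap Tree.kids)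

omit [MetricSpace X] in
theorem length_eq_sum (l : List (Tree X)) : (l.map fun _ => 1).sum = l.length := by simp

theorem run_flatMap_kids (s : ℝ × List (Tree X)) : run (flatMapE v1 (kidsE v0)) (encO s) =
    some (encL encT (s.2.flatMap Tree.kids)) :=
  run_flatMapE encT encT Tree.kids s.2 (by simp [run, encO]) fun t _ acc =>
      run_kidsE (by simp [run])

theorem cost_flatMap_kids_le (hM : 1 ≤ M) {s : ℝ × List (Tree X)} (hs : Small M s.2) :
    cost (flatMapE v1 (kidsE v0)) (encO s) ≤ 70 * M ^ 2 := by
  have h1 := cost_flatMapE_le (le := v1) (b := kidsE v0) (M := M) (v := encO s) encT encT Tree.kids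
    s.2 (by simp [run, encO])
    (fun t _ acc => run_kidsE (e := v0) (by simp [run])) (B := 35) (by simp [cost])
    (fun t ht => length_kids_le hM (hs.2 t ht))
  have h2 := hs.1
  have h3 : s.2.length * (35 + 14 * M + 5) ≤ M * (35 + 14 * M + 5) := Nat.mul_le_mul_right _ h2
  have h4 : cost v1 (encO s) = 3 := rfl
  rw [h4] at h1
  have h5 : M ≤ M ^ 2 := Nat.le_self_pow (by norm_num) M
  nlinarith

open Classical in
theorem run_popCondE (s : ℝ × List (Tree X)) : run popCondE (encO s) =
    some (.nat (if Superfluous s then 1 else 0)) := by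
  have h1 := run_sumE (le := .env) (b := .nat 1) (v := encL encT (s.2.flatMap Tree.kids)) encT
    (fun _ => 1) (s.2.flatMap Tree.kids) (by simp [run]) (by simp [run])
  have h2 := run_totalE (l := .env) (v := encL encT (s.2.flatMap Tree.kids))
    (L := s.2.flatMap Tree.kids) (by simp [run])
  rw [length_eq_sum] at h1
  rw [popCondE, run, run_flatMap_kids, Option.bind_some]
  by_cases h : (s.2.flatMap Tree.kids).length ≤ 1 <;>
    by_cases h' : 2 ≤ total (s.2.flatMap Tree.kids) <;>
    simp only [run, h1, h2, Superfluous, h, h', Val.IsZero] <;> simp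

theorem cost_popCondE_le (hM : 1 ≤ M) {s : ℝ × List (Tree X)} (hs : Small M s.2) :
    cost popCondE (encO s) ≤ 110 * M ^ 2 := by
  have h0 := cost_flatMap_kids_le hM hs
  have h1 := cost_sumE_le (le := .env) (b := .nat 1) (v := encL encT (s.2.flatMap Tree.kids)) encT
    (s.2.flatMap Tree.kids) (by simp [run]) (B := 1) (by simp [cost])
  have h2 := cost_totalE_le (l := .env) (v := encL encT (s.2.flatMap Tree.kids))
    (L := s.2.flatMap Tree.kids) (by simp [run])
  have h3 : (s.2.flatMap Tree.kids).length ≤ M ^ 2 := by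
    rw [pow_two]
    exact (length_flatMap_kids_le hM hs.2).trans (Nat.mul_le_mul_right _ hs.1)
  rw [popCondE, cost, run_flatMap_kids, Option.elim_some]
  simp only [cost] at h1 h2 ⊢
  have h5 : 1 ≤ M ^ 2 := Nat.one_le_pow _ _ hM
  omega

theorem run_popBodyE (s : ℝ × List (Tree X)) : run popBodyE (encO s) =
    some (encO (s.1 / 2, s.2.flatMap Tree.kids)) := by
  have h : ((1 / 2 : ℚ) : ℝ) * s.1 = s.1 / 2 := by push_cast; ring
  have h1 : run (.scale (1 / 2) v0) (encO s) = some (.real (s.1 / 2)) := by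
    rw [← h]; simp [run, encO]
  rw [popBodyE, run, run, run_flatMap_kids, h1]
  simp only [run]
  rfl

theorem run_popE (s : ℝ × List (Tree X)) (hn : ¬ Superfluous (popS s n))
    (hlt : ∀ k < n, Superfluous (popS s k)) : run popE (encO s) = some (encO (popS s n)) := by
  refine run_loop (fun k => encO (popS s k)) n (by simp [run, popS])
    (fun k _ => run_popBodyE _) ?_ ?_
  · intro k hk
    rw [run_popCondE, if_pos (hlt k hk)]
  · rw [run_popCondE, if_neg hn]

theorem cost_popE_le (s : ℝ × List (Tree X)) (hn : ¬ Superfluous (popS s n))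
    (hlt : ∀ k < n, Superfluous (popS s k)) (hM : 1 ≤ M) (hs : ∀ k ≤ n, Small M (popS s k).2) :
    cost popE (encO s) ≤ (n + 1) * (200 * M ^ 2) := by
  have h := cost_loop_le (c := popCondE) (b := popBodyE) (i := .env) (v := encO s)
    (fun k => encO (popS s k)) n (by simp [run, popS])
    (fun k _ => run_popBodyE _) (fun k hk => by rw [run_popCondE, if_pos (hlt k hk)])
    (by rw [run_popCondE, if_neg hn]) (B := 180 * M ^ 2 + 10) (by
      intro k hk
      have h1 := cost_popCondE_le hM (hs k hk)
      have h2 := cost_flatMap_kids_le hM (hs k hk)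
      simp only [popBodyE, cost] at h2 ⊢
      omega)
  have h2 : 1 ≤ M ^ 2 := Nat.one_le_pow _ _ hM
  refine h.trans ?_
  simp only [cost]
  nlinarith

/-- What is known about the loops of a deletion. -/
structure DeleteRun (r : ℕ) (x : X) (R : ℝ) (L : List (Tree X)) (m n : ℕ) : Prop where
  total : total (nearN x n R L) = 1
  total_lt : ∀ k < n, RGather.total (nearN x k R L) ≠ 1
  stops : ¬ Superfluous (popS (R, upd r x n R L []) m)
  lt : ∀ k < m, Superfluous (popS (R, upd r x n R L []) k)

theorem run_deleteE_aux (h : total (nearN x n R L) = 1)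
    (hlt : ∀ k < n, total (nearN x k R L) ≠ 1) :
    run (.pair v2 (.pair (updE 1 (.nat 0)) (.nat 0))) (.pair (.nat r) (.pair (.pt x)
      (.pair (.real R) (.pair (encL encT L) v)))) = some (encO (R, upd r x n R L [])) := by
  have h2 := run_updE (KE := .nat 0) (r := r) (v := v) (K := []) h hlt (by simp [run])
  simp only [run, h2]
  rfl

theorem run_deleteE {m n : ℕ} (h : DeleteRun r x R L m n) :
    run deleteE (.pair (.nat r) (.pair (.pt x) (.pair (.real R) (.pair (encL encT L) v)))) =
      some (encO (popS (R, upd r x n R L []) m)) := by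
  rw [deleteE, run, run_deleteE_aux h.total h.total_lt, Option.bind_some]
  exact run_popE _ h.stops h.lt

theorem cost_deleteE_le {m n : ℕ} (h : DeleteRun r x R L m n) (hM : 1 ≤ M)
    (hs : ∀ k ≤ n, Small M (nearN x k R L))
    (hKs : ∀ l₁ a l₂, stackN x R L n = l₁ ++ a :: l₂ →
      (l₁.foldl (fun K s => step r x s.1 s.2 K) []).length ≤ M)
    (hp : ∀ k ≤ m, Small M (popS (R, upd r x n R L []) k).2) :
    cost deleteE (.pair (.nat r) (.pair (.pt x) (.pair (.real R) (.pair (encL encT L) v)))) ≤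
      (m + n + 2) * (7000 * M ^ 2) := by
  have c2 := cost_updE_le (KE := .nat 0) (r := r) (v := v)
    (K := []) h.total h.total_lt hM hs (by simp [run]) hKs
  have c3 := cost_popE_le _ h.stops h.lt hM hp
  rw [deleteE, cost, run_deleteE_aux h.total h.total_lt, Option.elim_some]
  simp only [cost] at c2 ⊢
  have h5 : 1 ≤ M ^ 2 := Nat.one_le_pow _ _ hM
  nlinarith

/-! #### Queries -/

/-- The largest stored radius. -/
noncomputable def maxg (L : List (Tree X)) : ℝ := L.foldl (fun m k => max m k.g) 0

theorem run_maxgE {l : Fn} (hl : run l v = some (encL encT L)) :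
    run (maxgE l) v = some (.real (maxg L)) := by
  refine run_fold encT .real (fun m k => max m k.g) L 0 (by simp [run]) hl ?_
  intro k _ m
  refine run_ifz (b := decide (m ≤ k.g))
    (run_rle (by simp [run]) (by simp [run, encT_eq])) ?_ ?_
  · intro h
    rw [decide_eq_false_iff_not, not_le] at h
    simp [run, max_eq_left h.le]
  · intro h
    rw [decide_eq_true_iff] at h
    simp [run, encT_eq, max_eq_right h]

theorem cost_maxgE_le {l : Fn} (hl : run l v = some (encL encT L)) :
    cost (maxgE l) v ≤ 2 + cost l v + 30 * L.length := by
  have := cost_fold_le (i := .real 0) (b := .ifz (.rle v1 (gE v0)) v1 (gE v0)) (v := v)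
    encT L (x := .real 0) (by simp [run]) hl (B := 25) (by simp [cost])
  rw [maxgE]
  simp only [cost] at this ⊢
  omega

theorem run_queryE : run queryE (encL encT L) = some (.real (12 * maxg L)) := by
  have := run_maxgE (l := .env) (v := encL encT L) (L := L) (by simp [run])
  simp [queryE, run, this]

theorem cost_queryE_le : cost queryE (encL encT L) ≤ 10 + 30 * L.length := by
  have := cost_maxgE_le (l := .env) (v := encL encT L) (L := L) (by simp [run])
  simp only [queryE, cost] at this ⊢
  omega

/-- The center of a node of a list that has a child with center `y`. -/
noncomputable def follow (y : X) (L : List (Tree X)) : X :=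
  L.foldl (fun a u => if u.kids.any fun k => decide (dist k.x y ≤ 0) then u.x else a) y

/-- The last cluster center with distance at most `ρ` of `y`. -/
noncomputable def pick (ρ : ℝ) (y d : X) (L : List (Tree X)) : X :=
  L.foldl (fun a u => if u.flag && decide (dist u.x y ≤ ρ) then u.x else a) d

/-- Processing of a level by a query. -/
noncomputable def queryStep (G : ℝ) (a : X × X) (s : ℝ × List (Tree X)) : X × X :=
  -- Levels are processed upwards and each overwrites the previous choice, so the highest level with
  -- radius at most `G` decides. On a level, the pass with `5` overrides the pass with `10`.
  if s.1 ≤ G then (follow a.1 s.2, pick (5 * s.1) (follow a.1 s.2)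
    (pick (10 * s.1) (follow a.1 s.2) a.2 s.2) s.2) else a

/-- The value for a pair of points. -/
def encP (a : X × X) : Val X := .pair (.pt a.1) (.pt a.2)

theorem run_followE (s : ℝ × List (Tree X)) (a : X × X) :
    run followE (.pair (encS s) (.pair (encP a) v)) = some (.pt (follow a.1 s.2)) := by
  refine run_fold encT .pt _ s.2 a.1 (by simp [run, encP]) (by simp [run, encS]) ?_
  intro u _ b
  have h := run_anyE (le := kidsE v0) (b := .rle (.dist (xE v0) (.fst v5)) (.real 0))
    (v := .pair (encT u) (.pair (.pt b) (.pair (encS s) (.pair (encP a) v)))) encT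
    (fun k => decide (dist k.x a.1 ≤ 0)) u.kids (run_kidsE (by simp [run])) (by
      intro k _ acc
      exact run_rle (by simp [run, encT_eq, encP]) (by simp [run]))
  refine run_ifz h ?_ ?_
  · intro h; simp [run, h]
  · intro h; simp [run, h, encT_eq]

theorem cost_followE_le (hM : 1 ≤ M) (s : ℝ × List (Tree X)) (hs : Small M s.2) (a : X × X) :
    cost followE (.pair (encS s) (.pair (encP a) v)) ≤ 100 * M ^ 2 := by
  have h := cost_fold_le (i := .fst v1) (le := .snd v0)
    (b := .ifz (anyE (kidsE v0) (.rle (.dist (xE v0) (.fst v5)) (.real 0))) v1 (xE v0))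
    (v := .pair (encS s) (.pair (encP a) v)) (x := .pt a.1) encT s.2 (by simp [run, encP])
    (by simp [run, encS]) (B := 50 + 30 * M) (by
      intro u hu acc
      have h := cost_anyE_le (le := kidsE v0) (b := .rle (.dist (xE v0) (.fst v5)) (.real 0))
        (v := .pair (encT u) (.pair acc (.pair (encS s) (.pair (encP a) v)))) encT u.kids
        (run_kidsE (by simp [run])) (B := 24) (by simp [cost])
      have h2 := length_kids_le hM (hs.2 u hu)
      simp only [cost] at h ⊢
      omega)
  have h1 := hs.1
  rw [followE]
  simp only [cost] at h ⊢
  have h3 := Nat.mul_le_mul_right (50 + 30 * M + 1) h1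
  nlinarith

theorem run_pickBodyE {q : ℚ} {ρ c : ℝ} (hq : (q : ℝ) = c) {y a z : X} {u : Tree X} :
    run (pickBodyE q) (.pair (encT u) (.pair (.pt a) (.pair (.pt y) (.pair (.pt z)
      (.pair (.real ρ) v))))) =
      some (.pt (if u.flag && decide (dist u.x y ≤ c * ρ) then u.x else a)) := by
  refine run_ifz (b := u.flag) (by simp [run, encT_eq, encB]) ?_ ?_
  · intro h; simp [run, h]
  · intro h
    refine run_ifz (b := decide (dist u.x y ≤ c * ρ))
      (run_dleE hq (by simp [run, encT_eq]) (by simp [run]) (by simp [run])) ?_ ?_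
    · intro h'; simp only [decide_eq_false_iff_not] at h'; simp [run, h']
    · intro h'; simp only [decide_eq_true_eq] at h'; simp [run, h, h', encT_eq]

theorem run_pickE_aux {ρ : ℝ} {y d : X} :
    run (.fold v1 v3 (pickBodyE 10)) (.pair (.pt y) (.pair (.pt d) (.pair (.real ρ)
      (.pair (encL encT L) v)))) = some (.pt (pick (10 * ρ) y d L)) :=
  run_fold encT .pt _ L d (by simp [run]) (by simp [run]) fun _ _ _ =>
    run_pickBodyE (by norm_num)

theorem run_pickE {ρ : ℝ} {y d : X} :
    run pickE (.pair (.pt y) (.pair (.pt d) (.pair (.real ρ) (.pair (encL encT L) v)))) =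
      some (encP (y, pick (5 * ρ) y (pick (10 * ρ) y d L) L)) := by
  have h := run_fold (i := .fold v1 v3 (pickBodyE 10)) (le := v3) (b := pickBodyE 5)
    (v := .pair (.pt y) (.pair (.pt d) (.pair (.real ρ) (.pair (encL encT L) v)))) encT .pt
    (fun a u => if u.flag && decide (dist u.x y ≤ 5 * ρ) then u.x else a) L
    (pick (10 * ρ) y d L) run_pickE_aux (by simp [run]) fun _ _ _ => run_pickBodyE (by norm_num)
  rw [pickE, run, h]
  simp only [run]
  rfl

theorem cost_pickE_le {ρ : ℝ} {y d : X} :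
    cost pickE (.pair (.pt y) (.pair (.pt d) (.pair (.real ρ) (.pair (encL encT L) v)))) ≤
      30 + 100 * L.length := by
  have h1 := cost_fold_le (i := v1) (le := v3) (b := pickBodyE 10)
    (v := .pair (.pt y) (.pair (.pt d) (.pair (.real ρ) (.pair (encL encT L) v)))) (x := .pt d)
    encT L (by simp [run]) (by simp [run]) (B := 35) (by simp [pickBodyE, cost])
  have h2 := cost_fold_le (i := .fold v1 v3 (pickBodyE 10)) (le := v3) (b := pickBodyE 5)
    (v := .pair (.pt y) (.pair (.pt d) (.pair (.real ρ) (.pair (encL encT L) v))))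
    encT L run_pickE_aux (by simp [run]) (B := 35) (by simp [pickBodyE, cost])
  rw [pickE, cost]
  simp only [cost] at h1 h2 ⊢
  omega

theorem run_queryBodyE_comp (s : ℝ × List (Tree X)) (a : X × X) :
    run (.pair followE (.pair (.snd v1) (.pair (.fst v0) (.pair (.snd v0) (.nat 0)))))
      (.pair (encS s) (.pair (encP a) v)) = some (.pair (.pt (follow a.1 s.2))
        (.pair (.pt a.2) (.pair (.real s.1) (.pair (encL encT s.2) (.nat 0))))) := by
  have h1 := run_followE s a (v := v)
  simp only [run, h1]
  simp [encS, encP]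

theorem run_queryBodyE {G : ℝ} (s : ℝ × List (Tree X)) (a : X × X) :
    run queryBodyE (.pair (encS s) (.pair (encP a) (.pair (.real G) v))) =
      some (encP (queryStep G a s)) := by
  refine run_ifz (run_rle (y := s.1) (z := G) (by simp [run, encS]) (by simp [run])) ?_ ?_
  · intro h
    simp only [decide_eq_false_iff_not] at h
    simp [run, queryStep, h]
  · intro h
    simp only [decide_eq_true_eq] at h
    rw [run, run_queryBodyE_comp, Option.bind_some, run_pickE, queryStep, if_pos h]

theorem cost_queryBodyE_le (hM : 1 ≤ M) {G : ℝ} (s : ℝ × List (Tree X)) (hs : Small M s.2)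
    (a : X × X) : cost queryBodyE (.pair (encS s) (.pair (encP a) (.pair (.real G) v))) ≤
      300 * M ^ 2 := by
  have h1 := cost_followE_le hM s hs a (v := .pair (.real G) v)
  have h2 := cost_pickE_le (ρ := s.1) (y := follow a.1 s.2) (d := a.2) (L := s.2) (v := .nat 0)
  have h3 := hs.1
  have h5 : M ≤ M ^ 2 := Nat.le_self_pow (by norm_num) M
  have hc := congrArg (fun o : Option (Val X) => o.elim 0 (cost pickE))
    (run_queryBodyE_comp s a (v := .pair (.real G) v))
  simp only [Option.elim_some] at hc
  rw [queryBodyE]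
  simp only [cost] at h1 hc ⊢
  rw [hc]
  omega

/-- The center of the cluster of `x`, where `n` levels are inspected. -/
noncomputable def answer (x : X) (R : ℝ) (L : List (Tree X)) (n : ℕ) : X :=
  ((stackN x R L n).foldl (queryStep (maxg L)) (x, x)).2

theorem run_queryPointE_aux (hn : total (nearN x n R L) = 1)
    (hlt : ∀ k < n, total (nearN x k R L) ≠ 1) :
    run (.pair (maxgE v2) (.pair v0 (.snd (.snd (.snd (descendE 1))))))
      (.pair (.pt x) (.pair (.real R) (.pair (encL encT L) v))) =
      some (.pair (.real (maxg L)) (.pair (.pt x) (encL encS (stackN x R L n)))) := by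
  have h1 := run_maxgE (l := v2) (v := .pair (.pt x) (.pair (.real R) (.pair (encL encT L) v)))
    (L := L) (by simp [run])
  have h2 := run_descendE (v := v) hn hlt
  simp only [run, h1, h2, descendS]

theorem run_queryPointE (hn : total (nearN x n R L) = 1)
    (hlt : ∀ k < n, total (nearN x k R L) ≠ 1) :
    run queryPointE (.pair (.pt x) (.pair (.real R) (.pair (encL encT L) v))) =
      some (.pair (.real (12 * maxg L)) (.pt (answer x R L n))) := by
  have h := run_fold (i := .pair v1 v1) (le := .snd (.snd .env)) (b := queryBodyE)
    (v := .pair (.real (maxg L)) (.pair (.pt x) (encL encS (stackN x R L n)))) encS encP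
    (queryStep (maxg L)) (stackN x R L n) (x, x) (by simp [run, encP]) (by simp [run])
    (by intro s _ a; exact run_queryBodyE s a)
  rw [queryPointE, run, run_queryPointE_aux hn hlt, Option.bind_some, run, run, h]
  simp [run, encP, answer]

theorem cost_queryPointE_le (hn : total (nearN x n R L) = 1)
    (hlt : ∀ k < n, total (nearN x k R L) ≠ 1) (hM : 1 ≤ M)
    (hs : ∀ k ≤ n, Small M (nearN x k R L)) :
    cost queryPointE (.pair (.pt x) (.pair (.real R) (.pair (encL encT L) v))) ≤
      (n + 1) * (1000 * M ^ 2) := by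
  have h := cost_fold_le_prefix (i := .pair v1 v1) (le := .snd (.snd .env)) (b := queryBodyE)
    (v := .pair (.real (maxg L)) (.pair (.pt x) (encL encS (stackN x R L n)))) encS encP
    (queryStep (maxg L)) (stackN x R L n) (x, x) (by simp [run, encP]) (by simp [run])
    (by intro s _ a; exact run_queryBodyE s a) (B := 300 * M ^ 2) (by
      intro l₁ s l₂ hl
      obtain ⟨k, hk, hse⟩ := mem_stackN (s := s) (by rw [hl]; simp)
      exact cost_queryBodyE_le hM s (by rw [hse]; exact hs k hk.le) _)
  have h1 := cost_descendE_le (v := v) hn hlt hM hs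
  have h2 := cost_maxgE_le (l := v2) (v := .pair (.pt x) (.pair (.real R) (.pair (encL encT L) v)))
    (L := L) (by simp [run])
  have h3 : L.length ≤ M := (hs 0 (by omega)).1
  have h5 : M ≤ M ^ 2 := Nat.le_self_pow (by norm_num) M
  rw [length_stackN] at h
  rw [queryPointE, cost, run_queryPointE_aux hn hlt, Option.elim_some]
  simp only [cost] at h h2 ⊢
  nlinarith

end Semantics

/-! ### Packing -/

section Packing

variable {X : Type*} [MetricSpace X] {d : ℝ}

/-- The halving property is applied `k` times, to each of the sets found so far. -/
theorem DoublingDimLE.cover (hX : DoublingDimLE X d) (k : ℕ) {R : ℝ} (hR : 0 < R) {S : Set X}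
    (hS : ∀ x ∈ S, ∀ y ∈ S, dist x y ≤ R) :
    ∃ F : Finset (Set X), (F.card : ℝ) ≤ ((2 : ℝ) ^ d) ^ k ∧ ⋃₀ (F : Set (Set X)) = S ∧
      ∀ T ∈ F, ∀ x ∈ T, ∀ y ∈ T, dist x y ≤ R / 2 ^ k := by
  classical
  induction k with
  | zero => exact ⟨{S}, by simp, by simp, by simpa using hS⟩
  | succ k ih =>
    obtain ⟨F, h1, h2, h3⟩ := ih
    have h4 : ∀ T : Set X, ∃ G : Finset (Set X), T ∈ F → (G.card : ℝ) ≤ (2 : ℝ) ^ d ∧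
        ⋃₀ (G : Set (Set X)) = T ∧ ∀ U ∈ G, ∀ x ∈ U, ∀ y ∈ U, dist x y ≤ R / 2 ^ k / 2 := by
      intro T
      by_cases hT : T ∈ F
      · obtain ⟨G, hG⟩ := hX (R / 2 ^ k) (by positivity) T (h3 T hT)
        exact ⟨G, fun _ => hG⟩
      · exact ⟨∅, fun h => absurd h hT⟩
    choose G hG using h4
    refine ⟨F.biUnion G, ?_, ?_, ?_⟩
    · calc ((F.biUnion G).card : ℝ) ≤ ((∑ T ∈ F, (G T).card : ℕ) : ℝ) := by
            exact_mod_cast Finset.card_biUnion_le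
        _ = ∑ T ∈ F, ((G T).card : ℝ) := by push_cast; rfl
        _ ≤ ∑ T ∈ F, (2 : ℝ) ^ d := Finset.sum_le_sum fun T hT => (hG T hT).1
        _ = F.card * (2 : ℝ) ^ d := by rw [Finset.sum_const, nsmul_eq_mul]
        _ ≤ ((2 : ℝ) ^ d) ^ (k + 1) := by
            rw [pow_succ]
            exact mul_le_mul_of_nonneg_right h1 (by positivity)
    · rw [← h2]
      ext x
      simp only [Set.mem_sUnion, Finset.mem_coe, Finset.mem_biUnion]
      constructor
      · rintro ⟨U, ⟨T, hT, hU⟩, hx⟩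
        refine ⟨T, hT, ?_⟩
        rw [← (hG T hT).2.1]
        exact ⟨U, hU, hx⟩
      · rintro ⟨T, hT, hx⟩
        rw [← (hG T hT).2.1] at hx
        obtain ⟨U, hU, hx⟩ := hx
        exact ⟨U, ⟨T, hT, hU⟩, hx⟩
    · intro U hU
      obtain ⟨T, hT, hU⟩ := Finset.mem_biUnion.1 hU
      have := (hG T hT).2.2 U hU
      rwa [pow_succ, ← div_div]

/-- A bound for the number of nodes of a level that are near a point. -/
noncomputable def packing (d : ℝ) : ℕ := ⌊((2 : ℝ) ^ d) ^ 6⌋₊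

theorem one_le_packing (hd : 0 ≤ d) : 1 ≤ packing d :=
  Nat.le_floor (by
    rw [Nat.cast_one]
    exact one_le_pow₀ (Real.one_le_rpow (by norm_num) hd))

theorem packing_le (d : ℝ) : (packing d : ℝ) ≤ ((2 : ℝ) ^ d) ^ 6 := Nat.floor_le (by positivity)

/-- Six halvings turn the diameter `64 * ρ` into `ρ`, and a set of diameter `ρ` contains at most one
of the centers. -/
theorem length_le_packing (hX : DoublingDimLE X d) {ρ : ℝ} (hρ : 0 < ρ) {L : List (Tree X)}
    (hsep : L.Pairwise fun t u => ρ < dist t.x u.x)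
    (hL : ∀ t ∈ L, ∀ u ∈ L, dist t.x u.x ≤ 64 * ρ) : L.length ≤ packing d := by
  classical
  obtain ⟨F, h1, h2, h3⟩ := hX.cover 6 (R := 64 * ρ) (by positivity)
    (S := {x | ∃ t ∈ L, t.x = x}) (by
      rintro x ⟨t, ht, rfl⟩ y ⟨u, hu, rfl⟩
      exact hL t ht u hu)
  have h4 : 64 * ρ / 2 ^ 6 = ρ := by norm_num
  rw [h4] at h3
  have hsep' : (L.map Tree.x).Pairwise fun x y => ρ < dist x y := List.pairwise_map.2 hsep
  have hnd : (L.map Tree.x).Nodup := hsep'.imp fun {x y} h hxy => by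
    rw [hxy, dist_self] at h
    linarith
  have h5 : ∀ x : X, ∃ T : Set X, x ∈ L.map Tree.x → T ∈ F ∧ x ∈ T := by
    intro x
    by_cases hx : x ∈ L.map Tree.x
    · obtain ⟨t, ht, rfl⟩ := List.mem_map.1 hx
      have : t.x ∈ ⋃₀ (F : Set (Set X)) := by rw [h2]; exact ⟨t, ht, rfl⟩
      obtain ⟨T, hT, hxT⟩ := this
      exact ⟨T, fun _ => ⟨hT, hxT⟩⟩
    · exact ⟨∅, fun h => absurd h hx⟩
  choose T hT using h5
  have h6 : (L.map Tree.x).toFinset.card ≤ F.card := by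
    refine Finset.card_le_card_of_injOn T (fun x hx => (hT x (by simpa using hx)).1) ?_
    intro x hx y hy hxy
    have hx := List.mem_toFinset.1 (Finset.mem_coe.1 hx)
    have hy := List.mem_toFinset.1 (Finset.mem_coe.1 hy)
    by_contra hne
    have h7 := h3 _ (hT x hx).1 x (hT x hx).2 y (by rw [hxy]; exact (hT y hy).2)
    have : Std.Symm fun x y : X => ρ < dist x y := ⟨fun a b h => by rwa [dist_comm]⟩
    have h8 := hsep'.forall hx hy hne
    linarith
  rw [List.toFinset_card_of_nodup hnd, List.length_map] at h6
  refine Nat.le_floor ?_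
  refine le_trans ?_ h1
  exact_mod_cast h6

theorem kids_le_packing (hX : DoublingDimLE X d) {r : ℕ} {R : ℝ} (hR : 0 < R) {L : List (Tree X)}
    (h : Hered r R L) : ∀ t ∈ L, t.ch.length ≤ packing d := by
  intro t ht
  by_cases hch : t.ch = []
  · rw [hch]; simp
  · rw [← Tree.kids_eq_ch hch]
    have h1 := (hered_iff.1 (hered_iff.1 h).2).1.sep
    refine length_le_packing hX (ρ := R / 2) (by positivity)
      ((List.pairwise_flatMap.1 h1).1 t ht) ?_
    intro a ha b hb
    have h2 := (hered_iff.1 h).1.kid t ht a ha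
    have h3 := (hered_iff.1 h).1.kid t ht b hb
    have h4 := dist_triangle_right a.x b.x t.x
    linarith

theorem Split.small (hX : DoublingDimLE X d) {r : ℕ} {x : X} {R : ℝ} (hR : 0 < R)
    {L far : List (Tree X)} (h : Split r x R L far) : Small (packing d) L := by
  refine ⟨length_le_packing hX hR (List.pairwise_append.1 h.lvl.sep).1 ?_, fun t ht =>
    kids_le_packing hX hR h.hered t (List.mem_append_left _ ht)⟩
  intro t ht u hu
  have h1 := h.mem_near t ht
  have h2 := h.mem_near u hu
  have h3 := dist_triangle_right t.x u.x x
  linarith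

theorem Split.small_nearN (hX : DoublingDimLE X d) {r : ℕ} {x : X} {R : ℝ} (hR : 0 < R)
    {L far : List (Tree X)} (h : Split r x R L far) (k : ℕ) :
    Small (packing d) (RGather.nearN x k R L) := by
  obtain ⟨f, hf, -⟩ := h.nearN k
  exact hf.small hX (by positivity)

/-- By `Fits.step` each intermediate list is the near part of a level that satisfies the invariant,
so packing bounds its length however many steps came before. -/
theorem Split.prefix_length (hX : DoublingDimLE X d) {r : ℕ} {x : X} {R : ℝ} (hR : 0 < R)
    {L far : List (Tree X)} (h : Split r x R L far) (n : ℕ) {K : List (Tree X)}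
    (hK : Fits r x R L far n K) : ∀ l₁ a l₂, stackN x R L n = l₁ ++ a :: l₂ →
      (l₁.foldl (fun K s => RGather.step r x s.1 s.2 K) K).length ≤ packing d := by
  induction n generalizing K with
  | zero => intro l₁ a l₂ he; simp [stackN] at he
  | succ n ih =>
    intro l₁ a l₂ he
    match l₁ with
    | [] =>
      obtain ⟨f, hf, hp⟩ := h.nearN (n + 1)
      exact ((hK f hf hp).1.small hX (by positivity)).1
    | s :: l₁ =>
      simp only [stackN, List.cons_append, List.cons.injEq] at he
      rw [← he.1, List.foldl_cons]
      exact ih hK.step l₁ a l₂ he.2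

theorem Stores.small (hX : DoublingDimLE X d) {r : ℕ} {P : Finset X} {R : ℝ} {L : List (Tree X)}
    (h : Stores r P R L) : Small (packing d) L := by
  refine ⟨length_le_packing hX h.pos (hered_iff.1 h.hered).1.sep ?_,
    kids_le_packing hX h.pos h.hered⟩
  intro t ht u hu
  have := h.diam _ (h.center ht) _ (h.center hu)
  have := h.pos
  linarith

end Packing

/-! ### The number of levels -/

section Depth

variable {X : Type*} [MetricSpace X]

theorem exists_first {p : ℕ → Prop} {N : ℕ} (h : p N) : ∃ n ≤ N, p n ∧ ∀ k < n, ¬ p k := by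
  classical
  have h' : ∃ n, p n := ⟨N, h⟩
  exact ⟨Nat.find h', Nat.find_min' h' h, Nat.find_spec h', fun k hk => Nat.find_min h' hk⟩

/-- `δ` is a lower bound for the distances of different points of `P`, and upper bounds are given
in terms of it. -/
structure Scale (Δ : ℝ) (P : Finset X) (R δ : ℝ) : Prop where
  pos : 0 < δ
  sep : ∀ p ∈ P, ∀ q ∈ P, p ≠ q → δ ≤ dist p q
  diam : ∀ p ∈ P, ∀ q ∈ P, dist p q ≤ Δ * δ
  radius : R ≤ 2 * (Δ * δ)

/-- For at least two points `δ` is the minimum distance, and tightness bounds `R` by twice the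
diameter. For fewer points the conditions on distances are empty or trivial, and `δ = R` serves. -/
theorem AspectLE.scale {Δ : ℝ} (hΔ : 1 ≤ Δ) {P : Finset X} (h : AspectLE Δ P) {R : ℝ} (hR : 0 < R)
    (ht : Tight P R) : ∃ δ, Scale Δ P R δ := by
  by_cases hP : 2 ≤ P.card
  · have hne : P.offDiag.Nonempty := by
      obtain ⟨a, ha, b, hb, hab⟩ := Finset.one_lt_card.1 hP
      exact ⟨(a, b), Finset.mem_offDiag.2 ⟨ha, hb, hab⟩⟩
    obtain ⟨⟨a, b⟩, hab, hmin⟩ := P.offDiag.exists_min_image (fun z => dist z.1 z.2) hne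
    obtain ⟨ha, hb, hne'⟩ := Finset.mem_offDiag.1 hab
    have hpos : 0 < dist a b := dist_pos.2 hne'
    have hdiam : ∀ p ∈ P, ∀ q ∈ P, dist p q ≤ Δ * dist a b := by
      intro p hp q hq
      by_cases hpq : p = q
      · rw [hpq, dist_self]; positivity
      · exact h p hp q hq a ha b hb hpq hne'
    refine ⟨dist a b, hpos, fun p hp q hq hpq => hmin (p, q) (Finset.mem_offDiag.2 ⟨hp, hq, hpq⟩),
      hdiam, ?_⟩
    obtain ⟨p, hp, q, hq, hpq⟩ := ht hP
    have := hdiam p hp q hq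
    linarith
  · have heq : ∀ p ∈ P, ∀ q ∈ P, p = q := by
      intro p hp q hq
      by_contra hne
      exact hP (Finset.one_lt_card.2 ⟨p, hp, q, hq, hne⟩)
    refine ⟨R, hR, fun p hp q hq hpq => absurd (heq p hp q hq) hpq, fun p hp q hq => ?_, ?_⟩
    · rw [heq p hp q hq, dist_self]; positivity
    · nlinarith

/-- A bound for the number of levels. -/
noncomputable def depth (Δ : ℝ) : ℕ := ⌈Real.logb 2 (68 * Δ)⌉₊ + 1

theorem lt_two_pow_depth {Δ : ℝ} (hΔ : 1 ≤ Δ) : 68 * Δ < 2 ^ depth Δ := by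
  have h1 : Real.logb 2 (68 * Δ) < depth Δ := by
    rw [depth]
    push_cast
    have := Nat.le_ceil (Real.logb 2 (68 * Δ))
    linarith
  rw [Real.logb_lt_iff_lt_rpow (by norm_num) (by linarith), Real.rpow_natCast] at h1
  exact h1

/-- The `68` in `depth` is `34 * 2`, from the reach of near nodes and from the bound of the top
radius. At this depth no point other than `x` is below a node near `x`. -/
theorem Scale.small_radius {Δ : ℝ} (hΔ : 1 ≤ Δ) {P : Finset X} {R δ : ℝ} (h : Scale Δ P R δ) :
    34 * (R / 2 ^ depth Δ) < δ := by
  have h1 := lt_two_pow_depth hΔ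
  have h2 := h.radius
  have h3 := h.pos
  rw [← mul_div_assoc, div_lt_iff₀ (by positivity)]
  calc 34 * R ≤ 68 * Δ * δ := by linarith
    _ < 2 ^ depth Δ * δ := by gcongr
    _ = δ * 2 ^ depth Δ := mul_comm _ _

variable {r : ℕ} {P : Finset X} {R Δ : ℝ} {L : List (Tree X)} {x : X}

/-- The invariant between the operations. -/
structure Good (r : ℕ) (P : Finset X) (R : ℝ) (L : List (Tree X)) : Prop extends
  Stores r P R L where
  tight : Tight P R

/-- Going down to a point of the set. -/
theorem Good.exists_descent (hΔ : 1 ≤ Δ) (h : Good r P R L) (ha : AspectLE Δ P) (hx : x ∈ P) :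
    ∃ n ≤ depth Δ, total (nearN x n R L) = 1 ∧ ∀ k < n, total (nearN x k R L) ≠ 1 := by
  obtain ⟨δ, hδ⟩ := ha.scale hΔ h.pos h.tight
  refine exists_first ?_
  obtain ⟨f, hf, hp⟩ := (h.split_of_mem hx).nearN (depth Δ)
  rw [List.append_nil] at hp
  refine hf.total_eq_one (by have := h.pos; positivity) (hp.mem_iff.2 (h.mem.2 hx))
    (hp.nodup_iff.2 h.nodup) fun p hpp hpx => ?_
  exact (hδ.small_radius hΔ).trans_le (hδ.sep p (h.mem.1 (hp.mem_iff.1 hpp)) x hx hpx)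

theorem raiseS_fst (r : ℕ) (x : X) (s : ℝ × List (Tree X)) (k : ℕ) :
    (raiseS r x s k).1 = 2 ^ k * s.1 := by
  induction k with
  | zero => simp [raiseS]
  | succ k ih => rw [raiseS, ih, pow_succ']; ring

theorem popS_fst (s : ℝ × List (Tree X)) (k : ℕ) : (popS s k).1 = s.1 / 2 ^ k := by
  induction k with
  | zero => simp [popS]
  | succ k ih => rw [popS, ih, pow_succ, div_div]

theorem anchor_mem (d : X) (hL : L ≠ []) : ∃ t ∈ L, anchor d L = t.x := by
  obtain ⟨l, t, rfl⟩ := (List.eq_nil_or_concat L).resolve_left hL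
  exact ⟨t, by simp, by simp [anchor]⟩

theorem Stores.raiseS {s : ℝ × List (Tree X)} (h : Stores r P s.1 s.2) (k : ℕ)
    (hlt : ∀ i < k, ¬ AllNear x (raiseS r x s i)) :
    Stores r P (RGather.raiseS r x s k).1 (RGather.raiseS r x s k).2 := by
  induction k with
  | zero => exact h
  | succ k ih =>
    have ih := ih fun i hi => hlt i (by omega)
    have h1 : (RGather.raiseS r x s k).2 ≠ [] := by
      intro h2
      refine hlt k (by omega) ?_
      rw [AllNear, h2]
      simp
    obtain ⟨t, ht, he⟩ := anchor_mem x h1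
    exact ih.raise (by rw [he]; exact ih.center ht)

-- With a single stored point the radius bears no relation to any distance, so it is replaced by the
-- distance to the new point. The last clause bounds the radius from below, which limits how often a
-- level must be added at the top.
open Classical in
theorem Good.reset (hr : 2 ≤ r) (h : Good r P R L) (hx : x ∉ P) :
    Stores r P (reset x R L).1 (reset x R L).2 ∧ Tight (insert x P) (reset x R L).1 ∧
    ∀ δ, (∀ p ∈ insert x P, ∀ q ∈ insert x P, p ≠ q → δ ≤ dist p q) → P.Nonempty →
      δ ≤ 5 * (RGather.reset x R L).1 := by
  by_cases h1 : P.card = 1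
  · obtain ⟨p, rfl⟩ := Finset.card_eq_one.1 h1
    have ht : total L = 1 := by rw [h.total_eq, h1]
    have hne : L ≠ [] := by
      rintro rfl
      simp [total] at ht
    obtain ⟨t, htL, he⟩ := anchor_mem x hne
    have htp := Finset.mem_singleton.1 (h.center htL)
    have hpx : p ≠ x := fun hpx => hx (by simp [hpx])
    have hpos : 0 < dist p x := dist_pos.2 hpx
    rw [RGather.reset, if_pos ht, he, htp]
    refine ⟨Stores.leaf hr p hpos, fun _ => ⟨p, by simp, x, by simp, by linarith⟩, ?_⟩
    intro δ hδ _
    have := hδ p (by simp) x (by simp) hpx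
    simp only
    linarith
  · have ht : total L ≠ 1 := by rw [h.total_eq]; exact h1
    rw [RGather.reset, if_neg ht]
    refine ⟨h.toStores, ?_, ?_⟩
    · intro hc
      rw [Finset.card_insert_of_notMem hx] at hc
      obtain ⟨p, hp, q, hq, hpq⟩ := h.tight (by omega)
      exact ⟨p, Finset.mem_insert_of_mem hp, q, Finset.mem_insert_of_mem hq, hpq⟩
    · intro δ hδ hne
      have hc : 1 < P.card := by
        have := hne.card_pos
        omega
      obtain ⟨p, hp, q, hq, hpq⟩ := Finset.one_lt_card.1 hc
      exact (hδ p (Finset.mem_insert_of_mem hp) q (Finset.mem_insert_of_mem hq) hpq).trans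
        (h.diam p hp q hq)

open Classical in
theorem Good.exists_insertRun (hr : 2 ≤ r) (hΔ : 1 ≤ Δ) (h : Good r P R L)
    (hx : x ∉ P) (ha : AspectLE Δ (insert x P)) :
    ∃ m n s, m ≤ depth Δ ∧ n ≤ depth Δ ∧ InsertRun r x R L m n s ∧ Stores r P s.1 s.2 ∧
      Tight (insert x P) s.1 := by
  obtain ⟨hs, htight, hlow⟩ := h.reset hr hx
  set s₀ := RGather.reset x R L with hs₀
  obtain ⟨δ, hδ⟩ := ha.scale hΔ hs.pos htight
  have h1 : ∃ m ≤ depth Δ, AllNear x (raiseS r x s₀ m) ∧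
      ∀ k < m, ¬ AllNear x (raiseS r x s₀ k) := by
    by_contra hcon
    have hall : ∀ k ≤ depth Δ, ¬ AllNear x (raiseS r x s₀ k) := by
      intro k hk hn
      obtain ⟨m, hm, h1, h2⟩ := exists_first (p := fun k => AllNear x (raiseS r x s₀ k)) hn
      exact hcon ⟨m, hm.trans hk, h1, h2⟩
    have hst := hs.raiseS (depth Δ) (x := x) fun i hi => hall i hi.le
    have h2 := hall (depth Δ) le_rfl
    rw [AllNear] at h2
    push Not at h2
    obtain ⟨t, ht, htd⟩ := h2
    have h3 := hδ.diam t.x (Finset.mem_insert_of_mem (hst.center ht)) x (by simp)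
    have h4 := hlow δ hδ.sep ⟨_, hst.center ht⟩
    rw [raiseS_fst] at htd
    have h5 := lt_two_pow_depth hΔ
    have h6 := hδ.pos
    -- If all tests failed, the radius would exceed `68 * Δ * δ / 5`; then three times the radius
    -- exceeds the diameter, and the last test cannot have failed.
    have h7 : 68 * Δ * (δ / 5) ≤ 2 ^ depth Δ * s₀.1 :=
      mul_le_mul h5.le (by linarith) (by positivity) (by positivity)
    nlinarith
  obtain ⟨m, hm, hnear, hlt⟩ := h1
  have hst := hs.raiseS m hlt
  set s := raiseS r x s₀ m with hsdef
  -- The test that failed just before the last raise exhibits two points more than `3 / 2` of the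
  -- new radius apart.
  have htight' : Tight (insert x P) s.1 := by
    match m, hlt, hsdef with
    | 0, _, hsdef => rw [hsdef]; exact htight
    | k + 1, hlt, hsdef =>
      intro _
      have h2 := hlt k (by omega)
      rw [AllNear] at h2
      push Not at h2
      obtain ⟨t, ht, htd⟩ := h2
      have hst' := hs.raiseS k (x := x) fun i hi => hlt i (by omega)
      refine ⟨t.x, Finset.mem_insert_of_mem (hst'.center ht), x, by simp, ?_⟩
      have : s.1 = 2 * (raiseS r x s₀ k).1 := by rw [hsdef]; rfl
      have := hst'.pos
      linarith
  obtain ⟨δ', hδ'⟩ := ha.scale hΔ hst.pos htight'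
  have hsp := hst.split (x := x) fun t ht => (hnear t ht).trans (by have := hst.pos; linarith)
  have h2 : total (nearN x (depth Δ) s.1 s.2) = 0 := by
    obtain ⟨f, hf, hp⟩ := hsp.nearN (depth Δ)
    rw [List.append_nil] at hp
    refine hf.total_eq_zero fun p hpp => ?_
    have hpP := hst.mem.1 (hp.mem_iff.1 hpp)
    exact (hδ'.small_radius hΔ).trans_le (hδ'.sep p (Finset.mem_insert_of_mem hpP) x (by simp)
      fun hpx => hx (hpx ▸ hpP))
  obtain ⟨n, hn, hn0, hnlt⟩ := exists_first (p := fun k => total (nearN x k s.1 s.2) = 0) h2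
  exact ⟨m, n, s, hm, hn, ⟨rfl, hnear, hlt, hn0, hnlt⟩, hst, htight'⟩

theorem Superfluous.exists_kid {s : ℝ × List (Tree X)} (h : Superfluous s) :
    ∃ t, s.2.flatMap Tree.kids = [t] := by
  match hk : s.2.flatMap Tree.kids, h.1, h.2 with
  | [], _, h2 => simp [total] at h2
  | [t], _, _ => exact ⟨t, rfl⟩
  | t :: u :: l, h1, _ => simp at h1

theorem Stores.popS {s : ℝ × List (Tree X)} (h : Stores r P s.1 s.2) (k : ℕ)
    (hlt : ∀ i < k, Superfluous (popS s i)) :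
    Stores r P (RGather.popS s k).1 (RGather.popS s k).2 := by
  induction k with
  | zero => exact h
  | succ k ih =>
    have ih := ih fun i hi => hlt i (by omega)
    obtain ⟨t, ht⟩ := (hlt k (by omega)).exists_kid
    exact ih.pop ht

theorem Stores.tight_of_not_superfluous {s : ℝ × List (Tree X)} (h : Stores r P s.1 s.2)
    (hs : ¬ Superfluous s) : Tight P s.1 := by
  refine h.tight fun t ht => ?_
  have hh := (hered_iff.1 h.hered).2
  have h1 := (hered_iff.1 hh).1.cnt t (by rw [ht]; simp)
  have h2 := List.length_pos_of_mem (hh.center_mem t 0 (by rw [lev, ht]; simp))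
  rw [Superfluous, ht] at hs
  simp [total] at hs
  omega

open Classical in
theorem Good.exists_deleteRun (hΔ : 1 ≤ Δ) (h : Good r P R L) (hx : x ∈ P)
    (ha : AspectLE Δ P) : ∃ m n, m ≤ depth Δ ∧ n ≤ depth Δ ∧ DeleteRun r x R L m n := by
  obtain ⟨n, hn, h1, h2⟩ := h.exists_descent hΔ ha hx
  have hs := h.delete hx h1
  obtain ⟨δ, hδ⟩ := ha.scale hΔ h.pos h.tight
  have h3 : ∃ m ≤ depth Δ, ¬ Superfluous (popS (R, upd r x n R L []) m) ∧
      ∀ k < m, Superfluous (popS (R, upd r x n R L []) k) := by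
    by_contra hcon
    have hall : ∀ k ≤ depth Δ, Superfluous (popS (R, upd r x n R L []) k) := by
      intro k hk
      by_contra hn
      obtain ⟨m, hm, h1, h2⟩ :=
        exists_first (p := fun k => ¬ Superfluous (popS (R, upd r x n R L []) k)) hn
      exact hcon ⟨m, hm.trans hk, h1, fun k hk => not_not.1 (h2 k hk)⟩
    have hst := Stores.popS (s := (R, upd r x n R L [])) hs (depth Δ) fun i hi => hall i hi.le
    have hsup := hall (depth Δ) le_rfl
    obtain ⟨t, ht⟩ := hsup.exists_kid
    have hst' := hst.pop ht
    rw [ht] at hst'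
    have htot := hsup.2
    rw [ht, hst'.total_eq] at htot
    obtain ⟨p, hp, q, hq, hpq⟩ := Finset.one_lt_card.1 htot
    -- After that many removals, one node would have to hold two points although its radius is below
    -- a fixed fraction of the minimum distance.
    have key : ∀ p ∈ P.erase x, dist p t.x ≤ 2 * ((RGather.popS (R, upd r x n R L [])
        (depth Δ)).1 / 2) := by
      intro p hp
      have := hst'.mem.2 hp
      exact hst'.dist_le (List.mem_singleton_self t) (by simpa using this)
    have h4 := key p hp
    have h5 := key q hq
    have h6 := dist_triangle_right p q t.x
    have h7 := hδ.sep p (Finset.mem_of_mem_erase hp) q (Finset.mem_of_mem_erase hq) hpq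
    have h8 := hδ.small_radius hΔ
    rw [popS_fst] at h4 h5
    have h9 : 0 ≤ R / 2 ^ depth Δ := by have := h.pos; positivity
    simp only at h4 h5
    linarith
  obtain ⟨m, hm, h4, h5⟩ := h3
  exact ⟨m, n, hm, hn, h1, h2, h4, h5⟩

open Classical in
theorem Good.insert {m n : ℕ} {s : ℝ × List (Tree X)} (hr : 2 ≤ r) (hx : x ∉ P)
    (hrun : InsertRun r x R L m n s) (hs : Stores r P s.1 s.2)
    (ht : Tight (Insert.insert x P) s.1) :
    Good r (Insert.insert x P) s.1 (upd r x n s.1 s.2 [Tree.leaf x]) :=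
  ⟨hs.insert hr hx hrun.near hrun.total, ht⟩

open Classical in
theorem Good.delete {m n : ℕ} (h : Good r P R L) (hx : x ∈ P) (hrun : DeleteRun r x R L m n) :
    Good r (P.erase x) (popS (R, upd r x n R L []) m).1 (popS (R, upd r x n R L []) m).2 := by
  have hs := h.toStores.delete hx hrun.total
  have hp := Stores.popS (s := (R, upd r x n R L [])) hs m hrun.lt
  exact ⟨hp, hp.tight_of_not_superfluous hrun.stops⟩

/-! ### The costs of the operations -/

variable {d : ℝ} {v : Val X}

open Classical in
theorem Good.insertE (hX : DoublingDimLE X d) (hd : 0 ≤ d) (hr : 2 ≤ r) (hΔ : 1 ≤ Δ)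
    (h : Good r P R L) (hx : x ∉ P) (ha : AspectLE Δ (Insert.insert x P)) :
    ∃ s : ℝ × List (Tree X), run insertE (.pair (.nat r) (.pair (.pt x) (.pair (.real R)
        (.pair (encL encT L) v)))) = some (encO s) ∧
      cost RGather.insertE (.pair (.nat r) (.pair (.pt x) (.pair (.real R)
        (.pair (encL encT L) v)))) ≤ (2 * depth Δ + 2) * (7000 * packing d ^ 2) ∧
      Good r (Insert.insert x P) s.1 s.2 := by
  obtain ⟨m, n, s, hm, hn, hrun, hs, ht⟩ := h.exists_insertRun hr hΔ hx ha
  have hsp := hs.split (x := x) fun t ht => (hrun.near t ht).trans (by have := hs.pos; linarith)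
  refine ⟨_, run_insertE hrun, (cost_insertE_le hrun (one_le_packing hd) (h.small hX).1 ?_ ?_ ?_).trans
    ?_, Good.insert hr hx hrun hs ht⟩
  · intro k hk
    exact (((h.reset hr hx).1.raiseS k fun i hi => hrun.lt i (by omega)).small hX).1
  · intro k _
    exact hsp.small_nearN hX hs.pos k
  · exact hsp.prefix_length hX hs.pos n (hsp.fits_leaf hr hrun.total)
  · exact Nat.mul_le_mul_right _ (by omega)

open Classical in
theorem Good.deleteE (hX : DoublingDimLE X d) (hd : 0 ≤ d) (hΔ : 1 ≤ Δ)
    (h : Good r P R L) (hx : x ∈ P) (ha : AspectLE Δ P) :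
    ∃ s : ℝ × List (Tree X), run deleteE (.pair (.nat r) (.pair (.pt x) (.pair (.real R)
        (.pair (encL encT L) v)))) = some (encO s) ∧
      cost RGather.deleteE (.pair (.nat r) (.pair (.pt x) (.pair (.real R)
        (.pair (encL encT L) v)))) ≤ (2 * depth Δ + 2) * (7000 * packing d ^ 2) ∧
      Good r (P.erase x) s.1 s.2 := by
  obtain ⟨m, n, hm, hn, hrun⟩ := h.exists_deleteRun hΔ hx ha
  have hsp := h.split_of_mem hx
  refine ⟨_, run_deleteE hrun, (cost_deleteE_le hrun (one_le_packing hd) ?_ ?_ ?_).trans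
    ?_, h.delete hx hrun⟩
  · intro k _
    exact hsp.small_nearN hX h.pos k
  · exact hsp.prefix_length hX h.pos n
      (Split.fits_nil h.pos (by rw [List.append_nil]; exact h.mem.2 hx) hrun.total)
  · intro k hk
    have hs := h.toStores.delete hx hrun.total
    exact (Stores.popS (s := (R, upd r x n R L [])) hs k
      fun i hi => hrun.lt i (by omega)).small hX
  · exact Nat.mul_le_mul_right _ (by omega)

theorem Good.queryPointE (hX : DoublingDimLE X d) (hd : 0 ≤ d) (hΔ : 1 ≤ Δ)
    (h : Good r P R L) (hx : x ∈ P) (ha : AspectLE Δ P) :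
    ∃ n, total (nearN x n R L) = 1 ∧ (∀ k < n, total (nearN x k R L) ≠ 1) ∧
      cost queryPointE (.pair (.pt x) (.pair (.real R) (.pair (encL encT L) v))) ≤
        (depth Δ + 1) * (1000 * packing d ^ 2) := by
  obtain ⟨n, hn, h1, h2⟩ := h.exists_descent hΔ ha hx
  refine ⟨n, h1, h2, (cost_queryPointE_le h1 h2 (one_le_packing hd) fun k _ =>
    (h.split_of_mem hx).small_nearN hX h.pos k).trans (Nat.mul_le_mul_right _ (by omega))⟩

end Depth

/-! ### The approximation factor -/

section Approximation

variable {X : Type*} [MetricSpace X] {r : ℕ} {P : Finset X} {R : ℝ} {L : List (Tree X)}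

theorem foldl_max_le {c : ℝ} (L : List (Tree X)) (h : ∀ t ∈ L, t.g ≤ c) (m : ℝ) (hm : m ≤ c) :
    L.foldl (fun m k => max m k.g) m ≤ c := by
  induction L generalizing m with
  | nil => exact hm
  | cons t L ih =>
    exact ih (fun u hu => h u (List.mem_cons_of_mem _ hu)) _ (max_le hm (h t List.mem_cons_self))

theorem le_foldl_max (L : List (Tree X)) (m : ℝ) : m ≤ L.foldl (fun m k => max m k.g) m ∧
    ∀ t ∈ L, t.g ≤ L.foldl (fun m k => max m k.g) m := by
  induction L generalizing m with
  | nil => simp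
  | cons t L ih =>
    have h := ih (max m t.g)
    refine ⟨(le_max_left _ _).trans h.1, fun u hu => ?_⟩
    rcases List.mem_cons.1 hu with rfl | hu
    · exact (le_max_right _ _).trans h.1
    · exact h.2 u hu

theorem maxg_le {c : ℝ} (hc : 0 ≤ c) (h : ∀ t ∈ L, t.g ≤ c) : maxg L ≤ c := foldl_max_le L h 0 hc

theorem le_maxg {t : Tree X} (ht : t ∈ L) : t.g ≤ maxg L := (le_foldl_max L 0).2 t ht

theorem maxg_nonneg (L : List (Tree X)) : 0 ≤ maxg L := (le_foldl_max L 0).1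

/-- The stored radius is that of the lowest level for which no level from there on has bad nodes. -/
theorem Hered.maxg_eq (hR : 0 < R) (h : Hered r R L) (k : ℕ)
    (hgood : ∀ j ≤ k, ∀ t ∈ RGather.lev L j, t.bad = false)
    (hbad : ∃ t ∈ RGather.lev L (k + 1), t.bad = true) : maxg L = R / 2 ^ k := by
  have hch : ∀ {t}, t ∈ L → t.ch ≠ [] := fun {t} ht hnil => by
    have h1 := (hered_iff.1 h).1.of_nil t ht hnil
    rw [hgood 0 (by omega) t ht] at h1
    contradiction
  induction k generalizing R L with
  | zero =>
    rw [pow_zero, div_one]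
    refine le_antisymm (maxg_le hR.le (hered_iff.1 h).1.radius_le) ?_
    obtain ⟨k, hk, hkb⟩ := hbad
    obtain ⟨t, ht, hkt⟩ := List.mem_flatMap.1 (show k ∈ L.flatMap Tree.kids from hk)
    rw [Tree.kids_eq_ch (hch ht)] at hkt
    have h1 := (hered_iff.1 h).1.radius t ht (hch ht)
    rw [if_pos (List.any_eq_true.2 ⟨k, hkt, hkb⟩)] at h1
    exact h1.symm.trans_le (le_maxg ht)
  | succ k ih =>
    have h1 := ih (L := L.flatMap Tree.kids) (R := R / 2) (by positivity) (hered_iff.1 h).2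
      (fun j hj t ht => hgood (j + 1) (by omega) t ht) hbad (fun {t} ht hnil => by
        have h1 := (hered_iff.1 (hered_iff.1 h).2).1.of_nil t ht hnil
        rw [hgood 1 (by omega) t ht] at h1
        contradiction)
    -- No child is bad, so every node passes on the largest radius stored with its children.
    have h2 : ∀ t ∈ L, t.g = maxg t.ch := by
      intro t ht
      rw [(hered_iff.1 h).1.radius t ht (hch ht), if_neg]
      · rfl
      · rw [List.any_eq_true]
        rintro ⟨k, hk, hkb⟩
        rw [← Tree.kids_eq_ch (hch ht)] at hk
        rw [hgood 1 (by omega) k (List.mem_flatMap.2 ⟨t, ht, hk⟩)] at hkb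
        contradiction
    have h3 : maxg L = maxg (L.flatMap Tree.kids) := by
      refine le_antisymm (maxg_le (maxg_nonneg _) fun t ht => ?_) (maxg_le (maxg_nonneg _) fun k hk => ?_)
      · rw [h2 t ht]
        refine maxg_le (maxg_nonneg _) fun k hk => le_maxg ?_
        rw [← Tree.kids_eq_ch (hch ht)] at hk
        exact List.mem_flatMap.2 ⟨t, ht, hk⟩
      · obtain ⟨t, ht, hkt⟩ := List.mem_flatMap.1 hk
        rw [Tree.kids_eq_ch (hch ht)] at hkt
        exact (le_maxg hkt).trans ((h2 t ht).symm.trans_le (le_maxg ht))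
    rw [h3, h1, pow_succ', div_div]

/-- The points below the nodes that count for the weight. -/
noncomputable def ptsNear (R : ℝ) (L : List (Tree X)) (y : X) : List X :=
  (L.filter fun t => decide (dist t.x y ≤ 5 * R)).flatMap Tree.pts

theorem Lvl.weight_eq (h : Lvl r R L) (y : X) : weight R L y = (ptsNear R L y).length := by
  have hc := h.cnt
  clear h
  induction L with
  | nil => rfl
  | cons t L ih =>
    have ih := ih fun u hu => hc u (List.mem_cons_of_mem _ hu)
    have h1 : weight R (t :: L) y = (if dist t.x y ≤ 5 * R then t.c else 0) + weight R L y := by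
      simp [weight]
    rw [h1, ih, hc t List.mem_cons_self]
    by_cases hd : dist t.x y ≤ 5 * R
    · simp [ptsNear, hd]
    · simp [ptsNear, hd]

theorem mem_ptsNear {y p : X} : p ∈ ptsNear R L y ↔ ∃ t ∈ L, dist t.x y ≤ 5 * R ∧ p ∈ t.pts := by
  simp [ptsNear, and_assoc]

theorem ptsNear_sublist (y : X) : (ptsNear R L y).Sublist (L.flatMap Tree.pts) := by
  induction L with
  | nil => simp [ptsNear]
  | cons t L ih =>
    by_cases hd : dist t.x y ≤ 5 * R
    · rw [ptsNear, List.filter_cons_of_pos (by simpa using hd), List.flatMap_cons,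
        List.flatMap_cons]
      exact (List.Sublist.refl _).append ih
    · simp only [ptsNear, List.flatMap_cons]
      rw [List.filter_cons_of_neg (by simpa using hd)]
      exact ih.trans (List.sublist_append_right _ _)

theorem Stores.mem_lev (h : Stores r P R L) (k : ℕ) {p : X} :
    (∃ t ∈ lev L k, p ∈ t.pts) ↔ p ∈ P := by
  rw [← h.mem, ← flatMap_pts_lev L k, List.mem_flatMap]

theorem Stores.dist_lev (h : Stores r P R L) {k : ℕ} {t : Tree X} (ht : t ∈ lev L k) {p : X}
    (hp : p ∈ t.pts) : dist p t.x ≤ 2 * (R / 2 ^ k) :=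
  h.hered.dist_le h.pos.le t k ht p hp

theorem Stores.lev_center (h : Stores r P R L) {k : ℕ} {t : Tree X} (ht : t ∈ lev L k) :
    t.x ∈ P := (h.mem_lev k).1 ⟨t, ht, h.hered.center_mem t k ht⟩

/-- Each point is stored once, so distinct nodes of a level have disjoint lists of points. -/
theorem Stores.eq_of_mem_pts (h : Stores r P R L) {k : ℕ} {t u : Tree X} (ht : t ∈ lev L k)
    (hu : u ∈ lev L k) {p : X} (hpt : p ∈ t.pts) (hpu : p ∈ u.pts) : t = u := by
  by_contra hne
  have h1 := h.nodup
  rw [← flatMap_pts_lev L k, List.nodup_flatMap] at h1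
  have : Std.Symm (Function.onFun List.Disjoint (Tree.pts (X := X))) :=
    ⟨fun a b h => List.Disjoint.symm h⟩
  exact h1.2.forall ht hu hne hpt hpu

theorem Stores.eq_of_center (h : Stores r P R L) {k : ℕ} {t u : Tree X} (ht : t ∈ lev L k)
    (hu : u ∈ lev L k) (hx : t.x = u.x) : t = u :=
  h.eq_of_mem_pts ht hu (h.hered.center_mem t k ht) (hx ▸ h.hered.center_mem u k hu)

/-- There are many points near each top node. -/
theorem Stores.top_good (h : Stores r P R L) (hc : r ≤ P.card) : ∀ t ∈ L, t.bad = false := by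
  intro t ht
  have h1 : weight R L t.x = P.card := by
    rw [← h.total_eq, weight, total]
    refine congrArg List.sum (List.map_congr_left fun u hu => ?_)
    rw [if_pos (h.diam _ (h.center hu) _ (h.center ht))]
  rw [(hered_iff.1 h.hered).1.bad t ht, h1]
  simpa using hc

/-- A bad node shows that clusters must be large. -/
theorem Stores.lt_cost (h : Stores r P R L) {k : ℕ} {u : Tree X} (hu : u ∈ lev L k)
    (hb : u.bad = true) {S : Clustering X} (hS : S.IsGather r P) :
    3 * (R / 2 ^ k) < 2 * S.cost := by
  classical
  by_contra hcon
  push Not at hcon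
  obtain ⟨i, hi⟩ := (hS.cover u.x).1 (h.lev_center hu)
  have hdist : ∀ p ∈ S.cluster i, dist p (S.center i) ≤ S.cost := by
    intro p hp
    rw [← coe_nndist, NNReal.coe_le_coe]
    exact (Finset.le_sup (f := fun p => nndist p (S.center i)) hp).trans
      (Finset.le_sup (f := fun i => (S.cluster i).sup fun p => nndist p (S.center i))
        (Finset.mem_univ i))
  -- If twice the cost is at most three radii, every point of the cluster of `u.x` is within three
  -- radii of `u.x`, and its node is within two more. So the weight of `u` counts the whole cluster.
  have hsub : S.cluster i ⊆ (ptsNear (R / 2 ^ k) (lev L k) u.x).toFinset := by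
    intro p hp
    rw [List.mem_toFinset, mem_ptsNear]
    obtain ⟨t, ht, hpt⟩ := (h.mem_lev k).2 ((hS.cover p).2 ⟨i, hp⟩)
    refine ⟨t, ht, ?_, hpt⟩
    have h1 := hdist p hp
    have h2 := hdist u.x hi
    have h3 := h.dist_lev ht hpt
    have h4 := dist_triangle_right p u.x (S.center i)
    have h5 := dist_triangle_left t.x u.x p
    linarith
  have h1 := (Finset.card_le_card hsub).trans (List.toFinset_card_le _)
  rw [← (h.hered k).weight_eq] at h1
  have h2 := (h.hered k).bad u hu
  rw [hb] at h2
  have h3 := hS.size i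
  have h4 : ¬ r ≤ weight (R / 2 ^ k) (lev L k) u.x := by
    intro h5
    simp [h5] at h2
  omega

theorem mem_lev_of_mem_nearN {x : X} {n : ℕ} {t : Tree X} (ht : t ∈ nearN x n R L) :
    t ∈ lev L n := by
  induction n generalizing t with
  | zero => exact ht
  | succ n ih =>
    rw [nearN_succ] at ht
    obtain ⟨u, hu, htu⟩ := List.mem_flatMap.1 (List.mem_filter.1 ht).1
    rw [lev_succ]
    exact List.mem_flatMap.2 ⟨u, ih hu, htu⟩

/-- The descent misses nothing: a node within `32` radii of its own level is within `16` radii of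
the level above, so its parent is within `17` and was kept. -/
theorem Hered.mem_nearN (hR : 0 < R) (h : Hered r R L) {x : X} {n : ℕ} {t : Tree X}
    (ht : t ∈ RGather.lev L n) (hd : dist t.x x ≤ 32 * (R / 2 ^ n)) : t ∈ nearN x n R L := by
  induction n generalizing t with
  | zero => exact ht
  | succ n ih =>
    rw [lev_succ] at ht
    obtain ⟨u, hu, htu⟩ := List.mem_flatMap.1 ht
    have h1 : R / 2 ^ n = 2 * (R / 2 ^ (n + 1)) := by rw [pow_succ]; field_simp
    have h2 := (h n).kid u hu t htu
    have h3 := dist_triangle_left u.x x t.x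
    have h4 : 0 < R / 2 ^ n := by positivity
    rw [nearN_succ]
    refine List.mem_filter.2 ⟨List.mem_flatMap.2 ⟨u, ih hu (by linarith), htu⟩, ?_⟩
    simp only [decide_eq_true_eq]
    linarith

/-- If there is only one point then the node above it is bad. -/
theorem Stores.exists_bad (hr : 2 ≤ r) (h : Stores r P R L) {x : X} (hx : x ∈ P) {n : ℕ}
    (hn : total (nearN x n R L) = 1) : ∃ t ∈ lev L n, t.bad = true := by
  have hR := h.pos
  obtain ⟨f, hf, hp⟩ := (h.split_of_mem hx).nearN n
  rw [List.append_nil] at hp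
  obtain ⟨t, ht, htp, htx⟩ := hf.eq_singleton (by positivity) (hp.mem_iff.2 (h.mem.2 hx)) hn
  refine ⟨t, mem_lev_of_mem_nearN (by rw [ht]; simp), ?_⟩
  rw [ht] at hf hn
  rw [hf.lvl.bad t (by simp), weight_append, weight_eq_zero (L := f) (fun u hu => by
    have h1 := hf.mem_far u hu
    rw [htx]
    have := hf.pos
    have : 0 < R / 2 ^ n := by positivity
    linarith)]
  have h1 : weight (R / 2 ^ n) [t] t.x = 1 := by
    have : t.c = 1 := by simpa [total] using hn
    simp [weight, this]
    positivity
  rw [h1]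
  simp
  omega

/-! #### The answers of the queries -/

theorem foldl_last (p : Tree X → Bool) (d : X) (L : List (Tree X)) :
    (∃ u ∈ L, p u = true ∧ L.foldl (fun a u => if p u then u.x else a) d = u.x) ∨
    ((∀ u ∈ L, p u = false) ∧ L.foldl (fun a u => if p u then u.x else a) d = d) := by
  induction L generalizing d with
  | nil => simp
  | cons t L ih =>
    rw [List.foldl_cons]
    by_cases ht : p t = true
    · rw [if_pos ht]
      rcases ih t.x with ⟨u, hu, h1, h2⟩ | ⟨h1, h2⟩
      · exact Or.inl ⟨u, List.mem_cons_of_mem _ hu, h1, h2⟩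
      · exact Or.inl ⟨t, List.mem_cons_self, ht, h2⟩
    · rw [if_neg ht]
      rcases ih d with ⟨u, hu, h1, h2⟩ | ⟨h1, h2⟩
      · exact Or.inl ⟨u, List.mem_cons_of_mem _ hu, h1, h2⟩
      · refine Or.inr ⟨fun u hu => ?_, h2⟩
        rcases List.mem_cons.1 hu with rfl | hu
        · simpa using ht
        · exact h1 u hu

/-- `a` is the right cluster center for the point `p` if the clusters are formed on level `k`. -/
def Assigned (R : ℝ) (L : List (Tree X)) (k : ℕ) (p a : X) : Prop :=
  (∃ f ∈ lev L k, f.flag = true ∧ f.x = a) ∧ ∃ t ∈ lev L k, p ∈ t.pts ∧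
    dist t.x a ≤ 10 * (R / 2 ^ k) ∧
    ∀ f ∈ lev L k, f.flag = true → dist f.x t.x ≤ 5 * (R / 2 ^ k) → f.x = a

/-- A flagged node within five radii of `t` is unique by the separation of flags, and it is
preferred; otherwise `cover` supplies one within ten radii. -/
theorem Stores.assigned_pick (h : Stores r P R L) {p d : X} {k : ℕ} {t : Tree X}
    (ht : t ∈ lev L k) (hpt : p ∈ t.pts) : Assigned R L k p (pick (5 * (R / 2 ^ k)) t.x
      (pick (10 * (R / 2 ^ k)) t.x d (nearN p k R L)) (nearN p k R L)) := by
  have hRk : 0 < R / 2 ^ k := by have := h.pos; positivity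
  have hpd := h.dist_lev ht hpt
  -- All candidates are within `10 + 2` radii of `p`, hence occur in the list of near nodes.
  have hmem : ∀ f ∈ lev L k, dist f.x t.x ≤ 10 * (R / 2 ^ k) → f ∈ nearN p k R L := by
    intro f hf hd
    refine h.hered.mem_nearN h.pos hf ?_
    have := dist_triangle f.x t.x p
    rw [dist_comm t.x p] at this
    linarith
  rcases foldl_last (fun u => u.flag && decide (dist u.x t.x ≤ 5 * (R / 2 ^ k)))
    (pick (10 * (R / 2 ^ k)) t.x d (nearN p k R L)) (nearN p k R L) with
      ⟨u, hu, h1, h2⟩ | ⟨h1, h2⟩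
  · rw [pick, h2]
    simp only [Bool.and_eq_true, decide_eq_true_eq] at h1
    have hu' := mem_lev_of_mem_nearN hu
    refine ⟨⟨u, hu', h1.1, rfl⟩, t, ht, hpt, by rw [dist_comm]; linarith, ?_⟩
    intro f hf hff hfd
    by_contra hne
    have hne' : f ≠ u := fun h => hne (by rw [h])
    have : Std.Symm fun t u : Tree X => t.flag = true → u.flag = true →
        10 * (R / 2 ^ k) < dist t.x u.x := ⟨fun a b h h1 h2 => by rw [dist_comm]; exact h h2 h1⟩
    have h3 := (h.hered k).flagSep.forall hf hu' hne' hff h1.1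
    have h4 := dist_triangle_right f.x u.x t.x
    linarith
  · rw [pick, h2]
    rcases foldl_last (fun u => u.flag && decide (dist u.x t.x ≤ 10 * (R / 2 ^ k)))
      d (nearN p k R L) with ⟨u, hu, h3, h4⟩ | ⟨h3, h4⟩
    · rw [pick, h4]
      simp only [Bool.and_eq_true, decide_eq_true_eq] at h3
      refine ⟨⟨u, mem_lev_of_mem_nearN hu, h3.1, rfl⟩, t, ht, hpt, by rw [dist_comm]; exact h3.2, ?_⟩
      intro f hf hff hfd
      have h5 := h1 f (hmem f hf (by linarith))
      simp [hff, hfd] at h5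
    · exfalso
      obtain ⟨f, hf, hff, hfd⟩ := (h.hered k).cover t ht
      have h5 := h3 f (hmem f hf hfd)
      simp [hff] at h5
      linarith

/-- Nodes of a level are determined by their centers, so it suffices to remember the center of a
node in order to find its parent. -/
theorem Stores.follow_spec (h : Stores r P R L) {p : X} {j : ℕ} {t : Tree X}
    (ht : t ∈ nearN p (j + 1) R L) (hpt : p ∈ t.pts) :
    ∃ u ∈ nearN p j R L, p ∈ u.pts ∧ follow t.x (nearN p j R L) = u.x := by
  rcases foldl_last (fun u => u.kids.any fun k => decide (dist k.x t.x ≤ 0)) t.x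
    (nearN p j R L) with ⟨u, hu, h1, h2⟩ | ⟨h1, h2⟩
  · refine ⟨u, hu, ?_, h2⟩
    obtain ⟨k, hk, hkt⟩ := List.any_eq_true.1 h1
    simp only [dist_le_zero, decide_eq_true_eq] at hkt
    have hk' : k ∈ lev L (j + 1) := by
      rw [lev_succ]
      exact List.mem_flatMap.2 ⟨u, mem_lev_of_mem_nearN hu, hk⟩
    have := h.eq_of_center hk' (mem_lev_of_mem_nearN ht) hkt
    rw [Tree.pts_eq]
    exact List.mem_flatMap.2 ⟨k, hk, this ▸ hpt⟩
  · exfalso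
    rw [nearN_succ] at ht
    obtain ⟨u, hu, htu⟩ := List.mem_flatMap.1 (List.mem_filter.1 ht).1
    have h3 := h1 u hu
    rw [List.any_eq_false] at h3
    exact h3 t htu (by simp)

/-- Levels above level `k` have radii larger than the threshold and leave the choice alone. -/
theorem foldl_queryStep_above (hR : 0 < R) (p : X) (k : ℕ) (a : X × X) :
    (stackN p R L k).foldl (queryStep (R / 2 ^ k)) a = a := by
  have key : ∀ j ≤ k, ∀ a : X × X, (stackN p R L j).foldl (queryStep (R / 2 ^ k)) a = a := by
    intro j
    induction j with
    | zero => intro _ a; rfl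
    | succ j ih =>
      intro hj a
      rw [stackN, List.foldl_cons, queryStep, if_neg]
      · exact ih (by omega) a
      · simp only [not_le]
        exact div_lt_div_of_pos_left hR (by positivity)
          (pow_lt_pow_right₀ (by norm_num) (by omega))
  exact key k le_rfl a

/-- The center of the ancestor of `p` is carried upwards; whatever is picked below level `k` is
overwritten at level `k`. -/
theorem Stores.assigned_foldl (h : Stores r P R L) {p : X} {k : ℕ} (j : ℕ) (hkj : k < j)
    (a : X × X) (t : Tree X) (ht : t ∈ nearN p j R L) (hpt : p ∈ t.pts) (ha : a.1 = t.x) :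
    Assigned R L k p ((stackN p R L j).foldl (queryStep (R / 2 ^ k)) a).2 := by
  induction j generalizing a t with
  | zero => omega
  | succ j ih =>
    have hle : R / 2 ^ j ≤ R / 2 ^ k :=
      div_le_div_of_nonneg_left h.pos.le (by positivity) (pow_le_pow_right₀ (by norm_num) (by omega))
    obtain ⟨u, hu, hpu, hf⟩ := h.follow_spec ht hpt
    rw [stackN, List.foldl_cons, queryStep, if_pos hle]
    simp only [ha, hf]
    by_cases hj : k = j
    · subst hj
      rw [foldl_queryStep_above h.pos]
      exact h.assigned_pick (mem_lev_of_mem_nearN hu) hpu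
    · exact ih (by omega) _ u hu hpu rfl

theorem Stores.assigned_answer (h : Stores r P R L) {p : X} (hp : p ∈ P) {k n : ℕ} (hkn : k < n)
    (hG : maxg L = R / 2 ^ k) (hn : total (nearN p n R L) = 1) :
    Assigned R L k p (answer p R L n) := by
  have hR := h.pos
  obtain ⟨f, hf, hperm⟩ := (h.split_of_mem hp).nearN n
  rw [List.append_nil] at hperm
  obtain ⟨t, ht, htp, htx⟩ := hf.eq_singleton (by positivity) (hperm.mem_iff.2 (h.mem.2 hp)) hn
  rw [answer, hG]
  exact h.assigned_foldl n hkn _ t (by rw [ht]; simp) (by rw [htp]; simp) htx.symm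

/-- The maintained solution. -/
theorem Stores.approximation (hr : 2 ≤ r) (h : Stores r P R L) (hc : r ≤ P.card) (N : X → ℕ)
    (hN : ∀ p ∈ P, total (nearN p (N p) R L) = 1) :
    ∃ S : Clustering X, S.IsGather r P ∧ (S.cost : ℝ) ≤ 12 * maxg L ∧
      12 * maxg L ≤ 16 * (optCost r P : ℝ) ∧
      ∀ p ∈ P, ∃ i, p ∈ S.cluster i ∧ S.center i = answer p R L (N p) := by
  classical
  have hR := h.pos
  obtain ⟨p₀, hp₀⟩ : P.Nonempty := Finset.card_pos.1 (by omega)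
  -- `m` is the highest level with a bad node. It exists since the isolated node of any point is
  -- bad, and it is not the top level since top nodes see all points.
  obtain ⟨m, -, ⟨u, hu, hub⟩, hlt⟩ := exists_first
    (p := fun k => ∃ t ∈ lev L k, t.bad = true) (h.exists_bad hr hp₀ (hN p₀ hp₀))
  have hgood' : ∀ j < m, ∀ t ∈ lev L j, t.bad = false := by
    intro j hj t ht
    by_contra hb
    exact hlt j hj ⟨t, ht, by simpa using hb⟩
  obtain ⟨k, rfl⟩ : ∃ k, m = k + 1 := by
    refine Nat.exists_eq_succ_of_ne_zero fun hm => ?_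
    rw [hm] at hu
    rw [h.top_good hc u hu] at hub
    contradiction
  have hgood : ∀ j ≤ k, ∀ t ∈ lev L j, t.bad = false := fun j hj => hgood' j (by omega)
  have hG := h.hered.maxg_eq hR k hgood ⟨u, hu, hub⟩
  have hRk : 0 < R / 2 ^ k := by positivity
  have hans : ∀ p ∈ P, Assigned R L k p (answer p R L (N p)) := by
    intro p hp
    -- The isolated node of `p` is bad, so the descent to `p` ends below level `k` and passes
    -- through it.
    refine h.assigned_answer hp ?_ hG (hN p hp)
    by_contra hcon
    obtain ⟨t, ht, htb⟩ := h.exists_bad hr hp (hN p hp)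
    rw [hgood (N p) (by omega) t ht] at htb
    contradiction
  set F : List X := ((lev L k).filter Tree.flag).map Tree.x with hF
  have hFnd : F.Nodup := by
    have h1 : F.Pairwise fun x y => R / 2 ^ k < dist x y :=
      List.pairwise_map.2 ((h.hered k).sep.filter _)
    refine h1.imp fun {x y} h2 hxy => ?_
    rw [hxy, dist_self] at h2
    linarith
  have hFmem : ∀ f, f ∈ lev L k → f.flag = true → f.x ∈ F := fun f hf hff =>
    List.mem_map_of_mem (List.mem_filter.2 ⟨hf, hff⟩)
  let S : Clustering X :=
    { t := F.length
      cluster := fun i => P.filter fun p => answer p R L (N p) = F.get i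
      center := fun i => F.get i }
  have hcover : ∀ p ∈ P, ∃ i, p ∈ S.cluster i ∧ S.center i = answer p R L (N p) := by
    intro p hp
    obtain ⟨⟨f, hf, hff, hfx⟩, -⟩ := hans p hp
    obtain ⟨i, hi⟩ := List.get_of_mem (hFmem f hf hff)
    rw [hfx] at hi
    exact ⟨i, Finset.mem_filter.2 ⟨hp, hi.symm⟩, hi⟩
  have hgather : S.IsGather r P := by
    refine ⟨?_, ?_, ?_⟩
    · intro i j hij
      rw [Finset.disjoint_left]
      intro p hp hp'
      have h1 := (Finset.mem_filter.1 hp).2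
      have h2 := (Finset.mem_filter.1 hp').2
      exact hij (hFnd.injective_get (h1.symm.trans h2))
    · intro p
      exact ⟨fun hp => (hcover p hp).imp fun i hi => hi.1,
        fun ⟨i, hi⟩ => (Finset.mem_filter.1 hi).1⟩
    · intro i
      obtain ⟨f, hf, hfx⟩ := List.mem_map.1 (List.get_mem F i)
      obtain ⟨hf, hff⟩ := List.mem_filter.1 hf
      have h1 := (h.hered k).bad f hf
      rw [hgood k le_rfl f hf] at h1
      have h2 : r ≤ weight (R / 2 ^ k) (lev L k) f.x := by simpa using h1.symm
      rw [(h.hered k).weight_eq] at h2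
      -- The weight is the length of a list; it bounds the size of a set because no point occurs
      -- twice.
      have hnd : (ptsNear (R / 2 ^ k) (lev L k) f.x).Nodup := by
        refine (ptsNear_sublist f.x).nodup ?_
        rw [flatMap_pts_lev]
        exact h.nodup
      rw [← List.toFinset_card_of_nodup hnd] at h2
      refine h2.trans (Finset.card_le_card fun p hp => ?_)
      rw [List.mem_toFinset, mem_ptsNear] at hp
      obtain ⟨t, ht, htd, hpt⟩ := hp
      have hp : p ∈ P := (h.mem_lev k).1 ⟨t, ht, hpt⟩
      -- The node of such a point is within five radii of `f`, so the assignment was forced to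
      -- choose `f`.
      obtain ⟨-, t', ht', hpt', -, h3⟩ := hans p hp
      have htt := h.eq_of_mem_pts ht' ht hpt' hpt
      refine Finset.mem_filter.2 ⟨hp, ?_⟩
      rw [← h3 f hf hff (by rw [htt, dist_comm]; exact htd)]
      exact hfx
  refine ⟨S, hgather, ?_, ?_, hcover⟩
  · have h1 : S.cost ≤ (12 * maxg L).toNNReal := by
      refine Finset.sup_le fun i _ => Finset.sup_le fun p hp => ?_
      rw [← NNReal.coe_le_coe, coe_nndist, Real.coe_toNNReal _ (by
        have := maxg_nonneg L; positivity)]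
      obtain ⟨hp, hpi⟩ := Finset.mem_filter.1 hp
      obtain ⟨-, t, ht, hpt, htd, -⟩ := hans p hp
      have h2 := h.dist_lev ht hpt
      change dist p (F.get i) ≤ _
      rw [← hpi, hG]
      have h3 := dist_triangle p t.x (answer p R L (N p))
      linarith
    have h2 := NNReal.coe_le_coe.2 h1
    rwa [Real.coe_toNNReal _ (by have := maxg_nonneg L; positivity)] at h2
  · have h1 : (3 / 4 * (R / 2 ^ k)).toNNReal ≤ optCost r P := by
      -- `S` itself shows that there are solutions, so the infimum is not the default value `0` of
      -- the empty set.
      refine le_csInf ⟨_, S, hgather, rfl⟩ ?_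
      rintro c ⟨S', hS', rfl⟩
      rw [← NNReal.coe_le_coe, Real.coe_toNNReal _ (by positivity)]
      have h2 := h.lt_cost hu hub hS'
      have h3 : R / 2 ^ k = 2 * (R / 2 ^ (k + 1)) := by rw [pow_succ]; field_simp
      linarith
    have h2 := NNReal.coe_le_coe.2 h1
    rw [Real.coe_toNNReal _ (by positivity)] at h2
    rw [hG]
    linarith

end Approximation

/-! ### The programs of the algorithm -/

/-- Set up an empty forest. -/
def initI : List Instr := [.realConst 1 1, .natConst 8 1, .natConst 6 0, .natConst 4 3]

/-- Run `small` if the parameter is at most `1`, and `big` otherwise, after initialization. -/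
def guarded (small big : Prog) : Prog := .seq (block [.natConst 14 1])
  -- `N[4]` equals the zero register only before the first initialization; afterwards the heap
  -- pointer is odd.
  (.ite (.natLe 0 14) small (.seq (.ite (.natEq 4 2) (block initI) .skip) big))

/-- Evaluate an expression with the arguments `r`, `x`, `R` and `L`. -/
def withArgs (e : Fn) : Prog := .seq (block (newPtI 18)) (.seq (block (copyI 20 6))
  (.seq (block (copyI 22 8)) (.seq (block (copyI 24 0)) (.seq (block (copyI 26 2))
  (.seq (block (consI 28 20 26)) (.seq (block (consI 30 22 28)) (.seq (block (consI 32 18 30))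
  (.seq (block (consI 34 24 32)) (compile e 17)))))))))

/-- Store the new radius and top nodes. -/
def storeI : List Instr := .natLoad 8 36 :: (sndI 38 36 ++ [.natLoad 6 38])

/-- The algorithm. -/
def gatherAlg : DynAlg where
  insert := guarded .skip (.seq (withArgs insertE) (block storeI))
  delete := guarded .skip (.seq (withArgs deleteE) (block storeI))
  query := guarded (block [.realConst 0 0]) (.seq (block (copyI 18 6))
    (.seq (compile queryE 9) (block [.realLoad 0 20])))
  queryPoint := guarded (block [.realConst 0 0]) (.seq (withArgs (.comp queryPointE (.snd .env)))
    (block (.natLoad 38 36 :: .realLoad 0 38 :: (sndI 38 36 ++ [.ptLoad 0 38]))))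

section Machine

variable {X : Type*} [MetricSpace X] {r : ℕ} {P : Finset X} {R : ℝ} {L : List (Tree X)}
  {σ σ' : State X}

/-- The memory holds the forest `L` with top radius `R`. -/
structure Holds (r : ℕ) (R : ℝ) (L : List (Tree X)) (σ : State X) : Prop where
  param : σ.nat 0 = r
  proper : Proper σ
  radius : Rep σ (.real R) (σ.nat 8)
  roots : Rep σ (encL encT L) (σ.nat 6)

theorem Holds.post (h : Holds r R L σ) (hp : Post 8 σ σ') : Holds r R L σ' where
  param := by rw [hp.keep 0 (by omega) (by omega) (by omega) (by omega) (by omega), h.param]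
  proper := hp.proper
  radius := by
    rw [hp.keep 8 (by omega) (by omega) (by omega) (by omega) (by omega)]
    exact h.radius.mono hp.ext
  roots := by
    rw [hp.keep 6 (by omega) (by omega) (by omega) (by omega) (by omega)]
    exact h.roots.mono hp.ext

/-- The invariant of the memory between the operations. -/
def Mem (r : ℕ) (P : Finset X) (σ : State X) : Prop := σ.nat 0 = r ∧
  -- The first alternative is the untouched memory. For `r ≤ 1` no forest is kept, and only the
  -- parameter matters.
  (2 ≤ r → (σ.nat 4 = 0 ∧ σ.nat 2 = 0 ∧ P = ∅) ∨ ∃ R L, Good r P R L ∧ Holds r R L σ)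

theorem mem_initial : Mem r (∅ : Finset X) (State.initial X r) :=
  ⟨rfl, fun _ => Or.inl ⟨rfl, rfl, rfl⟩⟩

theorem Mem.setPt (h : Mem r P σ) (v : Option X) : Mem r P (σ.setPt 0 v) := by
  refine ⟨h.1, fun hr => ?_⟩
  rcases h.2 hr with h' | ⟨R, L, hG, hH⟩
  · exact Or.inl h'
  · exact Or.inr ⟨R, L, hG, hH.post (post_setPt hH.proper (by omega))⟩

theorem Mem.input (h : Mem r P σ) (o : Op X) : Mem r P (o.input σ) := by
  cases o
  · exact h.setPt _
  · exact h.setPt _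
  · exact h
  · exact h.setPt _

theorem good_nil : Good r (∅ : Finset X) 1 [] :=
  ⟨Stores.nil one_pos, fun h => by simp at h⟩

theorem exec_guarded_small (hr : r ≤ 1) (h : σ.nat 0 = r) {small big : Prog} {s k : ℕ}
    (hs : Exec small (σ.setNat 14 1) s k σ') : Exec (guarded small big) σ (s + 2) k σ' := by
  have h1 := exec_block [.natConst 14 1] σ
  have h2 : (Test.natLe 0 14).Holds (σ.setNat 14 1) := by
    simp [Test.Holds, State.setNat, h, hr]
  have := Exec.seq h1 (Exec.ite_true (q := .seq (.ite (.natEq 4 2) (block initI) .skip) big) h2 hs)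
  have e1 : [Instr.natConst 14 1].length + (1 + s) = s + 2 := by
    rw [List.length_singleton]
    omega
  have e2 : 0 + k = k := by omega
  rwa [e1, e2] at this

theorem exec_guarded_of_holds (hr : 2 ≤ r) (h : Holds r R L σ) (small big : Prog) :
    ∃ σ₁, Holds r R L σ₁ ∧ σ₁.pt = σ.pt ∧ ∀ s k σ', Exec big σ₁ s k σ' →
      ∃ s' ≤ s + 10, Exec (guarded small big) σ s' k σ' := by
  have h1 := exec_block [.natConst 14 1] σ
  have hP : Post 6 σ (σ.setNat 14 1) := by
    refine ⟨⟨le_rfl, ?_, fun _ _ _ => rfl, fun _ _ _ => rfl⟩, h.proper, ?_⟩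
    · intro a ha _
      simp only [State.setNat, Function.update_apply]
      rw [if_neg (by omega)]
    · intro a ha hl _ _ _
      simp only [State.setNat, Function.update_apply]
      rw [if_neg (by omega)]
  have hH : Holds r R L (σ.setNat 14 1) :=
    ⟨h.param, h.proper, h.radius.mono hP.ext, h.roots.mono hP.ext⟩
  refine ⟨σ.setNat 14 1, hH, rfl, fun s k σ' he => ?_⟩
  have h2 : ¬ (Test.natLe 0 14).Holds (σ.setNat 14 1) := by
    have h0 : (σ.setNat 14 1).nat 0 = r := h.param
    have h14 : (σ.setNat 14 1).nat 14 = 1 := by simp [State.setNat]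
    simp only [Test.Holds, h0, h14]
    omega
  have h3 : ¬ (Test.natEq 4 2).Holds (σ.setNat 14 1) := by
    have h4 := hH.proper.1
    have h5 := hH.proper.2
    simp only [Test.Holds, h4]
    intro h6
    rw [h6] at h5
    simp at h5
  have := Exec.seq h1 (Exec.ite_false (p := small) h2
    (Exec.seq (Exec.ite_false (p := block initI) h3 (Exec.skip _)) he))
  have e : 0 + (0 + k) = k := by omega
  rw [e] at this
  refine ⟨_, ?_, this⟩
  simp only [List.length_cons, List.length_nil]
  omega

theorem exec_guarded (hr : 2 ≤ r) (h : Mem r P σ) (small big : Prog) :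
    ∃ R L σ₁, Good r P R L ∧ Holds r R L σ₁ ∧ σ₁.pt = σ.pt ∧ ∀ s k σ', Exec big σ₁ s k σ' →
      ∃ s' ≤ s + 10, Exec (guarded small big) σ s' k σ' := by
  rcases h.2 hr with ⟨h4, h2, rfl⟩ | ⟨R, L, hG, hH⟩
  · have h1 := exec_block [.natConst 14 1] σ
    have hb := exec_block initI (σ.setNat 14 1)
    refine ⟨1, [], initI.foldl Instr.run (σ.setNat 14 1), good_nil,
      ⟨?_, ⟨?_, ?_⟩, ⟨?_, ?_, ?_⟩, ?_⟩, ?_, fun s k σ' he => ?_⟩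
    · simp [initI, Instr.run, State.setNat, State.setReal, h.1]
    · simp [initI, Instr.run, State.setNat, State.setReal, h2]
    · simp [initI, Instr.run, State.setNat, State.setReal]
    · simp [initI, Instr.run, State.setNat, State.setReal]
    · simp [initI, Instr.run, State.setNat, State.setReal]
    · simp [initI, Instr.run, State.setNat, State.setReal]
    · simp [initI, Instr.run, State.setNat, State.setReal, Rep]
    · simp [initI, Instr.run, State.setNat, State.setReal]
    · have h3 : ¬ (Test.natLe 0 14).Holds (σ.setNat 14 1) := by
        have h0 : (σ.setNat 14 1).nat 0 = r := h.1
        have h14 : (σ.setNat 14 1).nat 14 = 1 := by simp [State.setNat]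
        simp only [Test.Holds, h0, h14]
        omega
      have h5 : (Test.natEq 4 2).Holds (σ.setNat 14 1) := by
        simp [Test.Holds, State.setNat, h4, h2]
      have := Exec.seq h1 (Exec.ite_false (p := small) h3
        (Exec.seq (Exec.ite_true (q := .skip) h5 hb) he))
      have e : 0 + (0 + k) = k := by omega
      rw [e] at this
      refine ⟨_, ?_, this⟩
      simp only [initI, List.length_cons, List.length_nil]
      omega
  · obtain ⟨σ₁, h1⟩ := exec_guarded_of_holds hr hH small big
    exact ⟨R, L, σ₁, hG, h1⟩

theorem exec_copyI {d a b : ℕ} {v : Val X} (h : Proper σ) (hd : 8 ≤ d) (ha : a = 2 * d + 2)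
    (hv : Rep σ v (σ.nat b)) : ∃ σ', Exec (block (copyI a b)) σ 1 0 σ' ∧ Post d σ σ' ∧
      Rep σ' v (σ'.nat a) := by
  have h1 := exec_block (copyI a b) σ
  rw [foldl_copyI a b h] at h1
  have hp : Post d σ (σ.setNat a (σ.nat b)) := post_setNat h (by omega) (by omega) hd
  refine ⟨_, h1, hp, ?_⟩
  have : (σ.setNat a (σ.nat b)).nat a = σ.nat b := by simp [State.setNat]
  rw [this]
  exact hv.mono hp.ext

theorem exec_consI {d a b c : ℕ} {v w : Val X} (h : Proper σ) (hd : 8 ≤ d) (ha : a = 2 * d + 2)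
    (hb : b % 2 = 0) (hb16 : 16 ≤ b) (hc : c % 2 = 0) (hc16 : 16 ≤ c)
    (hv : Rep σ v (σ.nat b)) (hw : Rep σ w (σ.nat c)) :
    ∃ σ', Exec (block (consI a b c)) σ 7 0 σ' ∧ Post d σ σ' ∧ Rep σ' (.pair v w) (σ'.nat a) := by
  have h1 := exec_block (consI a b c) σ
  obtain ⟨h2, h3, -⟩ := rep_consI (d := d) (a := a) h hd (by omega) hb hc (by omega) hb16 hc16 hv hw
  exact ⟨_, h1, h2, h3⟩

theorem Post.rep {d a : ℕ} {v : Val X} (h : Post d σ σ') (ha : a % 2 = 0) (ha16 : 16 ≤ a)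
    (had : a ≤ 2 * d) (hv : Rep σ v (σ.nat a)) : Rep σ' v (σ'.nat a) := by
  rw [h.keep a ha had (by omega) (by omega) (by omega)]
  exact hv.mono h.ext

theorem computes_withArgs {x : X} (h : Holds r R L σ) (hx : σ.pt 0 = some x) {e : Fn} {w : Val X}
    (hw : run e (.pair (.nat r) (.pair (.pt x) (.pair (.real R) (.pair (encL encT L) (.nat 0))))) =
      some w) : ∃ s k σ', Exec (withArgs e) σ s k σ' ∧
        s + k ≤ 40 + 20 * cost e (.pair (.nat r) (.pair (.pt x) (.pair (.real R)
          (.pair (encL encT L) (.nat 0))))) ∧ Post 8 σ σ' ∧ Rep σ' w (σ'.nat 36) := by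
  have h1 := exec_block (newPtI 18) σ
  obtain ⟨p1, r1⟩ := rep_newPtI (d := 8) (a := 18) h.proper (by omega) (by omega) (by omega) hx
  set σ₁ := (newPtI 18).foldl Instr.run σ
  have H1 := h.post p1
  obtain ⟨σ₂, h2, p2, r2⟩ := exec_copyI (d := 9) (a := 20) (b := 6) H1.proper (by omega) (by omega)
    H1.roots
  have H2 := H1.post (p2.mono (by omega))
  obtain ⟨σ₃, h3, p3, r3⟩ := exec_copyI (d := 10) (a := 22) (b := 8) H2.proper (by omega) (by omega)
    H2.radius
  have H3 := H2.post (p3.mono (by omega))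
  obtain ⟨σ₄, h4, p4, r4⟩ := exec_copyI (d := 11) (a := 24) (b := 0) (v := .nat r) H3.proper
    (by omega) (by omega) (by rw [H3.param]; exact rfl)
  have H4 := H3.post (p4.mono (by omega))
  obtain ⟨σ₅, h5, p5, r5⟩ := exec_copyI (d := 12) (a := 26) (b := 2) (v := .nat 0) H4.proper
    (by omega) (by omega) H4.proper.1
  have H5 := H4.post (p5.mono (by omega))
  have r2' := p5.rep (by omega) (by omega) (by omega)
    (p4.rep (by omega) (by omega) (by omega) (p3.rep (by omega) (by omega) (by omega) r2))
  obtain ⟨σ₆, h6, p6, r6⟩ := exec_consI (d := 13) (a := 28) H5.proper (by omega) (by omega)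
    (by omega) (by omega) (by omega) (by omega) r2' r5
  have r3' := p6.rep (by omega) (by omega) (by omega) (p5.rep (by omega) (by omega) (by omega)
    (p4.rep (by omega) (by omega) (by omega) r3))
  obtain ⟨σ₇, h7, p7, r7⟩ := exec_consI (d := 14) (a := 30) p6.proper (by omega) (by omega)
    (by omega) (by omega) (by omega) (by omega) r3' r6
  have r1' := p7.rep (by omega) (by omega) (by omega) (p6.rep (by omega) (by omega) (by omega)
    (p5.rep (by omega) (by omega) (by omega) (p4.rep (by omega) (by omega) (by omega)
      (p3.rep (by omega) (by omega) (by omega) (p2.rep (by omega) (by omega) (by omega) r1)))))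
  obtain ⟨σ₈, h8, p8, r8⟩ := exec_consI (d := 15) (a := 32) p7.proper (by omega) (by omega)
    (by omega) (by omega) (by omega) (by omega) r1' r7
  have r4' := p8.rep (by omega) (by omega) (by omega) (p7.rep (by omega) (by omega) (by omega)
    (p6.rep (by omega) (by omega) (by omega) (p5.rep (by omega) (by omega) (by omega) r4)))
  obtain ⟨σ₉, h9, p9, r9⟩ := exec_consI (d := 16) (a := 34) p8.proper (by omega) (by omega)
    (by omega) (by omega) (by omega) (by omega) r4' r8
  obtain ⟨s, k, σ', he, hs, hp, hr⟩ := compile_spec e (d := 17) (by omega) p9.proper r9 hw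
  refine ⟨_, _, σ', .seq h1 (.seq h2 (.seq h3 (.seq h4 (.seq h5 (.seq h6 (.seq h7 (.seq h8
    (.seq h9 he)))))))), ?_, ?_, hr⟩
  · simp only [newPtI, List.length]
    omega
  · exact p1.trans <| (p2.mono (by omega)).trans <| (p3.mono (by omega)).trans <|
      (p4.mono (by omega)).trans <| (p5.mono (by omega)).trans <| (p6.mono (by omega)).trans <|
      (p7.mono (by omega)).trans <| (p8.mono (by omega)).trans <| (p9.mono (by omega)).trans <|
      hp.mono (by omega)

theorem exec_storeI (hr : σ.nat 0 = r) (h : Proper σ) {s : ℝ × List (Tree X)}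
    (hs : Rep σ (encO s) (σ.nat 36)) :
    ∃ σ', Exec (block storeI) σ 5 0 σ' ∧ Holds r s.1 s.2 σ' := by
  have h1 := exec_block storeI σ
  set σ' := storeI.foldl Instr.run σ with hσ'
  obtain ⟨e1, e2, e3, e4, e5, e6, e7⟩ := hs
  have hn : ∀ e, σ'.nat e = if e = 6 then σ.nat (σ.nat (σ.nat 36 + 2)) else
      if e = 38 then σ.nat (σ.nat 36 + 2) else if e = 12 then σ.nat 36 + 2 else
      if e = 10 then 2 else if e = 8 then σ.nat (σ.nat 36) else σ.nat e := by
    intro e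
    have n1 : σ.nat 36 + 2 ≠ 8 := by omega
    have n2 : σ.nat 36 + 2 ≠ 10 := by omega
    have n3 : σ.nat 36 + 2 ≠ 12 := by omega
    have n4 : σ.nat (σ.nat 36 + 2) ≠ 8 := by omega
    have n5 : σ.nat (σ.nat 36 + 2) ≠ 10 := by omega
    have n6 : σ.nat (σ.nat 36 + 2) ≠ 12 := by omega
    have n7 : σ.nat (σ.nat 36 + 2) ≠ 38 := by omega
    simp only [hσ', storeI, sndI, List.cons_append, List.nil_append, List.foldl, Instr.run,
      State.setNat, Function.update_apply]
    simp [n1, n2, n3, n4, n5, n6, n7]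
  have hreal : σ'.real = σ.real := by
    simp [hσ', storeI, sndI, Instr.run, State.setNat]
  have hpt : σ'.pt = σ.pt := by
    simp [hσ', storeI, sndI, Instr.run, State.setNat]
  have hext : Ext σ σ' := by
    refine ⟨?_, ?_, fun _ _ _ => by rw [hreal], fun _ _ _ => by rw [hpt]⟩
    · rw [hn]; simp
    · intro a ha _; rw [hn]; split_ifs <;> omega
  refine ⟨σ', h1, ⟨by rw [hn]; simpa using hr, ⟨by rw [hn]; simpa using h.1,
    by rw [hn]; simpa using h.2⟩, ?_, ?_⟩⟩
  · have : σ'.nat 8 = σ.nat (σ.nat 36) := by rw [hn]; simp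
    rw [this]
    exact Rep.mono hext e3
  · have : σ'.nat 6 = σ.nat (σ.nat (σ.nat 36 + 2)) := by rw [hn]; simp
    rw [this]
    exact Rep.mono hext e6

end Machine

/-! ### Every operation -/

section Operations

variable {X : Type*} [MetricSpace X] {r : ℕ} {P : Finset X} {R : ℝ} {L : List (Tree X)}
  {σ : State X} {d Δ : ℝ}

/-- A bound for the time of all operations. -/
noncomputable def opTime (d Δ : ℝ) : ℕ := 300000 * (depth Δ + 1) * packing d ^ 2

/-- Here `280000 = 20 * 2 * 7000`, from the overhead of compilation, the two phases of an update and
the cost of a level. The rest up to `300000` absorbs additive constants. -/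
theorem le_opTime (hd : 0 ≤ d) {a n : ℕ} (hn : n ≤ 280000 * (depth Δ + 1) * packing d ^ 2)
    (ha : a ≤ 1000) : a + n ≤ opTime d Δ := by
  have h1 : 1 ≤ packing d ^ 2 := Nat.one_le_pow _ _ (one_le_packing hd)
  have h2 : 1 ≤ (depth Δ + 1) * packing d ^ 2 := Nat.mul_pos (by omega) h1
  rw [opTime, mul_assoc]
  rw [mul_assoc] at hn
  omega

theorem exec_update {x : X} (hr : 2 ≤ r) (hd : 0 ≤ d) (hM : Mem r P σ) (hx : σ.pt 0 = some x)
    {P' : Finset X} {e : Fn} (he : ∀ R L, Good r P R L → ∃ s : ℝ × List (Tree X),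
      run e (.pair (.nat r) (.pair (.pt x) (.pair (.real R)
        (.pair (encL encT L) (.nat 0))))) = some (encO s) ∧
      cost e (.pair (.nat r) (.pair (.pt x) (.pair (.real R)
        (.pair (encL encT L) (.nat 0))))) ≤ (2 * depth Δ + 2) * (7000 * packing d ^ 2) ∧
      Good r P' s.1 s.2) :
    ∃ s k σ', Exec (guarded .skip (.seq (withArgs e) (block storeI))) σ s k σ' ∧
      s + k ≤ opTime d Δ ∧ Mem r P' σ' := by
  obtain ⟨R, L, σ₁, hG, hH, hpt, hex⟩ := exec_guarded hr hM .skip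
    (.seq (withArgs e) (block storeI))
  obtain ⟨s, hrun, hcost, hG'⟩ := he R L hG
  obtain ⟨s₁, k₁, σ₂, he₂, hs₂, hp₂, hr₂⟩ := computes_withArgs hH (by rw [hpt]; exact hx) hrun
  have hH₂ := hH.post hp₂
  obtain ⟨σ₃, he₃, hH₃⟩ := exec_storeI hH₂.param hH₂.proper hr₂
  obtain ⟨s', hs', hfin⟩ := hex _ _ _ (.seq he₂ he₃)
  refine ⟨s', _, σ₃, hfin, ?_, hH₃.param, fun _ => Or.inr ⟨_, _, hG', hH₃⟩⟩
  refine le_trans ?_ (le_opTime (a := 60) (n := 20 * ((2 * depth Δ + 2) * (7000 * packing d ^ 2))) hd ?_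
    (by omega))
  · omega
  · nlinarith [Nat.zero_le (packing d ^ 2), Nat.zero_le (depth Δ * packing d ^ 2)]

theorem exec_query (hX : DoublingDimLE X d) (hd : 0 ≤ d) (hG : Good r P R L)
    {σ₁ : State X} (hH : Holds r R L σ₁) : ∃ s k σ', Exec (.seq (block (copyI 18 6))
      (.seq (compile queryE 9) (block [.realLoad 0 20]))) σ₁ s k σ' ∧
      s + k + 10 ≤ opTime d Δ ∧ Holds r R L σ' ∧ σ'.real 0 = 12 * maxg L := by
  obtain ⟨σ₂, he₂, hp₂, hr₂⟩ := exec_copyI (d := 8) (a := 18) (b := 6) hH.proper (by omega)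
    (by omega) hH.roots
  obtain ⟨s, k, σ₃, he₃, hs₃, hp₃, hr₃⟩ := compile_spec queryE (d := 9) (by omega) hp₂.proper hr₂
    run_queryE
  have he₄ := exec_block [.realLoad 0 20] σ₃
  have hp₄ : Post 8 σ₃ (σ₃.setReal 0 (σ₃.real (σ₃.nat 20))) := post_setReal hp₃.proper (by omega)
  refine ⟨_, _, _, .seq he₂ (.seq he₃ he₄), ?_,
    ((hH.post hp₂).post (hp₃.mono (by omega))).post hp₄, ?_⟩
  · have h1 := cost_queryE_le (X := X) (L := L)
    have h2 := (hG.small hX).1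
    have h3 : packing d ≤ packing d ^ 2 := Nat.le_self_pow (by norm_num) _
    have h4 := le_opTime (d := d) (Δ := Δ) (a := 300) (n := 600 * packing d ^ 2) hd (by
      nlinarith [Nat.zero_le (packing d ^ 2), Nat.zero_le (depth Δ * packing d ^ 2)]) (by omega)
    simp only [List.length]
    omega
  · simp only [List.foldl, Instr.run, State.setReal, Function.update_self]
    exact hr₃.2.2

theorem exec_queryPoint (hX : DoublingDimLE X d) (hd : 0 ≤ d) (hΔ : 1 ≤ Δ)
    (hG : Good r P R L) {x : X} (hx : x ∈ P) (ha : AspectLE Δ P)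
    {σ₁ : State X} (hH : Holds r R L σ₁) (hpt : σ₁.pt 0 = some x) :
    ∃ s k σ', Exec (.seq (withArgs (.comp queryPointE (.snd .env)))
      (block (.natLoad 38 36 :: .realLoad 0 38 :: (sndI 38 36 ++ [.ptLoad 0 38])))) σ₁ s k σ' ∧
      s + k + 10 ≤ opTime d Δ ∧ Holds r R L σ' ∧ σ'.real 0 = 12 * maxg L ∧
      ∃ n, total (nearN x n R L) = 1 ∧ (∀ k < n, total (nearN x k R L) ≠ 1) ∧
        σ'.pt 0 = some (answer x R L n) := by
  obtain ⟨n, h1, h2, hcost⟩ := hG.queryPointE hX hd hΔ hx ha (v := .nat 0)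
  have hrun := run_queryPointE (v := .nat 0) h1 h2
  have hcost' : cost (.comp queryPointE (.snd .env)) (.pair (.nat r) (.pair (.pt x)
      (.pair (.real R) (.pair (encL encT L) (.nat 0))))) ≤
        3 + (depth Δ + 1) * (1000 * packing d ^ 2) := by
    simp only [cost, run, Option.elim_some]
    omega
  obtain ⟨s, k, σ₂, he₂, hs₂, hp₂, hr₂⟩ := computes_withArgs hH hpt
    (e := .comp queryPointE (.snd .env)) (by simp only [run, Option.bind_some]; exact hrun)
  have he₃ := exec_block (.natLoad 38 36 :: .realLoad 0 38 :: (sndI 38 36 ++ [.ptLoad 0 38])) σ₂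
  set σ₃ := (Instr.natLoad 38 36 :: .realLoad 0 38 :: (sndI 38 36 ++ [.ptLoad 0 38])).foldl
    Instr.run σ₂ with hσ₃
  obtain ⟨e1, e2, ⟨e3, e4, e5⟩, e6, e7, e8⟩ := hr₂
  have hn : ∀ e, σ₃.nat e = if e = 38 then σ₂.nat (σ₂.nat 36 + 2) else
      if e = 12 then σ₂.nat 36 + 2 else if e = 10 then 2 else σ₂.nat e := by
    intro e
    have n1 : σ₂.nat 36 + 2 ≠ 38 := by omega
    have n2 : σ₂.nat 36 + 2 ≠ 10 := by omega
    have n3 : σ₂.nat 36 + 2 ≠ 12 := by omega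
    simp only [hσ₃, sndI, List.cons_append, List.nil_append, List.foldl, Instr.run,
      State.setNat, State.setReal, State.setPt, Function.update_apply]
    simp [n1, n2, n3]
    split_ifs <;> rfl
  have hreal : ∀ e, σ₃.real e = if e = 0 then 12 * maxg L else σ₂.real e := by
    intro e
    have n1 : σ₂.nat 36 ≠ 38 := by omega
    simp only [hσ₃, sndI, List.cons_append, List.nil_append, List.foldl, Instr.run,
      State.setNat, State.setReal, State.setPt, Function.update_apply]
    simp [e5]
  have hpt₃ : ∀ e, σ₃.pt e = if e = 0 then some (answer x R L n) else σ₂.pt e := by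
    intro e
    have n1 : σ₂.nat 36 + 2 ≠ 38 := by omega
    have n2 : σ₂.nat 36 + 2 ≠ 10 := by omega
    have n3 : σ₂.nat 36 + 2 ≠ 12 := by omega
    simp only [hσ₃, sndI, List.cons_append, List.nil_append, List.foldl, Instr.run,
      State.setNat, State.setReal, State.setPt, Function.update_apply]
    simp [n1, n2, n3, e8]
  have hp₃ : Post 8 σ₂ σ₃ := by
    refine ⟨⟨?_, ?_, ?_, ?_⟩, ⟨?_, ?_⟩, ?_⟩
    · rw [hn]; simp
    · intro a ha _; rw [hn]; split_ifs <;> omega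
    · intro a ha _; rw [hreal, if_neg (by omega)]
    · intro a ha _; rw [hpt₃, if_neg (by omega)]
    · rw [hn]; simpa using hp₂.proper.1
    · rw [hn]; simpa using hp₂.proper.2
    · intro a ha hl _ _ _; rw [hn]; split_ifs <;> omega
  refine ⟨_, _, σ₃, .seq he₂ he₃, ?_, (hH.post hp₂).post hp₃, by rw [hreal, if_pos rfl],
    n, h1, h2, by rw [hpt₃, if_pos rfl]⟩
  have h4 := le_opTime (d := d) (Δ := Δ) (a := 300)
    (n := 20 * ((depth Δ + 1) * (1000 * packing d ^ 2))) hd (by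
      nlinarith [Nat.zero_le (packing d ^ 2), Nat.zero_le (depth Δ * packing d ^ 2)]) (by omega)
  simp only [sndI, List.length, List.cons_append, List.nil_append]
  omega

/-- The memory after a query, for the parameter `1`. -/
theorem exec_guarded_query_small (hr : r ≤ 1) (h : σ.nat 0 = r) (big : Prog) :
    ∃ s k σ', Exec (guarded (block [.realConst 0 0]) big) σ s k σ' ∧ s + k ≤ 10 ∧
      σ'.nat 0 = r ∧ σ'.real 0 = 0 ∧ σ'.pt = σ.pt := by
  have h1 := exec_block [.realConst 0 0] (σ.setNat 14 1)
  refine ⟨_, _, _, exec_guarded_small hr h h1, by simp, ?_, ?_, ?_⟩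
  · simpa [Instr.run, State.setReal, State.setNat] using h
  · simp [Instr.run, State.setReal, State.setNat]
  · simp [Instr.run, State.setReal, State.setNat]

/-- Every operation takes little time and preserves the invariant. -/
theorem exec_op (hX : DoublingDimLE X d) (hd : 0 ≤ d) (hΔ : 1 ≤ Δ) (hM : Mem r P σ) (o : Op X)
    (hl : o.Legal P) (ha : AspectLE Δ P) (ha' : AspectLE Δ (o.next P)) :
    ∃ s k σ', Exec (gatherAlg.prog o) (o.input σ) s k σ' ∧ s + k ≤ opTime d Δ ∧
      Mem r (o.next P) σ' := by
  have hM' := hM.input o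
  by_cases hr : r ≤ 1
  · have hop : 10 ≤ opTime d Δ := le_opTime (a := 10) (n := 0) hd (by omega) (by omega)
    have hupd : ∀ e P', ∃ s k σ', Exec (guarded .skip (.seq (withArgs e) (block storeI)))
        (o.input σ) s k σ' ∧ s + k ≤ opTime d Δ ∧ Mem r P' σ' := fun e P' =>
      ⟨_, _, _, exec_guarded_small hr hM'.1 (.skip _), by omega, hM'.1, fun h => by omega⟩
    cases o with
    | insert p => exact hupd _ _
    | delete p => exact hupd _ _
    | query =>
      obtain ⟨s, k, σ', h1, h2, h3, -⟩ := exec_guarded_query_small hr hM'.1 _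
      exact ⟨s, k, σ', h1, h2.trans hop, h3, fun h => by omega⟩
    | queryPoint p =>
      obtain ⟨s, k, σ', h1, h2, h3, -⟩ := exec_guarded_query_small hr hM'.1 _
      exact ⟨s, k, σ', h1, h2.trans hop, h3, fun h => by omega⟩
  · have hr : 2 ≤ r := by omega
    cases o with
    | insert p =>
      exact exec_update (x := p) hr hd hM' (by simp [Op.input, State.setPt]) fun R L hG =>
        hG.insertE hX hd hr hΔ hl ha'
    | delete p =>
      exact exec_update (x := p) hr hd hM' (by simp [Op.input, State.setPt]) fun R L hG =>
        hG.deleteE hX hd hΔ hl ha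
    | query =>
      obtain ⟨R, L, σ₁, hG, hH, -, hex⟩ := exec_guarded hr hM' (block [.realConst 0 0]) _
      obtain ⟨s, k, σ', h1, h2, h3, -⟩ := exec_query (Δ := Δ) hX hd hG hH
      obtain ⟨s', hs', h4⟩ := hex _ _ _ h1
      exact ⟨s', k, σ', h4, by omega, h3.param, fun _ => Or.inr ⟨R, L, hG, h3⟩⟩
    | queryPoint p =>
      obtain ⟨R, L, σ₁, hG, hH, hpt, hex⟩ := exec_guarded hr hM' (block [.realConst 0 0]) _
      obtain ⟨s, k, σ', h1, h2, h3, -⟩ := exec_queryPoint hX hd hΔ hG hl ha hH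
        (by rw [hpt]; simp [Op.input, State.setPt])
      obtain ⟨s', hs', h4⟩ := hex _ _ _ h1
      exact ⟨s', k, σ', h4, by omega, h3.param, fun _ => Or.inr ⟨R, L, hG, h3⟩⟩

/-! ### Sequences of operations -/

omit [MetricSpace X] in
theorem pointSet_snoc (h : List (Op X)) (o : Op X) : pointSet (h ++ [o]) = o.next (pointSet h) := by
  simp [pointSet]

theorem Admissible.of_snoc {h : List (Op X)} {o : Op X} (hA : Admissible Δ (h ++ [o])) :
    Admissible Δ h ∧ o.Legal (pointSet h) ∧ AspectLE Δ (pointSet (h ++ [o])) := by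
  generalize he : h ++ [o] = l at hA
  cases hA with
  | nil => simp at he
  | snoc hh legal aspect =>
    obtain ⟨rfl, he'⟩ := List.append_inj' he rfl
    obtain rfl := List.singleton_inj.1 he'
    exact ⟨hh, legal, aspect⟩

theorem Admissible.aspectLE {h : List (Op X)} (hA : Admissible Δ h) : AspectLE Δ (pointSet h) := by
  cases hA with
  | nil => intro x hx; simp [pointSet] at hx
  | snoc hh legal aspect => exact aspect

theorem Run.of_snoc {A : DynAlg} {h : List (Op X)} {o : Op X} {σ' : State X}
    (hR : Run A r (h ++ [o]) σ') :
    ∃ σ s k, Run A r h σ ∧ Exec (A.prog o) (o.input σ) s k σ' := by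
  generalize he : h ++ [o] = l at hR
  cases hR with
  | nil => simp at he
  | snoc hh ho =>
    obtain ⟨rfl, he'⟩ := List.append_inj' he rfl
    obtain rfl := List.singleton_inj.1 he'
    exact ⟨_, _, _, hh, ho⟩

theorem exists_run (hX : DoublingDimLE X d) (hd : 0 ≤ d) (hΔ : 1 ≤ Δ) {h : List (Op X)}
    (hA : Admissible Δ h) : ∃ σ, Run gatherAlg r h σ ∧ Mem r (pointSet h) σ := by
  induction hA with
  | nil => exact ⟨_, .nil, mem_initial⟩
  | snoc hh legal aspect ih =>
    obtain ⟨σ, hR, hM⟩ := ih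
    rw [pointSet_snoc] at aspect ⊢
    obtain ⟨s, k, σ', h1, -, h2⟩ := exec_op hX hd hΔ hM _ legal hh.aspectLE aspect
    exact ⟨σ', .snoc hR h1, h2⟩

/-- The run constructed in `exists_run` satisfies the invariant, and by determinism it is the only
one. -/
theorem mem_of_run (hX : DoublingDimLE X d) (hd : 0 ≤ d) (hΔ : 1 ≤ Δ) {h : List (Op X)}
    (hA : Admissible Δ h) (hR : Run gatherAlg r h σ) : Mem r (pointSet h) σ := by
  obtain ⟨σ', hR', hM⟩ := exists_run (r := r) hX hd hΔ hA
  rwa [hR.deterministic hR']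

omit [MetricSpace X] in
theorem next_of_not_isUpdate {o : Op X} (h : ¬ o.IsUpdate) (P : Finset X) : o.next P = P := by
  cases o
  · exact absurd trivial h
  · exact absurd trivial h
  · rfl
  · rfl

theorem pointSet_queries {h Q : List (Op X)} (hQ : ∀ o ∈ Q, ¬ o.IsUpdate) :
    pointSet (h ++ Q) = pointSet h := by
  induction Q using List.reverseRecOn with
  | nil => simp
  | append_singleton Q o ih =>
    rw [← List.append_assoc, pointSet_snoc, next_of_not_isUpdate (hQ o (by simp)),
      ih fun o ho => hQ o (by simp [ho])]

/-- A query answers from the forest, and does not change it. -/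
theorem exec_query_op (hX : DoublingDimLE X d) (hd : 0 ≤ d) (hΔ : 1 ≤ Δ) (hr : 2 ≤ r)
    (hG : Good r P R L) (hH : Holds r R L σ) (ha : AspectLE Δ P) {o : Op X} (ho : ¬ o.IsUpdate)
    (hl : o.Legal P) {s k : ℕ} {σ' : State X} (he : Exec (gatherAlg.prog o) (o.input σ) s k σ') :
    Holds r R L σ' ∧ σ'.real 0 = 12 * maxg L ∧ ∀ p, o = .queryPoint p →
      ∃ n, total (nearN p n R L) = 1 ∧ (∀ k < n, total (nearN p k R L) ≠ 1) ∧
        σ'.pt 0 = some (answer p R L n) := by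
  cases o with
  | insert p => exact absurd trivial ho
  | delete p => exact absurd trivial ho
  | query =>
    obtain ⟨σ₁, hH₁, -, hex⟩ := exec_guarded_of_holds hr hH (block [.realConst 0 0]) _
    obtain ⟨s₁, k₁, σ₂, h1, -, h2, h3⟩ := exec_query (Δ := Δ) hX hd hG hH₁
    obtain ⟨s', -, h4⟩ := hex _ _ _ h1
    obtain ⟨-, -, rfl⟩ := he.deterministic h4
    exact ⟨h2, h3, fun p hp => by cases hp⟩
  | queryPoint p =>
    have hH' : Holds r R L ((Op.queryPoint p).input σ) :=
      hH.post (post_setPt hH.proper (by omega))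
    obtain ⟨σ₁, hH₁, hpt, hex⟩ := exec_guarded_of_holds hr hH' (block [.realConst 0 0]) _
    obtain ⟨s₁, k₁, σ₂, h1, -, h2, h3, h5⟩ := exec_queryPoint hX hd hΔ hG hl ha hH₁
        (by rw [hpt]; simp [Op.input, State.setPt])
    obtain ⟨s', -, h4⟩ := hex _ _ _ h1
    obtain ⟨-, -, rfl⟩ := he.deterministic h4
    refine ⟨h2, h3, fun q hq => ?_⟩
    cases hq
    exact h5

/-- Queries leave the forest as it is, which is why all queries before the next update answer from
the same solution. -/
theorem holds_of_queries (hX : DoublingDimLE X d) (hd : 0 ≤ d) (hΔ : 1 ≤ Δ) (hr : 2 ≤ r)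
    {h Q : List (Op X)} (hG : Good r (pointSet h) R L) (hσ : ∀ σ, Run gatherAlg r h σ → Holds r R L σ)
    (hQ : ∀ o ∈ Q, ¬ o.IsUpdate) (hA : Admissible Δ (h ++ Q)) :
    ∀ σ, Run gatherAlg r (h ++ Q) σ → Holds r R L σ := by
  induction Q using List.reverseRecOn with
  | nil => simpa using hσ
  | append_singleton Q o ih =>
    intro σ hR
    rw [← List.append_assoc] at hR hA
    obtain ⟨hA', hl, -⟩ := hA.of_snoc
    obtain ⟨σ₀, s, k, hR', he⟩ := hR.of_snoc
    have hQ' : ∀ o ∈ Q, ¬ o.IsUpdate := fun o ho => hQ o (by simp [ho])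
    have hH := ih hQ' hA' σ₀ hR'
    rw [pointSet_queries hQ'] at hl
    have ha := hA'.aspectLE
    rw [pointSet_queries hQ'] at ha
    exact (exec_query_op hX hd hΔ hr hG hH ha (hQ o (by simp)) hl he).1

/-- The solution for the parameter `1`: every point is a cluster. -/
theorem exists_singletons (P : Finset X) : ∃ S : Clustering X, S.IsGather 1 P ∧ S.cost = 0 ∧
    ∀ p ∈ P, ∃ i, p ∈ S.cluster i ∧ S.center i = p := by
  classical
  let S : Clustering X :=
    { t := P.toList.length
      cluster := fun i => {P.toList.get i}
      center := fun i => P.toList.get i }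
  have hcover : ∀ p ∈ P, ∃ i, p ∈ S.cluster i ∧ S.center i = p := by
    intro p hp
    obtain ⟨i, hi⟩ := List.get_of_mem (Finset.mem_toList.2 hp)
    exact ⟨i, Finset.mem_singleton.2 hi.symm, hi⟩
  refine ⟨S, ⟨?_, ?_, ?_⟩, ?_, hcover⟩
  · intro i j hij
    rw [Finset.disjoint_singleton]
    exact fun h => hij (P.nodup_toList.injective_get h)
  · intro p
    refine ⟨fun hp => (hcover p hp).imp fun i hi => hi.1, fun ⟨i, hi⟩ => ?_⟩
    rw [Finset.mem_singleton.1 hi]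
    exact Finset.mem_toList.1 (List.get_mem _ _)
  · intro i
    simp [S]
  · refine le_antisymm (Finset.sup_le fun i _ => Finset.sup_le fun p hp => ?_) bot_le
    rw [Finset.mem_singleton.1 hp]
    exact (nndist_self _).le

/-! ### The time bound -/

/-- Since `log 68 ≤ 7`, the rounding and the two extra levels give at most `log Δ + 10`; this is at
most `6 log Δ` because `log Δ ≥ 2`. -/
theorem depth_le (hΔ : 4 ≤ Δ) : (depth Δ : ℝ) + 1 ≤ 6 * Real.logb 2 Δ := by
  have h1 : 2 ≤ Real.logb 2 Δ := by
    rw [Real.le_logb_iff_rpow_le (by norm_num) (by linarith)]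
    norm_num
    exact hΔ
  have h2 : Real.logb 2 68 ≤ 7 := by
    rw [Real.logb_le_iff_le_rpow (by norm_num) (by norm_num)]
    norm_num
  have h3 : Real.logb 2 (68 * Δ) = Real.logb 2 68 + Real.logb 2 Δ :=
    Real.logb_mul (by norm_num) (by linarith)
  have h4 : 0 ≤ Real.logb 2 (68 * Δ) := Real.logb_nonneg (by norm_num) (by linarith)
  have h5 := Nat.ceil_lt_add_one h4
  rw [depth]
  push_cast
  linarith

/-- The constant is `6 * 300000`. The exponent needs only `12 * d`, but one constant `K` has to
serve in both places. -/
theorem opTime_le (hd : 0 ≤ d) (hΔ : 4 ≤ Δ) :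
    (opTime d Δ : ℝ) ≤ 1800000 * (2 : ℝ) ^ ((1800000 : ℝ) * d) * Real.logb 2 Δ := by
  have h1 := depth_le hΔ
  have h2 : (packing d : ℝ) ^ 2 ≤ (2 : ℝ) ^ ((1800000 : ℝ) * d) := by
    calc (packing d : ℝ) ^ 2 ≤ (((2 : ℝ) ^ d) ^ 6) ^ 2 :=
          pow_le_pow_left₀ (by positivity) (packing_le d) 2
      _ = (2 : ℝ) ^ (12 * d) := by
          rw [← pow_mul, ← Real.rpow_natCast, ← Real.rpow_mul (by norm_num)]
          norm_num [mul_comm]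
      _ ≤ (2 : ℝ) ^ ((1800000 : ℝ) * d) :=
          Real.rpow_le_rpow_of_exponent_le (by norm_num) (by nlinarith)
  have h3 : 0 ≤ Real.logb 2 Δ := Real.logb_nonneg (by norm_num) (by linarith)
  rw [opTime]
  push_cast
  calc (300000 : ℝ) * (depth Δ + 1) * packing d ^ 2
      ≤ 300000 * (6 * Real.logb 2 Δ) * (2 : ℝ) ^ ((1800000 : ℝ) * d) := by gcongr
    _ = 1800000 * (2 : ℝ) ^ ((1800000 : ℝ) * d) * Real.logb 2 Δ := by ring

/-- The algorithm needs only one factor `log Δ`. The remaining factors of the bound are at least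
`1`, since `Δ ≥ 4` gives `log Δ ≥ 2` and `log log Δ ≥ 1`. -/
theorem le_timeBound (hd : 0 ≤ d) (hr : 1 ≤ r) (hΔ : 4 ≤ Δ) {τ : ℝ} (hτ : 1 ≤ τ) {s k : ℕ}
    (h : s + k ≤ opTime d Δ) (o : Op X) :
    (s : ℝ) + k * τ ≤ timeBound 1800000 r d Δ τ o := by
  have h1 : 2 ≤ Real.logb 2 Δ := by
    rw [Real.le_logb_iff_rpow_le (by norm_num) (by linarith)]
    norm_num
    exact hΔ
  have h2 : 1 ≤ Real.logb 2 (Real.logb 2 Δ) := by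
    rw [Real.le_logb_iff_rpow_le (by norm_num) (by linarith)]
    simpa using h1
  have h3 := opTime_le hd hΔ
  set A : ℝ := 1800000 * (2 : ℝ) ^ ((1800000 : ℝ) * d) with hA
  have hA0 : 0 ≤ A := by positivity
  have h4 : (s : ℝ) + k * τ ≤ opTime d Δ * τ := by
    have : (s : ℝ) + k ≤ opTime d Δ := by exact_mod_cast h
    have hs : (0 : ℝ) ≤ s := Nat.cast_nonneg s
    nlinarith
  have h5 : (s : ℝ) + k * τ ≤ A * Real.logb 2 Δ ^ 2 * τ := by
    refine h4.trans (mul_le_mul_of_nonneg_right (h3.trans ?_) (by linarith))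
    exact mul_le_mul_of_nonneg_left (by nlinarith) hA0
  have h6 : A * Real.logb 2 Δ ^ 2 * τ ≤ 1800000 * r * (2 : ℝ) ^ ((1800000 : ℝ) * d) *
      Real.logb 2 Δ ^ 2 * Real.logb 2 (Real.logb 2 Δ) * τ := by
    have hr' : (1 : ℝ) ≤ r := by exact_mod_cast hr
    have h7 : 1 ≤ (r : ℝ) * Real.logb 2 (Real.logb 2 Δ) := by nlinarith
    have h8 : 0 ≤ A * Real.logb 2 Δ ^ 2 * τ := by positivity
    calc A * Real.logb 2 Δ ^ 2 * τ
        ≤ A * Real.logb 2 Δ ^ 2 * τ * (r * Real.logb 2 (Real.logb 2 Δ)) :=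
          le_mul_of_one_le_right h8 h7
      _ = _ := by rw [hA]; ring
  cases o with
  | insert p => exact h5.trans h6
  | delete p => exact h5.trans h6
  | query => exact h5
  | queryPoint p => exact h5

end Operations

end RGather

theorem mainTheorem8 (C : ℝ) (hC : 1 < C) :
    ∃ (A : RGather.DynAlg) (K : ℝ), 0 < K ∧
      ∀ (X : Type*) [MetricSpace X] (d : ℝ), 0 ≤ d → RGather.DoublingDimLE X d →
      ∀ (r : ℕ), 1 ≤ r → ∀ (Δ : ℝ), 4 ≤ Δ →
        -- each operation halts within its time bound
        (∀ (h : List (RGather.Op X)) (o : RGather.Op X), RGather.Admissible Δ (h ++ [o]) →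
          ∀ σ : RGather.State X, RGather.Run A r h σ →
            ∃ (s k : ℕ) (σ' : RGather.State X), RGather.Exec (A.prog o) (o.input σ) s k σ' ∧
              ∀ τ : ℝ, 1 ≤ τ → (s : ℝ) + k * τ ≤ RGather.timeBound K r d Δ τ o) ∧
        -- an approximate solution is maintained; all queries up to the next update answer from it
        (∀ h : List (RGather.Op X), RGather.Admissible Δ h → r ≤ (RGather.pointSet h).card →
          ∃ (S : RGather.Clustering X) (ρ : ℝ),
            S.IsGather r (RGather.pointSet h) ∧
            (S.cost : ℝ) ≤ ρ ∧
            ρ ≤ 16 * C ^ 2 * (RGather.optCost r (RGather.pointSet h) : ℝ) ∧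
            ∀ (Q : List (RGather.Op X)) (q : RGather.Op X),
              (∀ o ∈ Q ++ [q], ¬ o.IsUpdate) → RGather.Admissible Δ (h ++ Q ++ [q]) →
              ∀ σ : RGather.State X, RGather.Run A r (h ++ Q ++ [q]) σ →
                q.Answered S ρ σ) := by
  open RGather in
  refine ⟨gatherAlg, 1800000, by norm_num, fun X _ d hd hX r hr Δ hΔ => ⟨?_, ?_⟩⟩
  · intro h o hA σ hR
    obtain ⟨hA', hl, ha⟩ := hA.of_snoc
    rw [pointSet_snoc] at ha
    obtain ⟨s, k, σ', h1, h2, -⟩ := exec_op hX hd (by linarith)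
      (mem_of_run hX hd (by linarith) hA' hR) o hl hA'.aspectLE ha
    exact ⟨s, k, σ', h1, fun τ hτ => le_timeBound hd hr hΔ hτ h2 o⟩
  · intro h hA hc
    have hopt : (0 : ℝ) ≤ (optCost r (pointSet h) : ℝ) := NNReal.coe_nonneg _
    have hC2 : 1 ≤ C ^ 2 := one_le_pow₀ hC.le
    have hΔ1 : 1 ≤ Δ := by linarith
    obtain ⟨σ₀, hR₀, hM₀⟩ := exists_run (r := r) hX hd hΔ1 hA
    by_cases hr2 : 2 ≤ r
    · rcases hM₀.2 hr2 with ⟨-, -, hP⟩ | ⟨R, L, hG, hH⟩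
      · rw [hP] at hc
        simp at hc
        omega
      -- For each point, the first level on which it is isolated, as found by the descent of a
      -- query. Outside the set the value `0` is arbitrary.
      have hN : ∀ p, ∃ n, p ∈ pointSet h →
          total (nearN p n R L) = 1 ∧ ∀ k < n, total (nearN p k R L) ≠ 1 := by
        intro p
        by_cases hp : p ∈ pointSet h
        · obtain ⟨n, -, h1⟩ := hG.exists_descent hΔ1 hA.aspectLE hp
          exact ⟨n, fun _ => h1⟩
        · exact ⟨0, fun h => absurd h hp⟩
      choose N hN using hN
      obtain ⟨S, h1, h2, h3, h4⟩ := hG.approximation hr2 hc N fun p hp => (hN p hp).1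
      refine ⟨S, 12 * maxg L, h1, h2, h3.trans ?_, ?_⟩
      -- The factor `16` has been proved, and `1 ≤ C ^ 2`.
      · nlinarith
      intro Q q hQ hAq σ hR
      obtain ⟨hA', hl, -⟩ := hAq.of_snoc
      obtain ⟨σ₁, s, k, hR', he⟩ := hR.of_snoc
      have hQ' : ∀ o ∈ Q, ¬ o.IsUpdate := fun o ho => hQ o (by simp [ho])
      have hH₁ := holds_of_queries hX hd hΔ1 hr2 hG
        (fun σ hσ => by rw [hσ.deterministic hR₀]; exact hH) hQ' hA' σ₁ hR'
      rw [pointSet_queries hQ'] at hl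
      have hq := hQ q (by simp)
      obtain ⟨-, h5, h6⟩ := exec_query_op hX hd hΔ1 hr2 hG hH₁ hA.aspectLE hq hl he
      cases q with
      | insert p => exact trivial
      | delete p => exact trivial
      | query => exact h5
      | queryPoint p =>
        obtain ⟨n, hn, hlt, hpt⟩ := h6 p rfl
        -- Both are the first level with a single near point, so the center that is output is the
        -- one used to define the clusters.
        have hnN : n = N p := by
          obtain ⟨h7, h8⟩ := hN p hl
          rcases lt_trichotomy n (N p) with h9 | h9 | h9
          · exact absurd hn (h8 n h9)
          · exact h9
          · exact absurd h7 (hlt _ h9)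
        obtain ⟨i, hi, hic⟩ := h4 p hl
        exact ⟨h5, i, hi, by rw [hpt, hnN, hic]⟩
    · obtain rfl : r = 1 := by omega
      obtain ⟨S, h1, h2, h3⟩ := exists_singletons (pointSet h)
      -- Each point is its own cluster and center. The estimate is `0`, and the program returns the
      -- queried point, which is still in `P[0]`.
      refine ⟨S, 0, h1, by rw [h2]; simp, by positivity, ?_⟩
      intro Q q hQ hAq σ hR
      obtain ⟨hA', hl, -⟩ := hAq.of_snoc
      obtain ⟨σ₁, s, k, hR', he⟩ := hR.of_snoc
      have hQ' : ∀ o ∈ Q, ¬ o.IsUpdate := fun o ho => hQ o (by simp [ho])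
      have hM₁ := (mem_of_run hX hd hΔ1 hA' hR').input q
      rw [pointSet_queries hQ'] at hl
      cases q with
      | insert p => exact trivial
      | delete p => exact trivial
      | query =>
        obtain ⟨s', k', σ', he', -, -, h5, -⟩ := exec_guarded_query_small le_rfl hM₁.1 _
        obtain ⟨-, -, rfl⟩ := he.deterministic he'
        exact h5
      | queryPoint p =>
        obtain ⟨s', k', σ', he', -, -, h5, h6⟩ := exec_guarded_query_small le_rfl hM₁.1 _
        obtain ⟨-, -, rfl⟩ := he.deterministic he'
        obtain ⟨i, hi, hic⟩ := h3 p hl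
        refine ⟨h5, i, hi, ?_⟩
        rw [h6, hic]
        simp [Op.input, State.setPt]
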